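/- Let $d\ge 1$ and let $\mathbf N=(N_1,\dots,N_d)$ be a vector of integers greater than $1$. Let $\Omega_{\mathbf N}=[N_1]\times\cdots\times[N_d]$, where $[N]=\{1,\dots,N\}$, and let $\mathcal A_{\mathbf N}$ be the family of all sets $\Omega_{\mathbf N}\cap\{\mathbf a+i\mathbf b: i=0,\dots,\ell-1\}$ with $\mathbf a,\mathbf b\in\mathbb Z^d$ and $\ell\ge 1$ an integer. For $\chi:\Omega_{\mathbf N}\to\{-1,1\}$ put $\operatorname{disc}(\mathcal A_{\mathbf N},\chi)=\max_{S\in\mathcal A_{\mathbf N}}\bigl|\sum_{\omega\in S}\chi(\omega)\bigr|$, and let $\operatorname{disc}(\mathcal A_{\mathbf N})=\min_\chi\operatorname{disc}(\mathcal A_{\mathbf N},\chi)$. Let $$f(\mathbf N)=\max_{I\subseteq\{1,\dots,d\}}\Bigl(\prod_{i\in I}N_i\Bigr)^{\frac1{2|I|+2}},$$ where the empty product is $1$. (1) For every $d\ge1$ there is a constant $C_d>0$, depending only on $d$, such that for all such $\mathbf N$ $$\operatorname{disc}(\mathcal A_{\mathbf N})\le C_d\sqrt{\log|\Omega_{\mathbf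 N}|}\; f(\mathbf N).$$ (2) The bound is constructive: there is a randomized algorithm that, given any $d\ge 1$ and any such $\mathbf N$, always computes a coloring $\chi:\Omega_{\mathbf N}\to\{-1,1\}$ in time bounded by a fixed polynomial in $|\Omega_{\mathbf N}|$ and such that, with high probability, $\operatorname{disc}(\mathcal A_{\mathbf N},\chi)\lesssim_d\sqrt{\log|\Omega_{\mathbf N}|}\,f(\mathbf N)$. That is, for every $d\ge1$ and every real $c>0$ there is a constant $C_{d,c}>0$, depending only on $d$ and $c$, such that for all such $\mathbf N$ $$\Pr\Bigl[\operatorname{disc}(\mathcal A_{\mathbf N},\chi)\le C_{d,c}\sqrt{\log|\Omega_{\mathbf N}|}\; f(\mathbf N)\Bigr]\ge 1-|\Omega_{\mathbf N}|^{-c}.$$ (Time is measured on a random access machine with fair coin tosses and logarithmic cost, which is polynomially equivalent to a probabilistic Turing machine.) -/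

import Mathlib

/-! ## Discrepancy of set systems -/

/-- The discrepancy of a finite set system `S` with respect to a colouring `χ` with values `±1`
(the units of `ℤ`): the maximum over the sets of `S` of the absolute value of the sum of the
colours. -/
def discWith {α : Type*} (S : Finset (Finset α)) (χ : α → ℤˣ) : ℕ :=
  S.sup fun A => (∑ x ∈ A, (χ x : ℤ)).natAbs

/-- The discrepancy of a set system: the minimum of `discWith S χ` over all colourings `χ`. -/
def disc {α : Type*} [Fintype α] [DecidableEq α] (S : Finset (Finset α)) : ℕ :=
  (Finset.univ : Finset (α → ℤˣ)).inf' Finset.univ_nonempty fun χ => discWith S χ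

/-! ## Arithmetic progressions in boxes -/

/-- The box `[N₁] × ⋯ × [N_d]`, as a finite set of integer points. -/
noncomputable def box {d : ℕ} (N : Fin d → ℕ) : Finset (Fin d → ℤ) :=
  Finset.Icc (fun _ => 1) (fun i => (N i : ℤ))

/-- The arithmetic progression `{a + i b : i = 0, …, ℓ - 1}` in `ℤ^d`. -/
def arithProg {d : ℕ} (a b : Fin d → ℤ) (l : ℕ) : Finset (Fin d → ℤ) :=
  (Finset.range l).image fun i : ℕ => a + (i : ℤ) • b

open Classical in
/-- The set system, on the universe `box N`, of all the intersections of `box N` with an arithmetic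
progression of `ℤ^d`. -/
noncomputable def boxAPs {d : ℕ} (N : Fin d → ℕ) : Finset (Finset (box N)) :=
  Finset.univ.filter fun A => ∃ (a b : Fin d → ℤ) (l : ℕ), 0 < l ∧
    A = Finset.univ.filter fun x : box N => (x : Fin d → ℤ) ∈ arithProg a b l

/-- `f(N) = max_{I ⊆ [d]} (∏_{i ∈ I} N_i)^{1/(2|I|+2)}`. -/
noncomputable def boxF {d : ℕ} (N : Fin d → ℕ) : ℝ :=
  (Finset.univ : Finset (Finset (Fin d))).sup' Finset.univ_nonempty fun I =>
    (∏ i ∈ I, (N i : ℝ)) ^ (1 / (2 * (I.card : ℝ) + 2))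

/-! ## Randomized algorithms

The machine model is the random access machine with logarithmic cost: memory cells hold integers
and are addressed by integers, and each integer that is computed, loaded or used as an address
costs its bit length. Programs are structured, and may toss fair coins. Up to a polynomial, the
cost of a run is the running time on a (probabilistic) Turing machine. -/

namespace RAM

/-- The number of binary digits of an integer, plus one. -/
def bitLen (z : ℤ) : ℕ := z.natAbs.size + 1

/-- Arithmetic expressions; `load a` is the content of the memory cell with address `a`. -/
inductive Expr : Type
  | lit (c : ℤ)
  | load (a : Expr)
  | add (a b : Expr)
  | sub (a b : Expr)
  | mul (a b : Expr)
  | div (a b : Expr)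

/-- The value of an expression when the memory is `M` (`div` is integer division, and a division
by `0` gives `0`). -/
def Expr.eval (M : ℤ → ℤ) : Expr → ℤ
  | lit c => c
  | load a => M (a.eval M)
  | add a b => a.eval M + b.eval M
  | sub a b => a.eval M - b.eval M
  | mul a b => a.eval M * b.eval M
  | div a b => a.eval M / b.eval M

/-- The cost of evaluating an expression: the sum of the bit lengths of the values of all its
subexpressions. -/
def Expr.cost (M : ℤ → ℤ) : Expr → ℕ
  | lit c => bitLen c
  | load a => a.cost M + bitLen (M (a.eval M))
  | add a b => a.cost M + b.cost M + bitLen (a.eval M + b.eval M)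
  | sub a b => a.cost M + b.cost M + bitLen (a.eval M - b.eval M)
  | mul a b => a.cost M + b.cost M + bitLen (a.eval M * b.eval M)
  | div a b => a.cost M + b.cost M + bitLen (a.eval M / b.eval M)

/-- Programs: do nothing; store the value of `e` in the cell with address `a`; toss a coin and
store the result (`0` or `1`) in the cell with address `a`; run `p`, then `q`; run `p` if `e > 0`
and `q` otherwise; run `p` as long as `e > 0`. -/
inductive Prog : Type
  | skip
  | store (a e : Expr)
  | flip (a : Expr)
  | seq (p q : Prog)
  | cond (e : Expr) (p q : Prog)
  | loop (e : Expr) (p : Prog)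

/-- A state of the machine: the memory, and the number of coins tossed so far. -/
structure State where
  mem : ℤ → ℤ
  pos : ℕ

/-- `Run ω p s t s'`: when the outcomes of the coin tosses are `ω 0, ω 1, …`, the program `p`,
started in the state `s`, halts in the state `s'`, at total cost `t`. -/
inductive Run (ω : ℕ → Bool) : Prog → State → ℕ → State → Prop
  | skip (s : State) : Run ω .skip s 1 s
  | store (a e : Expr) (s : State) :
      Run ω (.store a e) s (a.cost s.mem + e.cost s.mem + 1)
        ⟨Function.update s.mem (a.eval s.mem) (e.eval s.mem), s.pos⟩
  | flip (a : Expr) (s : State) :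
      Run ω (.flip a) s (a.cost s.mem + 1)
        ⟨Function.update s.mem (a.eval s.mem) (if ω s.pos then 1 else 0), s.pos + 1⟩
  | seq {p q : Prog} {s₁ s₂ s₃ : State} {t u : ℕ} :
      Run ω p s₁ t s₂ → Run ω q s₂ u s₃ → Run ω (.seq p q) s₁ (t + u + 1) s₃
  | condPos {e : Expr} {p q : Prog} {s₁ s₂ : State} {t : ℕ} :
      0 < e.eval s₁.mem → Run ω p s₁ t s₂ →
        Run ω (.cond e p q) s₁ (e.cost s₁.mem + t + 1) s₂
  | condNonpos {e : Expr} {p q : Prog} {s₁ s₂ : State} {t : ℕ} :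
      e.eval s₁.mem ≤ 0 → Run ω q s₁ t s₂ →
        Run ω (.cond e p q) s₁ (e.cost s₁.mem + t + 1) s₂
  | loopPos {e : Expr} {p : Prog} {s₁ s₂ s₃ : State} {t u : ℕ} :
      0 < e.eval s₁.mem → Run ω p s₁ t s₂ → Run ω (.loop e p) s₂ u s₃ →
        Run ω (.loop e p) s₁ (e.cost s₁.mem + t + u + 1) s₃
  | loopNonpos {e : Expr} {p : Prog} {s : State} :
      e.eval s.mem ≤ 0 → Run ω (.loop e p) s (e.cost s.mem + 1) s

/-- The distribution of an infinite sequence of independent fair coins. -/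
noncomputable def coins : MeasureTheory.Measure (ℕ → Bool) :=
  MeasureTheory.Measure.infinitePi fun _ => (PMF.uniformOfFintype Bool).toMeasure

/-- The initial state on the input `N = (N₁, …, N_d)`: cell `0` holds `d`, cell `i` holds `N_i` for
`1 ≤ i ≤ d`, and all other cells hold `0`. -/
def input {d : ℕ} (N : Fin d → ℕ) : State where
  mem z := if z = 0 then (d : ℤ) else ∑ i : Fin d, if z = (i : ℤ) + 1 then (N i : ℤ) else 0
  pos := 0

/-- The address of the output cell for the point `x` of `box N`: its rank in the enumeration
`0, 1, …, N₁ ⋯ N_d - 1` of the box by mixed radix digits, `∑ i, (x_i - 1) N₁ ⋯ N_{i-1}`. -/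
def outCell {d : ℕ} (N : Fin d → ℕ) (x : Fin d → ℤ) : ℤ :=
  ∑ i, (x i - 1) * ∏ j ∈ Finset.Iio i, (N j : ℤ)

/-- On the input `N` and the coin tosses `ω`, the program `p` halts at total cost `t`, with the
colouring `χ` of the box as its output. -/
def Outputs {d : ℕ} (p : Prog) (N : Fin d → ℕ) (ω : ℕ → Bool) (t : ℕ) (χ : box N → ℤˣ) : Prop :=
  ∃ s : State, Run ω p (input N) t s ∧ ∀ x : box N, s.mem (outCell N x) = (χ x : ℤ)

end RAM

/-! Colouring is treated as a vector balancing problem. Let `load s` be the product of the numbers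
`max 1 ⌊N_j / s⌋`, and let `s₀` be the first power of four with `load s₀ ≤ s₀`. Since `s = s₀ / 4`
was rejected, `s ^ (|I| + 1) ≤ ∏_{j ∈ I} N_j` for `I = {j : s ≤ N_j}`, so `√s₀ ≤ 2 f(N)`
(`two_pow_le_boxF`). Since `s₀` was accepted, at most `8 ^ d * s₀ / 4 ^ k` aligned progressions
("rows") with `4 ^ k * s₀` points pass through a point (`card_rowsAt_le'`): alignment leaves one row
for each difference, and there are few differences.

Every progression in the box is cut into 4-adic blocks, boundedly many of each length. It is enough
that a block of `4 ^ j < s₀` points has a sum of order `2 ^ j`, and a row of `4 ^ k * s₀` points a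
sum of order `√s₀ / √(2 ^ k)`, both times `√log n`, where `n` is the number of points of the box.
Both families of errors are geometric and add up to the order of `√s₀` (`Balanced.abs_sum_le`), so
the number of scales costs nothing.

Such a colouring is found by the Gram–Schmidt walk. The point `x` gets the vector with entry `√s₀`
at its own coordinate and `√(2 ^ k)` at each row of level `k` through it. The squared length is at
most `3 * 8 ^ d * s₀` (`gramMat_diag_le`). After normalization, the signed sum of these vectors is
subgaussian up to a constant factor. Testing it against the coordinates of the rows and the
normalized indicators of the short blocks gives all the required bounds, and the union bound over `2
* n ^ 3` tests produces `√log n` (`exists_rand_mainP`).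

For the subgaussian bound, the walk moves a fractional colouring along the direction in which the
combination of the alive vectors is a multiple of the residual `r` of the pivot. The potential `pot`
is the exponential moment, times the moment `tilt` of the future rounding of the pivot, times `exp
((S - ⟪θ, r⟫ ^ 2) / 2)`, where `S` is the squared length of the projection of `θ` to the span of the
alive vectors. It is affine along the direction (`pot_add_smul`), and it does not grow when
coordinates freeze (`pot_le_of_mem`, `pot_le_of_frozen`). It starts below `exp (‖θ‖ ^ 2 / 2)` and
ends above the exponential moment.

The machine works with exact integers: a position `z / e`, and the adjugate and determinant of the
Gram matrix restricted to the alive coordinates. The same fraction-free formula adds a row to the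
matrix and deletes an index from it, and all minors have polynomially many digits. The biased choice
of a step is made with a uniform number below a power of two; this costs a factor `1 + 1 / n` for
each of `n` steps, at most 3 in all. Programs are verified by total correctness triples with running
times, `Det` for deterministic ones and `Rnd` for randomized ones; the latter also bound
expectations of test functions. The existence of a good colouring follows because the algorithm
succeeds with positive probability. -/

/-! ## Registers and arrays in the memory of the machine -/

namespace RAM

/-- The names of the registers and arrays. A register is an array that is used at index `0`. -/
inductive Reg : Type
  | dim | size | scaleMin | scale | weight | fst | snd | dif | cnt | row | col | acc | det | det'
  | den | piv | num₁ | quo₁ | num₂ | quo₂ | modu | rnd | flag | dig₁ | dig₂ | val | lvl | rep | del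
  | rnd' | side | mat | vec | pos | dir

theorem Reg.ctorIdx_injective : Function.Injective Reg.ctorIdx := by
  intro a b h
  cases a <;> (cases b; all_goals first | rfl | exact absurd h (by decide))

theorem Reg.ctorIdx_lt (k : Reg) : k.ctorIdx < 64 := by
  cases k <;> decide

/-- The address of the entry of index `i` of the array `k`; it is negative if `0 ≤ i`. -/
def adr (k : Reg) (i : ℤ) : ℤ := ((k.ctorIdx : ℤ) - 64) + (-64) * i

/-- The entry of index `i` of the array `k`. -/
def rd (M : ℤ → ℤ) (k : Reg) (i : ℤ) : ℤ := M (adr k i)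

/-- The memory after storing `v` as the entry of index `i` of the array `k`. -/
def upd (M : ℤ → ℤ) (k : Reg) (i v : ℤ) : ℤ → ℤ := Function.update M (adr k i) v

/-- Each name owns one residue class of addresses modulo 64, so the arrays are unbounded and never
overlap. -/
theorem adr_inj {k k' : Reg} {i i' : ℤ} : adr k i = adr k' i' ↔ k = k' ∧ i = i' := by
  constructor
  · intro h
    have h1 := k.ctorIdx_lt
    have h2 := k'.ctorIdx_lt
    unfold adr at h
    have h3 : k.ctorIdx = k'.ctorIdx := by omega
    exact ⟨Reg.ctorIdx_injective h3, by omega⟩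
  · rintro ⟨rfl, rfl⟩; rfl

/-- Input and output live at nonnegative addresses, so writing to an array at a nonnegative index
cannot disturb them. -/
theorem adr_neg (k : Reg) {i : ℤ} (hi : 0 ≤ i) : adr k i < 0 := by
  have h1 := k.ctorIdx_lt
  unfold adr; omega

@[simp] theorem rd_upd_of_ne {M : ℤ → ℤ} {k k' : Reg} {i v : ℤ} (h : k' ≠ k) :
    rd (upd M k i v) k' = rd M k' := by
  funext j
  simp only [rd, upd, Function.update_apply, adr_inj, h, false_and, if_false]

@[simp] theorem rd_upd_self {M : ℤ → ℤ} {k : Reg} {i v : ℤ} :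
    rd (upd M k i v) k = Function.update (rd M k) i v := by
  funext j
  simp only [rd, upd, Function.update_apply, adr_inj, true_and]

theorem upd_apply_of_nonneg {M : ℤ → ℤ} {k : Reg} {i v z : ℤ} (hi : 0 ≤ i) (hz : 0 ≤ z) :
    upd M k i v z = M z := by
  have := adr_neg k hi
  rw [upd, Function.update_of_ne (by omega)]

theorem rd_update_of_nonneg {M : ℤ → ℤ} {k : Reg} {i v z : ℤ} (hi : 0 ≤ i) (hz : 0 ≤ z) :
    rd (Function.update M z v) k i = rd M k i := by
  have := adr_neg k hi
  rw [rd, Function.update_of_ne (by omega), rd]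

/-- The memories `M` and `M'` agree on all arrays that are not listed in `S`. -/
def Same (S : List Reg) (M M' : ℤ → ℤ) : Prop := ∀ k, k ∉ S → rd M' k = rd M k

theorem Same.refl (S : List Reg) (M : ℤ → ℤ) : Same S M M := fun _ _ => rfl

theorem Same.trans {S S' S'' : List Reg} {M M' M'' : ℤ → ℤ} (h : Same S M M')
    (h' : Same S' M' M'') (hS : S ⊆ S'') (hS' : S' ⊆ S'') : Same S'' M M'' := fun k hk =>
  (h' k fun hh => hk (hS' hh)).trans (h k fun hh => hk (hS hh))

theorem Same.mono {S S' : List Reg} {M M' : ℤ → ℤ} (h : Same S M M') (hS : S ⊆ S') :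
    Same S' M M' := fun k hk => h k fun hh => hk (hS hh)

theorem Same.upd {S : List Reg} {M M' : ℤ → ℤ} (h : Same S M M') {k : Reg} (hk : k ∈ S)
    (i v : ℤ) : Same S M (upd M' k i v) := fun k' hk' => by
  rw [rd_upd_of_ne (by rintro rfl; exact hk' hk)]; exact h k' hk'

/-! ## Expressions -/

instance : Add Expr := ⟨.add⟩
instance : Sub Expr := ⟨.sub⟩
instance : Mul Expr := ⟨.mul⟩
instance : Div Expr := ⟨.div⟩

/-- The entry of the array `k` whose index is the value of `e`. -/
def ar (k : Reg) (e : Expr) : Expr :=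
  .load (.add (.lit ((k.ctorIdx : ℤ) - 64)) (.mul (.lit (-64)) e))

/-- The register `k`. -/
def vr (k : Reg) : Expr := .load (.lit ((k.ctorIdx : ℤ) - 64))

@[simp] theorem eval_add (M : ℤ → ℤ) (a b : Expr) : (a + b).eval M = a.eval M + b.eval M := rfl
@[simp] theorem eval_sub (M : ℤ → ℤ) (a b : Expr) : (a - b).eval M = a.eval M - b.eval M := rfl
@[simp] theorem eval_mul (M : ℤ → ℤ) (a b : Expr) : (a * b).eval M = a.eval M * b.eval M := rfl
@[simp] theorem eval_div (M : ℤ → ℤ) (a b : Expr) : (a / b).eval M = a.eval M / b.eval M := rfl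
@[simp] theorem eval_lit (M : ℤ → ℤ) (c : ℤ) : (Expr.lit c).eval M = c := rfl
@[simp] theorem eval_load (M : ℤ → ℤ) (a : Expr) : (Expr.load a).eval M = M (a.eval M) := rfl
@[simp] theorem eval_ar (M : ℤ → ℤ) (k : Reg) (e : Expr) :
    (ar k e).eval M = rd M k (e.eval M) := rfl
@[simp] theorem eval_vr (M : ℤ → ℤ) (k : Reg) : (vr k).eval M = rd M k 0 := by
  simp [vr, rd, adr]

/-! ### Sizes of values and costs of expressions -/

/-- A bound for the size of an expression. -/
def Expr.weight : Expr → ℕ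
  | lit c => if c.natAbs < 128 then 7 else 1000
  | load a => a.weight + 1
  | add a b => a.weight + b.weight + 1
  | sub a b => a.weight + b.weight + 1
  | mul a b => a.weight + b.weight + 1
  | div a b => a.weight + b.weight + 1

/-- All cells of the memory `M` hold integers with at most `b` binary digits. -/
def Bdd (b : ℕ) (M : ℤ → ℤ) : Prop := 1 ≤ b ∧ ∀ z, (M z).natAbs < 2 ^ b

theorem Bdd.update {b : ℕ} {M : ℤ → ℤ} (h : Bdd b M) (z : ℤ) {v : ℤ} (hv : v.natAbs < 2 ^ b) :
    Bdd b (Function.update M z v) := by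
  refine ⟨h.1, fun y => ?_⟩
  rw [Function.update_apply]
  split_ifs
  exacts [hv, h.2 y]

theorem Expr.one_le_weight (e : Expr) : 1 ≤ e.weight := by
  cases e <;> simp only [weight] <;> first | omega | (split_ifs <;> omega)

theorem two_pow_add_two_pow_le {x y : ℕ} (hx : 1 ≤ x) (hy : 1 ≤ y) :
    2 ^ x + 2 ^ y ≤ 2 ^ (x + y) := by
  have h1 : 2 ≤ 2 ^ x := by simpa using Nat.pow_le_pow_right (n := 2) (by norm_num) hx
  have h2 : 2 ≤ 2 ^ y := by simpa using Nat.pow_le_pow_right (n := 2) (by norm_num) hy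
  rw [pow_add]; nlinarith

/-- Digit counts at worst add up under the arithmetic operations, so they grow no faster than the
weight. Literals from 128 on carry weight 1000, and the hypothesis on the weight excludes them. -/
theorem Expr.natAbs_eval_lt {b : ℕ} {M : ℤ → ℤ} (hM : Bdd b M) :
    ∀ e : Expr, e.weight < 1000 → (e.eval M).natAbs < 2 ^ (b * e.weight)
  | lit c, h => by
    simp only [weight, eval] at h ⊢
    split_ifs at h ⊢ with hc
    · refine lt_of_lt_of_le hc ?_
      calc 128 = 2 ^ (1 * 7) := by norm_num
        _ ≤ _ := Nat.pow_le_pow_right (by norm_num) (Nat.mul_le_mul_right _ hM.1)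
    · omega
  | load a, _ => by
    simp only [weight, eval]
    exact (hM.2 _).trans_le (Nat.pow_le_pow_right (by norm_num) (Nat.le_mul_of_pos_right _ (by omega)))
  | add x y, h => by
    simp only [weight, eval] at h ⊢
    have hx := natAbs_eval_lt hM x (by omega)
    have hy := natAbs_eval_lt hM y (by omega)
    have h1 := two_pow_add_two_pow_le (Nat.mul_pos hM.1 x.one_le_weight)
      (Nat.mul_pos hM.1 y.one_le_weight)
    have h2 : 2 ^ (b * x.weight + b * y.weight) ≤ 2 ^ (b * (x.weight + y.weight + 1)) :=
      Nat.pow_le_pow_right (by norm_num) (by nlinarith)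
    have := Int.natAbs_add_le (x.eval M) (y.eval M)
    omega
  | sub x y, h => by
    simp only [weight, eval] at h ⊢
    have hx := natAbs_eval_lt hM x (by omega)
    have hy := natAbs_eval_lt hM y (by omega)
    have h1 := two_pow_add_two_pow_le (Nat.mul_pos hM.1 x.one_le_weight)
      (Nat.mul_pos hM.1 y.one_le_weight)
    have h2 : 2 ^ (b * x.weight + b * y.weight) ≤ 2 ^ (b * (x.weight + y.weight + 1)) :=
      Nat.pow_le_pow_right (by norm_num) (by nlinarith)
    have := Int.natAbs_sub_le (x.eval M) (y.eval M)
    omega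
  | mul x y, h => by
    simp only [weight, eval] at h ⊢
    have hx := natAbs_eval_lt hM x (by omega)
    have hy := natAbs_eval_lt hM y (by omega)
    have h2 : 2 ^ (b * x.weight + b * y.weight) ≤ 2 ^ (b * (x.weight + y.weight + 1)) :=
      Nat.pow_le_pow_right (by norm_num) (by nlinarith)
    rw [Int.natAbs_mul]
    exact (Nat.mul_lt_mul'' hx hy).trans_le (by rwa [← pow_add])
  | div x y, h => by
    simp only [weight, eval] at h ⊢
    have hx := natAbs_eval_lt hM x (by omega)
    have h2 : 2 ^ (b * x.weight) ≤ 2 ^ (b * (x.weight + y.weight + 1)) :=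
      Nat.pow_le_pow_right (by norm_num) (by nlinarith)
    have h3 := Int.natAbs_ediv_le_natAbs (x.eval M) (y.eval M)
    omega

theorem bitLen_le {v : ℤ} {c : ℕ} (h : v.natAbs < 2 ^ c) : bitLen v ≤ c + 1 := by
  have := Nat.size_le.2 h
  unfold bitLen; omega

/-- There are at most `e.weight` subexpressions, and each value has at most `b * e.weight` digits.
-/
theorem Expr.cost_le {b : ℕ} {M : ℤ → ℤ} (hM : Bdd b M) :
    ∀ e : Expr, e.weight < 1000 → e.cost M ≤ e.weight * (b * e.weight + 1)
  | lit c, h => by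
    have := bitLen_le (natAbs_eval_lt hM (lit c) h)
    have h1 := (lit c).one_le_weight
    simp only [cost]
    simp only [eval] at this
    nlinarith
  | load a, h => by
    have h3 := bitLen_le (natAbs_eval_lt hM (load a) h)
    simp only [weight] at h h3 ⊢
    have h1 := cost_le hM a (by omega)
    simp only [cost, eval] at h3 ⊢
    nlinarith
  | add x y, h => by
    have h3 := bitLen_le (natAbs_eval_lt hM (add x y) h)
    simp only [weight] at h h3 ⊢
    have h1 := cost_le hM x (by omega)
    have h2 := cost_le hM y (by omega)
    simp only [cost, eval] at h3 ⊢
    nlinarith [Nat.zero_le (b * x.weight * y.weight), Nat.zero_le (b * x.weight), Nat.zero_le (b * y.weight)]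
  | sub x y, h => by
    have h3 := bitLen_le (natAbs_eval_lt hM (sub x y) h)
    simp only [weight] at h h3 ⊢
    have h1 := cost_le hM x (by omega)
    have h2 := cost_le hM y (by omega)
    simp only [cost, eval] at h3 ⊢
    nlinarith [Nat.zero_le (b * x.weight * y.weight), Nat.zero_le (b * x.weight), Nat.zero_le (b * y.weight)]
  | mul x y, h => by
    have h3 := bitLen_le (natAbs_eval_lt hM (mul x y) h)
    simp only [weight] at h h3 ⊢
    have h1 := cost_le hM x (by omega)
    have h2 := cost_le hM y (by omega)
    simp only [cost, eval] at h3 ⊢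
    nlinarith [Nat.zero_le (b * x.weight * y.weight), Nat.zero_le (b * x.weight), Nat.zero_le (b * y.weight)]
  | div x y, h => by
    have h3 := bitLen_le (natAbs_eval_lt hM (div x y) h)
    simp only [weight] at h h3 ⊢
    have h1 := cost_le hM x (by omega)
    have h2 := cost_le hM y (by omega)
    simp only [cost, eval] at h3 ⊢
    nlinarith [Nat.zero_le (b * x.weight * y.weight), Nat.zero_le (b * x.weight), Nat.zero_le (b * y.weight)]

/-- The unit in which running times are measured. -/
def unit (b : ℕ) : ℕ := 500000 * (b + 1)

/-- Two expressions of weight at most 400 cost at most `2 * 400 * (400 * b + 1)`; the constant in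
`unit` is chosen above this. Hence every elementary instruction fits into one unit. -/
theorem Expr.cost_add_cost_le {b : ℕ} {M : ℤ → ℤ} (hM : Bdd b M) {e e' : Expr}
    (h : e.weight ≤ 400) (h' : e'.weight ≤ 400) : e.cost M + e'.cost M + 1 ≤ unit b := by
  have h1 := e.cost_le hM (by omega)
  have h2 := e'.cost_le hM (by omega)
  have h3 : e.weight * (b * e.weight + 1) ≤ 400 * (b * 400 + 1) := by gcongr
  have h4 : e'.weight * (b * e'.weight + 1) ≤ 400 * (b * 400 + 1) := by gcongr
  unfold unit; omega

/-! ## Deterministic programs -/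

/-- The program `p`, started in the memory `M`, tosses no coins and halts after at most `T` units of
time in a memory with the property `Q`, and all cells hold at most `b` binary digits. -/
def Det (b : ℕ) (p : Prog) (T : ℕ) (M : ℤ → ℤ) (Q : (ℤ → ℤ) → Prop) : Prop :=
  Bdd b M → ∃ M', Bdd b M' ∧ Q M' ∧
    ∀ ω k, ∃ t ≤ T * unit b, Run ω p ⟨M, k⟩ t ⟨M', k⟩

/-- Store the value of `e` in the entry of the array `k` whose index is the value of `i`. -/
def st (k : Reg) (i e : Expr) : Prog :=
  .store (.add (.lit ((k.ctorIdx : ℤ) - 64)) (.mul (.lit (-64)) i)) e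

/-- Store the value of `e` in the register `k`. -/
def sv (k : Reg) (e : Expr) : Prog := st k (.lit 0) e

theorem Det.mono {b : ℕ} {p : Prog} {T T' : ℕ} {M : ℤ → ℤ} {Q Q' : (ℤ → ℤ) → Prop}
    (h : Det b p T M Q) (hT : T ≤ T') (hQ : ∀ M', Q M' → Q' M') : Det b p T' M Q' := by
  intro hM
  obtain ⟨M', h1, h2, h3⟩ := h hM
  refine ⟨M', h1, hQ _ h2, fun ω k => ?_⟩
  obtain ⟨t, ht, hr⟩ := h3 ω k
  exact ⟨t, ht.trans (by gcongr), hr⟩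

theorem det_skip {b : ℕ} {M : ℤ → ℤ} {Q : (ℤ → ℤ) → Prop} (h : Q M) : Det b .skip 1 M Q :=
  fun hM => ⟨M, hM, h, fun _ _ => ⟨1, by unfold unit; omega, .skip _⟩⟩

theorem det_store {b : ℕ} {a e : Expr} {M : ℤ → ℤ} {Q : (ℤ → ℤ) → Prop}
    (ha : a.weight ≤ 400) (he : e.weight ≤ 400) (hv : (e.eval M).natAbs < 2 ^ b)
    (h : Q (Function.update M (a.eval M) (e.eval M))) : Det b (.store a e) 1 M Q := fun hM =>
  ⟨_, hM.update _ hv, h, fun _ _ => ⟨_, by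
    rw [one_mul]; exact Expr.cost_add_cost_le hM ha he, .store a e _⟩⟩

theorem det_st {b : ℕ} {k : Reg} {i e : Expr} {M : ℤ → ℤ} {Q : (ℤ → ℤ) → Prop}
    (hi : i.weight ≤ 380) (he : e.weight ≤ 400) (hv : (e.eval M).natAbs < 2 ^ b)
    (h : Q (upd M k (i.eval M) (e.eval M))) : Det b (st k i e) 1 M Q := by
  refine det_store ?_ he hv h
  have := k.ctorIdx_lt
  simp only [Expr.weight]
  rw [if_pos (by omega), if_pos (by decide)]
  omega

theorem det_sv {b : ℕ} {k : Reg} {e : Expr} {M : ℤ → ℤ} {Q : (ℤ → ℤ) → Prop}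
    (he : e.weight ≤ 400) (hv : (e.eval M).natAbs < 2 ^ b)
    (h : Q (upd M k 0 (e.eval M))) : Det b (sv k e) 1 M Q :=
  det_st (by decide) he hv h

theorem det_seq {b : ℕ} {p q : Prog} {T U : ℕ} {M : ℤ → ℤ} {Q : (ℤ → ℤ) → Prop}
    (h : Det b p T M fun M' => Det b q U M' Q) : Det b (.seq p q) (T + U + 1) M Q := by
  intro hM
  obtain ⟨M', h1, h2, h3⟩ := h hM
  obtain ⟨M'', h4, h5, h6⟩ := h2 h1
  refine ⟨M'', h4, h5, fun ω k => ?_⟩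
  obtain ⟨t, ht, hr⟩ := h3 ω k
  obtain ⟨u, hu, hr'⟩ := h6 ω k
  refine ⟨_, ?_, .seq hr hr'⟩
  have : 1 ≤ unit b := by unfold unit; omega
  nlinarith

theorem det_cond {b : ℕ} {e : Expr} {p q : Prog} {T : ℕ} {M : ℤ → ℤ} {Q : (ℤ → ℤ) → Prop}
    (he : e.weight ≤ 400) (hp : 0 < e.eval M → Det b p T M Q)
    (hq : e.eval M ≤ 0 → Det b q T M Q) : Det b (.cond e p q) (T + 1) M Q := by
  intro hM
  have hc := Expr.cost_add_cost_le hM he he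
  rcases lt_or_ge 0 (e.eval M) with h | h
  · obtain ⟨M', h1, h2, h3⟩ := hp h hM
    refine ⟨M', h1, h2, fun ω k => ?_⟩
    obtain ⟨t, ht, hr⟩ := h3 ω k
    exact ⟨_, by nlinarith, .condPos h hr⟩
  · obtain ⟨M', h1, h2, h3⟩ := hq h hM
    refine ⟨M', h1, h2, fun ω k => ?_⟩
    obtain ⟨t, ht, hr⟩ := h3 ω k
    exact ⟨_, by nlinarith, .condNonpos h hr⟩

/-- The number of iterations is known in advance, so the invariant is indexed by the iteration, and
induction on the number of remaining iterations takes the place of a variant. -/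
theorem det_loop {b : ℕ} {e : Expr} {p : Prog} {T : ℕ} {Q : (ℤ → ℤ) → Prop} (N : ℕ)
    (I : ℕ → (ℤ → ℤ) → Prop) (he : e.weight ≤ 400)
    (hstep : ∀ j < N, ∀ M, I j M → 0 < e.eval M ∧ Det b p T M (I (j + 1)))
    (hend : ∀ M, I N M → e.eval M ≤ 0 ∧ Q M) {M : ℤ → ℤ} (h0 : I 0 M) :
    Det b (.loop e p) (N * (T + 1) + 1) M Q := by
  suffices h : ∀ c j, j + c = N → ∀ M, I j M → Det b (.loop e p) (c * (T + 1) + 1) M Q from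
    h N 0 (by simp) M h0
  intro c
  induction c with
  | zero =>
    intro j hj M hI hM
    obtain rfl : j = N := by simpa using hj
    have hc := Expr.cost_add_cost_le hM he he
    exact ⟨M, hM, (hend M hI).2, fun ω k => ⟨_, by nlinarith, .loopNonpos (hend M hI).1⟩⟩
  | succ c ih =>
    intro j hj M hI hM
    have hc := Expr.cost_add_cost_le hM he he
    obtain ⟨hpos, hd⟩ := hstep j (by omega) M hI
    obtain ⟨M', h1, h2, h3⟩ := hd hM
    obtain ⟨M'', h4, h5, h6⟩ := ih (j + 1) (by omega) M' h2 h1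
    refine ⟨M'', h4, h5, fun ω k => ?_⟩
    obtain ⟨t, ht, hr⟩ := h3 ω k
    obtain ⟨u, hu, hr'⟩ := h6 ω k
    exact ⟨_, by nlinarith, .loopPos hpos hr hr'⟩

/-! ### Counting loops, arrays filled by a loop, and sums -/

/-- For `c = 0, 1, …, e - 1`, run `p`. -/
def forP (c : Reg) (e : Expr) (p : Prog) : Prog :=
  .seq (sv c (.lit 0)) (.loop (e - vr c) (.seq p (sv c (vr c + .lit 1))))

theorem weight_vr (k : Reg) : (vr k).weight = 8 := by
  have := k.ctorIdx_lt
  simp only [vr, Expr.weight]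
  rw [if_pos (by omega)]

theorem weight_ar (k : Reg) (e : Expr) : (ar k e).weight = e.weight + 17 := by
  have := k.ctorIdx_lt
  simp only [ar, Expr.weight]
  rw [if_pos (by omega), if_pos (by decide)]
  omega

/-- The body has to preserve the counter, and the invariant is asked for after the increment that
`forP` appends to the body; this explains the memory `upd M' c 0 (j + 1)`. -/
theorem det_for {b : ℕ} {c : Reg} {e : Expr} {p : Prog} {T : ℕ} {M : ℤ → ℤ}
    {Q : (ℤ → ℤ) → Prop} (N : ℕ) (I : ℕ → (ℤ → ℤ) → Prop)
    (he : e.weight ≤ 300) (hN : N < 2 ^ b)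
    (heval : ∀ j ≤ N, ∀ M, I j M → e.eval M = N ∧ rd M c 0 = j)
    (h0 : I 0 (upd M c 0 0))
    (hstep : ∀ j < N, ∀ M, I j M →
      Det b p T M fun M' => rd M' c 0 = j ∧ I (j + 1) (upd M' c 0 ((j : ℤ) + 1)))
    (hend : ∀ M, I N M → Q M) :
    Det b (forP c e p) (N * (T + 3) + 3) M Q := by
  have h : Det b (forP c e p) (1 + (N * (T + 1 + 1 + 1) + 1) + 1) M Q := by
    refine det_seq (det_sv (by decide) (by simp) ?_)
    refine det_loop N I ?_ ?_ ?_ (by simpa using h0)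
    · have : (e - vr c).weight = e.weight + (vr c).weight + 1 := rfl
      rw [this, weight_vr]; omega
    · intro j hj M hI
      obtain ⟨h1, h2⟩ := heval j hj.le M hI
      refine ⟨by simp only [eval_sub, eval_vr, h1, h2]; omega, det_seq ?_⟩
      refine (hstep j hj M hI).mono le_rfl fun M' hM' => ?_
      have hw : (vr c + Expr.lit 1).weight = (vr c).weight + 7 + 1 := rfl
      refine det_sv (by rw [hw, weight_vr]; omega) ?_ ?_
      · simp only [eval_add, eval_vr, eval_lit, hM'.1]
        omega
      · simp only [eval_add, eval_vr, eval_lit, hM'.1]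
        exact hM'.2
    · intro M hI
      obtain ⟨h1, h2⟩ := heval N le_rfl M hI
      exact ⟨by simp only [eval_sub, eval_vr, h1, h2]; omega, hend M hI⟩
  refine h.mono ?_ fun _ h => h
  nlinarith

/-- A loop that fills the first entries of an array. -/
theorem det_map {b : ℕ} {c k : Reg} {e f : Expr} {M : ℤ → ℤ} (N : ℕ) (F : ℕ → ℤ) (hck : c ≠ k)
    (he : e.weight ≤ 300) (hf : f.weight ≤ 400) (hN : N < 2 ^ b)
    (heval : ∀ M', Same [c, k] M M' → e.eval M' = N)
    (hF : ∀ j < N, ∀ M', Same [c, k] M M' → rd M' c 0 = j →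
      (∀ i : ℤ, (j : ℤ) ≤ i → rd M' k i = rd M k i) → f.eval M' = F j)
    (hb : ∀ j < N, (F j).natAbs < 2 ^ b) :
    Det b (forP c e (st k (vr c) f)) (N * 4 + 3) M fun M' =>
      Same [c, k] M M' ∧ (∀ j < N, rd M' k j = F j) ∧
        ∀ i : ℤ, (i < 0 ∨ (N : ℤ) ≤ i) → rd M' k i = rd M k i := by
  refine det_for (T := 1) N (fun j M' => rd M' c 0 = j ∧ Same [c, k] M M' ∧
    (∀ i < j, rd M' k i = F i) ∧ ∀ i : ℤ, (i < 0 ∨ (j : ℤ) ≤ i) → rd M' k i = rd M k i)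
    he hN ?_ ?_ ?_ ?_
  · rintro j - M' ⟨h1, h2, -⟩
    exact ⟨heval M' h2, h1⟩
  · refine ⟨by simp, (Same.refl _ _).upd (by simp) _ _, by simp, fun i _ => ?_⟩
    rw [rd_upd_of_ne hck.symm]
  · rintro j hj M' ⟨h1, h2, h3, h4⟩
    have hv := hF j hj M' h2 h1 fun i hi => h4 i (Or.inr hi)
    refine det_st (by rw [weight_vr]; omega) hf (by rw [hv]; exact hb j hj) ?_
    rw [hv, eval_vr, h1]
    refine ⟨by rw [rd_upd_of_ne hck, h1], by simp, (h2.upd (by simp) _ _).upd (by simp) _ _, ?_, ?_⟩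
    · intro i hi
      rw [rd_upd_of_ne hck.symm, rd_upd_self, Function.update_apply]
      split_ifs with hij
      · rw [show i = j by exact_mod_cast hij]
      · exact h3 i (by omega)
    · intro i hi
      push_cast at hi
      rw [rd_upd_of_ne hck.symm, rd_upd_self, Function.update_of_ne (by omega)]
      exact h4 i (by omega)
  · rintro M' ⟨-, h2, h3, h4⟩
    exact ⟨h2, h3, h4⟩

/-- A loop that adds up the values of an expression. -/
theorem det_sum {b : ℕ} {c k : Reg} {e f : Expr} {M : ℤ → ℤ} (N : ℕ) (F : ℕ → ℤ) (hck : c ≠ k)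
    (he : e.weight ≤ 300) (hf : f.weight ≤ 380) (hN : N < 2 ^ b)
    (heval : ∀ M', Same [c, k] M M' → e.eval M' = N)
    (hF : ∀ j < N, ∀ M', Same [c, k] M M' → rd M' c 0 = j → f.eval M' = F j)
    (hb : ∀ j ≤ N, (rd M k 0 + ∑ i ∈ Finset.range j, F i).natAbs < 2 ^ b) :
    Det b (forP c e (sv k (vr k + f))) (N * 4 + 3) M fun M' =>
      Same [c, k] M M' ∧ rd M' k 0 = rd M k 0 + ∑ i ∈ Finset.range N, F i := by
  refine det_for (T := 1) N (fun j M' => rd M' c 0 = j ∧ Same [c, k] M M' ∧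
    rd M' k 0 = rd M k 0 + ∑ i ∈ Finset.range j, F i) he hN ?_ ?_ ?_ ?_
  · rintro j - M' ⟨h1, h2, -⟩
    exact ⟨heval M' h2, h1⟩
  · refine ⟨by simp, (Same.refl _ _).upd (by simp) _ _, ?_⟩
    rw [rd_upd_of_ne hck.symm]; simp
  · rintro j hj M' ⟨h1, h2, h3⟩
    have hv := hF j hj M' h2 h1
    have hs := hb (j + 1) hj
    have hw : (vr k + f).weight = (vr k).weight + f.weight + 1 := rfl
    refine det_sv (by rw [hw, weight_vr]; omega) ?_ ?_
    · rw [eval_add, eval_vr, hv, h3, add_assoc, ← Finset.sum_range_succ]; exact hs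
    · rw [eval_add, eval_vr, hv, h3, add_assoc, ← Finset.sum_range_succ]
      refine ⟨by rw [rd_upd_of_ne hck, h1], by simp,
        (h2.upd (by simp) _ _).upd (by simp) _ _, ?_⟩
      rw [rd_upd_of_ne hck.symm]; simp
  · rintro M' ⟨-, h2, h3⟩
    exact ⟨h2, h3⟩

end RAM

/-! ## Randomized programs -/

namespace RAM

open MeasureTheory

/-- A finite experiment with fair coins: a decision tree with outcomes at its leaves. -/
inductive Rand (α : Type) : Type
  | pure (a : α)
  | flip (f : Bool → Rand α)

namespace Rand

variable {α β : Type}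

/-- The outcome of the experiment with the coins `ω k, ω (k + 1), …`, and the index of the first
coin that is not used. -/
def run : Rand α → (ℕ → Bool) → ℕ → α × ℕ
  | pure a, _, k => (a, k)
  | flip f, ω, k => (f (ω k)).run ω (k + 1)

/-- The expected value of `Φ` at the outcome. -/
noncomputable def ev (Φ : α → ℝ) : Rand α → ℝ
  | pure a => Φ a
  | flip f => ((f true).ev Φ + (f false).ev Φ) / 2

/-- All possible outcomes have the property `Q`. -/
def All (Q : α → Prop) : Rand α → Prop
  | pure a => Q a
  | flip f => ∀ c, (f c).All Q

/-- Perform an experiment that depends on the outcome of the previous one. -/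
def bind (κ : α → Rand β) : Rand α → Rand β
  | pure a => κ a
  | flip f => flip fun c => (f c).bind κ

theorem All.run {Q : α → Prop} : ∀ {τ : Rand α}, τ.All Q → ∀ ω k, Q (τ.run ω k).1
  | pure _, h, _, _ => h
  | flip _, h, ω, k => All.run (h (ω k)) ω (k + 1)

theorem All.mono {Q Q' : α → Prop} (hQ : ∀ a, Q a → Q' a) : ∀ {τ : Rand α}, τ.All Q → τ.All Q'
  | pure _, h => hQ _ h
  | flip _, h => fun c => All.mono hQ (h c)

theorem All.bind {Q : α → Prop} {Q' : β → Prop} {κ : α → Rand β} (hQ : ∀ a, Q a → (κ a).All Q') :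
    ∀ {τ : Rand α}, τ.All Q → (τ.bind κ).All Q'
  | pure _, h => hQ _ h
  | flip _, h => fun c => All.bind hQ (h c)

theorem run_bind (κ : α → Rand β) (ω : ℕ → Bool) : ∀ (τ : Rand α) (k : ℕ),
    (τ.bind κ).run ω k = (κ (τ.run ω k).1).run ω (τ.run ω k).2
  | pure _, _ => rfl
  | flip f, k => run_bind κ ω (f (ω k)) (k + 1)

theorem ev_mono {Q : α → Prop} {Φ Φ' : α → ℝ} (h : ∀ a, Q a → Φ a ≤ Φ' a) :
    ∀ {τ : Rand α}, τ.All Q → τ.ev Φ ≤ τ.ev Φ'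
  | pure _, hτ => h _ hτ
  | flip f, hτ => by
    have h1 := ev_mono h (hτ true)
    have h2 := ev_mono h (hτ false)
    simp only [ev]; linarith

theorem ev_bind (κ : α → Rand β) (Φ : β → ℝ) : ∀ τ : Rand α,
    (τ.bind κ).ev Φ = τ.ev fun a => (κ a).ev Φ
  | pure _ => rfl
  | flip f => by simp only [bind, ev, ev_bind κ Φ]

theorem ev_sum {ι : Type*} (s : Finset ι) (Φ : ι → α → ℝ) : ∀ τ : Rand α,
    τ.ev (fun a => ∑ i ∈ s, Φ i a) = ∑ i ∈ s, τ.ev (Φ i)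
  | pure _ => rfl
  | flip f => by
    simp only [ev, ev_sum s Φ, ← Finset.sum_add_distrib, Finset.sum_div]

theorem ev_mul_const (c : ℝ) (Φ : α → ℝ) : ∀ τ : Rand α,
    τ.ev (fun a => Φ a * c) = τ.ev Φ * c
  | pure _ => rfl
  | flip f => by simp only [ev, ev_mul_const c Φ]; ring

theorem run_congr {ω ω' : ℕ → Bool} : ∀ (τ : Rand α) {k : ℕ}, (∀ i, k ≤ i → ω i = ω' i) →
    τ.run ω k = τ.run ω' k
  | pure _, _, _ => rfl
  | flip f, k, h => by
    simp only [run, h k le_rfl]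
    exact run_congr _ fun i hi => h i (by omega)

end Rand

/-! ### Finite experiments inside the infinite sequence of coins -/

instance : IsProbabilityMeasure coins := by unfold coins; infer_instance

/-- Toggle the outcome of the coin number `k`. -/
def toggle (k : ℕ) (ω : ℕ → Bool) : ℕ → Bool := fun i => (if i = k then not else id) (ω i)

/-- Negation preserves a fair coin, and a product of measure preserving maps preserves the product
measure. -/
theorem measurePreserving_toggle (k : ℕ) : MeasurePreserving (toggle k) coins coins := by
  refine ⟨measurable_pi_lambda _ fun i => ?_, ?_⟩
  · exact (measurable_of_countable _).comp (measurable_pi_apply i)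
  · have h := Measure.infinitePi_map_pi (X := fun _ : ℕ => Bool) (Y := fun _ : ℕ => Bool)
      (fun _ : ℕ => (PMF.uniformOfFintype Bool).toMeasure)
      (f := fun i => if i = k then not else id) fun i => measurable_of_countable _
    refine h.trans ?_
    unfold coins
    congr 1
    funext i
    split_ifs
    · rw [PMF.toMeasure_map not _ (measurable_of_countable _)]
      congr 1
      ext c
      rw [PMF.map_apply]
      cases c <;> simp
    · exact Measure.map_id

/-- Toggling coin `k` preserves the measure and maps `S` to itself, because `S` ignores this coin.
It exchanges the two halves of `S`, which therefore have equal measure. -/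
theorem coins_real_inter_eq (k : ℕ) {S : Set (ℕ → Bool)} (hS : MeasurableSet S)
    (hk : ∀ ω ω' : ℕ → Bool, (∀ i, i ≠ k → ω i = ω' i) → ω ∈ S → ω' ∈ S) (c : Bool) :
    coins.real ({ω | ω k = c} ∩ S) = coins.real S / 2 := by
  have hm : ∀ c, MeasurableSet {ω : ℕ → Bool | ω k = c} := fun c =>
    measurableSet_eq_fun (measurable_pi_apply k) measurable_const
  have h1 : ∀ c, coins.real ({ω | ω k = !c} ∩ S) = coins.real ({ω | ω k = c} ∩ S) := by
    intro c
    have h := (measurePreserving_toggle k).measure_preimage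
      ((hm c).inter hS).nullMeasurableSet
    have h2 : toggle k ⁻¹' ({ω | ω k = c} ∩ S) = {ω | ω k = !c} ∩ S := by
      ext ω
      have h3 : toggle k ω ∈ S ↔ ω ∈ S :=
        ⟨hk _ _ fun i hi => by simp [toggle, hi], hk _ _ fun i hi => by simp [toggle, hi]⟩
      simp only [Set.mem_preimage, Set.mem_inter_iff, h3, Set.mem_ofPred_eq, toggle, if_true]
      cases ω k <;> cases c <;> simp
    rw [h2] at h
    simp only [measureReal_def, h]
  have h2 : coins.real S = coins.real ({ω | ω k = c} ∩ S) + coins.real ({ω | ω k = !c} ∩ S) := by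
    rw [← measureReal_inter_add_sdiff (s := S) (hm c)]
    congr 2
    · exact Set.inter_comm _ _
    · ext ω
      simp only [Set.mem_sdiff, Set.mem_ofPred_eq, Set.mem_inter_iff]
      cases ω k <;> cases c <;> simp
  rw [h2, h1]; ring

open Classical in
/-- The probability of an event of an experiment. -/
theorem Rand.coins_real_eq {α : Type} (P : α → Prop) : ∀ (τ : Rand α) (k : ℕ),
    MeasurableSet {ω | P (τ.run ω k).1} ∧
      coins.real {ω | P (τ.run ω k).1} = τ.ev fun a => if P a then 1 else 0
  | pure a, k => by
    by_cases h : P a <;> simp [run, ev, h]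
  | flip f, k => by
    have ih := fun c => coins_real_eq P (f c) (k + 1)
    have hm : ∀ c, MeasurableSet {ω : ℕ → Bool | ω k = c} := fun c =>
      measurableSet_eq_fun (measurable_pi_apply k) measurable_const
    have h1 : {ω | P ((flip f).run ω k).1} =
        ({ω | ω k = true} ∩ {ω | P ((f true).run ω (k + 1)).1}) ∪
        ({ω | ω k = false} ∩ {ω | P ((f false).run ω (k + 1)).1}) := by
      ext ω
      simp only [run, Set.mem_ofPred_eq, Set.mem_union, Set.mem_inter_iff]
      cases ω k <;> simp
    have h2 : ∀ c, coins.real ({ω | ω k = c} ∩ {ω | P ((f c).run ω (k + 1)).1}) =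
        ((f c).ev fun a => if P a then 1 else 0) / 2 := by
      intro c
      rw [coins_real_inter_eq k (ih c).1 _ c, (ih c).2]
      intro ω ω' h
      simp only [Set.mem_ofPred_eq]
      rw [run_congr (f c) fun i hi => h i (by omega)]
      exact id
    rw [h1]
    refine ⟨((hm _).inter (ih _).1).union ((hm _).inter (ih _).1), ?_⟩
    rw [measureReal_union _ ((hm _).inter (ih _).1), h2, h2, ev]
    · ring
    · rw [Set.disjoint_left]
      rintro ω ⟨h3, -⟩ ⟨h4, -⟩
      simp only [Set.mem_ofPred_eq] at h3 h4
      rw [h3] at h4; exact absurd h4 (by decide)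

/-! ### Triples for randomized programs -/

/-- The program `p`, started in the memory `M`, halts after at most `T` units of time in a memory
with the property `Q`, and the expected value of `Φ θ` at this memory is at most `v θ`. -/
def Rnd (b : ℕ) (p : Prog) (T : ℕ) (M : ℤ → ℤ) (Q : (ℤ → ℤ) → Prop) {Θ : Type}
    (Φ : Θ → (ℤ → ℤ) → ℝ) (v : Θ → ℝ) : Prop :=
  Bdd b M → ∃ τ : Rand (ℤ → ℤ), τ.All (fun M' => Bdd b M' ∧ Q M') ∧ (∀ θ, τ.ev (Φ θ) ≤ v θ) ∧
    ∀ ω k, ∃ t ≤ T * unit b, Run ω p ⟨M, k⟩ t ⟨(τ.run ω k).1, (τ.run ω k).2⟩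

variable {b : ℕ} {p q : Prog} {T U : ℕ} {M : ℤ → ℤ} {Q Q' : (ℤ → ℤ) → Prop} {Θ Θ' : Type}

theorem Rnd.of_det {Φ : Θ → (ℤ → ℤ) → ℝ} {v : Θ → ℝ}
    (h : Det b p T M fun M' => Q M' ∧ ∀ θ, Φ θ M' ≤ v θ) : Rnd b p T M Q Φ v := by
  intro hM
  obtain ⟨M', h1, h2, h3⟩ := h hM
  exact ⟨.pure M', ⟨h1, h2.1⟩, h2.2, h3⟩

theorem Rnd.mono {T' : ℕ} {Φ : Θ → (ℤ → ℤ) → ℝ} {v : Θ → ℝ} {Φ' : Θ' → (ℤ → ℤ) → ℝ}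
    {v' : Θ' → ℝ} (h : Rnd b p T M Q Φ v) (hT : T ≤ T') (g : Θ' → Θ)
    (hQ : ∀ M', Q M' → Q' M' ∧ ∀ θ, Φ' θ M' ≤ Φ (g θ) M') (hv : ∀ θ, v (g θ) ≤ v' θ) :
    Rnd b p T' M Q' Φ' v' := by
  intro hM
  obtain ⟨τ, h1, h2, h3⟩ := h hM
  refine ⟨τ, h1.mono fun M' h => ⟨h.1, (hQ M' h.2).1⟩, fun θ => ?_, fun ω k => ?_⟩
  · exact (Rand.ev_mono (fun M' hM' => (hQ M' hM'.2).2 θ) h1).trans ((h2 (g θ)).trans (hv θ))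
  · obtain ⟨t, ht, hr⟩ := h3 ω k
    exact ⟨t, ht.trans (by gcongr), hr⟩

/-- The common core of sequencing and looping: a tree for the continuation is chosen for every
intermediate memory and grafted onto the first tree. The relation `R` carries along the statement
about the run, whatever it is. -/
theorem exists_bind {Q Q' : (ℤ → ℤ) → Prop} {Φ : Θ → (ℤ → ℤ) → ℝ} {Φ' : Θ → (ℤ → ℤ) → ℝ}
    {v : Θ → ℝ} {R : (ℤ → ℤ) → (ℕ → Bool) → ℕ → (ℤ → ℤ) × ℕ → Prop} {τ : Rand (ℤ → ℤ)}
    (h1 : τ.All Q) (h2 : ∀ θ, τ.ev (Φ θ) ≤ v θ)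
    (h : ∀ M, Q M → ∃ σ : Rand (ℤ → ℤ), σ.All Q' ∧ (∀ θ, σ.ev (Φ' θ) ≤ Φ θ M) ∧
      ∀ ω k, R M ω k (σ.run ω k)) :
    ∃ σ : Rand (ℤ → ℤ), σ.All Q' ∧ (∀ θ, σ.ev (Φ' θ) ≤ v θ) ∧
      ∀ ω k, Q (τ.run ω k).1 ∧ R (τ.run ω k).1 ω (τ.run ω k).2 (σ.run ω k) := by
  have : Nonempty (Rand (ℤ → ℤ)) := ⟨.pure 0⟩
  choose! κ hκ1 hκ2 hκ3 using h
  refine ⟨τ.bind κ, h1.bind hκ1, fun θ => ?_, fun ω k => ⟨h1.run ω k, ?_⟩⟩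
  · rw [Rand.ev_bind]
    exact (Rand.ev_mono (fun M hM => hκ2 M hM θ) h1).trans (h2 θ)
  · rw [Rand.run_bind]
    exact hκ3 _ (h1.run ω k) _ _

/-- The bound promised by the second program is the test function of the first, so expectations
compose as for a supermartingale. -/
theorem Rnd.seq {Φ : Θ → (ℤ → ℤ) → ℝ} {v : Θ → ℝ} {Φ' : Θ → (ℤ → ℤ) → ℝ}
    (h : Rnd b p T M Q Φ v) (h' : ∀ M', Q M' → Rnd b q U M' Q' Φ' fun θ => Φ θ M') :
    Rnd b (.seq p q) (T + U + 1) M Q' Φ' v := by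
  intro hM
  obtain ⟨τ, h1, h2, h3⟩ := h hM
  obtain ⟨σ, h4, h5, h6⟩ := exists_bind
    (R := fun M ω k s => ∃ t ≤ U * unit b, Run ω q ⟨M, k⟩ t ⟨s.1, s.2⟩) h1 h2
    fun M' hM' => h' M' hM'.2 hM'.1
  refine ⟨σ, h4, h5, fun ω k => ?_⟩
  obtain ⟨t, ht, hr⟩ := h3 ω k
  obtain ⟨u, hu, hr'⟩ := (h6 ω k).2
  have : 1 ≤ unit b := by unfold unit; omega
  exact ⟨_, by nlinarith, .seq hr hr'⟩

theorem Rnd.cond {e : Expr} {Φ : Θ → (ℤ → ℤ) → ℝ} {v : Θ → ℝ}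
    (he : e.weight ≤ 400) (hp : 0 < e.eval M → Rnd b p T M Q Φ v)
    (hq : e.eval M ≤ 0 → Rnd b q T M Q Φ v) : Rnd b (.cond e p q) (T + 1) M Q Φ v := by
  intro hM
  have hc := Expr.cost_add_cost_le hM he he
  rcases lt_or_ge 0 (e.eval M) with h | h
  · obtain ⟨τ, h1, h2, h3⟩ := hp h hM
    refine ⟨τ, h1, h2, fun ω k => ?_⟩
    obtain ⟨t, ht, hr⟩ := h3 ω k
    exact ⟨_, by nlinarith, .condPos h hr⟩
  · obtain ⟨τ, h1, h2, h3⟩ := hq h hM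
    refine ⟨τ, h1, h2, fun ω k => ?_⟩
    obtain ⟨t, ht, hr⟩ := h3 ω k
    exact ⟨_, by nlinarith, .condNonpos h hr⟩

theorem Rnd.loop {e : Expr} (N : ℕ) (I : ℕ → (ℤ → ℤ) → Prop) (Ψ : ℕ → Θ → (ℤ → ℤ) → ℝ)
    (he : e.weight ≤ 400)
    (hstep : ∀ j < N, ∀ M, I j M →
      0 < e.eval M ∧ Rnd b p T M (I (j + 1)) (Ψ (j + 1)) fun θ => Ψ j θ M)
    (hend : ∀ M, I N M → e.eval M ≤ 0) {M : ℤ → ℤ} (h0 : I 0 M) :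
    Rnd b (.loop e p) (N * (T + 1) + 1) M (I N) (Ψ N) fun θ => Ψ 0 θ M := by
  suffices h : ∀ c j, j + c = N → ∀ M, I j M →
      Rnd b (.loop e p) (c * (T + 1) + 1) M (I N) (Ψ N) fun θ => Ψ j θ M from
    h N 0 (by simp) M h0
  intro c
  induction c with
  | zero =>
    intro j hj M hI hM
    obtain rfl : j = N := by simpa using hj
    have hc := Expr.cost_add_cost_le hM he he
    exact ⟨.pure M, ⟨hM, hI⟩, fun _ => le_rfl, fun ω k =>
      ⟨_, by nlinarith, .loopNonpos (hend M hI)⟩⟩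
  | succ c ih =>
    intro j hj M hI hM
    have hc := Expr.cost_add_cost_le hM he he
    obtain ⟨hpos, hd⟩ := hstep j (by omega) M hI
    obtain ⟨τ, h1, h2, h3⟩ := hd hM
    obtain ⟨σ, h4, h5, h6⟩ := exists_bind
      (R := fun M ω k s => ∃ t ≤ (c * (T + 1) + 1) * unit b, Run ω (.loop e p) ⟨M, k⟩ t ⟨s.1, s.2⟩)
      h1 h2 fun M' hM' => ih (j + 1) (by omega) M' hM'.2 hM'.1
    refine ⟨σ, h4, h5, fun ω k => ?_⟩
    obtain ⟨t, ht, hr⟩ := h3 ω k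
    obtain ⟨u, hu, hr'⟩ := (h6 ω k).2
    exact ⟨_, by nlinarith, .loopPos hpos hr hr'⟩

theorem rnd_for {c : Reg} {e : Expr} (N : ℕ) (I : ℕ → (ℤ → ℤ) → Prop)
    (Ψ : ℕ → Θ → (ℤ → ℤ) → ℝ) (he : e.weight ≤ 300) (hN : N < 2 ^ b)
    (heval : ∀ j ≤ N, ∀ M, I j M → e.eval M = N ∧ rd M c 0 = j)
    (h0 : I 0 (upd M c 0 0))
    (hstep : ∀ j < N, ∀ M, I j M →
      Rnd b p T M (fun M' => rd M' c 0 = j ∧ I (j + 1) (upd M' c 0 ((j : ℤ) + 1)))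
        (fun θ M' => Ψ (j + 1) θ (upd M' c 0 ((j : ℤ) + 1))) fun θ => Ψ j θ M) :
    Rnd b (forP c e p) (N * (T + 3) + 3) M (I N) (Ψ N) fun θ => Ψ 0 θ (upd M c 0 0) := by
  have h : Rnd b (forP c e p) (1 + (N * (T + 1 + 1 + 1) + 1) + 1) M (I N) (Ψ N)
      fun θ => Ψ 0 θ (upd M c 0 0) := by
    refine Rnd.seq (Q := I 0) (Φ := Ψ 0) (.of_det (det_sv (by decide) (by simp) ?_)) fun M' hM' => ?_
    · simpa using h0
    refine Rnd.loop N I Ψ ?_ ?_ ?_ hM'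
    · have : (e - vr c).weight = e.weight + (vr c).weight + 1 := rfl
      rw [this, weight_vr]; omega
    · intro j hj M hI
      obtain ⟨h1, h2⟩ := heval j hj.le M hI
      refine ⟨by simp only [eval_sub, eval_vr, h1, h2]; omega, Rnd.seq (hstep j hj M hI) ?_⟩
      intro M' hM'
      have hw : (vr c + Expr.lit 1).weight = (vr c).weight + 7 + 1 := rfl
      refine .of_det (det_sv (by rw [hw, weight_vr]; omega) ?_ ?_)
      · simp only [eval_add, eval_vr, eval_lit, hM'.1]
        omega
      · simp only [eval_add, eval_vr, eval_lit, hM'.1]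
        exact ⟨hM'.2, fun _ => le_rfl⟩
    · intro M hI
      obtain ⟨h1, h2⟩ := heval N le_rfl M hI
      simp only [eval_sub, eval_vr, h1, h2]; omega
  refine h.mono ?_ id (fun _ h => ⟨h, fun _ => le_rfl⟩) fun _ => le_rfl
  nlinarith

/-- Toss a coin and store the result in the register `k`. -/
def tossP (k : Reg) : Prog := .flip (.lit ((k.ctorIdx : ℤ) - 64))

theorem rnd_toss {k : Reg} {Φ : Θ → (ℤ → ℤ) → ℝ} (h : ∀ c : Bool, Q (upd M k 0 (if c then 1 else 0))) :
    Rnd b (tossP k) 1 M Q Φ fun θ => (Φ θ (upd M k 0 1) + Φ θ (upd M k 0 0)) / 2 := by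
  intro hM
  have ha : (Expr.lit ((k.ctorIdx : ℤ) - 64)).eval M = adr k 0 := by simp [adr]
  refine ⟨.flip fun c => .pure (upd M k 0 (if c then 1 else 0)), fun c => ⟨?_, h c⟩,
    fun θ => ?_, fun ω j => ?_⟩
  · have : 1 < 2 ^ b := Nat.one_lt_two_pow (by have := hM.1; omega)
    refine hM.update _ ?_
    split_ifs
    · simpa using this
    · simp
  · simp [Rand.ev]
  · have hr := Run.flip (ω := ω) (.lit ((k.ctorIdx : ℤ) - 64)) ⟨M, j⟩
    rw [ha] at hr
    refine ⟨_, ?_, hr⟩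
    have hw : (Expr.lit ((k.ctorIdx : ℤ) - 64)).weight ≤ 400 := by
      have := k.ctorIdx_lt
      simp only [Expr.weight]
      rw [if_pos (by omega)]; omega
    have := Expr.cost_add_cost_le hM hw hw
    simp only [one_mul]; omega

end RAM

/-! ## Integer matrices: rank one updates and principal submatrices -/

namespace IntMatrix

set_option linter.unusedSectionVars false

open Matrix

variable {ι : Type*} [Fintype ι] [DecidableEq ι]

/-- The matrix determinant lemma, cleared of the inverse: over `ℚ` the inverse is the adjugate
divided by the determinant. -/
theorem det_add_vecMulVec {M : Matrix ι ι ℤ} (hM : M.det ≠ 0) (v : ι → ℤ) :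
    (M + vecMulVec v v).det = M.det + v ⬝ᵥ (M.adjugate *ᵥ v) := by
  have hinj : Function.Injective (Int.castRingHom ℚ) := Int.cast_injective
  apply hinj
  set A : Matrix ι ι ℚ := (Int.castRingHom ℚ).mapMatrix M with hA
  set w : ι → ℚ := fun i => (v i : ℚ) with hw
  have hdA : A.det = (M.det : ℚ) := by rw [hA, ← RingHom.map_det]; rfl
  have hd : IsUnit A.det := by
    rw [hdA]; exact isUnit_iff_ne_zero.2 (by exact_mod_cast hM)
  have h := det_add_replicateCol_mul_replicateRow (ι := Unit) hd w w
  have h1 : A + replicateCol Unit w * replicateRow Unit w =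
      (Int.castRingHom ℚ).mapMatrix (M + vecMulVec v v) := by
    ext i j
    simp [hA, hw, vecMulVec_apply, Matrix.mul_apply]
  rw [h1, ← RingHom.map_det] at h
  rw [h]
  have h2 : A⁻¹ = A.det⁻¹ • A.adjugate := by rw [inv_def, Ring.inverse_eq_inv']
  have h3 : A.adjugate = (Int.castRingHom ℚ).mapMatrix M.adjugate := by
    rw [RingHom.map_adjugate]
  have h4 : (replicateRow Unit w * A⁻¹ * replicateCol Unit w) () () =
      A.det⁻¹ * ((v ⬝ᵥ (M.adjugate *ᵥ v) : ℤ) : ℚ) := by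
    rw [Matrix.mul_assoc, h2, Matrix.smul_mul, Matrix.mul_smul, Matrix.smul_apply, smul_eq_mul, h3]
    congr 1
    simp [Matrix.mul_apply, dotProduct, mulVec, hw]
  have hd' : A.det ≠ 0 := hd.ne_zero
  rw [det_unique (1 + _)]
  change A.det * (1 + (replicateRow Unit w * A⁻¹ * replicateCol Unit w) () ()) = _
  rw [h4, mul_add, ← mul_assoc, mul_inv_cancel₀ hd', hdA]
  simp

theorem mul_left_cancel_of_det_ne_zero {M A B : Matrix ι ι ℤ} (hM : M.det ≠ 0)
    (h : M * A = M * B) : A = B := by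
  have h1 := congrArg (M.adjugate * ·) h
  simp only [← Matrix.mul_assoc, adjugate_mul, Matrix.smul_mul, Matrix.one_mul] at h1
  ext i j
  have h2 := congrFun (congrFun h1 i) j
  simp only [Matrix.smul_apply, smul_eq_mul] at h2
  exact mul_left_cancel₀ hM h2

/-- The Sherman–Morrison formula multiplied by both determinants. It is checked after multiplication
by `M + v vᵀ`, which can be cancelled; symmetry makes `vᵀ adj M` the transpose of `adj M v`. -/
theorem adjugate_add_vecMulVec {M : Matrix ι ι ℤ} (hM : M.det ≠ 0) (hs : M.IsSymm) (v : ι → ℤ)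
    (h' : (M + vecMulVec v v).det ≠ 0) :
    M.det • (M + vecMulVec v v).adjugate = (M + vecMulVec v v).det • M.adjugate -
      vecMulVec (M.adjugate *ᵥ v) (M.adjugate *ᵥ v) := by
  refine mul_left_cancel_of_det_ne_zero h' ?_
  rw [Matrix.mul_smul, mul_adjugate]
  set y := M.adjugate *ᵥ v with hy
  have hd := det_add_vecMulVec hM v
  rw [← hy] at hd
  have hsym : (M.adjugate).IsSymm := by
    rw [Matrix.IsSymm, adjugate_transpose, hs]
  have h1 : M *ᵥ y = M.det • v := by
    rw [hy, mulVec_mulVec, mul_adjugate, smul_mulVec, one_mulVec]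
  have h2 : v ᵥ* M.adjugate = y := by
    rw [hy, ← vecMul_transpose, hsym]
  rw [Matrix.add_mul, Matrix.mul_sub, Matrix.mul_smul, mul_adjugate, mul_vecMulVec, h1,
    Matrix.mul_sub, Matrix.mul_smul, vecMulVec_mul, h2, vecMulVec_mul_vecMulVec]
  generalize (M + vecMulVec v v).det = D' at *
  ext i j
  simp only [Matrix.smul_apply, Matrix.add_apply, Matrix.sub_apply, smul_eq_mul, vecMulVec_apply,
    Pi.smul_apply, hd]
  ring

/-! ### Principal submatrices and the deletion of an index -/

/-- The rows and columns of `M` outside `A` are replaced by those of the identity matrix. -/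
def restr (A : Finset ι) (M : Matrix ι ι ℤ) : Matrix ι ι ℤ :=
  Matrix.of fun i j => if i ∈ A ∧ j ∈ A then M i j else if i = j then 1 else 0

/-- The adjugate of the principal submatrix of `M` on `A`, filled up with zeros. -/
def adjOn (A : Finset ι) (M : Matrix ι ι ℤ) : Matrix ι ι ℤ :=
  Matrix.of fun i j => if i ∈ A ∧ j ∈ A then (restr A M).adjugate i j else 0

/-- A real symmetric positive definite matrix with integer entries. -/
def IsPosDef (M : Matrix ι ι ℤ) : Prop := (M.map ((↑) : ℤ → ℝ)).PosDef

theorem IsPosDef.isSymm {M : Matrix ι ι ℤ} (h : IsPosDef M) : M.IsSymm := by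
  have h1 := h.isHermitian
  ext i j
  have h2 := congrFun (congrFun h1 i) j
  simpa using h2

theorem IsPosDef.det_pos {M : Matrix ι ι ℤ} (h : IsPosDef M) : 0 < M.det := by
  have h1 := Matrix.PosDef.det_pos h
  have h2 : (M.map ((↑) : ℤ → ℝ)).det = ((M.det : ℤ) : ℝ) := by
    have := (Int.castRingHom ℝ).map_det M
    exact this.symm
  rw [h2] at h1
  exact_mod_cast h1

theorem IsPosDef.add_vecMulVec {M : Matrix ι ι ℤ} (h : IsPosDef M) (v : ι → ℤ) :
    IsPosDef (M + vecMulVec v v) := by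
  have h1 : (M + vecMulVec v v).map ((↑) : ℤ → ℝ) =
      M.map ((↑) : ℤ → ℝ) + vecMulVec (fun i => (v i : ℝ)) (star fun i => (v i : ℝ)) := by
    ext i j; simp [vecMulVec_apply]
  unfold IsPosDef
  rw [h1]
  exact Matrix.PosDef.add_posSemidef h (posSemidef_vecMulVec_self_star _)

theorem isPosDef_smul_one {c : ℤ} (hc : 0 < c) : IsPosDef (c • (1 : Matrix ι ι ℤ)) := by
  have h1 : (c • (1 : Matrix ι ι ℤ)).map ((↑) : ℤ → ℝ) = (c : ℝ) • (1 : Matrix ι ι ℝ) := by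
    ext i j
    rw [map_apply, Matrix.smul_apply, Matrix.smul_apply, Matrix.one_apply, Matrix.one_apply]
    split_ifs <;> simp
  unfold IsPosDef
  rw [h1]
  exact Matrix.PosDef.one.smul (by exact_mod_cast hc)

/-- The quadratic form splits into that of `M` at the part of `x` supported on `A`, plus the sum of
the squares of the other coordinates. -/
theorem IsPosDef.restr {M : Matrix ι ι ℤ} (h : IsPosDef M) (A : Finset ι) :
    IsPosDef (restr A M) := by
  refine Matrix.PosDef.of_dotProduct_mulVec_pos ?_ fun x hx => ?_
  · ext i j
    have := h.isSymm.apply i j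
    simp only [IntMatrix.restr, conjTranspose_apply, map_apply, of_apply, star_trivial]
    by_cases hi : i ∈ A <;> by_cases hj : j ∈ A <;> simp [hi, hj, this, eq_comm]
  · set w : ι → ℝ := fun i => if i ∈ A then x i else 0 with hw
    have key : star x ⬝ᵥ ((IntMatrix.restr A M).map ((↑) : ℤ → ℝ) *ᵥ x) =
        star w ⬝ᵥ (M.map ((↑) : ℤ → ℝ) *ᵥ w) + ∑ i, if i ∈ A then 0 else x i ^ 2 := by
      simp only [dotProduct, mulVec, star_trivial, ← Finset.sum_add_distrib]
      refine Finset.sum_congr rfl fun i _ => ?_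
      by_cases hi : i ∈ A
      · simp only [hw, hi, if_true, add_zero]
        congr 1
        refine Finset.sum_congr rfl fun j _ => ?_
        by_cases hj : j ∈ A
        · simp [IntMatrix.restr, hi, hj]
        · have : i ≠ j := by rintro rfl; exact hj hi
          simp [IntMatrix.restr, hj, this]
      · simp only [hw, hi, if_false, zero_mul, zero_add]
        rw [Finset.sum_eq_single i]
        · simp [IntMatrix.restr, hi]; ring
        · intro j _ hj
          simp [IntMatrix.restr, hi, hj.symm]
        · simp
    rw [key]
    by_cases hw0 : w = 0
    · rw [hw0]
      simp only [star_zero, zero_dotProduct, zero_add]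
      obtain ⟨i, hi⟩ := Function.ne_iff.1 hx
      have hiA : i ∉ A := fun hA => hi (by simpa [hw, hA] using congrFun hw0 i)
      refine Finset.sum_pos' (fun j _ => by split_ifs <;> positivity) ⟨i, Finset.mem_univ _, ?_⟩
      rw [if_neg hiA]
      have : x i ≠ 0 := hi
      positivity
    · have := h.dotProduct_mulVec_pos hw0
      have h2 : 0 ≤ ∑ i, if i ∈ A then 0 else x i ^ 2 :=
        Finset.sum_nonneg fun j _ => by split_ifs <;> positivity
      linarith

theorem restr_univ (M : Matrix ι ι ℤ) : restr Finset.univ M = M := by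
  ext i j; simp [restr]

theorem adjOn_univ (M : Matrix ι ι ℤ) : adjOn Finset.univ M = M.adjugate := by
  ext i j; simp [adjOn, restr_univ]

theorem adjOn_symm {M : Matrix ι ι ℤ} (h : IsPosDef M) (A : Finset ι) (i j : ι) :
    adjOn A M i j = adjOn A M j i := by
  have h1 : (restr A M).adjugate.IsSymm := by
    rw [Matrix.IsSymm, adjugate_transpose, (h.restr A).isSymm]
  simp only [adjOn, of_apply, and_comm (a := i ∈ A), h1.apply i j]

/-- The cofactor is a determinant with row `p` replaced by a unit vector. Multiples of this row
clear column `p`, after which row and column `p` are those of the identity. -/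
theorem det_restr_erase {M : Matrix ι ι ℤ} {A : Finset ι} {p : ι} (hp : p ∈ A) :
    (restr (A.erase p) M).det = adjOn A M p p := by
  simp only [adjOn, of_apply, hp, and_self, if_true, adjugate_apply]
  symm
  refine det_eq_of_forall_row_eq_smul_add_const (fun i => if i = p then 0 else restr A M i p) p
    (by simp) fun i j => ?_
  by_cases hi : i = p
  · subst hi
    by_cases hj : j = i
    · subst hj; simp [restr]
    · simp [restr, hj, Ne.symm hj]
  · rw [updateRow_ne hi]
    by_cases hj : j = p
    · subst hj
      simp [restr, hi]
    · have hj' : ¬ p = j := fun h => hj h.symm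
      simp [restr, hi, hj, hj']

theorem adjOn_diag_pos {M : Matrix ι ι ℤ} (h : IsPosDef M) {A : Finset ι} {p : ι} (hp : p ∈ A) :
    0 < adjOn A M p p := by
  rw [← det_restr_erase hp]
  exact (h.restr _).det_pos

theorem sum_mul_adjOn {M : Matrix ι ι ℤ} {A : Finset ι} {i j : ι} (hi : i ∈ A) (hj : j ∈ A) :
    ∑ k, M i k * adjOn A M k j = if i = j then (restr A M).det else 0 := by
  have h := congrFun (congrFun (mul_adjugate (restr A M)) i) j
  simp only [Matrix.mul_apply, Matrix.smul_apply, Matrix.one_apply, smul_eq_mul, mul_ite, mul_one,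
    mul_zero] at h
  rw [← h]
  refine Finset.sum_congr rfl fun k _ => ?_
  by_cases hk : k ∈ A
  · simp [adjOn, restr, hi, hj, hk]
  · have : i ≠ k := by rintro rfl; exact hk hi
    simp [adjOn, restr, hk, this]

/-- A Desnanot–Jacobi identity. It has the shape of the rank one update, with the diagonal cofactor
as the new determinant and column `p` as the vector, so that a single program serves for adding rows
and for deleting indices. -/
theorem det_mul_adjOn_erase {M : Matrix ι ι ℤ} (h : IsPosDef M) {A : Finset ι} {p : ι}
    (hp : p ∈ A) (i j : ι) :
    (restr A M).det * adjOn (A.erase p) M i j =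
      adjOn A M p p * adjOn A M i j - adjOn A M i p * adjOn A M p j := by
  by_cases hij : i ∈ A.erase p ∧ j ∈ A.erase p
  swap
  · have h0 : adjOn (A.erase p) M i j = 0 := by simp only [adjOn, of_apply, if_neg hij]
    rw [h0, mul_zero]
    by_cases hi : i = p
    · subst hi; ring
    by_cases hj : j = p
    · subst hj; ring
    by_cases hiA : i ∈ A
    · have hjA : j ∉ A := fun hjA => hij ⟨Finset.mem_erase.2 ⟨hi, hiA⟩, Finset.mem_erase.2 ⟨hj, hjA⟩⟩
      simp [adjOn, hjA]
    · simp [adjOn, hiA]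
  set R := restr A M with hR
  set R' := restr (A.erase p) M with hR'
  have hd' : R'.det ≠ 0 := (h.restr _).det_pos.ne'
  have hdet : R'.det = adjOn A M p p := det_restr_erase hp
  have hpp : adjOn A M p p = R.adjugate p p := by simp [adjOn, hp, hR]
  set Y : Matrix ι ι ℤ := Matrix.of fun i j => R.adjugate p p * R.adjugate i j -
    R.adjugate i p * R.adjugate p j with hY
  -- `Y` vanishes in row and column `p`, whereas `R'` has a `1` at the diagonal place; the missing
  -- entry of the adjugate is added separately.
  have key : R.det • R'.adjugate = Y + (R.det * R'.det) • Matrix.single p p (1 : ℤ) := by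
    refine mul_left_cancel_of_det_ne_zero hd' ?_
    rw [Matrix.mul_smul, mul_adjugate]
    have hR1 : R * R.adjugate = R.det • (1 : Matrix ι ι ℤ) := mul_adjugate _
    ext i k
    have hYp : ∀ k, Y p k = 0 := fun k => by simp [hY, mul_comm]
    have hsum : ∀ i k, i ≠ p → (R' * Y) i k = (R * Y) i k := by
      intro i k hi
      simp only [Matrix.mul_apply]
      refine Finset.sum_congr rfl fun j _ => ?_
      by_cases hj : j = p
      · subst hj; simp [hYp]
      · congr 1
        simp [hR, hR', restr, hi, hj]
    have hRY : ∀ i k, (R * Y) i k = R.adjugate p p * (R.det * (1 : Matrix ι ι ℤ) i k) -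
        (R.det * (1 : Matrix ι ι ℤ) i p) * R.adjugate p k := by
      intro i k
      have h1 := congrFun (congrFun hR1 i) k
      have h2 := congrFun (congrFun hR1 i) p
      simp only [Matrix.mul_apply, Matrix.smul_apply, smul_eq_mul] at h1 h2
      rw [← h1, ← h2]
      simp only [Matrix.mul_apply, hY, of_apply, Finset.mul_sum, Finset.sum_mul,
        ← Finset.sum_sub_distrib]
      exact Finset.sum_congr rfl fun j _ => by ring
    have hE : (R' * Matrix.single p p (1 : ℤ)) i k = if i = p ∧ k = p then 1 else 0 := by
      rw [Matrix.mul_apply, Finset.sum_eq_single p]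
      · by_cases hi : i = p <;> by_cases hk : k = p
        · subst hi; subst hk; simp [hR', restr]
        · simp [hk, Ne.symm hk, hi]
        · simp [hR', restr, hi, hk]
        · simp [hk, Ne.symm hk, hi]
      · intro j _ hj
        simp [hj.symm]
      · simp
    rw [Matrix.mul_add, Matrix.mul_smul, Matrix.add_apply, Matrix.smul_apply, Matrix.smul_apply,
      Matrix.smul_apply, hE]
    simp only [smul_eq_mul]
    by_cases hi : i = p
    · subst hi
      have h3 : (R' * Y) i k = 0 := by
        rw [Matrix.mul_apply]
        refine Finset.sum_eq_zero fun j _ => ?_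
        by_cases hj : j = i
        · subst hj; simp [hYp]
        · simp [hR', restr, Ne.symm hj]
      rw [h3]
      by_cases hk : i = k
      · subst hk; simp
      · simp [hk, Ne.symm hk]
    · rw [hsum i k hi, hRY, hdet, hpp]
      simp only [hi, false_and, if_false, Matrix.one_apply, mul_zero, zero_mul, sub_zero, add_zero]
      ring
  obtain ⟨hi, hj⟩ := hij
  have h1 := congrFun (congrFun key i) j
  have hip : i ≠ p := (Finset.mem_erase.1 hi).1
  have hiA : i ∈ A := (Finset.mem_erase.1 hi).2
  have hjA : j ∈ A := (Finset.mem_erase.1 hj).2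
  have e1 : adjOn (A.erase p) M i j = R'.adjugate i j := by
    simp only [adjOn, of_apply, hi, hj, and_self, if_true, hR']
  have e2 : ∀ i' ∈ A, ∀ j' ∈ A, adjOn A M i' j' = R.adjugate i' j' := fun i' hi' j' hj' => by
    simp only [adjOn, of_apply, hi', hj', and_self, if_true, hR]
  rw [e1, e2 p hp p hp, e2 i hiA j hjA, e2 i hiA p hp, e2 p hp j hjA]
  simpa [hY, Matrix.single_apply, hip.symm] using h1

/-- The Leibniz expansion has `n!` terms, each a product of `n` entries. This and its consequences
keep all minors at polynomially many digits. -/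
theorem natAbs_det_le {M : Matrix ι ι ℤ} {c : ℕ} (hM : ∀ i j, (M i j).natAbs ≤ c) :
    M.det.natAbs ≤ (Fintype.card ι).factorial * c ^ Fintype.card ι := by
  have := Matrix.det_le (A := M) (abv := AbsoluteValue.abs) (x := (c : ℤ)) fun i j => by
    have := hM i j
    simp only [AbsoluteValue.abs_apply, Int.abs_eq_natAbs]; exact_mod_cast this
  simp only [AbsoluteValue.abs_apply, nsmul_eq_mul] at this
  rw [Int.abs_eq_natAbs] at this
  exact_mod_cast this

theorem natAbs_adjugate_le {M : Matrix ι ι ℤ} {c : ℕ} (hc : 1 ≤ c)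
    (hM : ∀ i j, (M i j).natAbs ≤ c) (i j : ι) :
    (M.adjugate i j).natAbs ≤ (Fintype.card ι).factorial * c ^ Fintype.card ι := by
  rw [adjugate_apply]
  refine natAbs_det_le fun k l => ?_
  by_cases hk : k = j
  · subst hk
    rw [updateRow_self, Pi.single_apply]
    split_ifs
    exacts [by simpa using hc, by simp]
  · rw [updateRow_ne hk]; exact hM k l

theorem natAbs_restr_le {M : Matrix ι ι ℤ} {c : ℕ} (hc : 1 ≤ c)
    (hM : ∀ i j, (M i j).natAbs ≤ c) (A : Finset ι) (i j : ι) : (restr A M i j).natAbs ≤ c := by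
  simp only [restr, of_apply]
  split_ifs
  exacts [hM i j, by simpa using hc, by simp]

theorem natAbs_adjOn_le {M : Matrix ι ι ℤ} {c : ℕ} (hc : 1 ≤ c)
    (hM : ∀ i j, (M i j).natAbs ≤ c) (A : Finset ι) (i j : ι) :
    (adjOn A M i j).natAbs ≤ (Fintype.card ι).factorial * c ^ Fintype.card ι := by
  simp only [adjOn, of_apply]
  split_ifs
  · exact natAbs_adjugate_le hc (natAbs_restr_le hc hM A) i j
  · simp

end IntMatrix

/-! ## The potential of the Gram–Schmidt walk -/

namespace GSWalk

set_option linter.unusedSectionVars false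

open Real Finset

/-! ### Exponential moments of a biased sign -/

/-- The exponential moment `E exp (a (ξ - x))` of a random sign `ξ` with mean `x`. -/
noncomputable def tilt (x a : ℝ) : ℝ := exp (-(a * x)) * (cosh a + x * sinh a)

theorem tilt_eq (x a : ℝ) :
    tilt x a = (1 + x) / 2 * exp (a * (1 - x)) + (1 - x) / 2 * exp (-(a * (1 + x))) := by
  rw [tilt, cosh_eq, sinh_eq]
  have h1 : exp (a * (1 - x)) = exp (-(a * x)) * exp a := by rw [← exp_add]; ring_nf
  have h2 : exp (-(a * (1 + x))) = exp (-(a * x)) * exp (-a) := by rw [← exp_add]; ring_nf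
  rw [h1, h2]; ring

theorem tilt_one (a : ℝ) : tilt 1 a = 1 := by rw [tilt_eq]; norm_num

theorem tilt_neg_one (a : ℝ) : tilt (-1) a = 1 := by rw [tilt_eq]; norm_num

theorem tilt_neg (x a : ℝ) : tilt x (-a) = tilt (-x) a := by
  rw [tilt_eq, tilt_eq]; ring_nf

theorem tilt_zero (x : ℝ) : tilt x 0 = 1 := by simp [tilt]

theorem hasDerivAt_tilt (x a : ℝ) : HasDerivAt (tilt x)
    ((1 - x ^ 2) / 2 * (exp (a * (1 - x)) - exp (-(a * (1 + x))))) a := by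
  have h : tilt x = fun a => (1 + x) / 2 * exp (a * (1 - x)) + (1 - x) / 2 * exp (-(a * (1 + x))) :=
    funext (tilt_eq x)
  rw [h]
  have h1 : HasDerivAt (fun a : ℝ => a * (1 - x)) (1 - x) a := by
    simpa using (hasDerivAt_id a).mul_const (1 - x)
  have h2 : HasDerivAt (fun a : ℝ => -(a * (1 + x))) (-(1 + x)) a := by
    have := ((hasDerivAt_id' a).mul_const (1 + x)).fun_neg
    rwa [one_mul] at this
  refine ((h1.exp.const_mul ((1 + x) / 2)).fun_add
    (h2.exp.const_mul ((1 - x) / 2))).congr_deriv ?_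
  ring

theorem tilt_mono {x a a' : ℝ} (hx : |x| ≤ 1) (ha : 0 ≤ a) (h : a ≤ a') :
    tilt x a ≤ tilt x a' := by
  obtain ⟨h1, h2⟩ := abs_le.1 hx
  refine monotoneOn_of_deriv_nonneg (convex_Ici 0)
    (fun y _ => (hasDerivAt_tilt x y).continuousAt.continuousWithinAt)
    (fun y _ => (hasDerivAt_tilt x y).differentiableAt.differentiableWithinAt)
    (fun y hy => ?_) ha (ha.trans h) h
  rw [interior_Ici] at hy
  have hy0 : (0 : ℝ) < y := hy
  rw [(hasDerivAt_tilt x y).deriv]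
  have : exp (-(y * (1 + x))) ≤ exp (y * (1 - x)) := exp_le_exp.2 (by nlinarith)
  have h3 : 0 ≤ (1 - x ^ 2) / 2 := by nlinarith
  exact mul_nonneg h3 (by linarith)

theorem one_le_tilt {x : ℝ} (hx : |x| ≤ 1) (a : ℝ) : 1 ≤ tilt x a := by
  rcases le_total 0 a with h | h
  · simpa [tilt_zero] using tilt_mono hx le_rfl h
  · have := tilt_mono (x := -x) (a := 0) (a' := -a) (by rwa [abs_neg]) le_rfl (by linarith)
    rw [tilt_neg, neg_neg, tilt_zero] at this
    exact this

theorem tilt_pos {x : ℝ} (hx : |x| ≤ 1) (a : ℝ) : 0 < tilt x a :=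
  zero_lt_one.trans_le (one_le_tilt hx a)

theorem cosh_add_mul_sinh_pos {x : ℝ} (hx : |x| ≤ 1) (a : ℝ) : 0 < cosh a + x * sinh a := by
  have := tilt_pos hx a
  unfold tilt at this
  exact (mul_pos_iff_of_pos_left (exp_pos _)).1 this

/-- The mean of a random sign after tilting. -/
theorem div_le_add {x a : ℝ} (hx : |x| ≤ 1) (ha : 0 ≤ a) :
    sinh a + x * cosh a ≤ (x + a) * (cosh a + x * sinh a) := by
  -- The quotient is the mean of the sign under the tilted law. Its derivative is the tilted
  -- variance, one minus the square of the mean, hence at most one.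
  have hd : ∀ y, HasDerivAt (fun a => (sinh a + x * cosh a) / (cosh a + x * sinh a) - a)
      (((cosh y + x * sinh y) * (cosh y + x * sinh y) - (sinh y + x * cosh y) *
        (sinh y + x * cosh y)) / (cosh y + x * sinh y) ^ 2 - 1) y := by
    intro y
    have h1 : HasDerivAt (fun a => sinh a + x * cosh a) (cosh y + x * sinh y) y :=
      (hasDerivAt_sinh y).add ((hasDerivAt_cosh y).const_mul x)
    have h2 : HasDerivAt (fun a => cosh a + x * sinh a) (sinh y + x * cosh y) y :=
      (hasDerivAt_cosh y).add ((hasDerivAt_sinh y).const_mul x)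
    exact (h1.div h2 (cosh_add_mul_sinh_pos hx y).ne').sub (hasDerivAt_id y)
  have hanti := antitoneOn_of_deriv_nonpos (convex_Ici 0)
    (fun y _ => (hd y).continuousAt.continuousWithinAt)
    (fun y _ => (hd y).differentiableAt.differentiableWithinAt)
    (fun y _ => by
      rw [(hd y).deriv]
      have := cosh_add_mul_sinh_pos hx y
      rw [sub_nonpos, div_le_one (by positivity)]
      nlinarith [sq_nonneg (sinh y + x * cosh y)]) (Set.self_mem_Ici (a := (0 : ℝ))) ha ha
  simp only [sinh_zero, cosh_zero, mul_one, mul_zero, zero_add, add_zero, sub_zero, div_one] at hanti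
  rw [sub_le_iff_le_add, div_le_iff₀ (cosh_add_mul_sinh_pos hx a)] at hanti
  exact hanti

/-- The logarithmic derivative of `tilt x` at `a` is the tilted mean minus `x`, which `div_le_add`
bounds by `a`; the Gaussian factor compensates exactly for this. -/
theorem tilt_mul_exp_anti {x a a' : ℝ} (hx : |x| ≤ 1) (ha : 0 ≤ a) (h : a ≤ a') :
    tilt x a' * exp (-(a' ^ 2 / 2)) ≤ tilt x a * exp (-(a ^ 2 / 2)) := by
  have hd : ∀ y, HasDerivAt (fun a => tilt x a * exp (-(a ^ 2 / 2)))
      (exp (-(y * x)) * exp (-(y ^ 2 / 2)) *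
        (sinh y + x * cosh y - (x + y) * (cosh y + x * sinh y))) y := by
    intro y
    have h1 : HasDerivAt (fun a : ℝ => exp (-(a * x))) (exp (-(y * x)) * -x) y := by
      have := ((hasDerivAt_id' y).mul_const x).fun_neg.exp
      rwa [one_mul] at this
    have h2 : HasDerivAt (fun a => cosh a + x * sinh a) (sinh y + x * cosh y) y :=
      (hasDerivAt_cosh y).add ((hasDerivAt_sinh y).const_mul x)
    have h3 : HasDerivAt (fun a : ℝ => exp (-(a ^ 2 / 2))) (exp (-(y ^ 2 / 2)) * -y) y := by
      refine (((hasDerivAt_id' y).fun_pow 2).div_const 2).fun_neg.exp.congr_deriv ?_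
      norm_num
    have h4 := (h1.fun_mul h2).fun_mul h3
    unfold tilt
    refine h4.congr_deriv ?_
    ring
  refine antitoneOn_of_deriv_nonpos (convex_Ici 0)
    (fun y _ => (hd y).continuousAt.continuousWithinAt)
    (fun y _ => (hd y).differentiableAt.differentiableWithinAt)
    (fun y hy => ?_) ha (ha.trans h) h
  rw [interior_Ici] at hy
  have hy0 : (0 : ℝ) ≤ y := le_of_lt hy
  rw [(hd y).deriv]
  have := div_le_add hx hy0
  exact mul_nonpos_of_nonneg_of_nonpos (by positivity) (by linarith)

theorem tilt_le {x : ℝ} (hx : |x| ≤ 1) (a : ℝ) : tilt x a ≤ exp (a ^ 2 / 2) := by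
  have key : ∀ {x a : ℝ}, |x| ≤ 1 → 0 ≤ a → tilt x a ≤ exp (a ^ 2 / 2) := by
    intro x a hx h
    have := tilt_mul_exp_anti hx le_rfl h
    rw [tilt_zero, exp_neg] at this
    norm_num at this
    rwa [← div_eq_mul_inv, div_le_one (exp_pos _)] at this
  rcases le_total 0 a with h | h
  · exact key hx h
  · have := key (x := -x) (a := -a) (by rwa [abs_neg]) (by linarith)
    rwa [tilt_neg, neg_neg, neg_sq] at this

/-- The comparison of the tilts that is needed when the pivot survives a step. -/
theorem tilt_mul_exp_le {x a a' S S' : ℝ} (hx : |x| ≤ 1)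
    (h1 : 0 ≤ a * a' → a ^ 2 ≤ a' ^ 2 → S' ≤ S)
    (h2 : 0 ≤ a * a' → a' ^ 2 ≤ a ^ 2 → S' - a' ^ 2 ≤ S - a ^ 2)
    (h3 : a * a' < 0 → S' ≤ S - a ^ 2) :
    tilt x a' * exp ((S' - a' ^ 2) / 2) ≤ tilt x a * exp ((S - a ^ 2) / 2) := by
  -- For a larger `a'` the factor `exp (-(a' ^ 2 / 2))` outweighs the growth of the tilt; for a
  -- smaller `a'` the tilt itself decreases.
  have key : ∀ {x a a' : ℝ}, |x| ≤ 1 → 0 ≤ a → 0 ≤ a' →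
      (a ^ 2 ≤ a' ^ 2 → S' ≤ S) → (a' ^ 2 ≤ a ^ 2 → S' - a' ^ 2 ≤ S - a ^ 2) →
      tilt x a' * exp ((S' - a' ^ 2) / 2) ≤ tilt x a * exp ((S - a ^ 2) / 2) := by
    intro x a a' hx ha ha' h1 h2
    rcases le_total a a' with h | h
    · have hS := h1 (by gcongr)
      have := tilt_mul_exp_anti hx ha h
      calc tilt x a' * exp ((S' - a' ^ 2) / 2)
          = tilt x a' * exp (-(a' ^ 2 / 2)) * exp (S' / 2) := by
            rw [mul_assoc, ← exp_add]; ring_nf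
        _ ≤ tilt x a * exp (-(a ^ 2 / 2)) * exp (S / 2) := by
            have := tilt_pos hx a
            gcongr
        _ = _ := by rw [mul_assoc, ← exp_add]; ring_nf
    · have hS := h2 (by gcongr)
      have h5 := tilt_mono hx ha' h
      have := tilt_pos hx a
      gcongr
  rcases lt_or_ge (a * a') 0 with h | h
  -- For opposite signs monotonicity is of no use, and both tilts are replaced by their extreme
  -- bounds `exp (a' ^ 2 / 2)` and `1`.
  · have hS := h3 h
    have e1 := tilt_le hx a'
    have e2 := one_le_tilt hx a
    calc tilt x a' * exp ((S' - a' ^ 2) / 2)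
        ≤ exp (a' ^ 2 / 2) * exp ((S' - a' ^ 2) / 2) := by gcongr
      _ = 1 * exp (S' / 2) := by rw [← exp_add]; ring_nf
      _ ≤ tilt x a * exp ((S - a ^ 2) / 2) := by gcongr
  · by_cases hs : 0 ≤ a ∧ 0 ≤ a'
    · exact key hx hs.1 hs.2 (h1 h) (h2 h)
    · have hs' : a ≤ 0 ∧ a' ≤ 0 := by
        rcases le_total 0 a with ha | ha <;> rcases le_total 0 a' with ha' | ha'
        · exact absurd ⟨ha, ha'⟩ hs
        · rcases ha.eq_or_lt with h0 | h0
          · exact ⟨h0.symm.le, ha'⟩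
          · rcases ha'.eq_or_lt with h0' | h0'
            · exact absurd ⟨ha, h0'.symm.le⟩ hs
            · nlinarith
        · rcases ha'.eq_or_lt with h0 | h0
          · exact ⟨ha, h0.symm.le⟩
          · rcases ha.eq_or_lt with h0' | h0'
            · exact absurd ⟨h0'.symm.le, ha'⟩ hs
            · nlinarith
        · exact ⟨ha, ha'⟩
      have := key (x := -x) (a := -a) (a' := -a') (by rwa [abs_neg]) (by linarith) (by linarith)
        (by simpa using h1 h) (by simpa using h2 h)
      rwa [tilt_neg, tilt_neg, neg_neg, neg_sq, neg_sq] at this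

/-! ### Squared lengths of orthogonal projections -/

variable {E : Type*} [NormedAddCommGroup E] [InnerProductSpace ℝ E]

open scoped InnerProductSpace

/-- The squared length of the projection of `θ` to `W`. -/
noncomputable def projSq (W : Submodule ℝ E) [W.HasOrthogonalProjection] (θ : E) : ℝ :=
  ‖W.starProjection θ‖ ^ 2

theorem inner_starProjection {W : Submodule ℝ E} [W.HasOrthogonalProjection] (θ : E) {w : E}
    (hw : w ∈ W) : ⟪W.starProjection θ, w⟫_ℝ = ⟪θ, w⟫_ℝ := by
  have := Submodule.sub_starProjection_mem_orthogonal (K := W) θ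
  have h := (Submodule.mem_orthogonal' W _).1 this w hw
  rw [inner_sub_left] at h
  linarith

/-- Expand the square of `P θ - w`. The squared projection is the maximum of such expressions over
`W`, so lower bounds for it come from the choice of a good `w`. -/
theorem two_mul_inner_sub_le_projSq {W : Submodule ℝ E} [W.HasOrthogonalProjection] (θ : E) {w : E}
    (hw : w ∈ W) : 2 * ⟪θ, w⟫_ℝ - ‖w‖ ^ 2 ≤ projSq W θ := by
  have h := norm_sub_sq_real (W.starProjection θ) w
  rw [inner_starProjection θ hw] at h
  have := sq_nonneg ‖W.starProjection θ - w‖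
  unfold projSq
  linarith

theorem projSq_eq_inner (W : Submodule ℝ E) [W.HasOrthogonalProjection] (θ : E) :
    projSq W θ = ⟪θ, W.starProjection θ⟫_ℝ := by
  rw [← inner_starProjection θ (Submodule.starProjection_apply_mem W θ), projSq,
    real_inner_self_eq_norm_sq]

theorem projSq_le (W : Submodule ℝ E) [W.HasOrthogonalProjection] (θ : E) :
    projSq W θ ≤ ‖θ‖ ^ 2 := by
  have h := norm_sub_sq_real θ (W.starProjection θ)
  rw [← projSq_eq_inner] at h
  have := sq_nonneg ‖θ - W.starProjection θ‖
  have h2 : ‖W.starProjection θ‖ ^ 2 = projSq W θ := rfl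
  linarith

/-- Cauchy–Schwarz in the part of `W` orthogonal to `W'`. The test vector is the projection to `W'`
plus `c • q`, and the best `c` is `⟪θ, q⟫ / ‖q‖ ^ 2`. -/
theorem projSq_add_le {W W' : Submodule ℝ E} [W.HasOrthogonalProjection]
    [W'.HasOrthogonalProjection] (hW : W' ≤ W) {q : E} (hq : q ∈ W) (hq' : ∀ w ∈ W', ⟪w, q⟫_ℝ = 0)
    (θ : E) : ⟪θ, q⟫_ℝ ^ 2 ≤ (projSq W θ - projSq W' θ) * ‖q‖ ^ 2 := by
  have hP := Submodule.starProjection_apply_mem W' θ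
  have key : ∀ c : ℝ, projSq W' θ + 2 * c * ⟪θ, q⟫_ℝ - c ^ 2 * ‖q‖ ^ 2 ≤ projSq W θ := by
    intro c
    have h := two_mul_inner_sub_le_projSq θ (W.add_mem (hW hP) (W.smul_mem c hq))
    rw [inner_add_right, ← projSq_eq_inner, inner_smul_right, norm_add_sq_real,
      inner_smul_right, hq' _ hP, norm_smul, mul_pow, Real.norm_eq_abs, sq_abs] at h
    have h2 : ‖W'.starProjection θ‖ ^ 2 = projSq W' θ := rfl
    linarith
  rcases (sq_nonneg ‖q‖).eq_or_lt with h0 | h0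
  · have hq0 : q = 0 := by
      have : ‖q‖ = 0 := by nlinarith
      exact norm_eq_zero.1 this
    simp [hq0]
  · have h := key (⟪θ, q⟫_ℝ / ‖q‖ ^ 2)
    have e : 2 * (⟪θ, q⟫_ℝ / ‖q‖ ^ 2) * ⟪θ, q⟫_ℝ - (⟪θ, q⟫_ℝ / ‖q‖ ^ 2) ^ 2 * ‖q‖ ^ 2 =
        ⟪θ, q⟫_ℝ ^ 2 / ‖q‖ ^ 2 := by
      field_simp; ring
    rw [← div_le_iff₀ h0]
    linarith

theorem projSq_mono {W W' : Submodule ℝ E} [W.HasOrthogonalProjection]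
    [W'.HasOrthogonalProjection] (hW : W' ≤ W) (θ : E) : projSq W' θ ≤ projSq W θ := by
  have h := two_mul_inner_sub_le_projSq θ (hW (Submodule.starProjection_apply_mem W' θ))
  rw [← projSq_eq_inner] at h
  have h2 : ‖W'.starProjection θ‖ ^ 2 = projSq W' θ := rfl
  linarith

/-! ### The residual of the pivot and the potential -/

variable {ι : Type*} [Fintype ι] [DecidableEq ι]

/-- The span of the vectors of the set `A` other than the pivot `p`. -/
noncomputable def spanErase (v : ι → E) (A : Finset ι) (p : ι) : Submodule ℝ E :=
  Submodule.span ℝ (v '' (A.erase p))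

noncomputable instance (v : ι → E) (A : Finset ι) (p : ι) :
    FiniteDimensional ℝ (spanErase v A p) := by
  unfold spanErase
  exact FiniteDimensional.span_of_finite ℝ ((A.erase p).finite_toSet.image v)

/-- The component of the vector of the pivot that is orthogonal to the other vectors. -/
noncomputable def resid (v : ι → E) (A : Finset ι) (p : ι) : E :=
  v p - (spanErase v A p).starProjection (v p)

/-- The potential of the walk at the point `x`, for the set `A` and the pivot `p`. -/
noncomputable def pot (v : ι → E) (θ : E) (x : ι → ℝ) (A : Finset ι) (p : ι) : ℝ :=
  exp ⟪θ, ∑ i, x i • v i⟫_ℝ * (tilt (x p) ⟪θ, resid v A p⟫_ℝ *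
    exp ((projSq (spanErase v A p) θ + ⟪θ, resid v A p⟫_ℝ ^ 2 / ‖resid v A p‖ ^ 2 -
      ⟪θ, resid v A p⟫_ℝ ^ 2) / 2))

variable {v : ι → E} {θ : E} {x : ι → ℝ} {A A' : Finset ι} {p p' : ι}

theorem pot_nonneg (hx : |x p| ≤ 1) : 0 ≤ pot v θ x A p := by
  have := tilt_pos hx ⟪θ, resid v A p⟫_ℝ
  unfold pot; positivity

theorem resid_orthogonal {w : E} (hw : w ∈ spanErase v A p) : ⟪w, resid v A p⟫_ℝ = 0 :=
  Submodule.sub_starProjection_mem_orthogonal (K := spanErase v A p) (v p) w hw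

/-- Uniqueness of the orthogonal decomposition; this will recognize the residual in a column of an
adjugate. -/
theorem resid_eq {b : E} (h1 : v p - b ∈ spanErase v A p)
    (h2 : ∀ i ∈ A.erase p, ⟪v i, b⟫_ℝ = 0) : resid v A p = b := by
  have h3 : (spanErase v A p).starProjection (v p) = v p - b := by
    refine Submodule.eq_starProjection_of_mem_orthogonal h1 ?_
    rw [sub_sub_cancel]
    refine (Submodule.mem_orthogonal _ _).2 fun w hw => ?_
    unfold spanErase at hw
    induction hw using Submodule.span_induction with
    | mem w hw =>
      obtain ⟨i, hi, rfl⟩ := hw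
      exact h2 i (Finset.mem_coe.1 hi)
    | zero => simp
    | add w w' _ _ h h' => rw [inner_add_left, h, h', add_zero]
    | smul c w _ h => rw [inner_smul_left, h, mul_zero]
  rw [resid, h3, sub_sub_cancel]

theorem spanErase_mono (h : A' ⊆ A) : spanErase v A' p ≤ spanErase v A p :=
  Submodule.span_mono (Set.image_mono (Finset.coe_subset.2 (Finset.erase_subset_erase p h)))

theorem mem_spanErase {i : ι} (hi : i ∈ A.erase p) : v i ∈ spanErase v A p :=
  Submodule.subset_span (Set.mem_image_of_mem v (Finset.mem_coe.2 hi))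

theorem resid_ne_zero (hv : LinearIndependent ℝ v) : resid v A p ≠ 0 := by
  intro h
  have h1 : v p ∈ spanErase v A p := by
    have := Submodule.starProjection_apply_mem (spanErase v A p) (v p)
    rwa [← sub_eq_zero.1 h] at this
  unfold spanErase at h1
  exact (LinearIndependent.notMem_span_image hv (by simp)) h1

theorem sq_norm_resid_pos (hv : LinearIndependent ℝ v) : 0 < ‖resid v A p‖ ^ 2 := by
  have := norm_pos_iff.2 (resid_ne_zero (A := A) (p := p) hv)
  positivity

theorem norm_resid_le (hv : ‖v p‖ ≤ 1) : ‖resid v A p‖ ^ 2 ≤ 1 := by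
  have h1 := resid_orthogonal (Submodule.starProjection_apply_mem (spanErase v A p) (v p))
  have h2 : v p = (spanErase v A p).starProjection (v p) + resid v A p := by
    unfold resid; abel
  have h3 : ‖v p‖ ^ 2 = ‖(spanErase v A p).starProjection (v p)‖ ^ 2 + ‖resid v A p‖ ^ 2 := by
    conv_lhs => rw [h2, norm_add_sq_real, h1]
    ring
  have h4 : ‖v p‖ ^ 2 ≤ 1 := by nlinarith [norm_nonneg (v p)]
  nlinarith [sq_nonneg ‖(spanErase v A p).starProjection (v p)‖]

/-- The potential is affine along the direction of the walk. -/
theorem pot_add_smul {u : ι → ℝ} (hu : ∑ i, u i • v i = u p • resid v A p) (s t : ℝ) :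
    pot v θ (fun i => x i + s * u i) A p * t + pot v θ (fun i => x i - t * u i) A p * s =
      (s + t) * pot v θ x A p := by
  -- Along `u` the growth of the exponential moment cancels against the factor `exp (-(a * x p))` of
  -- the tilt. Only `cosh a + x p * sinh a` still depends on `s`, and it is affine.
  have key : ∀ s : ℝ, pot v θ (fun i => x i + s * u i) A p =
      exp (⟪θ, ∑ i, x i • v i⟫_ℝ - ⟪θ, resid v A p⟫_ℝ * x p) *
      (cosh ⟪θ, resid v A p⟫_ℝ + (x p + s * u p) * sinh ⟪θ, resid v A p⟫_ℝ) *
      exp ((projSq (spanErase v A p) θ + ⟪θ, resid v A p⟫_ℝ ^ 2 / ‖resid v A p‖ ^ 2 -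
      ⟪θ, resid v A p⟫_ℝ ^ 2) / 2) := by
    intro s
    have h1 : ∑ i, (x i + s * u i) • v i = ∑ i, x i • v i + (s * u p) • resid v A p := by
      simp only [add_smul, sum_add_distrib, mul_smul, ← smul_sum, hu]
    rw [pot, h1, tilt, inner_add_right, inner_smul_right]
    rw [← mul_assoc, ← mul_assoc, ← exp_add]
    congr 3
    ring
  have h2 : pot v θ (fun i => x i - t * u i) A p = pot v θ (fun i => x i + -t * u i) A p := by
    congr 1; ext i; ring
  have h3 : pot v θ x A p = pot v θ (fun i => x i + 0 * u i) A p := by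
    congr 1; ext i; ring
  rw [h2, h3, key, key, key]
  ring

/-- The potential does not increase when the pivot survives a step. -/
theorem pot_le_of_mem (hv : LinearIndependent ℝ v) (hv1 : ‖v p‖ ≤ 1) (hx : |x p| ≤ 1)
    (hA : A' ⊆ A) : pot v θ x A' p ≤ pot v θ x A p := by
  have hW := spanErase_mono (v := v) (p := p) hA
  have hr := sq_norm_resid_pos (A := A) (p := p) hv
  have hr1 := norm_resid_le (A := A) hv1
  have hr' := sq_norm_resid_pos (A := A') (p := p) hv
  have hr1' := norm_resid_le (A := A') hv1
  -- The vector `q` lies in the old span and is orthogonal to the new one. It measures at once how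
  -- much the residual grows and how much the projection of `θ` must shrink.
  obtain ⟨q, hq⟩ : ∃ q, q = resid v A' p - resid v A p := ⟨_, rfl⟩
  have hqW : q ∈ spanErase v A p := by
    rw [hq, resid, resid, sub_sub_sub_cancel_left]
    exact Submodule.sub_mem _ (Submodule.starProjection_apply_mem _ _)
      (hW (Submodule.starProjection_apply_mem _ _))
  have hqW' : ∀ w ∈ spanErase v A' p, ⟪w, q⟫_ℝ = 0 := fun w hw => by
    rw [hq, inner_sub_right, resid_orthogonal hw, resid_orthogonal (hW hw), sub_zero]
  have hnorm : ‖resid v A' p‖ ^ 2 = ‖resid v A p‖ ^ 2 + ‖q‖ ^ 2 := by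
    have h1 : resid v A' p = q + resid v A p := by rw [hq]; abel
    rw [h1, norm_add_sq_real, resid_orthogonal hqW]; ring
  have hin : ⟪θ, q⟫_ℝ = ⟪θ, resid v A' p⟫_ℝ - ⟪θ, resid v A p⟫_ℝ := by rw [hq, inner_sub_right]
  have hP := projSq_add_le hW hqW hqW' θ
  have hPm := projSq_mono hW θ
  rw [hin] at hP
  unfold pot
  refine mul_le_mul_of_nonneg_left ?_ (exp_pos _).le
  generalize ⟪θ, resid v A' p⟫_ℝ = a' at *
  generalize ⟪θ, resid v A p⟫_ℝ = a at *
  generalize projSq (spanErase v A p) θ = P at *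
  generalize projSq (spanErase v A' p) θ = P' at *
  generalize ‖resid v A p‖ ^ 2 = r at *
  generalize ‖resid v A' p‖ ^ 2 = r' at *
  have hQ : 0 ≤ ‖q‖ ^ 2 := sq_nonneg _
  generalize ‖q‖ ^ 2 = Q at *
  subst hnorm
  refine tilt_mul_exp_le hx ?_ ?_ ?_
  -- With `b = a' - a` this is `(a + b) ^ 2 / (r + Q) ≤ a ^ 2 / r + b ^ 2 / Q`, followed by `b ^ 2 ≤
  -- (P - P') * Q`. If `Q = 0`, then `a' = a`.
  · intro _ _
    have : a' ^ 2 / (r + Q) ≤ a ^ 2 / r + (P - P') := by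
      rw [div_add' _ _ _ hr.ne', div_le_div_iff₀ hr' hr]
      have h0 : 0 ≤ P - P' := by linarith
      rcases hQ.eq_or_lt with h | h
      · subst h
        have : a' = a := by nlinarith
        subst this
        nlinarith [mul_nonneg h0 hr.le]
      · have h1 : 2 * a * (a' - a) * r * Q ≤ a ^ 2 * Q * Q + (a' - a) ^ 2 * r * r := by
          nlinarith [sq_nonneg (a * Q - (a' - a) * r)]
        have h2 : (a' - a) ^ 2 * r * (r + Q) ≤ (P - P') * Q * r * (r + Q) := by
          have := mul_le_mul_of_nonneg_right hP (mul_nonneg hr.le hr'.le)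
          nlinarith
        have h3 : a' ^ 2 * r * Q ≤ (a ^ 2 + (P - P') * r) * (r + Q) * Q := by nlinarith
        exact le_of_mul_le_mul_right h3 h
    linarith
  · intro _ h
    have h1 : a' ^ 2 / (r + Q) - a' ^ 2 = a' ^ 2 * (1 / (r + Q) - 1) := by ring
    have h2 : a ^ 2 / r - a ^ 2 = a ^ 2 * (1 / r - 1) := by ring
    have h3 : 1 / (r + Q) ≤ 1 / r := one_div_le_one_div_of_le hr (by linarith)
    have h4 : 1 ≤ 1 / (r + Q) := by rw [le_div_iff₀ hr']; linarith
    have h5 : a' ^ 2 * (1 / (r + Q) - 1) ≤ a ^ 2 * (1 / r - 1) :=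
      mul_le_mul h (by linarith) (by linarith) (sq_nonneg _)
    linarith
  -- Opposite signs give `a' ^ 2 ≤ (a' - a) ^ 2 ≤ (P - P') * Q`. Here, as in the preceding case, the
  -- bound `‖v p‖ ≤ 1` enters, through `a ^ 2 ≤ a ^ 2 / r`.
  · intro h
    have h1 : a' ^ 2 / (r + Q) ≤ P - P' := by
      rw [div_le_iff₀ hr']
      nlinarith [sq_nonneg a, mul_nonneg (sub_nonneg.2 hPm) hr.le]
    have h2 : a ^ 2 ≤ a ^ 2 / r := by
      rw [le_div_iff₀ hr]; nlinarith [sq_nonneg a]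
    linarith

/-- The residual completes the span of the other vectors by an orthogonal direction; the two terms
are the squared projections to these two orthogonal pieces of `W`. -/
theorem projSq_add_inner_le (hv : LinearIndependent ℝ v) {W : Submodule ℝ E}
    [W.HasOrthogonalProjection] (hW : spanErase v A p ≤ W) (hp : v p ∈ W) :
    projSq (spanErase v A p) θ + ⟪θ, resid v A p⟫_ℝ ^ 2 / ‖resid v A p‖ ^ 2 ≤ projSq W θ := by
  have hr := sq_norm_resid_pos (A := A) (p := p) hv
  have h := projSq_add_le hW (q := resid v A p)
    (W.sub_mem hp (hW (Submodule.starProjection_apply_mem _ _))) (fun w hw => resid_orthogonal hw) θ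
  rw [← div_le_iff₀ hr] at h
  linarith

theorem pot_eq_of_frozen (hx : |x p| = 1) : pot v θ x A p = exp ⟪θ, ∑ i, x i • v i⟫_ℝ *
    exp ((projSq (spanErase v A p) θ + ⟪θ, resid v A p⟫_ℝ ^ 2 / ‖resid v A p‖ ^ 2 -
      ⟪θ, resid v A p⟫_ℝ ^ 2) / 2) := by
  have h : tilt (x p) ⟪θ, resid v A p⟫_ℝ = 1 := by
    rcases eq_or_eq_neg_of_abs_eq hx with h | h <;> rw [h]
    exacts [tilt_one _, tilt_neg_one _]
  rw [pot, h, one_mul]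

theorem sq_inner_resid_le (hv : LinearIndependent ℝ v) (hv1 : ‖v p‖ ≤ 1) :
    ⟪θ, resid v A p⟫_ℝ ^ 2 ≤ ⟪θ, resid v A p⟫_ℝ ^ 2 / ‖resid v A p‖ ^ 2 := by
  have hr := sq_norm_resid_pos (A := A) (p := p) hv
  have hr1 := norm_resid_le (A := A) hv1
  rw [le_div_iff₀ hr]
  nlinarith [sq_nonneg ⟪θ, resid v A p⟫_ℝ]

/-- The potential bounds the exponential moment at the end of the walk. -/
theorem exp_le_pot (hv : LinearIndependent ℝ v) (hv1 : ‖v p‖ ≤ 1) (hx : |x p| = 1) :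
    exp ⟪θ, ∑ i, x i • v i⟫_ℝ ≤ pot v θ x A p := by
  rw [pot_eq_of_frozen hx]
  refine le_mul_of_one_le_right (exp_pos _).le (one_le_exp ?_)
  have h1 := sq_inner_resid_le (θ := θ) (A := A) hv hv1
  have h2 : 0 ≤ projSq (spanErase v A p) θ := sq_nonneg _
  linarith

/-- An upper bound for the potential. -/
theorem pot_le_exp (hv : LinearIndependent ℝ v) (hx : |x p| ≤ 1) {W : Submodule ℝ E}
    [W.HasOrthogonalProjection] (hW : spanErase v A p ≤ W) (hp : v p ∈ W) :
    pot v θ x A p ≤ exp ⟪θ, ∑ i, x i • v i⟫_ℝ * exp (projSq W θ / 2) := by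
  refine mul_le_mul_of_nonneg_left ?_ (exp_pos _).le
  calc _ ≤ exp (⟪θ, resid v A p⟫_ℝ ^ 2 / 2) * _ :=
        mul_le_mul_of_nonneg_right (tilt_le hx _) (exp_pos _).le
    _ ≤ _ := by
        rw [← exp_add, exp_le_exp]
        have := projSq_add_inner_le (θ := θ) hv hW hp
        linarith

/-- The potential does not increase when the pivot is frozen and a new pivot is chosen. -/
theorem pot_le_of_frozen (hv : LinearIndependent ℝ v) (hv1 : ‖v p‖ ≤ 1) (hx : |x p| = 1)
    (hx' : |x p'| ≤ 1) (hA : A' ⊆ A.erase p) (hp' : p' ∈ A') :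
    pot v θ x A' p' ≤ pot v θ x A p := by
  have hW : spanErase v A' p' ≤ spanErase v A p :=
    Submodule.span_mono (Set.image_mono (Finset.coe_subset.2 ((Finset.erase_subset _ _).trans hA)))
  -- The new potential is bounded by means of the projection to the span without the old pivot. That
  -- projection already occurs in the old exponent, whose remaining terms are nonnegative because
  -- the residual has length at most one.
  refine (pot_le_exp hv hx' hW (mem_spanErase (hA hp'))).trans ?_
  rw [pot_eq_of_frozen hx]
  refine mul_le_mul_of_nonneg_left (exp_le_exp.2 ?_) (exp_pos _).le
  have h1 := sq_inner_resid_le (θ := θ) (A := A) hv hv1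
  linarith

theorem pot_zero_le (hv : LinearIndependent ℝ v) [FiniteDimensional ℝ E] :
    pot v θ 0 A p ≤ exp (‖θ‖ ^ 2 / 2) := by
  refine (pot_le_exp (W := ⊤) hv (by simp) le_top Submodule.mem_top).trans ?_
  simp only [Pi.zero_apply, zero_smul, sum_const_zero, inner_zero_right, exp_zero, one_mul]
  have := projSq_le (⊤ : Submodule ℝ E) θ
  exact exp_le_exp.2 (by linarith)

end GSWalk

/-! ## Programs for the updates of the adjugate -/

namespace RAM

open Reg IntMatrix Matrix

/-- The first `n` entries of the array `k` are the vector `y`. -/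
def HasVec {n : ℕ} (k : Reg) (M : ℤ → ℤ) (y : Fin n → ℤ) : Prop :=
  ∀ i : Fin n, rd M k (i : ℕ) = y i

/-- The array `mat` holds the matrix `X`. -/
def HasMat {n : ℕ} (M : ℤ → ℤ) (X : Matrix (Fin n) (Fin n) ℤ) : Prop :=
  ∀ i j : Fin n, rd M mat ((i : ℕ) * n + (j : ℕ)) = X i j

theorem HasMat.of_eq {n : ℕ} {M M' : ℤ → ℤ} {X : Matrix (Fin n) (Fin n) ℤ} (h : HasMat M X)
    (h' : rd M' mat = rd M mat) : HasMat M' X := fun i j => by rw [h', h]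

theorem HasVec.of_eq {n : ℕ} {k : Reg} {M M' : ℤ → ℤ} {y : Fin n → ℤ} (h : HasVec k M y)
    (h' : rd M' k = rd M k) : HasVec k M' y := fun i => by rw [h', h]

@[simp] theorem weight_add (a b : Expr) : (a + b).weight = a.weight + b.weight + 1 := rfl
@[simp] theorem weight_sub (a b : Expr) : (a - b).weight = a.weight + b.weight + 1 := rfl
@[simp] theorem weight_mul (a b : Expr) : (a * b).weight = a.weight + b.weight + 1 := rfl
@[simp] theorem weight_div (a b : Expr) : (a / b).weight = a.weight + b.weight + 1 := rfl
theorem weight_lit {c : ℤ} (h : c.natAbs < 128) : (Expr.lit c).weight = 7 := if_pos h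
@[simp] theorem weight_lit_zero : (Expr.lit 0).weight = 7 := rfl
@[simp] theorem weight_lit_one : (Expr.lit 1).weight = 7 := rfl
@[simp] theorem weight_lit_two : (Expr.lit 2).weight = 7 := rfl
@[simp] theorem weight_lit_four : (Expr.lit 4).weight = 7 := rfl
attribute [simp] weight_vr weight_ar

/-- Replace the matrix `X` by `(D' X - y yᵀ) / D`, where `y` is the array `vec`, and `D` by `D'`. -/
def updateP : Prog :=
  .seq (forP col (vr size * vr size) (st mat (vr col)
    ((vr det' * ar mat (vr col) - ar vec (vr col / vr size) *
      ar vec (vr col - vr size * (vr col / vr size))) / vr det)))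
  (sv det (vr det'))

/-- The numerator equals `D * X'`, so the integer division is exact. The update works in place
because an entry of the matrix is read only when it is itself replaced. -/
theorem det_updateP {b n : ℕ} {M : ℤ → ℤ} {X X' : Matrix (Fin n) (Fin n) ℤ} {y : Fin n → ℤ}
    {D D' : ℤ} (hsize : rd M size 0 = n) (hX : HasMat M X) (hy : HasVec vec M y)
    (hD : rd M det 0 = D) (hD' : rd M det' 0 = D') (hD0 : D ≠ 0)
    (h : ∀ i j, D * X' i j = D' * X i j - y i * y j) (hn : n * n < 2 ^ b)
    (hb : ∀ i j, (X' i j).natAbs < 2 ^ b) (hb' : D'.natAbs < 2 ^ b) :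
    Det b updateP (n * n * 4 + 5) M fun M' =>
      Same [col, mat, det] M M' ∧ HasMat M' X' ∧ rd M' det 0 = D' := by
  have hlt : ∀ q < n * n, q / n < n ∧ q % n < n := fun q hq =>
    ⟨Nat.div_lt_of_lt_mul hq, Nat.mod_lt _ (Nat.pos_of_ne_zero (by rintro rfl; simp at hq))⟩
  refine (det_seq (T := n * n * 4 + 3) (U := 1) ?_).mono (by omega) fun _ h => h
  refine (det_map (n * n)
    (fun q => if hq : q < n * n then X' ⟨q / n, (hlt q hq).1⟩ ⟨q % n, (hlt q hq).2⟩ else 0)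
    (by simp) (by simp) (by simp) hn (fun M' hM' => ?_) (fun q hq M' hM' hc hold => ?_)
    (fun q hq => ?_)).mono le_rfl fun M' hM' => ?_
  · simp [hM' size (by simp), hsize]
  · obtain ⟨h1, h2⟩ := hlt q hq
    simp only [eval_div, eval_sub, eval_mul, eval_ar, eval_vr, hc, hM' size (by simp), hsize,
      hM' det' (by simp), hD', hM' vec (by simp), hM' det (by simp), hD, dif_pos hq,
      hold q le_rfl]
    have e1 : (q : ℤ) / (n : ℤ) = ((q / n : ℕ) : ℤ) := by push_cast; rfl
    have e2 : (q : ℤ) - (n : ℤ) * ((q / n : ℕ) : ℤ) = ((q % n : ℕ) : ℤ) := by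
      have := Nat.div_add_mod q n
      have h3 : ((n * (q / n) + q % n : ℕ) : ℤ) = q := by exact_mod_cast this
      push_cast at h3 ⊢
      linarith
    have e3 : (q : ℤ) = ((q / n : ℕ) : ℤ) * n + ((q % n : ℕ) : ℤ) := by linarith
    rw [e1, e2]
    have hx := hX ⟨q / n, h1⟩ ⟨q % n, h2⟩
    simp only at hx
    rw [← e3] at hx
    have hy1 := hy ⟨q / n, h1⟩
    have hy2 := hy ⟨q % n, h2⟩
    simp only at hy1 hy2
    rw [hx, hy1, hy2, ← h, Int.mul_ediv_cancel_left _ hD0]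
  · rw [dif_pos hq]; exact hb _ _
  · obtain ⟨h1, h2, -⟩ := hM'
    have h3 : rd M' det' 0 = D' := by rw [h1 det' (by simp), hD']
    refine det_sv (by simp) (by simpa [h3] using hb') ?_
    refine ⟨(h1.mono (by simp)).upd (by simp) _ _, fun i j => ?_, by simp [h3]⟩
    have hij : (i : ℕ) * n + j < n * n := by
      have := i.2; have := j.2
      calc (i : ℕ) * n + j < (i : ℕ) * n + n := by omega
        _ = (i + 1) * n := by ring
        _ ≤ n * n := Nat.mul_le_mul_right _ i.2
    rw [rd_upd_of_ne (by simp)]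
    have h4 := h2 _ hij
    rw [dif_pos hij] at h4
    push_cast at h4
    rw [h4]
    have hn0 : 0 < n := lt_of_le_of_lt (Nat.zero_le _) j.2
    congr 1
    · ext
      simp only
      rw [mul_comm, Nat.mul_add_div hn0, Nat.div_eq_of_lt j.2, add_zero]
    · ext
      simp only
      rw [mul_comm, Nat.mul_add_mod, Nat.mod_eq_of_lt j.2]

/-- The state of the matrix: `X` and `D` are the adjugate and the determinant of `G`. -/
structure HasAdj {n : ℕ} (M : ℤ → ℤ) (G : Matrix (Fin n) (Fin n) ℤ) : Prop where
  mat : HasMat M G.adjugate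
  det : rd M det 0 = G.det

theorem HasAdj.of_same {n : ℕ} {M M' : ℤ → ℤ} {G : Matrix (Fin n) (Fin n) ℤ} {S : List Reg}
    (h : HasAdj M G) (h' : Same S M M') (h1 : Reg.mat ∉ S) (h2 : Reg.det ∉ S) : HasAdj M' G :=
  ⟨h.mat.of_eq (h' _ h1), by rw [h' _ h2, h.det]⟩

/-! ### Rank one updates by the indicator of a progression -/

/-- The points `a + t e`, for `t < s`. -/
def progIdx (s a e : ℕ) : Finset ℕ := (Finset.range s).image fun t => a + t * e

/-- The indicator of the points `a + t e`, for `t < s`. -/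
def progVec (n s a e : ℕ) : Fin n → ℤ := fun x => if (x : ℕ) ∈ progIdx s a e then 1 else 0

theorem sum_mul_progVec {n s a e : ℕ} (he : 0 < e) (hs : ∀ t < s, a + t * e < n) (f : ℕ → ℤ) :
    ∑ x : Fin n, f x * progVec n s a e x = ∑ t ∈ Finset.range s, f (a + t * e) := by
  have h1 : ∑ x : Fin n, f x * progVec n s a e x =
      ∑ x ∈ Finset.range n, f x * if x ∈ progIdx s a e then 1 else 0 :=
    (Finset.sum_range fun x => f x * if x ∈ progIdx s a e then 1 else 0).symm
  rw [h1]
  simp only [mul_ite, mul_one, mul_zero]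
  rw [← Finset.sum_filter]
  have h2 : (Finset.range n).filter (· ∈ progIdx s a e) = progIdx s a e := by
    ext x
    simp only [Finset.mem_filter, Finset.mem_range, and_iff_right_iff_imp, progIdx,
      Finset.mem_image]
    rintro ⟨t, ht, rfl⟩
    exact hs t ht
  rw [h2, progIdx, Finset.sum_image]
  intro t _ t' _ htt
  simp only at htt
  exact Nat.eq_of_mul_eq_mul_right he (by omega)

/-- Add the points `fst + t * dif`, for `t < scale`, as a new row. -/
def rankP : Prog :=
  .seq (forP row (vr size) (.seq (sv acc (.lit 0)) (.seq
    (forP cnt (vr scale)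
      (sv acc (vr acc + ar mat (vr row * vr size + vr fst + vr cnt * vr dif))))
    (st vec (vr row) (vr acc)))))
  (.seq (sv det' (vr det)) (.seq
    (forP cnt (vr scale) (sv det' (vr det' + ar vec (vr fst + vr cnt * vr dif))))
    updateP))

/-- The registers that hold the data of a row. -/
structure HasRow (M : ℤ → ℤ) (n s a e : ℕ) : Prop where
  size : rd M size 0 = n
  scale : rd M scale 0 = s
  fst : rd M fst 0 = a
  dif : rd M dif 0 = e

theorem natAbs_sum_le {f : ℕ → ℤ} {H : ℕ} {s : ℕ} (h : ∀ t < s, (f t).natAbs ≤ H) :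
    (∑ t ∈ Finset.range s, f t).natAbs ≤ s * H := by
  refine (Int.natAbs_sum_le _ _).trans ?_
  refine (Finset.sum_le_card_nsmul _ _ H fun t ht => h t (Finset.mem_range.1 ht)).trans ?_
  simp

/-- The program computes `y = adj(G) v` and `D' = D + v · y`, as the determinant lemma demands. The
entries of `y` are at most `n * H` and `D'` is at most `H + n * n * H`, which is the origin of `hb`.
-/
theorem det_rankP {b n s a e H : ℕ} {M : ℤ → ℤ} {G : Matrix (Fin n) (Fin n) ℤ}
    (hM : HasRow M n s a e) (he : 0 < e) (hs : ∀ t < s, a + t * e < n) (hsn : s ≤ n)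
    (hG : IsPosDef G) (hA : HasAdj M G)
    (hH : ∀ i j, (G.adjugate i j).natAbs ≤ H)
    (hH' : ∀ i j, ((G + vecMulVec (progVec n s a e) (progVec n s a e)).adjugate i j).natAbs ≤ H)
    (hD : G.det.natAbs ≤ H)
    (hb : (n + 1) * (n + 1) * (H + 1) < 2 ^ b) :
    Det b rankP (n * (n * 4 + 10) + n * n * 4 + n * 4 + 20) M fun M' =>
      Same [row, acc, cnt, vec, det', col, mat, Reg.det] M M' ∧
        HasAdj M' (G + vecMulVec (progVec n s a e) (progVec n s a e)) := by
  set v := progVec n s a e with hv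
  set y := G.adjugate *ᵥ v with hy
  have hyi : ∀ i : Fin n, y i = ∑ t ∈ Finset.range s,
      rd M mat ((i : ℕ) * n + (a + t * e : ℕ)) := by
    intro i
    rw [← sum_mul_progVec he hs fun x => rd M mat ((i : ℕ) * n + (x : ℕ))]
    simp only [hy, mulVec, dotProduct, ← hv]
    exact Finset.sum_congr rfl fun j _ => by rw [hA.mat i j]
  have hentry : ∀ (i : Fin n), ∀ t < s, (rd M mat ((i : ℕ) * n + (a + t * e : ℕ))).natAbs ≤ H := by
    intro i t ht
    have h1 := hA.mat i ⟨a + t * e, hs t ht⟩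
    simp only at h1
    rw [h1]; exact hH _ _
  have hyb : ∀ i, (y i).natAbs ≤ n * H := fun i => by
    rw [hyi]
    exact (natAbs_sum_le (hentry i)).trans (Nat.mul_le_mul_right _ hsn)
  have hnb : n < 2 ^ b := by nlinarith
  have hsb : s < 2 ^ b := hsn.trans_lt hnb
  have hT : n * ((1 + (s * 4 + 3 + 1 + 1) + 1) + 3) + 3 + (1 + (s * 4 + 3 + (n * n * 4 + 5) + 1) + 1) + 1 ≤
      n * (n * 4 + 10) + n * n * 4 + n * 4 + 20 := by
    have : n * (s * 4) ≤ n * (n * 4) := by gcongr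
    nlinarith
  refine (det_seq (T := n * ((1 + (s * 4 + 3 + 1 + 1) + 1) + 3) + 3)
    (U := 1 + (s * 4 + 3 + (n * n * 4 + 5) + 1) + 1) ?_).mono hT fun _ h => h
  refine det_for (T := 1 + (s * 4 + 3 + 1 + 1) + 1) n (fun i M' => rd M' row 0 = i ∧ Same [row, acc, cnt, vec] M M' ∧
    ∀ j : Fin n, (j : ℕ) < i → rd M' vec (j : ℕ) = y j) (by simp) hnb ?_ ?_ ?_ ?_
  · rintro i - M' ⟨h1, h2, -⟩
    exact ⟨by simp [h2 size (by simp), hM.size], h1⟩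
  · exact ⟨by simp, (Same.refl _ _).upd (by simp) _ _, by simp⟩
  · rintro i hi M' ⟨h1, h2, h3⟩
    refine det_seq (T := 1) (U := s * 4 + 3 + 1 + 1) (det_sv (by simp) (by simp) ?_)
    refine det_seq (T := s * 4 + 3) (U := 1) ?_
    refine (det_sum s (fun t => rd M mat ((i : ℕ) * n + (a + t * e : ℕ))) (by simp) (by simp)
      (by simp) hsb (fun M'' hM'' => ?_) (fun t ht M'' hM'' hc => ?_)
      (fun t ht => ?_)).mono le_rfl ?_
    · simp [hM'' scale (by simp), h2 scale (by simp), hM.scale]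
    · simp only [eval_ar, eval_add, eval_mul, eval_vr, hc, hM'' size (by simp),
        hM'' mat (by simp), hM'' row (by simp), hM'' fst (by simp), hM'' dif (by simp)]
      simp only [eval_lit, ne_eq, reduceCtorEq, not_false_eq_true, rd_upd_of_ne,
        h2 size (by simp), h2 mat (by simp), h2 fst (by simp), h2 dif (by simp), hM.size,
        hM.fst, hM.dif, h1]
      congr 1
      push_cast
      ring
    · simp only [eval_lit, rd_upd_self, Function.update_self, zero_add]
      have := natAbs_sum_le (s := t) (f := fun t => rd M mat ((i : ℕ) * n + (a + t * e : ℕ)))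
        (H := H) fun t' ht' => hentry ⟨i, hi⟩ t' (by omega)
      have h4 : t * H ≤ n * H := Nat.mul_le_mul_right _ (by omega)
      nlinarith
    · rintro M'' ⟨h4, h5⟩
      have h6 : rd M'' acc 0 = y ⟨i, hi⟩ := by rw [h5, hyi]; simp
      have h7 : rd M'' row 0 = i := by rw [h4 row (by simp)]; simp [h1]
      refine det_st (by simp) (by simp) ?_ ?_
      · rw [eval_vr, h6]
        have := hyb ⟨i, hi⟩
        nlinarith
      · rw [eval_vr, eval_vr, h6, h7]
        refine ⟨by simp [h7], by simp, ?_, fun j hj => ?_⟩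
        · refine Same.upd (Same.upd ?_ (by simp) _ _) (by simp) _ _
          exact h2.trans (Same.trans (S := [acc]) ((Same.refl _ _).upd (by simp) _ _) h4
            (S'' := [acc, cnt]) (by simp) (by simp)) (by simp) (by simp)
        · rw [rd_upd_of_ne (by simp), rd_upd_self, Function.update_apply]
          split_ifs with hji
          · have : j = ⟨i, hi⟩ := Fin.ext (by exact_mod_cast hji)
            rw [this]
          · rw [h4 vec (by simp), rd_upd_of_ne (by simp)]
            exact h3 j (by
              have : (j : ℕ) ≠ i := fun h => hji (by exact_mod_cast h)
              omega)
  · rintro M' ⟨-, h2, h3⟩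
    have hy' : HasVec vec M' y := fun j => h3 j j.2
    refine det_seq (T := 1) (U := s * 4 + 3 + (n * n * 4 + 5) + 1) (det_sv (by simp) ?_ ?_)
    · rw [eval_vr, h2 Reg.det (by simp), hA.det]; nlinarith
    rw [eval_vr, h2 Reg.det (by simp), hA.det]
    refine det_seq (T := s * 4 + 3) (U := n * n * 4 + 5) ?_
    refine (det_sum s (fun t => rd M' vec ((a + t * e : ℕ) : ℤ)) (by simp) (by simp)
      (by simp) hsb (fun M'' hM'' => ?_) (fun t ht M'' hM'' hc => ?_)
      (fun t ht => ?_)).mono le_rfl ?_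
    · rw [eval_vr, hM'' scale (by simp), rd_upd_of_ne (by simp), h2 scale (by simp), hM.scale]
    · simp only [eval_ar, eval_add, eval_mul, eval_vr, hc, hM'' vec (by simp),
        hM'' fst (by simp), hM'' dif (by simp)]
      simp only [ne_eq, reduceCtorEq, not_false_eq_true, rd_upd_of_ne,
        h2 fst (by simp), h2 dif (by simp), hM.fst, hM.dif]
      congr 1
    · simp only [rd_upd_self, Function.update_self]
      have h4 := natAbs_sum_le (s := t) (f := fun t => rd M' vec ((a + t * e : ℕ) : ℤ))
        (H := n * H) fun t' ht' => by
          have := hy' ⟨a + t' * e, hs t' (by omega)⟩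
          simp only at this
          rw [this]; exact hyb _
      have h5 : t * (n * H) ≤ n * (n * H) := Nat.mul_le_mul_right _ (by omega)
      refine (Int.natAbs_add_le _ _).trans_lt ?_
      nlinarith
    · rintro M'' ⟨h4, h5⟩
      have h6 : Same [row, acc, cnt, vec, det'] M M'' := by
        refine h2.trans (Same.trans (S := [det']) ((Same.refl _ _).upd (by simp) _ _) h4
            (S'' := [cnt, det']) (by simp) (by simp)) (by simp) (by simp)
      have hdet : rd M'' det' 0 = (G + vecMulVec v v).det := by
        rw [h5, det_add_vecMulVec hG.det_pos.ne']
        simp only [rd_upd_self, Function.update_self]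
        congr 1
        rw [← sum_mul_progVec he hs fun x => rd M' vec ((x : ℕ) : ℤ), dotProduct]
        exact Finset.sum_congr rfl fun j _ => by rw [hy' j, mul_comm]
      have hG' := hG.add_vecMulVec v
      have hDb : ((G + vecMulVec v v).det).natAbs < 2 ^ b := by
        rw [det_add_vecMulVec hG.det_pos.ne', ← hy, dotProduct]
        have h7 : (∑ i, v i * y i).natAbs ≤ n * (n * H) := by
          refine (Int.natAbs_sum_le _ _).trans ?_
          refine (Finset.sum_le_card_nsmul _ _ (n * H) fun i _ => ?_).trans (by simp)
          rw [Int.natAbs_mul]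
          have : (v i).natAbs ≤ 1 := by
            simp only [hv, progVec]; split_ifs <;> simp
          calc _ ≤ 1 * (n * H) := Nat.mul_le_mul this (hyb i)
            _ = _ := one_mul _
        refine (Int.natAbs_add_le _ _).trans_lt ?_
        nlinarith
      have h7 : HasVec vec M'' y := hy'.of_eq (by
        rw [h4 vec (by simp), rd_upd_of_ne (by simp)])
      refine (det_updateP (X := G.adjugate) (X' := (G + vecMulVec v v).adjugate) (y := y)
        (D := G.det) (by rw [h6 size (by simp), hM.size])
        (hA.mat.of_eq (h6 mat (by simp))) h7 (by rw [h6 Reg.det (by simp), hA.det]) hdet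
        hG.det_pos.ne' (fun i j => ?_) (by nlinarith) (fun i j => ?_) hDb).mono le_rfl ?_
      · have h8 := congrFun (congrFun
          (adjugate_add_vecMulVec hG.det_pos.ne' hG.isSymm v hG'.det_pos.ne') i) j
        simpa only [Matrix.smul_apply, Matrix.sub_apply, smul_eq_mul, vecMulVec_apply] using h8
      · have := hH' i j
        nlinarith
      · rintro M3 ⟨h8, h9, h10⟩
        exact ⟨h6.trans h8 (by simp) (by simp), h9, h10⟩

end RAM

/-! ## Programs for the Gram matrix -/

namespace RAM

open Reg IntMatrix Matrix

/-- The digit number `j` of `r` in the mixed radix system with the radices `N`. -/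
def dig (N : ℕ → ℕ) (j r : ℕ) : ℕ := r / (∏ i ∈ Finset.range j, N i) % N j

/-- The digit number `j` of the point number `s` of the progression that starts with the points of
rank `a` and `a'`. -/
def lastDig (N : ℕ → ℕ) (s a a' j : ℕ) : ℤ :=
  dig N j a + ((s : ℤ) - 1) * ((dig N j a' : ℤ) - dig N j a)

/-- The points of rank `a` and `a'` are the first two of an aligned progression with `s` points in
the box. -/
def RowOk (d : ℕ) (N : ℕ → ℕ) (s a a' : ℕ) : Prop :=
  a < a' ∧ s ∣ a / (a' - a) ∧ ∀ j < d, 0 ≤ lastDig N s a a' j ∧ lastDig N s a a' j < N j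

instance (d : ℕ) (N : ℕ → ℕ) (s a a' : ℕ) : Decidable (RowOk d N s a a') := by
  unfold RowOk; infer_instance

/-- The value of the digit that is being processed, in terms of the register with the quotient. -/
def digE (k : Reg) : Expr := vr k - ar side (vr cnt) * (vr k / ar side (vr cnt))

/-- Set `flag` to `1` if the progression that starts with `fst` and `snd` and has `scale` points
lies in the box, and to `0` otherwise. -/
def testP : Prog :=
  .seq (sv flag (.lit 1)) (.seq (sv dig₁ (vr fst)) (.seq (sv dig₂ (vr snd))
    (forP cnt (vr dim) (.seq
      (sv val (digE dig₁ + (vr scale - .lit 1) * (digE dig₂ - digE dig₁))) (.seq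
      (.cond (.lit 0 - vr val) (sv flag (.lit 0)) .skip) (.seq
      (.cond (vr val - ar side (vr cnt) + .lit 1) (sv flag (.lit 0)) .skip) (.seq
      (sv dig₁ (vr dig₁ / ar side (vr cnt)))
      (sv dig₂ (vr dig₂ / ar side (vr cnt))))))))))

/-- The registers that hold the dimensions of the box. -/
structure HasBox (M : ℤ → ℤ) (d n : ℕ) (N : ℕ → ℕ) : Prop where
  dim : rd M dim 0 = d
  size : rd M size 0 = n
  side : ∀ j < d, rd M side (j : ℕ) = N j

theorem HasBox.of_same {M M' : ℤ → ℤ} {d n : ℕ} {N : ℕ → ℕ} {S : List Reg}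
    (h : HasBox M d n N) (h' : Same S M M')
    (hS : Reg.dim ∉ S ∧ Reg.size ∉ S ∧ Reg.side ∉ S) : HasBox M' d n N :=
  ⟨by rw [h' _ hS.1, h.dim], by rw [h' _ hS.2.1, h.size], fun j hj => by
    rw [h' _ hS.2.2, h.side j hj]⟩

theorem sub_mul_ediv_eq (x m : ℕ) : (x : ℤ) - (m : ℤ) * ((x : ℤ) / (m : ℤ)) = ((x % m : ℕ) : ℤ) := by
  have := Int.emod_add_mul_ediv (x : ℤ) (m : ℤ)
  push_cast
  linarith

@[simp] theorem weight_digE (k : Reg) : (digE k).weight = 69 := by simp [digE]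

theorem natAbs_lastDig_le {N : ℕ → ℕ} {n s a a' j : ℕ} (ha : a ≤ n) (ha' : a' ≤ n) (hs : 1 ≤ s)
    (hsn : s ≤ n) : (lastDig N s a a' j).natAbs ≤ n * n := by
  have h1 : dig N j a ≤ n := (Nat.mod_le _ _).trans ((Nat.div_le_self _ _).trans ha)
  have h2 : dig N j a' ≤ n := (Nat.mod_le _ _).trans ((Nat.div_le_self _ _).trans ha')
  unfold lastDig
  zify at *
  rw [abs_le]
  constructor <;> nlinarith

/-- The digits are split off by successive division by the sides, and only the last point of the
progression is examined: each coordinate is monotone along it, so the intermediate points lie in the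
box as well. -/
theorem det_testP {b d n s a a' : ℕ} {N : ℕ → ℕ} {M : ℤ → ℤ} (hB : HasBox M d n N)
    (hs : rd M scale 0 = s) (hfst : rd M fst 0 = a) (hsnd : rd M snd 0 = a') (hs1 : 1 ≤ s)
    (hsn : s ≤ n) (ha : a < n) (ha' : a' < n) (hd : d ≤ n) (hb : (n + 1) * (n + 1) < 2 ^ b) :
    Det b testP (n * 14 + 20) M fun M' =>
      Same [flag, dig₁, dig₂, cnt, val] M M' ∧ rd M' flag 0 =
        if ∀ j < d, 0 ≤ lastDig N s a a' j ∧ lastDig N s a a' j < N j then 1 else 0 := by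
  have hnb : n < 2 ^ b := by nlinarith
  have h1b : 1 < 2 ^ b := by nlinarith
  refine (det_seq (T := 1) (U := 1 + (1 + (d * (11 + 3) + 3) + 1) + 1) (det_sv (by simp) (by simpa using h1b)
    (det_seq (T := 1) (U := 1 + (d * (11 + 3) + 3) + 1) (det_sv (by simp) ?_
    (det_seq (T := 1) (U := d * (11 + 3) + 3) (det_sv (by simp) ?_ ?_)))))).mono (by omega)
    fun _ h => h
  · simp only [eval_vr, ne_eq, reduceCtorEq, not_false_eq_true, rd_upd_of_ne, hfst]; omega
  · simp only [eval_vr, ne_eq, reduceCtorEq, not_false_eq_true, rd_upd_of_ne, hsnd]; omega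
  refine det_for (T := 11) d (fun j M' => rd M' cnt 0 = j ∧ Same [flag, dig₁, dig₂, cnt, val] M M' ∧
    rd M' dig₁ 0 = (a / (∏ i ∈ Finset.range j, N i) : ℕ) ∧
    rd M' dig₂ 0 = (a' / (∏ i ∈ Finset.range j, N i) : ℕ) ∧
    rd M' flag 0 = if ∀ i < j, 0 ≤ lastDig N s a a' i ∧ lastDig N s a a' i < N i then 1 else 0)
    (by simp) (hd.trans_lt hnb) ?_ ?_ ?_ ?_
  · rintro j - M' ⟨h1, h2, -⟩
    exact ⟨by simp [h2 dim (by simp), hB.dim], h1⟩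
  · refine ⟨by simp, ?_, by simp [hfst], by simp [hsnd], by simp⟩
    exact ((((Same.refl _ _).upd (by simp) _ _).upd (by simp) _ _).upd (by simp) _ _).upd
      (by simp) _ _
  · rintro j hj M' ⟨h1, h2, h3, h4, h5⟩
    have hN : rd M' side (j : ℤ) = N j := by rw [h2 side (by simp), hB.side j hj]
    have hv : (digE dig₁ + (vr scale - Expr.lit 1) * (digE dig₂ - digE dig₁)).eval M' =
        lastDig N s a a' j := by
      simp only [digE, eval_add, eval_sub, eval_mul, eval_div, eval_vr, eval_ar, eval_lit, h1, h3,
        h4, hN, h2 scale (by simp), hs, sub_mul_ediv_eq, lastDig, dig]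
    have hvb := natAbs_lastDig_le (N := N) (j := j) ha.le ha'.le hs1 hsn
    have hq : ∀ x : ℕ, ((x : ℕ) / (∏ i ∈ Finset.range j, N i) : ℕ) / N j =
        x / (∏ i ∈ Finset.range (j + 1), N i) := fun x => by
      rw [Finset.prod_range_succ, Nat.div_div_eq_div_mul]
    have hqb : ∀ x : ℕ, x < n → x / (∏ i ∈ Finset.range (j + 1), N i) < 2 ^ b := fun x hx =>
      (Nat.div_le_self _ _).trans_lt (hx.trans hnb)
    refine det_seq (T := 1) (U := 9) (det_sv (by simp) (by rw [hv]; nlinarith) ?_)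
    rw [hv]
    -- Both branches of the second test continue with the same two divisions, which are handled once
    -- for every memory with the right flag.
    have hlast : ∀ M'', Same [flag] (upd M' val 0 (lastDig N s a a' j)) M'' →
        rd M'' flag 0 = (if ∀ i < j + 1, 0 ≤ lastDig N s a a' i ∧ lastDig N s a a' i < N i
          then 1 else 0) →
        Det b (.seq (sv dig₁ (vr dig₁ / ar side (vr cnt))) (sv dig₂ (vr dig₂ / ar side (vr cnt))))
          3 M'' fun M' => rd M' cnt 0 = j ∧ (rd (upd M' cnt 0 (j + 1)) cnt 0 = ((j + 1 : ℕ) : ℤ) ∧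
          Same [flag, dig₁, dig₂, cnt, val] M (upd M' cnt 0 (j + 1)) ∧
          rd (upd M' cnt 0 (j + 1)) dig₁ 0 = (a / (∏ i ∈ Finset.range (j + 1), N i) : ℕ) ∧
          rd (upd M' cnt 0 (j + 1)) dig₂ 0 = (a' / (∏ i ∈ Finset.range (j + 1), N i) : ℕ) ∧
          rd (upd M' cnt 0 (j + 1)) flag 0 =
            if ∀ i < j + 1, 0 ≤ lastDig N s a a' i ∧ lastDig N s a a' i < N i then 1 else 0) := by
      intro M'' hM'' hflag
      have e1 : (vr dig₁ / ar side (vr cnt)).eval M'' =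
          (a / (∏ i ∈ Finset.range (j + 1), N i) : ℕ) := by
        simp only [eval_div, eval_vr, eval_ar, hM'' dig₁ (by simp), hM'' side (by simp),
          hM'' cnt (by simp)]
        simp only [ne_eq, reduceCtorEq, not_false_eq_true, rd_upd_of_ne, h1, h3, hN, ← hq]
        push_cast; rfl
      refine det_seq (T := 1) (U := 1) (det_sv (by simp) (by rw [e1]; exact hqb a ha) ?_)
      rw [e1]
      set M3 := upd M'' dig₁ 0 ((a / (∏ i ∈ Finset.range (j + 1), N i) : ℕ) : ℤ) with hM3
      have e2 : (vr dig₂ / ar side (vr cnt)).eval M3 =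
          (a' / (∏ i ∈ Finset.range (j + 1), N i) : ℕ) := by
        simp only [hM3, eval_div, eval_vr, eval_ar, ne_eq, reduceCtorEq, not_false_eq_true,
          rd_upd_of_ne, hM'' dig₂ (by simp), hM'' side (by simp), hM'' cnt (by simp), h1, h4, hN,
          ← hq]
        push_cast; rfl
      refine det_sv (by simp) (by rw [e2]; exact hqb a' ha') ?_
      rw [e2]
      refine ⟨?_, by simp, ?_, by simp [hM3], by simp, by simpa [hM3] using hflag⟩
      · simp [hM3, hM'' cnt (by simp), h1]
      · refine Same.upd (Same.upd (Same.upd ?_ (by simp) _ _) (by simp) _ _) (by simp) _ _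
        exact (h2.upd (k := val) (by simp) _ _).trans hM'' (by simp) (by simp)
    set M2 := upd M' val 0 (lastDig N s a a' j) with hM2
    have hval : rd M2 val 0 = lastDig N s a a' j := by simp [hM2]
    have hside : rd M2 side (rd M2 cnt 0) = N j := by simp [hM2, h1, hN]
    have hflag : rd M2 flag 0 = if ∀ i < j, 0 ≤ lastDig N s a a' i ∧ lastDig N s a a' i < N i
        then 1 else 0 := by simp only [hM2, ne_eq, reduceCtorEq, not_false_eq_true, rd_upd_of_ne, h5]
    have hiff : (∀ i < j + 1, 0 ≤ lastDig N s a a' i ∧ lastDig N s a a' i < N i) ↔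
        (∀ i < j, 0 ≤ lastDig N s a a' i ∧ lastDig N s a a' i < N i) ∧
          (0 ≤ lastDig N s a a' j ∧ lastDig N s a a' j < N j) := Nat.forall_lt_succ_right
    have hP1 : Det b (.cond (.lit 0 - vr val) (sv flag (.lit 0)) .skip) 2 M2 fun M3 =>
        Same [flag] M2 M3 ∧ rd M3 flag 0 =
          if (∀ i < j, 0 ≤ lastDig N s a a' i ∧ lastDig N s a a' i < N i) ∧ 0 ≤ lastDig N s a a' j
          then 1 else 0 := by
      refine det_cond (T := 1) (by simp) (fun h => det_sv (by simp) (by simp) ?_)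
        fun h => det_skip ?_
      · simp only [eval_sub, eval_lit, eval_vr, hval] at h
        refine ⟨(Same.refl _ _).upd (by simp) _ _, ?_⟩
        rw [if_neg (by rintro ⟨-, h'⟩; omega)]
        simp
      · simp only [eval_sub, eval_lit, eval_vr, hval] at h
        refine ⟨Same.refl _ _, ?_⟩
        rw [hflag]
        have : 0 ≤ lastDig N s a a' j := by omega
        simp [this]
    refine det_seq (T := 2) (U := 6) (hP1.mono le_rfl ?_)
    rintro M3 ⟨hM3, hflag3⟩
    refine det_seq (T := 2) (U := 3) (det_cond (T := 1) (by simp)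
      (fun h => det_sv (by simp) (by simp) ?_) fun h => det_skip ?_)
    · simp only [eval_add, eval_sub, eval_lit, eval_vr, eval_ar, hM3 val (by simp),
        hM3 side (by simp), hM3 cnt (by simp), hside, hval] at h
      refine hlast _ (hM3.upd (by simp) _ _) ?_
      rw [if_neg (by rw [hiff]; rintro ⟨-, -, h'⟩; omega)]
      simp
    · simp only [eval_add, eval_sub, eval_lit, eval_vr, eval_ar, hM3 val (by simp),
        hM3 side (by simp), hM3 cnt (by simp), hside, hval] at h
      refine hlast _ hM3 ?_
      have h' : lastDig N s a a' j < N j := by omega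
      rw [hflag3]
      simp only [hiff, h', and_true]
  · rintro M' ⟨-, h2, -, -, h5⟩
    exact ⟨h2, h5⟩

/-- Add the row that starts with `fst` and `snd`, with multiplicity `weight`, if there is one. -/
def rowP : Prog :=
  .cond (vr snd - vr fst) (.seq (sv dif (vr snd - vr fst))
    (.cond (.lit 1 - (vr fst / vr dif - vr scale * (vr fst / vr dif / vr scale)))
      (.seq testP (.cond (vr flag) (forP rep (vr weight) rankP) .skip)) .skip)) .skip

/-- The contribution of a row to the Gram matrix. -/
def rowMat (d n : ℕ) (N : ℕ → ℕ) (s w a a' : ℕ) : Matrix (Fin n) (Fin n) ℤ :=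
  if RowOk d N s a a' then
    (w : ℤ) • vecMulVec (progVec n s a (a' - a)) (progVec n s a (a' - a)) else 0

theorem natAbs_vecMulVec_progVec_le (n s a e : ℕ) (i j : Fin n) :
    (vecMulVec (progVec n s a e) (progVec n s a e) i j).natAbs ≤ 1 := by
  simp only [vecMulVec_apply, progVec]
  split_ifs <;> simp

/-- A positive definite matrix with entries that are bounded by `c`. -/
structure Adm {n : ℕ} (c : ℕ) (G : Matrix (Fin n) (Fin n) ℤ) : Prop where
  posDef : IsPosDef G
  le : ∀ i j, (G i j).natAbs ≤ c

theorem Adm.mono {n c c' : ℕ} {G : Matrix (Fin n) (Fin n) ℤ} (h : Adm c G) (hc : c ≤ c') :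
    Adm c' G := ⟨h.posDef, fun i j => (h.le i j).trans hc⟩

/-- An indicator changes each entry by at most one, so the entry bound simply counts the updates
made so far. -/
theorem Adm.add_smul {n c s a e : ℕ} {G : Matrix (Fin n) (Fin n) ℤ} (h : Adm c G) (r : ℕ) :
    Adm (c + r) (G + (r : ℤ) • vecMulVec (progVec n s a e) (progVec n s a e)) := by
  induction r with
  | zero => simpa using h
  | succ r ih =>
    have : G + ((r + 1 : ℕ) : ℤ) • vecMulVec (progVec n s a e) (progVec n s a e) =
        G + (r : ℤ) • vecMulVec (progVec n s a e) (progVec n s a e) +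
          vecMulVec (progVec n s a e) (progVec n s a e) := by
      push_cast
      rw [_root_.add_smul, one_smul, add_assoc]
    rw [this]
    refine ⟨ih.posDef.add_vecMulVec _, fun i j => ?_⟩
    have h1 := ih.le i j
    have h2 := natAbs_vecMulVec_progVec_le n s a e i j
    rw [Matrix.add_apply]
    have := Int.natAbs_add_le ((G + (r : ℤ) • vecMulVec (progVec n s a e) (progVec n s a e)) i j)
      (vecMulVec (progVec n s a e) (progVec n s a e) i j)
    omega

theorem Adm.add_rowMat {d n c : ℕ} {N : ℕ → ℕ} {G : Matrix (Fin n) (Fin n) ℤ} (h : Adm c G)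
    (s w a a' : ℕ) : Adm (c + w) (G + rowMat d n N s w a a') := by
  unfold rowMat
  split_ifs
  · exact h.add_smul w
  · rw [add_zero]; exact h.mono (by omega)

/-- A bound for the determinant and the adjugate of an integer matrix. -/
def hadBound (n c : ℕ) : ℕ := n.factorial * c ^ n

theorem natAbs_adjugate_le_hadBound {n c : ℕ} (hc : 1 ≤ c) {G : Matrix (Fin n) (Fin n) ℤ}
    (h : ∀ i j, (G i j).natAbs ≤ c) (i j : Fin n) : (G.adjugate i j).natAbs ≤ hadBound n c := by
  simpa [hadBound] using natAbs_adjugate_le hc h i j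

theorem natAbs_det_le_hadBound {n c : ℕ} {G : Matrix (Fin n) (Fin n) ℤ}
    (h : ∀ i j, (G i j).natAbs ≤ c) : G.det.natAbs ≤ hadBound n c := by
  simpa [hadBound] using natAbs_det_le h

theorem le_of_hadBound {b n c : ℕ} (hb : (n + 1) * (n + 1) * (hadBound n c + 1) < 2 ^ b) :
    (n + 1) * (n + 1) < 2 ^ b :=
  lt_of_le_of_lt (Nat.le_mul_of_pos_right _ (by omega)) hb

/-- A bound for the running time of `rowP`. -/
def rowTime (n : ℕ) : ℕ := n * (n * (n * 4 + 10) + n * n * 4 + n * 4 + 20 + 3) + n * 14 + 40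

/-- The weight is realized by repeating the rank one update. All intermediate matrices are then
integral and positive definite with controlled minors, and `w ≤ n` keeps the time polynomial. -/
theorem det_rowP {b d n s w a a' c : ℕ} {N : ℕ → ℕ} {M : ℤ → ℤ} {G : Matrix (Fin n) (Fin n) ℤ}
    (hB : HasBox M d n N) (hs : rd M scale 0 = s) (hw : rd M weight 0 = w)
    (hfst : rd M fst 0 = a) (hsnd : rd M snd 0 = a') (hs1 : 1 ≤ s) (hsn : s ≤ n) (hwn : w ≤ n)
    (ha : a < n) (ha' : a' < n) (hd : d ≤ n) (hA : HasAdj M G) (hG : Adm c G)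
    (hrow : RowOk d N s a a' → ∀ t < s, a + t * (a' - a) < n)
    (hb : (n + 1) * (n + 1) * (hadBound n (c + w) + 1) < 2 ^ b) (hc : 1 ≤ c) :
    Det b rowP (rowTime n) M fun M' =>
      Same [dif, flag, dig₁, dig₂, cnt, val, rep, row, acc, vec, det', col, mat, Reg.det] M M' ∧
        HasAdj M' (G + rowMat d n N s w a a') := by
  have hb1 := le_of_hadBound hb
  have hnb : n < 2 ^ b := by nlinarith
  have hTpos : 3 ≤ rowTime n := by unfold rowTime; omega
  have hno : ¬ RowOk d N s a a' → HasAdj M (G + rowMat d n N s w a a') := fun h => by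
    rwa [rowMat, if_neg h, add_zero]
  have hno' : ∀ M' S, ¬ RowOk d N s a a' → Same S M M' → mat ∉ S → Reg.det ∉ S →
      HasAdj M' (G + rowMat d n N s w a a') := fun M' S h h1 h2 h3 => (hno h).of_same h1 h2 h3
  set R := n * (n * (n * 4 + 10) + n * n * 4 + n * 4 + 20 + 3) + 3 with hR
  refine (det_cond (T := 1 + ((n * 14 + 20 + (R + 1) + 1) + 1) + 1) (by simp) (fun h1 => ?_)
    fun h1 => ?_).mono (by unfold rowTime; omega) fun _ h => h
  swap
  · refine det_skip ⟨Same.refl _ _, hno fun h => ?_⟩ |>.mono (by omega) fun _ h => h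
    simp only [eval_sub, eval_vr, hfst, hsnd] at h1
    have := h.1
    omega
  simp only [eval_sub, eval_vr, hfst, hsnd] at h1
  have haa : a < a' := by omega
  have hdif : (a' : ℤ) - a = ((a' - a : ℕ) : ℤ) := by push_cast [haa.le]; rfl
  refine det_seq (det_sv (by simp) ?_ ?_)
  · simp only [eval_sub, eval_vr, hfst, hsnd]; omega
  simp only [eval_sub, eval_vr, hfst, hsnd]
  rw [hdif]
  set M1 := upd M dif 0 ((a' - a : ℕ) : ℤ) with hM1
  have hS1 : Same [dif] M M1 := (Same.refl _ _).upd (by simp) _ _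
  have hcond : (Expr.lit 1 - (vr fst / vr dif - vr scale * (vr fst / vr dif / vr scale))).eval M1 =
      1 - ((a / (a' - a) % s : ℕ) : ℤ) := by
    simp only [eval_sub, eval_lit, eval_div, eval_mul, eval_vr]
    have e1 : rd M1 dif 0 = ((a' - a : ℕ) : ℤ) := by simp [hM1]
    rw [e1, hS1 fst (by simp), hS1 scale (by simp), hfst, hs, ← Int.natCast_div]
    rw [sub_mul_ediv_eq]
  refine det_cond (by simp) (fun h2 => ?_) fun h2 => ?_
  swap
  · refine det_skip ⟨hS1.mono (by simp), hno' _ _ (fun h => ?_) hS1 (by simp) (by simp)⟩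
      |>.mono (by omega) fun _ h => h
    rw [hcond, Nat.mod_eq_zero_of_dvd h.2.1] at h2
    simp at h2
  rw [hcond] at h2
  have hdvd : s ∣ a / (a' - a) := Nat.dvd_of_mod_eq_zero (by omega)
  refine det_seq ?_
  refine (det_testP (hB.of_same hS1 (by simp)) (by rw [hS1 scale (by simp), hs])
    (by rw [hS1 fst (by simp), hfst]) (by rw [hS1 snd (by simp), hsnd]) hs1 hsn ha ha' hd hb1).mono
    le_rfl ?_
  rintro M2 ⟨hS2, hflag⟩
  have hS12 : Same [dif, flag, dig₁, dig₂, cnt, val] M M2 := hS1.trans hS2 (by simp) (by simp)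
  refine det_cond (by simp) (fun h3 => ?_) fun h3 => ?_
  swap
  · refine det_skip ⟨hS12.mono (by simp), hno' _ _ (fun h => ?_) hS12 (by simp) (by simp)⟩
      |>.mono (by omega) fun _ h => h
    rw [eval_vr, hflag, if_pos h.2.2] at h3
    simp at h3
  rw [eval_vr, hflag] at h3
  have hok : RowOk d N s a a' := ⟨haa, hdvd, by
    by_contra hcon
    rw [if_neg hcon] at h3
    simp at h3⟩
  rw [rowMat, if_pos hok]
  set v := progVec n s a (a' - a) with hv
  refine (det_for (T := n * (n * 4 + 10) + n * n * 4 + n * 4 + 20) w (fun r M' => rd M' rep 0 = r ∧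
    Same [dif, flag, dig₁, dig₂, cnt, val, rep, row, acc, vec, det', col, mat, Reg.det] M M' ∧
    rd M' dif 0 = ((a' - a : ℕ) : ℤ) ∧
    HasAdj M' (G + (r : ℤ) • vecMulVec v v)) (by simp) (by omega) ?_ ?_ ?_ ?_).mono
      (by rw [hR]; gcongr) fun _ h => h
  · rintro r - M' ⟨h4, h5, -⟩
    exact ⟨by simp [h5 weight (by simp), hw], h4⟩
  · refine ⟨by simp, (hS12.mono (by simp)).upd (by simp) _ _, ?_, ?_⟩
    · rw [rd_upd_of_ne (by simp), hS2 dif (by simp)]; simp [hM1]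
    · simp only [Nat.cast_zero, zero_smul, add_zero]
      exact (hA.of_same hS12 (by simp) (by simp)).of_same ((Same.refl [rep] _).upd (by simp) _ _)
        (by simp) (by simp)
  · rintro r hr M' ⟨h4, h5, h6, h7⟩
    have hGr := hG.add_smul (s := s) (a := a) (e := a' - a) r
    have hGr' := hG.add_smul (s := s) (a := a) (e := a' - a) (r + 1)
    rw [← hv] at hGr hGr'
    have hsucc : G + ((r + 1 : ℕ) : ℤ) • vecMulVec v v = G + (r : ℤ) • vecMulVec v v +
        vecMulVec v v := by
      push_cast
      rw [_root_.add_smul, one_smul, add_assoc]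
    have hle : ∀ i j, ((G + (r : ℤ) • vecMulVec v v) i j).natAbs ≤ c + w := fun i j =>
      (hGr.le i j).trans (by omega)
    have hle' : ∀ i j, ((G + (r : ℤ) • vecMulVec v v + vecMulVec v v) i j).natAbs ≤ c + w :=
      fun i j => by rw [← hsucc]; exact (hGr'.le i j).trans (by omega)
    refine (det_rankP (H := hadBound n (c + w)) (M := M') (s := s) (a := a) (e := a' - a)
      ⟨by rw [h5 size (by simp), hB.size], by rw [h5 scale (by simp), hs],
        by rw [h5 fst (by simp), hfst], h6⟩ (by omega) (hrow hok) hsn hGr.posDef h7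
      (natAbs_adjugate_le_hadBound (by omega) hle) (natAbs_adjugate_le_hadBound (by omega) hle')
      (natAbs_det_le_hadBound hle) hb).mono le_rfl ?_
    rintro M'' ⟨h8, h9⟩
    refine ⟨by rw [h8 rep (by simp), h4], by simp,
      (h5.trans h8 (by simp) (by simp)).upd (by simp) _ _,
      by rw [rd_upd_of_ne (by simp), h8 dif (by simp), h6], ?_⟩
    rw [hsucc]
    exact h9.of_same ((Same.refl [rep] _).upd (by simp) _ _) (by simp) (by simp)
  · rintro M' ⟨-, h5, -, h7⟩
    exact ⟨h5, h7⟩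

end RAM

/-! ## The program for the Gram matrix -/

namespace RAM

open Reg IntMatrix Matrix

theorem hadBound_mono {n c c' : ℕ} (h : c ≤ c') : hadBound n c ≤ hadBound n c' := by
  unfold hadBound; gcongr

/-- A loop over `0, …, n - 1` that adds up contributions to the Gram matrix. -/
theorem det_forAdj {b n c₀ δ T : ℕ} {ctr : Reg} {p : Prog} {S : List Reg} {M : ℤ → ℤ}
    {G : Matrix (Fin n) (Fin n) ℤ} (F : ℕ → Matrix (Fin n) (Fin n) ℤ) (hctr : ctr ∉ S)
    (hsize : size ∉ ctr :: S) (hM : rd M size 0 = n) (hn : n < 2 ^ b)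
    (hmat : mat ∉ [ctr]) (hdet : Reg.det ∉ [ctr])
    (hadm : ∀ j < n, ∀ G c, Adm c G → Adm (c + δ) (G + F j))
    (hbody : ∀ j < n, ∀ M', Same (ctr :: S) M M' → rd M' ctr 0 = j → ∀ G, HasAdj M' G →
      Adm (c₀ + j * δ) G → Det b p T M' fun M'' => Same S M' M'' ∧ HasAdj M'' (G + F j))
    (hA : HasAdj M G) (hG : Adm c₀ G) :
    Det b (forP ctr (vr size) p) (n * (T + 3) + 3) M fun M' =>
      Same (ctr :: S) M M' ∧ HasAdj M' (G + ∑ j ∈ Finset.range n, F j) := by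
  have hadms : ∀ j ≤ n, Adm (c₀ + j * δ) (G + ∑ i ∈ Finset.range j, F i) := by
    intro j hj
    induction j with
    | zero => simpa using hG
    | succ j ih =>
      rw [Finset.sum_range_succ, ← add_assoc, Nat.succ_mul, ← add_assoc]
      exact hadm j (by omega) _ _ (ih (by omega))
  refine det_for n (fun j M' => rd M' ctr 0 = j ∧ Same (ctr :: S) M M' ∧
    HasAdj M' (G + ∑ i ∈ Finset.range j, F i)) (by simp) hn ?_ ?_ ?_ ?_
  · rintro j - M' ⟨h1, h2, -⟩
    exact ⟨by rw [eval_vr, h2 _ hsize, hM], h1⟩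
  · refine ⟨by simp, (Same.refl _ _).upd (by simp) _ _, ?_⟩
    simp only [Finset.range_zero, Finset.sum_empty, add_zero]
    exact hA.of_same ((Same.refl [ctr] _).upd (by simp) _ _) hmat hdet
  · rintro j hj M' ⟨h1, h2, h3⟩
    refine (hbody j hj M' h2 h1 _ h3 (hadms j hj.le)).mono le_rfl ?_
    rintro M'' ⟨h4, h5⟩
    refine ⟨by rw [h4 ctr hctr, h1], by simp,
      (h2.trans h4 (by simp) (by simp)).upd (by simp) _ _, ?_⟩
    rw [Finset.sum_range_succ, ← add_assoc]
    exact h5.of_same ((Same.refl [ctr] _).upd (by simp) _ _) hmat hdet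
  · rintro M' ⟨-, h2, h3⟩
    exact ⟨h2, h3⟩

theorem Adm.add_sum {n c δ k : ℕ} {G : Matrix (Fin n) (Fin n) ℤ}
    {F : ℕ → Matrix (Fin n) (Fin n) ℤ} (h : Adm c G)
    (hF : ∀ j < k, ∀ G c, Adm c G → Adm (c + δ) (G + F j)) :
    Adm (c + k * δ) (G + ∑ j ∈ Finset.range k, F j) := by
  induction k with
  | zero => simpa using h
  | succ k ih =>
    rw [Finset.sum_range_succ, ← add_assoc, Nat.succ_mul, ← add_assoc]
    exact hF k (by omega) _ _ (ih fun j hj => hF j (by omega))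

/-- The contribution of the rows with `s` points. -/
def levelMat (d n : ℕ) (N : ℕ → ℕ) (s w : ℕ) : Matrix (Fin n) (Fin n) ℤ :=
  if s ≤ n then ∑ a ∈ Finset.range n, ∑ a' ∈ Finset.range n, rowMat d n N s w a a' else 0

/-- The Gram matrix, up to the level `k`. -/
def gramMat (d n : ℕ) (N : ℕ → ℕ) (s₀ k : ℕ) : Matrix (Fin n) (Fin n) ℤ :=
  (s₀ : ℤ) • 1 + ∑ i ∈ Finset.range k, levelMat d n N (4 ^ i * s₀) (2 ^ i)

/-- Add all rows with `scale` points. -/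
def levelP : Prog :=
  .cond (vr size + .lit 1 - vr scale)
    (forP fst (vr size) (forP snd (vr size) rowP)) .skip

/-- The list of the registers that are used by `rowP`. -/
abbrev rowRegs : List Reg :=
  [dif, flag, dig₁, dig₂, cnt, val, rep, row, acc, vec, det', col, mat, Reg.det]

theorem levelMat_adm {d n c s w : ℕ} {N : ℕ → ℕ} {G : Matrix (Fin n) (Fin n) ℤ} (h : Adm c G)
    (hw : s ≤ n → w ≤ n) : Adm (c + n * n * n) (G + levelMat d n N s w) := by
  unfold levelMat
  split_ifs with hs
  · rw [mul_assoc]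
    exact h.add_sum fun a _ G c hG => hG.add_sum fun a' _ G c hG =>
      (hG.add_rowMat s w a a').mono (by have := hw hs; omega)
  · rw [add_zero]; exact h.mono (by omega)

theorem det_levelP {b d n s w c : ℕ} {N : ℕ → ℕ} {M : ℤ → ℤ} {G : Matrix (Fin n) (Fin n) ℤ}
    (hB : HasBox M d n N) (hs : rd M scale 0 = s) (hw : rd M weight 0 = w)
    (hs1 : 1 ≤ s) (hwn : s ≤ n → w ≤ n) (hd : d ≤ n) (hA : HasAdj M G) (hG : Adm c G) (hc : 1 ≤ c)
    (hrow : ∀ a a', a' < n → RowOk d N s a a' → ∀ t < s, a + t * (a' - a) < n)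
    (hb : (n + 1) * (n + 1) * (hadBound n (c + n * n * n) + 1) < 2 ^ b) :
    Det b levelP (n * (n * (rowTime n + 3) + 6) + 4) M fun M' =>
      Same (fst :: snd :: rowRegs) M M' ∧ HasAdj M' (G + levelMat d n N s w) := by
  have hb1 := le_of_hadBound hb
  have hnb : n < 2 ^ b := by nlinarith
  refine (det_cond (T := n * (n * (rowTime n + 3) + 3 + 3) + 3) (by simp) (fun h1 => ?_)
    fun h1 => ?_).mono (Nat.le_of_eq (by ring)) fun _ h => h
  swap
  · refine det_skip ⟨Same.refl _ _, ?_⟩ |>.mono (by omega) fun _ h => h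
    simp only [eval_sub, eval_add, eval_vr, eval_lit, hB.size, hs] at h1
    rwa [levelMat, if_neg (by omega), add_zero]
  simp only [eval_sub, eval_add, eval_vr, eval_lit, hB.size, hs] at h1
  have hsn : s ≤ n := by omega
  have hw' := hwn hsn
  rw [levelMat, if_pos hsn]
  refine det_forAdj (c₀ := c) (δ := n * n) (F := fun a => ∑ a' ∈ Finset.range n, rowMat d n N s w a a')
    (by simp) (by simp) hB.size hnb (by simp) (by simp) (fun a _ G c hG => hG.add_sum fun a' _ G c hG =>
      (hG.add_rowMat s w a a').mono (by omega)) (fun a ha M₁ hM₁ hfst G₁ hA₁ hG₁ => ?_) hA hG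
  refine det_forAdj (c₀ := c + a * (n * n)) (δ := n) (F := fun a' => rowMat d n N s w a a')
    (by simp) (by simp) (by rw [hM₁ size (by simp), hB.size]) hnb (by simp) (by simp)
    (fun a' _ G c hG => (hG.add_rowMat s w a a').mono (by omega))
    (fun a' ha' M₂ hM₂ hsnd G₂ hA₂ hG₂ => ?_) hA₁ hG₁
  have hS : Same (fst :: snd :: rowRegs) M M₂ := hM₁.trans hM₂ (by simp) (by simp)
  refine det_rowP (c := c + a * (n * n) + a' * n) (hB.of_same hS (by simp))
    (by rw [hS scale (by simp), hs]) (by rw [hS weight (by simp), hw])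
    (by rw [hM₂ fst (by simp), hfst]) hsnd hs1 hsn hw' ha ha' hd hA₂ hG₂ (hrow a a' ha')
    (lt_of_le_of_lt ?_ hb) (by omega)
  refine Nat.mul_le_mul_left _ (Nat.add_le_add_right (hadBound_mono ?_) 1)
  have h2 : a' * n + n ≤ n * n := by
    calc a' * n + n = (a' + 1) * n := by ring
      _ ≤ n * n := Nat.mul_le_mul_right _ ha'
  have h3 : a * (n * n) + n * n ≤ n * n * n := by
    calc a * (n * n) + n * n = (a + 1) * (n * n) := by ring
      _ ≤ n * (n * n) := Nat.mul_le_mul_right _ ha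
      _ = _ := by ring
  omega

/-- Add the rows of all levels. -/
def gramP : Prog :=
  .seq (sv scale (vr scaleMin)) (.seq (sv weight (.lit 1)) (forP lvl (vr size) (.seq levelP (.seq
    (sv scale (.lit 4 * vr scale)) (sv weight (.lit 2 * vr weight))))))

theorem gramMat_adm {d n s₀ : ℕ} (N : ℕ → ℕ) (h : 1 ≤ s₀) (k : ℕ) :
    Adm (s₀ + k * (n * n * n)) (gramMat d n N s₀ k) := by
  refine Adm.add_sum ⟨isPosDef_smul_one (by exact_mod_cast h), fun i j => ?_⟩ fun k _ G c hG =>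
    levelMat_adm hG fun hk => ?_
  · rw [Matrix.smul_apply, Matrix.one_apply]
    split_ifs <;> simp
  -- The weight of a level does not exceed the number of points of its rows, so it is at most `n`
  -- whenever the level is not empty.
  · calc 2 ^ k ≤ 4 ^ k := Nat.pow_le_pow_left (by norm_num) k
      _ ≤ 4 ^ k * s₀ := Nat.le_mul_of_pos_right _ h
      _ ≤ n := hk

/-- Levels whose rows would have more than `n` points contribute nothing, and `n` levels cover all
others. The register `scale` nevertheless grows up to `4 ^ n * s₀`, whence `hb'`. -/
theorem det_gramP {b d n s₀ : ℕ} {N : ℕ → ℕ} {M : ℤ → ℤ} (hB : HasBox M d n N)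
    (hs : rd M scaleMin 0 = s₀) (hs₀ : 1 ≤ s₀) (hd : d ≤ n)
    (hA : HasAdj M ((s₀ : ℤ) • (1 : Matrix (Fin n) (Fin n) ℤ)))
    (hrow : ∀ s a a', 1 ≤ s → a' < n → RowOk d N s a a' → ∀ t < s, a + t * (a' - a) < n)
    (hb : (n + 1) * (n + 1) * (hadBound n (s₀ + n * (n * n * n)) + 1) < 2 ^ b)
    (hb' : 4 ^ n * s₀ < 2 ^ b) :
    Det b gramP (n * (n * (n * (rowTime n + 3) + 6) + 11) + 9) M fun M' =>
      Same (scale :: weight :: lvl :: fst :: snd :: rowRegs) M M' ∧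
        HasAdj M' (gramMat d n N s₀ n) := by
  have hb1 := le_of_hadBound hb
  have hnb : n < 2 ^ b := by nlinarith
  have hsb : s₀ < 2 ^ b := lt_of_le_of_lt (Nat.le_mul_of_pos_left _ (by positivity)) hb'
  obtain ⟨L, hL⟩ : ∃ L, L = n * (n * (rowTime n + 3) + 6) + 4 := ⟨_, rfl⟩
  refine (det_seq (T := 1) (U := 1 + (n * (L + 3 + 1 + 3) + 3) + 1) (det_sv (by simp)
    (by simpa [hs] using hsb) (det_seq (T := 1) (U := n * (L + 3 + 1 + 3) + 3)
    (det_sv (by simp) ?_ ?_)))).mono ?_ fun _ h => h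
  · simp only [eval_lit]; omega
  swap
  · have e : n * (n * (n * (rowTime n + 3) + 6) + 11) = n * (L + 3 + 1 + 3) := by rw [hL]
    omega
  simp only [eval_vr, hs, eval_lit]
  refine det_for (T := L + 3 + 1) n (fun k M' => rd M' lvl 0 = k ∧
    Same (scale :: weight :: lvl :: fst :: snd :: rowRegs) M M' ∧
    rd M' scale 0 = (4 ^ k * s₀ : ℕ) ∧ rd M' weight 0 = (2 ^ k : ℕ) ∧
    HasAdj M' (gramMat d n N s₀ k)) (by simp) hnb ?_ ?_ ?_ ?_
  · rintro k - M' ⟨h1, h2, -⟩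
    exact ⟨by rw [eval_vr, h2 size (by simp), hB.size], h1⟩
  · have hS : Same (scale :: weight :: lvl :: fst :: snd :: rowRegs) M
        (upd (upd (upd M scale 0 s₀) weight 0 1) lvl 0 0) :=
      (((Same.refl _ _).upd (by simp) _ _).upd (by simp) _ _).upd (by simp) _ _
    refine ⟨by simp, hS, by simp, by simp, ?_⟩
    simp only [gramMat, Finset.range_zero, Finset.sum_empty, add_zero]
    exact hA.of_same ((((Same.refl [scale, weight, lvl] _).upd (by simp) _ _).upd (by simp) _ _).upd
      (by simp) _ _) (by simp) (by simp)
  · rintro k hk M' ⟨h1, h2, h3, h4, h5⟩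
    have hkn : k + 1 ≤ n := hk
    refine det_seq (T := L) (U := 3) ?_
    refine (det_levelP (hB.of_same h2 (by simp)) h3 h4
      (Nat.one_le_iff_ne_zero.2 (by positivity)) (fun h => ?_) hd h5 (gramMat_adm N hs₀ k) (by omega)
      (fun a a' => hrow _ a a' (Nat.one_le_iff_ne_zero.2 (by positivity)))
      (lt_of_le_of_lt ?_ hb)).mono hL.ge ?_
    · calc 2 ^ k ≤ 4 ^ k := Nat.pow_le_pow_left (by norm_num) k
        _ ≤ 4 ^ k * s₀ := Nat.le_mul_of_pos_right _ hs₀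
        _ ≤ n := h
    · refine Nat.mul_le_mul_left _ (Nat.add_le_add_right (hadBound_mono ?_) 1)
      have : (k + 1) * (n * n * n) ≤ n * (n * n * n) := Nat.mul_le_mul_right _ hk
      rw [Nat.succ_mul] at this
      omega
    · rintro M₁ ⟨h6, h7⟩
      have hv : 4 * ((4 ^ k * s₀ : ℕ) : ℤ) = (4 ^ (k + 1) * s₀ : ℕ) := by push_cast; ring
      have hw : 2 * ((2 ^ k : ℕ) : ℤ) = (2 ^ (k + 1) : ℕ) := by push_cast; ring
      have hpow : 4 ^ (k + 1) * s₀ < 2 ^ b :=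
        lt_of_le_of_lt (Nat.mul_le_mul_right _ (Nat.pow_le_pow_right (by norm_num) hkn)) hb'
      have hpow2 : 2 ^ (k + 1) < 2 ^ b :=
        lt_of_le_of_lt ((Nat.pow_le_pow_left (by norm_num : 2 ≤ 4) _).trans
          (Nat.le_mul_of_pos_right _ hs₀)) hpow
      refine det_seq (T := 1) (U := 1) (det_sv (by simp) ?_ (det_sv (by simp) ?_ ?_))
      · rw [eval_mul, eval_lit, eval_vr, h6 scale (by simp), h3, hv]; exact hpow
      · rw [eval_mul, eval_lit, eval_vr, rd_upd_of_ne (by simp), h6 weight (by simp), h4, hw]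
        exact hpow2
      · simp only [eval_mul, eval_lit, eval_vr, h6 scale (by simp), h3, hv, ne_eq, reduceCtorEq,
          not_false_eq_true, rd_upd_of_ne, h6 weight (by simp), h4, hw]
        refine ⟨by rw [h6 lvl (by simp), h1], by simp, ?_, by simp, by simp, ?_⟩
        · exact (((h2.trans h6 (by simp) (by simp)).upd (by simp) _ _).upd (by simp) _ _).upd
            (by simp) _ _
        · rw [gramMat, Finset.sum_range_succ, ← add_assoc]
          exact h7.of_same ((((Same.refl [scale, weight, lvl] _).upd (by simp) _ _).upd
            (by simp) _ _).upd (by simp) _ _) (by simp) (by simp)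
  · rintro M' ⟨-, h2, -, -, h5⟩
    exact ⟨h2, h5⟩

/-! ## Initialization -/

/-- Read the dimensions of the box. -/
def readP : Prog :=
  .seq (sv dim (.load (.lit 0))) (.seq (sv size (.lit 1)) (forP cnt (vr dim) (.seq
    (st side (vr cnt) (.load (vr cnt + .lit 1)))
    (sv size (vr size * ar side (vr cnt))))))

theorem det_readP {b d n : ℕ} {N : ℕ → ℕ} {M : ℤ → ℤ} (h0 : M 0 = d)
    (hN : ∀ j < d, M ((j : ℤ) + 1) = N j) (hn : ∏ j ∈ Finset.range d, N j = n)
    (hN1 : ∀ j < d, 1 ≤ N j) (hd : d ≤ n) (hb : n < 2 ^ b) :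
    Det b readP (n * 6 + 7) M fun M' => Same [dim, size, cnt, side] M M' ∧ HasBox M' d n N := by
  have hle : ∀ j ≤ d, ∏ i ∈ Finset.range j, N i ≤ n := fun j hj => by
    rw [← hn]
    exact Finset.prod_le_prod_of_subset_of_one_le' (Finset.range_subset_range.2 hj) fun i hi _ =>
      hN1 i (Finset.mem_range.1 hi)
  have hle' : ∀ j < d, N j ≤ n := fun j hj => by
    rw [← hn]
    exact Finset.single_le_prod' (f := N) (fun i hi => hN1 i (Finset.mem_range.1 hi))
      (Finset.mem_range.2 hj)
  have h1 : 1 ≤ n := by simpa using hle 0 (by omega)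
  refine (det_seq (T := 1) (U := 1 + (d * (3 + 3) + 3) + 1) (det_sv (by decide) ?_
    (det_seq (T := 1) (U := d * (3 + 3) + 3) (det_sv (by simp) ?_ ?_)))).mono (by omega)
    fun _ h => h
  · rw [eval_load, eval_lit, h0]; omega
  · rw [eval_lit]; omega
  rw [eval_load, eval_lit, h0, eval_lit]
  refine det_for (T := 3) d (fun j M' => rd M' cnt 0 = j ∧ Same [dim, size, cnt, side] M M' ∧
    (∀ z : ℤ, 0 ≤ z → M' z = M z) ∧ rd M' dim 0 = d ∧
    rd M' size 0 = (∏ i ∈ Finset.range j, N i : ℕ) ∧ ∀ i < j, rd M' side (i : ℕ) = N i)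
    (by simp) (by omega) ?_ ?_ ?_ ?_
  · rintro j - M' ⟨h1, -, -, h2, -⟩
    exact ⟨by rw [eval_vr, h2], h1⟩
  · refine ⟨by simp, ?_, fun z hz => ?_, by simp, by simp, by simp⟩
    · exact (((Same.refl _ _).upd (by simp) _ _).upd (by simp) _ _).upd (by simp) _ _
    · rw [upd_apply_of_nonneg le_rfl hz, upd_apply_of_nonneg le_rfl hz,
        upd_apply_of_nonneg le_rfl hz]
  · rintro j hj M' ⟨h1, h2, h3, h4, h5, h6⟩
    have hw1 : (Expr.load (vr cnt + Expr.lit 1)).weight = (vr cnt + Expr.lit 1).weight + 1 := rfl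
    refine det_seq (T := 1) (U := 1) (det_st (by simp) (by rw [hw1]; simp) ?_ ?_)
    · rw [eval_load, eval_add, eval_vr, eval_lit, h1, h3 _ (by positivity), hN j hj]
      have := hle' j hj
      omega
    rw [eval_load, eval_add, eval_vr, eval_lit, h1, h3 _ (by positivity), hN j hj]
    have hv : (vr size * ar side (vr cnt)).eval (upd M' side (j : ℕ) (N j)) =
        (∏ i ∈ Finset.range (j + 1), N i : ℕ) := by
      simp only [eval_mul, eval_vr, eval_ar, ne_eq, reduceCtorEq, not_false_eq_true, rd_upd_of_ne,
        h1, rd_upd_self, Function.update_self, h5, Finset.prod_range_succ]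
      push_cast; rfl
    refine det_sv (by simp) ?_ ?_
    · rw [hv]
      have := hle (j + 1) hj
      omega
    · rw [hv]
      refine ⟨by simp [h1], by simp, ?_, fun z hz => ?_, by simp [h4], by simp, fun i hi => ?_⟩
      · exact ((h2.upd (by simp) _ _).upd (by simp) _ _).upd (by simp) _ _
      · rw [upd_apply_of_nonneg le_rfl hz, upd_apply_of_nonneg le_rfl hz,
          upd_apply_of_nonneg (by positivity) hz, h3 z hz]
      · simp only [ne_eq, reduceCtorEq, not_false_eq_true, rd_upd_of_ne, rd_upd_self,
          Function.update_apply]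
        split_ifs with hij
        · rw [show i = j by exact_mod_cast hij]
        · exact h6 i (by
            have : i ≠ j := fun h => hij (by exact_mod_cast h)
            omega)
  · rintro M' ⟨-, h2, -, h4, h5, h6⟩
    exact ⟨h2, ⟨h4, by rw [h5, hn], h6⟩⟩

/-! ### The smallest scale -/

/-- The quantity that is compared to `s` in the choice of the smallest scale. -/
def load (d : ℕ) (N : ℕ → ℕ) (s : ℕ) : ℕ := ∏ j ∈ Finset.range d, max 1 (N j / s)

/-- The candidates for the smallest scale. -/
def scaleSeq (d : ℕ) (N : ℕ → ℕ) : ℕ → ℕ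
  | 0 => 1
  | k + 1 => if scaleSeq d N k < load d N (scaleSeq d N k) then 4 * scaleSeq d N k
      else scaleSeq d N k

/-- Compute the smallest scale. -/
def scaleMinP : Prog :=
  .seq (sv scaleMin (.lit 1)) (forP lvl (vr size) (.seq (sv acc (.lit 1)) (.seq
    (forP cnt (vr dim) (.cond (ar side (vr cnt) / vr scaleMin)
      (sv acc (vr acc * (ar side (vr cnt) / vr scaleMin))) .skip))
    (.cond (vr acc - vr scaleMin) (sv scaleMin (.lit 4 * vr scaleMin)) .skip))))

theorem load_le {d n : ℕ} {N : ℕ → ℕ} (hn : ∏ j ∈ Finset.range d, N j = n)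
    (hN1 : ∀ j < d, 1 ≤ N j) {k : ℕ} (hk : k ≤ d) (s : ℕ) : load k N s ≤ n := by
  rw [← hn]
  calc load k N s ≤ ∏ j ∈ Finset.range k, N j := Finset.prod_le_prod' fun j hj =>
        max_le (hN1 j ((Finset.mem_range.1 hj).trans_le hk)) (Nat.div_le_self _ _)
    _ ≤ _ := Finset.prod_le_prod_of_subset_of_one_le' (Finset.range_subset_range.2 hk) fun i hi _ =>
        hN1 i (Finset.mem_range.1 hi)

theorem one_le_scaleSeq (d : ℕ) (N : ℕ → ℕ) (k : ℕ) : 1 ≤ scaleSeq d N k := by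
  induction k with
  | zero => exact le_rfl
  | succ k ih => rw [scaleSeq]; split_ifs <;> omega

/-- The last multiplication by four happened at a value below its load, and loads are at most `n`.
-/
theorem scaleSeq_le {d n : ℕ} {N : ℕ → ℕ} (hn : ∏ j ∈ Finset.range d, N j = n)
    (hN1 : ∀ j < d, 1 ≤ N j) (hn1 : 1 ≤ n) (k : ℕ) : scaleSeq d N k ≤ 4 * n := by
  induction k with
  | zero => rw [scaleSeq]; omega
  | succ k ih =>
    rw [scaleSeq]
    split_ifs with h
    · have := load_le hn hN1 le_rfl (scaleSeq d N k)
      omega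
    · exact ih

theorem det_scaleMinP {b d n : ℕ} {N : ℕ → ℕ} {M : ℤ → ℤ} (hB : HasBox M d n N)
    (hn : ∏ j ∈ Finset.range d, N j = n) (hN1 : ∀ j < d, 1 ≤ N j) (hd : d ≤ n) (hn1 : 1 ≤ n)
    (hb : 4 * n < 2 ^ b) :
    Det b scaleMinP (n * (n * 5 + 11) + 5) M fun M' => Same [scaleMin, lvl, acc, cnt] M M' ∧
      rd M' scaleMin 0 = scaleSeq d N n := by
  refine (det_seq (T := 1) (U := n * (1 + (d * (2 + 3) + 3 + 2 + 1) + 1 + 3) + 3)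
    (det_sv (by simp) ?_ ?_)).mono ?_ fun _ h => h
  · rw [eval_lit]; omega
  swap
  · have : n * (d * 5) ≤ n * (n * 5) := by gcongr
    nlinarith
  rw [eval_lit]
  refine det_for (T := 1 + (d * (2 + 3) + 3 + 2 + 1) + 1) n (fun k M' => rd M' lvl 0 = k ∧
    Same [scaleMin, lvl, acc, cnt] M M' ∧ rd M' scaleMin 0 = scaleSeq d N k)
    (by simp) (by omega) ?_ ?_ ?_ ?_
  · rintro k - M' ⟨h1, h2, -⟩
    exact ⟨by rw [eval_vr, h2 size (by simp), hB.size], h1⟩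
  · refine ⟨by simp, ?_, by simp [scaleSeq]⟩
    exact ((Same.refl _ _).upd (by simp) _ _).upd (by simp) _ _
  · rintro k hk M' ⟨h1, h2, h3⟩
    have hS4 := scaleSeq_le hn hN1 hn1 k
    have hS1 := one_le_scaleSeq d N k
    set s := scaleSeq d N k with hs
    refine det_seq (T := 1) (U := d * (2 + 3) + 3 + 2 + 1) (det_sv (by simp) ?_ ?_)
    · rw [eval_lit]; omega
    rw [eval_lit]
    refine det_seq (T := d * (2 + 3) + 3) (U := 2) ?_
    refine (det_for (T := 2) d (fun j M'' => rd M'' cnt 0 = j ∧ Same [acc, cnt] M' M'' ∧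
      rd M'' acc 0 = load j N s) (by simp) (by omega) ?_ ?_ ?_ fun _ h => h).mono le_rfl ?_
    · rintro j - M'' ⟨h4, h5, -⟩
      exact ⟨by rw [eval_vr, h5 dim (by simp), h2 dim (by simp), hB.dim], h4⟩
    · refine ⟨by simp, ?_, by simp [load]⟩
      exact ((Same.refl _ _).upd (by simp) _ _).upd (by simp) _ _
    · rintro j hj M'' ⟨h4, h5, h6⟩
      have hq : (ar side (vr cnt) / vr scaleMin).eval M'' = (N j / s : ℕ) := by
        simp only [eval_div, eval_ar, eval_vr, h4, h5 side (by simp), h2 side (by simp),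
          hB.side j hj, h5 scaleMin (by simp), h3]
        push_cast; rfl
      have hload : load (j + 1) N s = load j N s * max 1 (N j / s) := by
        rw [load, Finset.prod_range_succ, load]
      refine det_cond (T := 1) (by simp) (fun h7 => ?_) fun h7 => det_skip ?_
      · rw [hq] at h7
        have hmul : (vr acc * (ar side (vr cnt) / vr scaleMin)).eval M'' = load (j + 1) N s := by
          rw [eval_mul, hq, eval_vr, h6, hload, max_eq_right (by omega)]
          push_cast; rfl
        refine det_sv (by simp) ?_ ?_
        · rw [hmul]
          have := load_le hn hN1 (show j + 1 ≤ d from hj) s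
          omega
        · rw [hmul]
          refine ⟨by simp [h4], by simp, ?_, by simp⟩
          exact (h5.upd (by simp) _ _).upd (by simp) _ _
      · rw [hq] at h7
        refine ⟨h4, by simp, h5.upd (by simp) _ _, ?_⟩
        rw [rd_upd_of_ne (by simp), h6, hload, max_eq_left (by omega), mul_one]
    · rintro M'' ⟨-, h5, h6⟩
      have h7 : rd M'' scaleMin 0 = s := by rw [h5 scaleMin (by simp), h3]
      have h8 : rd M'' lvl 0 = k := by rw [h5 lvl (by simp), h1]
      have hS : Same [scaleMin, lvl, acc, cnt] M M'' := h2.trans h5 (by simp) (by simp)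
      refine det_cond (T := 1) (by simp) (fun h9 => ?_) fun h9 => det_skip ?_
      · simp only [eval_sub, eval_vr, h6, h7] at h9
        have h10 : s < load d N s := by omega
        have := load_le hn hN1 le_rfl s
        refine det_sv (by simp) ?_ ?_
        · rw [eval_mul, eval_lit, eval_vr, h7]; omega
        · rw [eval_mul, eval_lit, eval_vr, h7]
          refine ⟨by simp [h8], by simp, (hS.upd (by simp) _ _).upd (by simp) _ _, ?_⟩
          rw [rd_upd_of_ne (by simp), rd_upd_self, Function.update_self, scaleSeq, ← hs,
            if_pos h10]
          push_cast; rfl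
      · simp only [eval_sub, eval_vr, h6, h7] at h9
        refine ⟨h8, by simp, hS.upd (by simp) _ _, ?_⟩
        rw [rd_upd_of_ne (by simp), h7, scaleSeq, ← hs, if_neg (by omega)]
  · rintro M' ⟨-, h2, h3⟩
    exact ⟨h2, h3⟩

/-! ### The adjugate of the initial scalar matrix -/

/-- Store the adjugate of `scaleMin` times the identity matrix. -/
def diagP : Prog :=
  .seq (sv Reg.det (.lit 1)) (.seq
    (forP cnt (vr size) (.seq (sv acc (vr Reg.det)) (sv Reg.det (vr Reg.det * vr scaleMin))))
    (forP row (vr size) (st mat (vr row * vr size + vr row) (vr acc))))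

/-- The register `acc` stays one factor behind `det`: it ends with `s ^ (n - 1)`, the diagonal entry
of the adjugate, when `det` reaches `s ^ n`. The other entries of the array are still zero from the
start. -/
theorem det_diagP {b n s : ℕ} {M : ℤ → ℤ} (hsize : rd M size 0 = n) (hs : rd M scaleMin 0 = s)
    (hmat : ∀ i : ℤ, 0 ≤ i → rd M mat i = 0) (hn : 1 ≤ n) (hs1 : 1 ≤ s) (hb : s ^ n < 2 ^ b)
    (hnb : n < 2 ^ b) :
    Det b diagP (n * 10 + 9) M fun M' => Same [Reg.det, cnt, acc, row, mat] M M' ∧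
      HasAdj M' ((s : ℤ) • (1 : Matrix (Fin n) (Fin n) ℤ)) := by
  have hpow : ∀ j ≤ n, s ^ j < 2 ^ b := fun j hj =>
    lt_of_le_of_lt (Nat.pow_le_pow_right hs1 hj) hb
  refine (det_seq (T := 1) (U := n * (3 + 3) + 3 + (n * (1 + 3) + 3) + 1) (det_sv (by simp) ?_
    ?_)).mono (by omega) fun _ h => h
  · rw [eval_lit]
    have := hpow 0 (by omega)
    simpa using this
  rw [eval_lit]
  refine det_seq (T := n * (3 + 3) + 3) (U := n * (1 + 3) + 3) ?_
  refine (det_for (T := 3) n (fun j M' => rd M' cnt 0 = j ∧ Same [Reg.det, cnt, acc] M M' ∧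
    rd M' Reg.det 0 = (s ^ j : ℕ) ∧ (1 ≤ j → rd M' acc 0 = (s ^ (j - 1) : ℕ))) (by simp) hnb
    ?_ ?_ ?_ fun _ h => h).mono le_rfl ?_
  · rintro j - M' ⟨h1, h2, -⟩
    exact ⟨by rw [eval_vr, h2 size (by simp), hsize], h1⟩
  · refine ⟨by simp, ?_, by simp, by simp⟩
    exact ((Same.refl _ _).upd (by simp) _ _).upd (by simp) _ _
  · rintro j hj M' ⟨h1, h2, h3, -⟩
    refine det_seq (T := 1) (U := 1) (det_sv (by simp) ?_ (det_sv (by simp) ?_ ?_))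
    · rw [eval_vr, h3]; exact hpow j hj.le
    all_goals
      simp only [eval_mul, eval_vr, ne_eq, reduceCtorEq, not_false_eq_true, rd_upd_of_ne, h3,
        h2 scaleMin (by simp), hs]
      rw [show ((s ^ j : ℕ) : ℤ) * s = (s ^ (j + 1) : ℕ) by push_cast; ring]
    · exact hpow (j + 1) hj
    · refine ⟨h1, by simp, ?_, by simp, fun _ => by simp⟩
      exact ((h2.upd (by simp) _ _).upd (by simp) _ _).upd (by simp) _ _
  · rintro M₁ ⟨-, h2, h3, h4⟩
    have hacc := h4 hn
    refine det_for (T := 1) n (fun j M' => rd M' row 0 = j ∧ Same [row, mat] M₁ M' ∧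
      ∀ i k : Fin n, rd M' mat ((i : ℕ) * n + (k : ℕ)) =
        if i = k ∧ (i : ℕ) < j then (s ^ (n - 1) : ℕ) else 0) (by simp) hnb ?_ ?_ ?_ ?_
    · rintro j - M' ⟨h5, h6, -⟩
      exact ⟨by rw [eval_vr, h6 size (by simp), h2 size (by simp), hsize], h5⟩
    · refine ⟨by simp, (Same.refl _ _).upd (by simp) _ _, fun i k => ?_⟩
      rw [rd_upd_of_ne (by simp), h2 mat (by simp), hmat _ (by positivity), if_neg (by simp)]; rfl
    · rintro j hj M' ⟨h5, h6, h7⟩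
      have hacc' : rd M' acc 0 = (s ^ (n - 1) : ℕ) := by rw [h6 acc (by simp), hacc]
      refine det_st (by simp) (by simp) ?_ ?_
      · rw [eval_vr, hacc']; exact hpow _ (by omega)
      · simp only [eval_add, eval_mul, eval_vr, h5, hacc', h6 size (by simp), h2 size (by simp),
          hsize]
        refine ⟨by simp [h5], by simp, (h6.upd (by simp) _ _).upd (by simp) _ _, fun i k => ?_⟩
        rw [rd_upd_of_ne (by simp), rd_upd_self, Function.update_apply, h7]
        by_cases hik : (i : ℕ) = j ∧ (k : ℕ) = j
        · obtain ⟨hi, hk⟩ := hik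
          have : i = k := Fin.ext (hi.trans hk.symm)
          rw [if_pos (by rw [hi, hk]), if_pos ⟨this, by omega⟩]
        · have hne : ¬ ((i : ℤ) * n + k = (j : ℤ) * n + j) := by
            intro h
            have h' : (i : ℕ) * n + k = j * n + j := by exact_mod_cast h
            have e1 : i = j := by
              have := congrArg (· / n) h'
              rwa [mul_comm, Nat.mul_add_div (by omega), Nat.div_eq_of_lt k.2, mul_comm,
                Nat.mul_add_div (by omega), Nat.div_eq_of_lt hj, add_zero, add_zero] at this
            have e2 : (k : ℕ) = j := by rw [e1] at h'; omega
            exact hik ⟨e1, e2⟩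
          rw [if_neg hne]
          by_cases h1 : i = k
          · have : (i : ℕ) ≠ j := fun h => hik ⟨h, by rw [← h1, h]⟩
            have hlt : (i : ℕ) < j ↔ (i : ℕ) < j + 1 := by omega
            simp only [hlt]
          · simp [h1]
    · rintro M' ⟨-, h6, h7⟩
      refine ⟨h2.trans h6 (by simp) (by simp), ⟨fun i k => ?_, ?_⟩⟩
      · rw [h7, adjugate_smul, adjugate_one, Matrix.smul_apply, Matrix.one_apply, Fintype.card_fin]
        by_cases hik : i = k <;> simp [hik]
      · rw [h6 Reg.det (by simp), h3, det_smul, det_one, Fintype.card_fin]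
        simp

end RAM

/-! ## The steps of the Gram-Schmidt walk with rational numbers -/

namespace GSWalk

open Real IntMatrix
open scoped InnerProductSpace

variable {E : Type*} [NormedAddCommGroup E] [InnerProductSpace ℝ E] {n : ℕ}

/-- The coordinates of `z / e` that are not yet `±1`. -/
def alive (z : Fin n → ℤ) (e : ℤ) : Finset (Fin n) := Finset.univ.filter fun i => |z i| < e

theorem mem_alive {z : Fin n → ℤ} {e : ℤ} {i : Fin n} : i ∈ alive z e ↔ |z i| < e := by
  simp [alive]

/-- The rational vector `z / e`. -/
noncomputable def frac (z : Fin n → ℤ) (e : ℤ) : Fin n → ℝ := fun i => (z i : ℝ) / e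

theorem abs_frac_le {z : Fin n → ℤ} {e : ℤ} (he : 0 < e) (hz : ∀ i, |z i| ≤ e) (i : Fin n) :
    |frac z e i| ≤ 1 := by
  have he' : (0 : ℝ) < e := by exact_mod_cast he
  rw [frac, abs_div, abs_of_pos he', div_le_one he']
  exact_mod_cast hz i

theorem abs_frac_eq {z : Fin n → ℤ} {e : ℤ} (he : 0 < e) (hz : ∀ i, |z i| ≤ e) {i : Fin n}
    (hi : i ∉ alive z e) : |frac z e i| = 1 := by
  have he' : (0 : ℝ) < e := by exact_mod_cast he
  rw [mem_alive, not_lt] at hi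
  rw [frac, abs_div, abs_of_pos he', div_eq_one_iff_eq he'.ne']
  exact_mod_cast (hz i).antisymm hi

/-- The potential of the walk at `z / e`, where the pivot is the largest element of `alive z e`. -/
noncomputable def walkPot (v : Fin n → E) (θ : E) (z : Fin n → ℤ) (e : ℤ) : ℝ :=
  if h : (alive z e).Nonempty then pot v θ (frac z e) (alive z e) ((alive z e).max' h)
  else exp ⟪θ, ∑ i, frac z e i • v i⟫_ℝ

variable {v : Fin n → E} {θ : E} {z : Fin n → ℤ} {e : ℤ} {A : Finset (Fin n)} {p : Fin n}

theorem walkPot_nonneg (he : 0 < e) (hz : ∀ i, |z i| ≤ e) : 0 ≤ walkPot v θ z e := by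
  unfold walkPot
  split_ifs
  exacts [pot_nonneg (abs_frac_le he hz _), (exp_pos _).le]

theorem walkPot_eq (hp : p ∈ alive z e) (hmax : ∀ i ∈ alive z e, i ≤ p) :
    walkPot v θ z e = pot v θ (frac z e) (alive z e) p := by
  have h : (alive z e).max' ⟨p, hp⟩ = p :=
    le_antisymm (Finset.max'_le _ _ _ hmax) (Finset.le_max' _ _ hp)
  rw [walkPot, dif_pos ⟨p, hp⟩, h]

/-- The three possible outcomes of a step: the pivot survives, or it freezes and another pivot takes
over, or nothing is left alive and the potential turns into the plain exponential moment. -/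
theorem walkPot_le (hv : LinearIndependent ℝ v) (hv1 : ∀ i, ‖v i‖ ≤ 1) (he : 0 < e)
    (hz : ∀ i, |z i| ≤ e) (hmax : ∀ i ∈ A, i ≤ p) (hA : alive z e ⊆ A) :
    walkPot v θ z e ≤ pot v θ (frac z e) A p := by
  by_cases hp : p ∈ alive z e
  · rw [walkPot_eq hp fun i hi => hmax i (hA hi)]
    exact pot_le_of_mem hv (hv1 p) (abs_frac_le he hz p) hA
  · have hp1 := abs_frac_eq he hz hp
    unfold walkPot
    split_ifs with h
    · refine pot_le_of_frozen hv (hv1 p) hp1 (abs_frac_le he hz _) (fun i hi => ?_)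
        (Finset.max'_mem _ h)
      exact Finset.mem_erase.2 ⟨by rintro rfl; exact hp hi, hA hi⟩
    · exact exp_le_pot hv (hv1 p) hp1

/-- Rounding the probabilities of a step to multiples of `1 / m`. -/
theorem sum_ite_lt_le {a b m N : ℕ} (ha : 0 < a) (hb : 0 < b) (hN : 0 < N)
    (hm : N * (a + b) ≤ m) {f g : ℝ} (hf : 0 ≤ f) (hg : 0 ≤ g) :
    (∑ r ∈ Finset.range m, if r * (a + b) < a * m then f else g) / m ≤
      (1 + 1 / N) * ((a * f + b * g) / (a + b)) := by
  have ha' : (0 : ℝ) < a := by exact_mod_cast ha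
  have hb' : (0 : ℝ) < b := by exact_mod_cast hb
  have hN' : (0 : ℝ) < N := by exact_mod_cast hN
  have hm0 : 0 < m := lt_of_lt_of_le (by positivity) hm
  have hm' : (0 : ℝ) < m := by exact_mod_cast hm0
  have hmR : (N : ℝ) * (a + b) ≤ m := by exact_mod_cast hm
  have hab : (0 : ℝ) < a + b := by positivity
  -- Exactly `K` of the `m` numbers lead to `f`. The ideal count `a * m / (a + b)` is at least `N`,
  -- so rounding it up costs a relative error of at most `1 / N`, while the share of `g` only
  -- shrinks.
  set K := ⌈(a * m : ℝ) / (a + b)⌉₊ with hK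
  have hiff : ∀ r : ℕ, r * (a + b) < a * m ↔ r < K := fun r => by
    rw [hK, Nat.lt_ceil, lt_div_iff₀ hab]
    exact_mod_cast Iff.rfl
  have hKm : K ≤ m := by
    refine Nat.ceil_le.2 ?_
    rw [div_le_iff₀ hab]
    nlinarith
  have hsum : (∑ r ∈ Finset.range m, if r * (a + b) < a * m then f else g) =
      K * f + (m - K) * g := by
    simp only [hiff]
    rw [← Nat.sub_add_cancel hKm, add_comm, Finset.sum_range_add]
    rw [Finset.sum_congr rfl fun r hr => if_pos (Finset.mem_range.1 hr)]
    rw [Finset.sum_congr rfl fun r _ => if_neg (by omega)]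
    simp [Nat.cast_sub hKm]
  have h1 : (a * m : ℝ) / (a + b) ≤ K := Nat.le_ceil _
  have h2 : (K : ℝ) < a * m / (a + b) + 1 := Nat.ceil_lt_add_one (by positivity)
  have h3 : (K : ℝ) ≤ (1 + 1 / N) * (a * m / (a + b)) := by
    have h4 : (1 : ℝ) ≤ 1 / N * (a * m / (a + b)) := by
      have ha1 : (1 : ℝ) ≤ a := by exact_mod_cast ha
      rw [div_mul_div_comm, one_mul, le_div_iff₀ (by positivity)]
      nlinarith
    linarith
  have h5 : (m : ℝ) - K ≤ (1 + 1 / N) * (b * m / (a + b)) := by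
    have h6 : (m : ℝ) - a * m / (a + b) = b * m / (a + b) := by field_simp; ring
    have h7 : 0 ≤ 1 / (N : ℝ) * (b * m / (a + b)) := by positivity
    linarith
  rw [hsum, div_le_iff₀ hm']
  calc K * f + (m - K) * g ≤ (1 + 1 / N) * (a * m / (a + b)) * f +
        (1 + 1 / N) * (b * m / (a + b)) * g :=
        add_le_add (mul_le_mul_of_nonneg_right h3 hf) (mul_le_mul_of_nonneg_right h5 hg)
    _ = _ := by field_simp

/-- A column of the adjugate is a multiple of the coordinates of the residual vector. -/
theorem sum_adjOn_smul {G : Matrix (Fin n) (Fin n) ℤ} (hG : IsPosDef G) {κ : ℝ}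
    (hgram : ∀ i j, ⟪v i, v j⟫_ℝ = κ * G i j) (hp : p ∈ A) :
    ∑ i, (adjOn A G i p : ℝ) • v i = (adjOn A G p p : ℝ) • resid v A p := by
  have hpos : (0 : ℝ) < adjOn A G p p := by exact_mod_cast adjOn_diag_pos hG hp
  rw [resid_eq (v := v) (A := A) (p := p)
    (b := (adjOn A G p p : ℝ)⁻¹ • ∑ i, (adjOn A G i p : ℝ) • v i), smul_smul,
    mul_inv_cancel₀ hpos.ne', one_smul]
  · have : v p - (adjOn A G p p : ℝ)⁻¹ • ∑ i, (adjOn A G i p : ℝ) • v i =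
        -((adjOn A G p p : ℝ)⁻¹ • ∑ i ∈ Finset.univ.erase p, (adjOn A G i p : ℝ) • v i) := by
      rw [← Finset.add_sum_erase _ _ (Finset.mem_univ p), smul_add, smul_smul,
        inv_mul_cancel₀ hpos.ne', one_smul]
      abel
    rw [this]
    refine Submodule.neg_mem _ (Submodule.smul_mem _ _ (Submodule.sum_mem _ fun i hi => ?_))
    by_cases hiA : i ∈ A
    · exact Submodule.smul_mem _ _ (mem_spanErase
        (Finset.mem_erase.2 ⟨Finset.ne_of_mem_erase hi, hiA⟩))
    · simp [adjOn, hiA]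
  -- Orthogonality to `v j` is an off-diagonal entry of the product of the Gram matrix and its
  -- adjugate.
  · intro j hj
    have hjp := Finset.ne_of_mem_erase hj
    rw [inner_smul_right, inner_sum]
    have h := sum_mul_adjOn (M := G) (Finset.mem_of_mem_erase hj) hp
    rw [if_neg hjp] at h
    have h' : ∑ i, ⟪v j, (adjOn A G i p : ℝ) • v i⟫_ℝ =
        κ * ((∑ k, G j k * adjOn A G k p : ℤ) : ℝ) := by
      push_cast
      rw [Finset.mul_sum]
      refine Finset.sum_congr rfl fun i _ => ?_
      rw [inner_smul_right, hgram]; ring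
    rw [h', h]; simp

/-- The step of the walk: the two possible positions are `z / e + (P₁ / q₁) u / e` and
`z / e - (P₂ / q₂) u / e`, and the choice is made with a random number below `m`. -/
theorem walk_step {G : Matrix (Fin n) (Fin n) ℤ} (hG : IsPosDef G) {κ : ℝ}
    (hgram : ∀ i j, ⟪v i, v j⟫_ℝ = κ * G i j) (hv : LinearIndependent ℝ v)
    (hv1 : ∀ i, ‖v i‖ ≤ 1) (he : 0 < e)
    (hp : p ∈ alive z e) (hmax : ∀ i ∈ alive z e, i ≤ p) {z₁ z₂ : Fin n → ℤ} {P₁ q₁ P₂ q₂ m N : ℕ}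
    (hP₁ : 0 < P₁) (hq₁ : 0 < q₁) (hP₂ : 0 < P₂) (hq₂ : 0 < q₂)
    (hz₁ : ∀ i, z₁ i = z i * q₁ + P₁ * adjOn (alive z e) G i p)
    (hz₂ : ∀ i, z₂ i = z i * q₂ - P₂ * adjOn (alive z e) G i p)
    (hz₁' : ∀ i, |z₁ i| ≤ e * q₁) (hz₂' : ∀ i, |z₂ i| ≤ e * q₂)
    (hA₁ : alive z₁ (e * q₁) ⊆ alive z e) (hA₂ : alive z₂ (e * q₂) ⊆ alive z e)
    (hN : 0 < N) (hm : N * (P₂ * q₁ + P₁ * q₂) ≤ m) :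
    (∑ r ∈ Finset.range m, if r * (P₂ * q₁ + P₁ * q₂) < P₂ * q₁ * m
      then walkPot v θ z₁ (e * q₁) else walkPot v θ z₂ (e * q₂)) / m ≤
      (1 + 1 / N) * walkPot v θ z e := by
  have hq₁' : (0 : ℝ) < q₁ := by exact_mod_cast hq₁
  have hq₂' : (0 : ℝ) < q₂ := by exact_mod_cast hq₂
  have hP₁' : (0 : ℝ) < P₁ := by exact_mod_cast hP₁
  have hP₂' : (0 : ℝ) < P₂ := by exact_mod_cast hP₂
  have he' : (0 : ℝ) < e := by exact_mod_cast he
  have he₁ : 0 < e * (q₁ : ℤ) := by positivity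
  have he₂ : 0 < e * (q₂ : ℤ) := by positivity
  have h := sum_ite_lt_le (a := P₂ * q₁) (b := P₁ * q₂) (m := m) (N := N) (by positivity)
    (by positivity) hN hm (walkPot_nonneg (v := v) (θ := θ) he₁ hz₁')
    (walkPot_nonneg (v := v) (θ := θ) he₂ hz₂')
  refine h.trans (mul_le_mul_of_nonneg_left ?_ (by positivity))
  have h₁ := walkPot_le (θ := θ) hv hv1 he₁ hz₁' hmax hA₁
  have h₂ := walkPot_le (θ := θ) hv hv1 he₂ hz₂' hmax hA₂
  have hu := sum_adjOn_smul hG hgram hp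
  -- The step lengths are `P₁ / (q₁ e)` forwards and `P₂ / (q₂ e)` backwards. The affine potential
  -- is preserved on average if each is chosen in proportion to the other's length, that is, as `P₂
  -- q₁` to `P₁ q₂`.
  have key := pot_add_smul (θ := θ) (x := frac z e)
    (u := fun i => (adjOn (alive z e) G i p : ℝ)) hu (P₁ / (q₁ * e)) (P₂ / (q₂ * e))
  have e₁ : (fun i => frac z e i + P₁ / (q₁ * e) * (adjOn (alive z e) G i p : ℝ)) =
      frac z₁ (e * q₁) := by
    funext i
    simp only [frac, hz₁]
    push_cast
    field_simp
  have e₂ : (fun i => frac z e i - P₂ / (q₂ * e) * (adjOn (alive z e) G i p : ℝ)) =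
      frac z₂ (e * q₂) := by
    funext i
    simp only [frac, hz₂]
    push_cast
    field_simp
  rw [e₁, e₂, ← walkPot_eq hp hmax] at key
  rw [div_le_iff₀ (by positivity)]
  push_cast
  have hk : P₂ * q₁ * pot v θ (frac z₁ (e * q₁)) (alive z e) p +
      P₁ * q₂ * pot v θ (frac z₂ (e * q₂)) (alive z e) p =
      walkPot v θ z e * (P₂ * q₁ + P₁ * q₂) := by
    field_simp at key
    linarith
  rw [← hk]
  gcongr

end GSWalk

/-! ## Programs for the steps of the walk -/

namespace RAM

open Reg IntMatrix Matrix GSWalk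

/-! ### The ratio test for the length of a step -/

/-- The distance from `z i` to the end of the interval `[-e, e]` in the direction of `σ u i`. -/
def gap {n : ℕ} (σ e : ℤ) (z u : Fin n → ℤ) (i : Fin n) : ℤ :=
  if u i < 0 then e + σ * z i else e - σ * z i

/-- The pair `num / quo` is the ratio `gap i / |u i|` for some `i`, and is at most this ratio for
all `i < k`. -/
def Least {n : ℕ} (σ e : ℤ) (z u : Fin n → ℤ) (k : ℕ) (num quo : ℤ) : Prop :=
  (∃ i, u i ≠ 0 ∧ num = gap σ e z u i ∧ quo = |u i|) ∧
    ∀ i : Fin n, (i : ℕ) < k → num * |u i| ≤ gap σ e z u i * quo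

theorem gap_nonneg {n : ℕ} {σ e : ℤ} {z u : Fin n → ℤ} (hσ : σ = 1 ∨ σ = -1)
    (hz : ∀ i, |z i| ≤ e) (i : Fin n) : 0 ≤ gap σ e z u i ∧ gap σ e z u i ≤ 2 * e := by
  have := abs_le.1 (hz i)
  unfold gap
  rcases hσ with rfl | rfl <;> split_ifs <;> constructor <;> linarith

theorem Least.quo_pos {n : ℕ} {σ e : ℤ} {z u : Fin n → ℤ} {k : ℕ} {num quo : ℤ}
    (h : Least σ e z u k num quo) : 0 < quo := by
  obtain ⟨⟨i, h1, -, rfl⟩, -⟩ := h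
  exact abs_pos.2 h1

/-- Ratios are compared by cross multiplication with positive denominators; a strict improvement
cannot come from an index with `u j = 0`. -/
theorem Least.update {n : ℕ} {σ e : ℤ} {z u : Fin n → ℤ} {num quo : ℤ} {j : Fin n}
    (hσ : σ = 1 ∨ σ = -1) (hz : ∀ i, |z i| ≤ e) (h : Least σ e z u j num quo)
    (hj : gap σ e z u j * quo < num * |u j|) :
    Least σ e z u (j + 1) (gap σ e z u j) |u j| := by
  have hq := h.quo_pos
  have hg := (gap_nonneg (u := u) hσ hz j).1
  have hu : u j ≠ 0 := by
    intro h0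
    rw [h0, abs_zero, mul_zero] at hj
    have := mul_nonneg hg hq.le
    omega
  refine ⟨⟨j, hu, rfl, rfl⟩, fun i hi => ?_⟩
  rcases Nat.lt_succ_iff_lt_or_eq.1 hi with hi | hi
  · have h1 := h.2 i hi
    refine le_of_mul_le_mul_right ?_ hq
    calc gap σ e z u j * |u i| * quo = gap σ e z u j * quo * |u i| := by ring
      _ ≤ num * |u j| * |u i| := mul_le_mul_of_nonneg_right hj.le (abs_nonneg _)
      _ = num * |u i| * |u j| := by ring
      _ ≤ gap σ e z u i * quo * |u j| := mul_le_mul_of_nonneg_right h1 (abs_nonneg _)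
      _ = _ := by ring
  · rw [Fin.ext hi]

theorem Least.succ {n : ℕ} {σ e : ℤ} {z u : Fin n → ℤ} {num quo : ℤ} {j : Fin n}
    (h : Least σ e z u j num quo) (hj : num * |u j| ≤ gap σ e z u j * quo) :
    Least σ e z u (j + 1) num quo := by
  refine ⟨h.1, fun i hi => ?_⟩
  rcases Nat.lt_succ_iff_lt_or_eq.1 hi with hi | hi
  · exact h.2 i hi
  · rwa [Fin.ext hi]

/-- The consequences of the choice of the step length. -/
theorem Least.move {n : ℕ} {σ e : ℤ} {z u : Fin n → ℤ} {num quo : ℤ} (hσ : σ = 1 ∨ σ = -1)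
    (hz : ∀ i, |z i| ≤ e) (hu : ∀ i, i ∉ alive z e → u i = 0)
    (h : Least σ e z u n num quo) :
    0 < num ∧ (∀ i, |z i * quo + σ * (num * u i)| ≤ e * quo) ∧
      alive (fun i => z i * quo + σ * (num * u i)) (e * quo) ⊂ alive z e := by
  have hq := h.quo_pos
  have hle : ∀ i, |z i * quo + σ * (num * u i)| ≤ e * quo := by
    intro i
    have h1 := h.2 i i.2
    have h2 := abs_le.1 (hz i)
    have hn : 0 ≤ num := by
      obtain ⟨⟨k, -, rfl, -⟩, -⟩ := h
      exact (gap_nonneg hσ hz k).1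
    have h3 : (e + z i) * quo ≥ 0 := mul_nonneg (by linarith) hq.le
    have h4 : (e - z i) * quo ≥ 0 := mul_nonneg (by linarith) hq.le
    unfold gap at h1
    rw [abs_le]
    split_ifs at h1 with hi
    · rw [abs_of_neg hi] at h1
      have h5 : 0 ≤ num * -(u i) := mul_nonneg hn (by linarith)
      rcases hσ with rfl | rfl <;> constructor <;> nlinarith
    · rw [abs_of_nonneg (not_lt.1 hi)] at h1
      have h5 : 0 ≤ num * u i := mul_nonneg hn (not_lt.1 hi)
      rcases hσ with rfl | rfl <;> constructor <;> nlinarith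
  have hsub : alive (fun i => z i * quo + σ * (num * u i)) (e * quo) ⊆ alive z e := by
    intro i hi
    by_contra hi'
    have h1 := hu i hi'
    rw [mem_alive] at hi hi'
    rw [h1, mul_zero, mul_zero, add_zero, abs_mul, abs_of_pos hq] at hi
    exact hi' (lt_of_mul_lt_mul_right hi hq.le)
  obtain ⟨⟨k, hk, hnum, hquo⟩, -⟩ := h
  have hkA : k ∈ alive z e := by
    by_contra h'
    exact hk (hu k h')
  refine ⟨?_, hle, Finset.ssubset_iff_subset_ne.2 ⟨hsub, fun heq => ?_⟩⟩
  · rw [hnum]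
    have := abs_lt.1 (mem_alive.1 hkA)
    unfold gap
    rcases hσ with rfl | rfl <;> split_ifs <;> linarith
  -- The coordinate that attains the least ratio arrives exactly at an end of the interval, so it is
  -- no longer alive.
  · rw [← heq, mem_alive] at hkA
    refine absurd hkA (not_lt.2 (le_of_eq ?_))
    unfold gap at hnum
    rw [← abs_of_pos hq, hnum, hquo]
    have he : 0 ≤ e := (abs_nonneg _).trans (hz k)
    rw [abs_abs]
    rcases lt_or_gt_of_ne hk with hk' | hk'
    · rw [if_pos hk', abs_of_neg hk']
      rcases hσ with rfl | rfl
      · rw [show z k * -u k + 1 * ((e + 1 * z k) * u k) = -(e * -u k) by ring, abs_neg,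
          abs_of_nonneg (mul_nonneg he (by linarith))]
      · rw [show z k * -u k + -1 * ((e + -1 * z k) * u k) = e * -u k by ring,
          abs_of_nonneg (mul_nonneg he (by linarith))]
    · rw [if_neg (by linarith), abs_of_pos hk']
      rcases hσ with rfl | rfl
      · rw [show z k * u k + 1 * ((e - 1 * z k) * u k) = e * u k by ring,
          abs_of_nonneg (mul_nonneg he (by linarith))]
      · rw [show z k * u k + -1 * ((e - -1 * z k) * u k) = -(e * u k) by ring, abs_neg,
          abs_of_nonneg (mul_nonneg he (by linarith))]

/-- Compute the length of the step in the direction `σ`. -/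
def scanP (σ : ℤ) (num quo : Reg) : Prog :=
  .seq (sv num (vr den - .lit σ * ar pos (vr piv))) (.seq (sv quo (ar dir (vr piv)))
    (forP cnt (vr size) (.seq (sv val (ar dir (vr cnt))) (.seq
      (sv acc (vr den - .lit σ * ar pos (vr cnt))) (.seq
      (.cond (.lit 0 - ar dir (vr cnt)) (.seq (sv val (.lit 0 - ar dir (vr cnt)))
        (sv acc (vr den + .lit σ * ar pos (vr cnt)))) .skip)
      (.cond (vr num * vr val - vr acc * vr quo) (.seq (sv num (vr acc)) (sv quo (vr val)))
        .skip))))))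

/-- The pivot supplies the first candidate: its entry in the direction is a diagonal cofactor and
hence positive, so the denominator never vanishes. -/
theorem det_scanP {b n : ℕ} {σ e : ℤ} {num quo : Reg} {M : ℤ → ℤ} {z u : Fin n → ℤ} {p : Fin n}
    (hσ : σ = 1 ∨ σ = -1) (hnq : num ≠ quo) (hnum : num ∉ [size, den, piv, cnt, val, acc, pos, dir])
    (hquo : quo ∉ [size, den, piv, cnt, val, acc, pos, dir])
    (hsize : rd M size 0 = n) (hden : rd M den 0 = e) (hpiv : rd M piv 0 = (p : ℕ))
    (hpos : HasVec pos M z) (hdir : HasVec dir M u) (hz : ∀ i, |z i| ≤ e) (hup : 0 < u p)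
    (hnb : n < 2 ^ b) (he : (2 * e).natAbs < 2 ^ b) (hu : ∀ i, (u i).natAbs < 2 ^ b) :
    Det b (scanP σ num quo) (n * 16 + 7) M fun M' => Same [num, quo, cnt, val, acc] M M' ∧
      Least σ e z u n (rd M' num 0) (rd M' quo 0) := by
  simp only [List.mem_cons, List.not_mem_nil, or_false, not_or] at hnum hquo
  have hgap : ∀ i, (gap σ e z u i).natAbs < 2 ^ b := fun i => by
    have := gap_nonneg (u := u) hσ hz i
    omega
  have hw : (Expr.lit σ).weight = 7 := weight_lit (by rcases hσ with rfl | rfl <;> decide)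
  have hgp : e - σ * z p = gap σ e z u p := by rw [gap, if_neg (by omega)]
  have e1 : (vr den - .lit σ * ar pos (vr piv)).eval M = gap σ e z u p := by
    simp only [eval_sub, eval_mul, eval_lit, eval_vr, eval_ar, hden, hpiv, hpos p, hgp]
  refine (det_seq (T := 1) (U := 1 + (n * (13 + 3) + 3) + 1) (det_sv (by simp [hw]) ?_
    (det_seq (T := 1) (U := n * (13 + 3) + 3) (det_sv (by simp) ?_ ?_)))).mono (by omega)
    fun _ h => h
  · rw [e1]; exact hgap p
  · simp only [eval_ar, eval_vr, rd_upd_of_ne (Ne.symm hnum.2.2.1), hpiv,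
      rd_upd_of_ne (Ne.symm hnum.2.2.2.2.2.2.2), hdir p]
    exact hu p
  rw [e1]
  simp only [eval_ar, eval_vr, rd_upd_of_ne (Ne.symm hnum.2.2.1), hpiv,
      rd_upd_of_ne (Ne.symm hnum.2.2.2.2.2.2.2), hdir p]
  refine det_for (T := 13) n (fun j M' => rd M' cnt 0 = j ∧ Same [num, quo, cnt, val, acc] M M' ∧
    Least σ e z u j (rd M' num 0) (rd M' quo 0)) (by simp) hnb ?_ ?_ ?_ ?_
  · rintro j - M' ⟨h1, h2, -⟩
    refine ⟨?_, h1⟩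
    rw [eval_vr, h2 size (by simp [Ne.symm hnum.1, Ne.symm hquo.1]), hsize]
  · refine ⟨by simp, ?_, ?_⟩
    · exact (((Same.refl _ _).upd (by simp) _ _).upd (by simp) _ _).upd (by simp) _ _
    · rw [rd_upd_of_ne hnum.2.2.2.1, rd_upd_of_ne hnq, rd_upd_of_ne hquo.2.2.2.1, rd_upd_self,
        rd_upd_self, Function.update_self, Function.update_self]
      exact ⟨⟨p, hup.ne', rfl, (abs_of_pos hup).symm⟩, by simp⟩
  · rintro j hj M₁ ⟨h1, h2, h3⟩
    have hd : rd M₁ den 0 = e := by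
      rw [h2 den (by simp [Ne.symm hnum.2.1, Ne.symm hquo.2.1]), hden]
    have hdirj : rd M₁ dir (j : ℕ) = u ⟨j, hj⟩ := by
      rw [h2 dir (by simp [Ne.symm hnum.2.2.2.2.2.2.2, Ne.symm hquo.2.2.2.2.2.2.2])]
      exact hdir ⟨j, hj⟩
    have hposj : rd M₁ pos (j : ℕ) = z ⟨j, hj⟩ := by
      rw [h2 pos (by simp [Ne.symm hnum.2.2.2.2.2.2.1, Ne.symm hquo.2.2.2.2.2.2.1])]
      exact hpos ⟨j, hj⟩
    set i : Fin n := ⟨j, hj⟩ with hi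
    have hb2 := abs_le.1 (hz i)
    have hbz : (e - σ * z i).natAbs < 2 ^ b ∧ (e + σ * z i).natAbs < 2 ^ b := by
      rcases hσ with rfl | rfl <;> constructor <;> omega
    refine det_seq (T := 1) (U := 11) (det_sv (by simp) ?_ (det_seq (T := 1) (U := 9)
      (det_sv (by simp [hw]) ?_ (det_seq (T := 4) (U := 4) ?_))))
    · simp only [eval_ar, eval_vr, h1, hdirj]; exact hu i
    · simp only [eval_sub, eval_mul, eval_lit, eval_vr, eval_ar, ne_eq, reduceCtorEq,
        not_false_eq_true, rd_upd_of_ne, hd, h1, hposj]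
      exact hbz.1
    have hmid : Det b (.cond (.lit 0 - ar dir (vr cnt)) (.seq (sv val (.lit 0 - ar dir (vr cnt)))
        (sv acc (vr den + .lit σ * ar pos (vr cnt)))) .skip) 4
        (upd (upd M₁ val 0 ((ar dir (vr cnt)).eval M₁)) acc 0
          ((vr den - .lit σ * ar pos (vr cnt)).eval (upd M₁ val 0 ((ar dir (vr cnt)).eval M₁))))
        fun M' => Same [val, acc] M₁ M' ∧ rd M' val 0 = |u i| ∧ rd M' acc 0 = gap σ e z u i := by
      simp only [eval_sub, eval_mul, eval_lit, eval_vr, eval_ar, ne_eq, reduceCtorEq,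
        not_false_eq_true, rd_upd_of_ne, hd, h1, hposj, hdirj]
      refine det_cond (T := 3) (by simp) (fun h4 => ?_) fun h4 => (det_skip ?_).mono (by omega)
        fun _ h => h
      · simp only [eval_sub, eval_lit, eval_vr, eval_ar, ne_eq, reduceCtorEq,
          not_false_eq_true, rd_upd_of_ne, h1, hdirj] at h4
        refine det_seq (T := 1) (U := 1) (det_sv (by simp) ?_ (det_sv (by simp [hw]) ?_ ?_))
        all_goals simp only [eval_sub, eval_add, eval_mul, eval_lit, eval_vr, eval_ar, ne_eq,
          reduceCtorEq, not_false_eq_true, rd_upd_of_ne, hd, h1, hposj, hdirj]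
        · have := hu i; omega
        · exact hbz.2
        · refine ⟨?_, by simp [abs_of_neg (show u i < 0 by omega)],
            by simp [gap, if_pos (show u i < 0 by omega)]⟩
          exact ((((Same.refl _ _).upd (by simp) _ _).upd (by simp) _ _).upd (by simp) _ _).upd
            (by simp) _ _
      · simp only [eval_sub, eval_lit, eval_vr, eval_ar, ne_eq, reduceCtorEq,
          not_false_eq_true, rd_upd_of_ne, h1, hdirj] at h4
        refine ⟨?_, by simp [abs_of_nonneg (show 0 ≤ u i by omega)],
            by simp [gap, if_neg (show ¬ u i < 0 by omega)]⟩
        exact ((Same.refl _ _).upd (by simp) _ _).upd (by simp) _ _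
    refine hmid.mono le_rfl ?_
    rintro M₂ ⟨h4, h5, h6⟩
    have hn2 : rd M₂ num 0 = rd M₁ num 0 := by
      rw [h4 num (by simp [hnum.2.2.2.2.1, hnum.2.2.2.2.2.1])]
    have hq2 : rd M₂ quo 0 = rd M₁ quo 0 := by
      rw [h4 quo (by simp [hquo.2.2.2.2.1, hquo.2.2.2.2.2.1])]
    have hc2 : rd M₂ cnt 0 = j := by rw [h4 cnt (by simp), h1]
    have hS : Same [num, quo, cnt, val, acc] M M₂ := h2.trans h4 (by simp) (by simp)
    refine det_cond (T := 3) (by simp) (fun h7 => ?_) fun h7 => (det_skip ?_).mono (by omega)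
        fun _ h => h
    · simp only [eval_sub, eval_mul, eval_vr, h5, h6, hn2, hq2] at h7
      refine det_seq (T := 1) (U := 1) (det_sv (by simp) ?_ (det_sv (by simp) ?_ ?_))
      · rw [eval_vr, h6]; exact hgap i
      · rw [eval_vr, rd_upd_of_ne (Ne.symm hnum.2.2.2.2.1), h5, Int.natAbs_abs]; exact hu i
      rw [eval_vr, eval_vr, rd_upd_of_ne (Ne.symm hnum.2.2.2.2.1), h5, h6]
      refine ⟨by rw [rd_upd_of_ne (Ne.symm hquo.2.2.2.1), rd_upd_of_ne (Ne.symm hnum.2.2.2.1), hc2],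
        by simp, ((hS.upd (by simp) _ _).upd (by simp) _ _).upd (by simp) _ _, ?_⟩
      rw [rd_upd_of_ne hnum.2.2.2.1, rd_upd_of_ne hnq, rd_upd_of_ne hquo.2.2.2.1, rd_upd_self,
        rd_upd_self, Function.update_self, Function.update_self]
      exact Least.update hσ hz h3 (by omega)
    · simp only [eval_sub, eval_mul, eval_vr, h5, h6, hn2, hq2] at h7
      refine ⟨hc2, by simp, hS.upd (by simp) _ _, ?_⟩
      rw [rd_upd_of_ne hnum.2.2.2.1, rd_upd_of_ne hquo.2.2.2.1, hn2, hq2]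
      exact Least.succ (j := i) h3 (by omega)
  · rintro M' ⟨-, h2, h3⟩
    exact ⟨h2, h3⟩

/-! ### Random numbers -/

theorem Rnd.of_le {b : ℕ} {p : Prog} {T T' : ℕ} {M : ℤ → ℤ} {Q : (ℤ → ℤ) → Prop} {Θ : Type}
    {Φ : Θ → (ℤ → ℤ) → ℝ} {v v' : Θ → ℝ} (h : Rnd b p T M Q Φ v) (hT : T ≤ T')
    (hv : ∀ θ, v θ ≤ v' θ) : Rnd b p T' M Q Φ v' :=
  h.mono hT id (fun _ h => ⟨h, fun _ => le_rfl⟩) hv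

/-- The mean of `g` over the numbers whose leading binary digits are given by `r`. -/
noncomputable def blockMean (g : ℕ → ℝ) (L r : ℕ) : ℝ :=
  (∑ t ∈ Finset.range (2 ^ L), g (r * 2 ^ L + t)) / (2 ^ L : ℕ)

/-- One more binary digit splits a block into two halves of equal size, so the means form a
martingale under the coin tosses. -/
theorem blockMean_succ (g : ℕ → ℝ) (L r : ℕ) :
    blockMean g (L + 1) r = (blockMean g L (r * 2 + 1) + blockMean g L (r * 2)) / 2 := by
  unfold blockMean
  rw [pow_succ, mul_two, Finset.sum_range_add]
  have h1 : ∀ t, r * (2 ^ L + 2 ^ L) + t = r * 2 * 2 ^ L + t := fun t => by ring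
  have h2 : ∀ t, r * (2 ^ L + 2 ^ L) + (2 ^ L + t) = (r * 2 + 1) * 2 ^ L + t := fun t => by ring
  simp only [h1]
  push_cast
  field_simp
  ring_nf

/-- The sum of the products by which the step is chosen. -/
def totE : Expr := vr num₂ * vr quo₁ + vr num₁ * vr quo₂

/-- Choose a random number below a power of two that is at least `size * totE`. -/
def drawP : Prog :=
  .seq (sv modu (.lit 1)) (.seq (sv rnd (.lit 0)) (.loop (vr size * totE - vr modu) (.seq
    (tossP flag) (.seq (sv rnd (vr rnd * .lit 2 + vr flag)) (sv modu (vr modu * .lit 2))))))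

/-- The conditional expectation of `g`, given the leading digits, is the block mean. The loop stops
at the first power of two that reaches `n * t`, which is the precision needed for a relative
rounding error of `1 / n`. -/
theorem rnd_drawP {b n t K : ℕ} {M : ℤ → ℤ} {Θ : Type} (g : Θ → ℕ → ℝ) (hsize : rd M size 0 = n)
    (htot : totE.eval M = t) (hK : K = Nat.clog 2 (n * t)) (hb : 2 * (n * t) + 1 < 2 ^ b) :
    Rnd b drawP (b * 6 + 5) M (fun M' => Same [modu, rnd, flag] M M' ∧
      rd M' modu 0 = (2 ^ K : ℕ) ∧ ∃ r : ℕ, r < 2 ^ K ∧ rd M' rnd 0 = r)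
      (fun θ M' => g θ (rd M' rnd 0).toNat)
      fun θ => (∑ r ∈ Finset.range (2 ^ K), g θ r) / (2 ^ K : ℕ) := by
  have hlt : ∀ j < K, 2 ^ j < n * t := fun j hj => by
    rw [hK] at hj
    exact (Nat.lt_clog_iff_pow_lt (by norm_num)).1 hj
  have hle : n * t ≤ 2 ^ K := by rw [hK]; exact Nat.le_pow_clog (by norm_num) _
  have hKb : K ≤ b := by
    by_contra h
    have := hlt b (by omega)
    omega
  have heq : ∀ M', Same [modu, rnd, flag] M M' → (vr size * totE - vr modu).eval M' =
      n * t - rd M' modu 0 := fun M' h => by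
    rw [← htot, ← hsize]
    simp [totE, h size, h num₁, h num₂, h quo₁, h quo₂]
  have hone : 1 < 2 ^ b := by omega
  suffices h : Rnd b drawP (1 + (1 + (K * (5 + 1) + 1) + 1) + 1) M (fun M' => Same [modu, rnd, flag] M M' ∧
      rd M' modu 0 = (2 ^ K : ℕ) ∧ ∃ r : ℕ, r < 2 ^ K ∧ rd M' rnd 0 = r)
      (fun θ M' => blockMean (g θ) (K - K) (rd M' rnd 0).toNat) fun θ => blockMean (g θ) (K - 0) 0 by
    refine h.mono (by omega) id (fun M' hM' => ⟨hM', fun θ => ?_⟩) fun θ => ?_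
    · simp [blockMean]
    · simp [blockMean]
  refine Rnd.seq (Q := fun M' => M' = upd M modu 0 1) (Φ := fun θ _ => blockMean (g θ) (K - 0) 0)
    (.of_det (det_sv (by simp) (by simpa using hone) ⟨by simp, fun _ => le_rfl⟩)) ?_
  rintro M' rfl
  refine Rnd.seq (Q := fun M' => M' = upd (upd M modu 0 1) rnd 0 0)
    (Φ := fun θ M' => blockMean (g θ) (K - 0) (rd M' rnd 0).toNat)
    (.of_det (det_sv (by simp) (by simp) ⟨by simp, fun _ => by simp⟩)) ?_
  rintro M' rfl
  have hloop := Rnd.loop (b := b) (T := 5) (e := vr size * totE - vr modu)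
    (p := .seq (tossP flag) (.seq (sv rnd (vr rnd * .lit 2 + vr flag)) (sv modu (vr modu * .lit 2))))
    K (fun j M' => Same [modu, rnd, flag] M M' ∧ rd M' modu 0 = (2 ^ j : ℕ) ∧
      ∃ r : ℕ, r < 2 ^ j ∧ rd M' rnd 0 = r)
    (fun j (θ : Θ) M' => blockMean (g θ) (K - j) (rd M' rnd 0).toNat) (by simp [totE]) ?_ ?_
    (M := upd (upd M modu 0 1) rnd 0 0) ?_
  · exact hloop
  · rintro j hj M' ⟨h1, h2, r, hr, h3⟩
    have hj' := hlt j hj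
    refine ⟨?_, ?_⟩
    · rw [heq M' h1, h2]
      have : ((2 ^ j : ℕ) : ℤ) < (n * t : ℕ) := by exact_mod_cast hj'
      push_cast at this ⊢
      linarith
    · refine (Rnd.seq (T := 1) (U := 3) (Q := fun M'' => ∃ c : Bool, M'' = upd M' flag 0 (if c then 1 else 0))
        (Φ := fun θ M'' => blockMean (g θ) (K - (j + 1))
          (rd M'' rnd 0 * 2 + rd M'' flag 0).toNat) (v := fun θ => blockMean (g θ) (K - j) r)
        ?_ ?_).of_le le_rfl fun θ => ?_
      · refine (rnd_toss (fun c => ⟨c, rfl⟩)).of_le le_rfl fun θ => ?_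
        simp only [ne_eq, reduceCtorEq, not_false_eq_true, rd_upd_of_ne, h3, rd_upd_self,
          Function.update_self]
        rw [show K - j = K - (j + 1) + 1 by omega, blockMean_succ]
        norm_cast
      · rintro M'' ⟨c, rfl⟩
        have hc : ∃ c' : ℕ, c' ≤ 1 ∧ (if c = true then (1 : ℤ) else 0) = c' := by
          cases c
          exacts [⟨0, by simp⟩, ⟨1, by simp⟩]
        obtain ⟨c', hc', hcc⟩ := hc
        rw [hcc]
        have hpow : 2 ^ j * 2 < 2 ^ b := by omega
        refine .of_det (det_seq (T := 1) (U := 1) (det_sv (by simp) ?_ (det_sv (by simp) ?_ ?_)))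
        all_goals simp only [eval_add, eval_mul, eval_vr, eval_lit, ne_eq, reduceCtorEq,
          not_false_eq_true, rd_upd_of_ne, h3, h2, rd_upd_self, Function.update_self]
        · omega
        · omega
        · refine ⟨⟨((h1.upd (by simp) _ _).upd (by simp) _ _).upd (by simp) _ _, by push_cast; ring,
            r * 2 + c', by rw [pow_succ]; omega, by push_cast; ring⟩, fun θ => le_rfl⟩
      · simp only [h3]
        exact le_of_eq (by simp)
  · rintro M' ⟨h1, h2, -⟩
    rw [heq M' h1, h2]
    have : ((n * t : ℕ) : ℤ) ≤ (2 ^ K : ℕ) := by exact_mod_cast hle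
    push_cast at this ⊢
    linarith
  · refine ⟨((Same.refl _ _).upd (by simp) _ _).upd (by simp) _ _, by simp, 0, by simp, by simp⟩

end RAM

/-! ## Deletions from the matrix and moves of the walk -/

namespace RAM

open Reg IntMatrix Matrix GSWalk

/-- Delete the index `del` from the matrix. -/
def deleteP : Prog :=
  .seq (forP row (vr size) (st vec (vr row) (ar mat (vr row * vr size + vr del))))
    (.seq (sv det' (ar mat (vr del * vr size + vr del))) updateP)

/-- The state of the matrix: the adjugate and the determinant of `G`, restricted to `A`. -/
structure HasAdjOn {n : ℕ} (M : ℤ → ℤ) (A : Finset (Fin n)) (G : Matrix (Fin n) (Fin n) ℤ) :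
    Prop where
  mat : HasMat M (adjOn A G)
  det : rd M det 0 = (restr A G).det

theorem HasAdjOn.of_same {n : ℕ} {M M' : ℤ → ℤ} {A : Finset (Fin n)}
    {G : Matrix (Fin n) (Fin n) ℤ} {S : List Reg}
    (h : HasAdjOn M A G) (h' : Same S M M') (hS : Reg.mat ∉ S ∧ Reg.det ∉ S) : HasAdjOn M' A G :=
  ⟨h.mat.of_eq (h' _ hS.1), by rw [h' _ hS.2, h.det]⟩

theorem det_deleteP {b n H : ℕ} {M : ℤ → ℤ} {A : Finset (Fin n)} {G : Matrix (Fin n) (Fin n) ℤ}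
    {p : Fin n} (hsize : rd M size 0 = n) (hdel : rd M del 0 = (p : ℕ)) (hA : HasAdjOn M A G)
    (hp : p ∈ A) (hG : IsPosDef G) (hH : ∀ A i j, (adjOn A G i j).natAbs ≤ H)
    (hHb : H < 2 ^ b) (hn : n * n < 2 ^ b) :
    Det b deleteP (n * n * 4 + n * 4 + 11) M fun M' =>
      Same [row, vec, det', col, mat, Reg.det] M M' ∧ HasAdjOn M' (A.erase p) G := by
  have hnb : n < 2 ^ b := lt_of_le_of_lt (Nat.le_mul_self n) hn
  have hb : ∀ A i j, (adjOn A G i j).natAbs < 2 ^ b := fun A i j => (hH A i j).trans_lt hHb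
  refine (det_seq (T := n * 4 + 3) (U := 1 + (n * n * 4 + 5) + 1) ?_).mono (by omega) fun _ h => h
  refine (det_map n (fun i => if hi : i < n then adjOn A G ⟨i, hi⟩ p else 0) (by simp) (by simp)
    (by simp) hnb (fun M' hM' => ?_) (fun j hj M' hM' hc _ => ?_) (fun j hj => ?_)).mono le_rfl ?_
  · rw [eval_vr, hM' size (by simp), hsize]
  · simp only [eval_ar, eval_add, eval_mul, eval_vr, hc, hM' size (by simp), hM' mat (by simp),
      hM' del (by simp), hsize, hdel, dif_pos hj]
    exact hA.mat ⟨j, hj⟩ p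
  · rw [dif_pos hj]; exact hb _ _ _
  · rintro M₁ ⟨h1, h2, -⟩
    have hpp : (ar mat (vr del * vr size + vr del)).eval M₁ = adjOn A G p p := by
      simp only [eval_ar, eval_add, eval_mul, eval_vr, h1 size (by simp), h1 mat (by simp),
        h1 del (by simp), hsize, hdel]
      exact hA.mat p p
    refine det_seq (T := 1) (U := n * n * 4 + 5) (det_sv (by simp) ?_ ?_)
    · rw [hpp]; exact hb _ _ _
    rw [hpp]
    have hS : Same [row, vec, det'] M (upd M₁ det' 0 (adjOn A G p p)) :=
      (h1.mono (by simp)).upd (by simp) _ _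
    have hA' := hA.of_same hS (by simp)
    have hdet : (restr (A.erase p) G).det = adjOn A G p p := det_restr_erase hp
    refine (det_updateP (X' := adjOn (A.erase p) G) (y := fun i => adjOn A G i p)
      (D' := adjOn A G p p) (by rw [hS size (by simp), hsize]) hA'.mat (fun i => ?_) hA'.det
      (by simp) (hG.restr A).det_pos.ne' (fun i j => ?_) hn (fun i j => hb _ _ _)
      (hb _ _ _)).mono le_rfl ?_
    · rw [rd_upd_of_ne (by simp), h2 i i.2, dif_pos i.2]
    · rw [det_mul_adjOn_erase hG hp, adjOn_symm hG A p j]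
    · rintro M₂ ⟨h3, h4, h5⟩
      exact ⟨hS.trans h3 (by simp) (by simp), h4, by rw [h5, hdet]⟩

/-- Delete all coordinates that have become `±1`. -/
def freezeP : Prog :=
  forP del (vr size) (.cond ((vr den - ar pos (vr del)) * (vr den + ar pos (vr del))) .skip
    (.cond (ar mat (vr del * vr size + vr del)) deleteP .skip))

theorem sub_mul_add_pos_iff {e z : ℤ} (h : |z| ≤ e) : 0 < (e - z) * (e + z) ↔ |z| < e := by
  have h1 : (e - z) * (e + z) = e ^ 2 - z ^ 2 := by ring
  have he : 0 ≤ e := (abs_nonneg z).trans h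
  rw [h1, sub_pos, sq_lt_sq, abs_of_nonneg he]

/-- The diagonal of the stored matrix is positive on `A` and zero elsewhere, so its sign tells which
indices are still present and the set `A` needs no record of its own. -/
theorem det_freezeP {b n H : ℕ} {M : ℤ → ℤ} {A : Finset (Fin n)} {G : Matrix (Fin n) (Fin n) ℤ}
    {z : Fin n → ℤ} {e : ℤ} (hsize : rd M size 0 = n) (hden : rd M den 0 = e)
    (hpos : HasVec pos M z) (hz : ∀ i, |z i| ≤ e) (hA : HasAdjOn M A G) (hzA : alive z e ⊆ A)
    (hG : IsPosDef G) (hH : ∀ A i j, (adjOn A G i j).natAbs ≤ H)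
    (hHb : H < 2 ^ b) (hn : n * n < 2 ^ b) :
    Det b freezeP (n * (n * n * 4 + n * 4 + 16) + 3) M fun M' =>
      Same [del, row, vec, det', col, mat, Reg.det] M M' ∧ HasAdjOn M' (alive z e) G := by
  have hnb : n < 2 ^ b := lt_of_le_of_lt (Nat.le_mul_self n) hn
  have hAn : A.filter (fun i => i ∈ alive z e ∨ n ≤ (i : ℕ)) = alive z e := by
    ext i
    have := i.2
    simp only [Finset.mem_filter, show ¬ n ≤ (i : ℕ) by omega, or_false]
    exact ⟨fun h => h.2, fun h => ⟨hzA h, h⟩⟩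
  refine det_for (T := n * n * 4 + n * 4 + 13) n (fun j M' => rd M' del 0 = j ∧
    Same [del, row, vec, det', col, mat, Reg.det] M M' ∧
    HasAdjOn M' (A.filter fun i => i ∈ alive z e ∨ j ≤ (i : ℕ)) G) (by simp) hnb ?_ ?_ ?_ ?_
  · rintro j - M' ⟨h1, h2, -⟩
    exact ⟨by rw [eval_vr, h2 size (by simp), hsize], h1⟩
  · have hS : Same [del] M (upd M del 0 0) := (Same.refl _ _).upd (by simp) _ _
    refine ⟨by simp, hS.mono (by simp), ?_⟩
    simpa using hA.of_same hS (by simp)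
  · rintro j hj M' ⟨h1, h2, h3⟩
    set i : Fin n := ⟨j, hj⟩ with hi
    have hev : ((vr den - ar pos (vr del)) * (vr den + ar pos (vr del))).eval M' =
        (e - z i) * (e + z i) := by
      simp only [eval_mul, eval_sub, eval_add, eval_ar, eval_vr, h1, h2 den (by simp),
        h2 pos (by simp), hden]
      rw [hpos i]
    have hmm : (ar mat (vr del * vr size + vr del)).eval M' =
        adjOn (A.filter fun i => i ∈ alive z e ∨ j ≤ (i : ℕ)) G i i := by
      simp only [eval_ar, eval_add, eval_mul, eval_vr, h1, h2 size (by simp), hsize]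
      exact h3.mat i i
    have key : ∀ M'', Same [del, row, vec, det', col, mat, Reg.det] M M'' →
        HasAdjOn M'' (A.filter fun k => k ∈ alive z e ∨ j + 1 ≤ (k : ℕ)) G →
        Same [del, row, vec, det', col, mat, Reg.det] M (upd M'' del 0 ((j : ℤ) + 1)) ∧
        HasAdjOn (upd M'' del 0 ((j : ℤ) + 1)) (A.filter fun k => k ∈ alive z e ∨ j + 1 ≤ (k : ℕ)) G :=
      fun M'' h h' => ⟨h.upd (by simp) _ _,
        h'.of_same (S := [del]) ((Same.refl _ _).upd (by simp) _ _) (by simp)⟩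
    refine det_cond (T := n * n * 4 + n * 4 + 12) (by simp)
      (fun h4 => (det_skip ?_).mono (by omega) fun _ h => h) fun h4 => ?_
    · rw [hev, sub_mul_add_pos_iff (hz i), ← mem_alive] at h4
      refine ⟨h1, by simp, key _ h2 ?_⟩
      convert h3 using 1
      ext k
      simp only [Finset.mem_filter, and_congr_right_iff]
      intro _
      constructor
      · exact Or.imp_right fun h => by omega
      · rintro (h | h)
        · exact Or.inl h
        · rcases Nat.eq_or_lt_of_le h with h | h
          · left
            rwa [show k = i from Fin.ext h.symm]
          · exact Or.inr h
    · rw [hev, ← not_lt, sub_mul_add_pos_iff (hz i), ← mem_alive] at h4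
      have hset : (A.filter fun k => k ∈ alive z e ∨ j + 1 ≤ (k : ℕ)) =
          (A.filter fun k => k ∈ alive z e ∨ j ≤ (k : ℕ)).erase i := by
        ext k
        simp only [Finset.mem_filter, Finset.mem_erase]
        constructor
        · rintro ⟨h5, h6⟩
          refine ⟨?_, h5, h6.imp_right fun h => by omega⟩
          rintro rfl
          rcases h6 with h6 | h6
          · exact h4 h6
          · simp [hi] at h6
        · rintro ⟨h5, h6, h7⟩
          refine ⟨h6, h7.imp_right fun h => ?_⟩
          have : (k : ℕ) ≠ j := fun h => h5 (Fin.ext h)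
          omega
      refine det_cond (T := n * n * 4 + n * 4 + 11) (by simp) (fun h5 => ?_)
        fun h5 => (det_skip ?_).mono (by omega) fun _ h => h
      · rw [hmm] at h5
        have hiA : i ∈ A.filter fun k => k ∈ alive z e ∨ j ≤ (k : ℕ) := by
          by_contra h6
          rw [adjOn, Matrix.of_apply, if_neg fun h => h6 h.1] at h5
          exact lt_irrefl _ h5
        refine (det_deleteP (p := i) (by rw [h2 size (by simp), hsize]) h1 h3 hiA hG hH hHb
          hn).mono le_rfl ?_
        rintro M'' ⟨h6, h7⟩
        refine ⟨by rw [h6 del (by simp), h1], by simp, key _ (h2.trans h6 (by simp) (by simp)) ?_⟩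
        rwa [hset]
      · rw [hmm] at h5
        refine ⟨h1, by simp, key _ h2 ?_⟩
        rw [hset, Finset.erase_eq_of_notMem]
        · exact h3
        · intro h6
          exact absurd (adjOn_diag_pos hG h6) (not_lt.2 h5)
  · rintro M' ⟨-, h2, h3⟩
    rw [hAn] at h3
    exact ⟨h2, h3⟩

/-! ### The choice of the pivot and the change of position -/

/-- Find the pivot, the last coordinate that is not `±1`, or `-1`. -/
def pivP : Prog :=
  .seq (sv piv (.lit (-1))) (forP cnt (vr size)
    (.cond ((vr den - ar pos (vr cnt)) * (vr den + ar pos (vr cnt))) (sv piv (vr cnt)) .skip))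

theorem det_pivP {b n : ℕ} {M : ℤ → ℤ} {z : Fin n → ℤ} {e : ℤ} (hsize : rd M size 0 = n)
    (hden : rd M den 0 = e) (hpos : HasVec pos M z) (hz : ∀ i, |z i| ≤ e) (hn : n < 2 ^ b)
    (hn1 : 1 ≤ n) :
    Det b pivP (n * 5 + 5) M fun M' => Same [piv, cnt] M M' ∧
      ((alive z e = ∅ ∧ rd M' piv 0 = -1) ∨
        ∃ p ∈ alive z e, (∀ i ∈ alive z e, i ≤ p) ∧ rd M' piv 0 = (p : ℕ)) := by
  refine (det_seq (T := 1) (U := n * (2 + 3) + 3)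
    (det_sv (by rw [weight_lit (by decide)]; norm_num) ?_ ?_)).mono (by omega) fun _ h => h
  · rw [eval_lit]
    exact lt_of_le_of_lt hn1 hn
  rw [eval_lit]
  refine det_for (T := 2) n (fun j M' => rd M' cnt 0 = j ∧ Same [piv, cnt] M M' ∧
    (((∀ i ∈ alive z e, j ≤ (i : ℕ)) ∧ rd M' piv 0 = -1) ∨
      ∃ p ∈ alive z e, (∀ i ∈ alive z e, (i : ℕ) < j → i ≤ p) ∧ rd M' piv 0 = (p : ℕ)))
    (by simp) hn ?_ ?_ ?_ ?_
  · rintro j - M' ⟨h1, h2, -⟩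
    exact ⟨by rw [eval_vr, h2 size (by simp), hsize], h1⟩
  · refine ⟨by simp, ((Same.refl _ _).upd (by simp) _ _).upd (by simp) _ _, Or.inl ?_⟩
    simp
  · rintro j hj M' ⟨h1, h2, h3⟩
    set i : Fin n := ⟨j, hj⟩ with hi
    have hev : ((vr den - ar pos (vr cnt)) * (vr den + ar pos (vr cnt))).eval M' =
        (e - z i) * (e + z i) := by
      simp only [eval_mul, eval_sub, eval_add, eval_ar, eval_vr, h1, h2 den (by simp),
        h2 pos (by simp), hden]
      rw [hpos i]
    refine det_cond (T := 1) (by simp) (fun h4 => det_sv (by simp) ?_ ?_) fun h4 => det_skip ?_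
    · rw [eval_vr, h1]; omega
    · rw [hev, sub_mul_add_pos_iff (hz i), ← mem_alive] at h4
      rw [eval_vr, h1]
      refine ⟨by simp [h1], by simp, (h2.upd (by simp) _ _).upd (by simp) _ _, Or.inr ⟨i, h4, ?_⟩⟩
      refine ⟨fun k _ hk => Fin.le_def.2 (by simp only [hi]; omega), by simp [hi]⟩
    · rw [hev, ← not_lt, sub_mul_add_pos_iff (hz i), ← mem_alive] at h4
      have hne : ∀ k ∈ alive z e, (k : ℕ) ≠ j := fun k hk h => h4 (by
        rwa [show i = k from Fin.ext h.symm])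
      refine ⟨h1, by simp, h2.upd (by simp) _ _, ?_⟩
      rw [rd_upd_of_ne (by simp)]
      refine h3.imp ?_ ?_
      · rintro ⟨h5, h6⟩
        exact ⟨fun k hk => by have := h5 k hk; have := hne k hk; omega, h6⟩
      · rintro ⟨p, hp, h5, h6⟩
        exact ⟨p, hp, fun k hk hkj => h5 k hk (by have := hne k hk; omega), h6⟩
  · rintro M' ⟨-, h2, h3⟩
    refine ⟨h2, h3.imp ?_ ?_⟩
    · rintro ⟨h5, h6⟩
      refine ⟨Finset.eq_empty_of_forall_notMem fun i hi => ?_, h6⟩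
      have := h5 i hi
      omega
    · rintro ⟨p, hp, h5, h6⟩
      exact ⟨p, hp, fun i hi => h5 i hi i.2, h6⟩

/-- Move by `num / quo` in the direction `σ`. -/
def moveP (σ : ℤ) (num quo : Reg) : Prog :=
  .seq (forP cnt (vr size) (st pos (vr cnt) (ar pos (vr cnt) * vr quo +
    .lit σ * (vr num * ar dir (vr cnt))))) (sv den (vr den * vr quo))

theorem det_moveP {b n : ℕ} {σ e N q : ℤ} {num quo : Reg} {M : ℤ → ℤ} {z u : Fin n → ℤ}
    (hσ : σ = 1 ∨ σ = -1) (hnum : num ∉ [cnt, pos]) (hquo : quo ∉ [cnt, pos])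
    (hsize : rd M size 0 = n) (hden : rd M den 0 = e)
    (hpos : HasVec pos M z) (hdir : HasVec dir M u) (hN : rd M num 0 = N) (hq : rd M quo 0 = q)
    (hz : ∀ i, |z i * q + σ * (N * u i)| ≤ e * q) (hnb : n < 2 ^ b) (he : (e * q).natAbs < 2 ^ b) :
    Det b (moveP σ num quo) (n * 4 + 5) M fun M' => Same [cnt, pos, den] M M' ∧
      HasVec pos M' (fun i => z i * q + σ * (N * u i)) ∧ rd M' den 0 = e * q := by
  have hw : (Expr.lit σ).weight = 7 := weight_lit (by rcases hσ with rfl | rfl <;> decide)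
  refine (det_seq (T := n * 4 + 3) (U := 1) ?_).mono (by omega) fun _ h => h
  refine (det_map n (fun i => if hi : i < n then z ⟨i, hi⟩ * q + σ * (N * u ⟨i, hi⟩) else 0)
    (by simp) (by simp) (by simp [hw]) hnb (fun M' hM' => ?_) (fun j hj M' hM' hc hold => ?_)
    (fun j hj => ?_)).mono le_rfl ?_
  · rw [eval_vr, hM' size (by simp), hsize]
  · simp only [eval_ar, eval_add, eval_mul, eval_lit, eval_vr, hc, hM' num hnum, hM' quo hquo,
      hM' dir (by simp), hN, hq, dif_pos hj]
    rw [hold j le_rfl, hpos ⟨j, hj⟩, hdir ⟨j, hj⟩]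
  · rw [dif_pos hj]
    have := hz ⟨j, hj⟩
    have h0 := abs_le.1 this
    omega
  · rintro M' ⟨h1, h2, -⟩
    have hv : (vr den * vr quo).eval M' = e * q := by
      rw [eval_mul, eval_vr, eval_vr, h1 den (by simp), h1 quo hquo, hden, hq]
    refine det_sv (by simp) (by rw [hv]; exact he) ?_
    rw [hv]
    refine ⟨(h1.mono (by simp)).upd (by simp) _ _, fun i => ?_, by simp⟩
    rw [rd_upd_of_ne (by simp), h2 i i.2, dif_pos i.2]

end RAM

/-! ## One step of the walk -/

namespace RAM

open Reg IntMatrix Matrix GSWalk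
open scoped InnerProductSpace

/-- The state of the walk: the position is `z / e`, and the matrix is the adjugate of `G`,
restricted to the coordinates that are not `±1`. -/
structure WalkAt {n : ℕ} (M : ℤ → ℤ) (G : Matrix (Fin n) (Fin n) ℤ) (z : Fin n → ℤ) (e : ℤ) :
    Prop where
  size : rd M size 0 = n
  den : rd M den 0 = e
  pos : HasVec pos M z
  e_pos : 0 < e
  le : ∀ i, |z i| ≤ e
  adj : HasAdjOn M (alive z e) G

/-- Compute the direction of the step, and the lengths of the two possible steps. -/
def prepP : Prog :=
  .seq (forP cnt (vr size) (st dir (vr cnt) (ar mat (vr cnt * vr size + vr piv))))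
    (.seq (scanP 1 num₁ quo₁) (scanP (-1) num₂ quo₂))

theorem det_prepP {b n H : ℕ} {M : ℤ → ℤ} {G : Matrix (Fin n) (Fin n) ℤ} {z : Fin n → ℤ} {e : ℤ}
    {p : Fin n} (h : WalkAt M G z e) (hp : p ∈ alive z e) (hpiv : rd M piv 0 = (p : ℕ))
    (hG : IsPosDef G) (hH : ∀ A i j, (adjOn A G i j).natAbs ≤ H) (hHb : H < 2 ^ b)
    (hn : n < 2 ^ b) (he : (2 * e).natAbs < 2 ^ b) :
    Det b prepP (n * 36 + 19) M fun M' =>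
      Same [dir, num₁, quo₁, num₂, quo₂, cnt, val, acc] M M' ∧
      HasVec dir M' (fun i => adjOn (alive z e) G i p) ∧
      Least 1 e z (fun i => adjOn (alive z e) G i p) n (rd M' num₁ 0) (rd M' quo₁ 0) ∧
      Least (-1) e z (fun i => adjOn (alive z e) G i p) n (rd M' num₂ 0) (rd M' quo₂ 0) := by
  set u : Fin n → ℤ := fun i => adjOn (alive z e) G i p with hu
  have hub : ∀ i, (u i).natAbs < 2 ^ b := fun i => (hH _ _ _).trans_lt hHb
  have hup : 0 < u p := adjOn_diag_pos hG hp
  refine (det_seq (T := n * 4 + 3) (U := n * 16 + 7 + (n * 16 + 7) + 1) ?_).mono (by omega)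
    fun _ h => h
  refine (det_map n (fun i => if hi : i < n then u ⟨i, hi⟩ else 0) (by simp) (by simp)
    (by simp) hn (fun M' hM' => ?_) (fun j hj M' hM' hc _ => ?_) (fun j hj => ?_)).mono le_rfl ?_
  · rw [eval_vr, hM' size (by simp), h.size]
  · simp only [eval_ar, eval_add, eval_mul, eval_vr, hc, hM' size (by simp), hM' mat (by simp),
      hM' piv (by simp), h.size, hpiv, dif_pos hj]
    exact h.adj.mat ⟨j, hj⟩ p
  · rw [dif_pos hj]; exact hub _
  rintro M₁ ⟨h1, h2, -⟩
  have hdir : HasVec dir M₁ u := fun i => by rw [h2 i i.2, dif_pos i.2]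
  refine det_seq (T := n * 16 + 7) (U := n * 16 + 7) ?_
  refine (det_scanP (p := p) (Or.inl rfl) (by simp) (by simp) (by simp)
    (by rw [h1 size (by simp), h.size]) (by rw [h1 den (by simp), h.den])
    (by rw [h1 piv (by simp), hpiv]) (h.pos.of_eq (h1 pos (by simp))) hdir h.le hup hn he
    hub).mono le_rfl ?_
  rintro M₂ ⟨h3, h4⟩
  have hS : Same [dir, num₁, quo₁, cnt, val, acc] M M₂ := h1.trans h3 (by simp) (by simp)
  refine (det_scanP (p := p) (Or.inr rfl) (by simp) (by simp) (by simp)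
    (by rw [hS size (by simp), h.size]) (by rw [hS den (by simp), h.den])
    (by rw [hS piv (by simp), hpiv]) (h.pos.of_eq (hS pos (by simp)))
    (hdir.of_eq (h3 dir (by simp))) h.le hup hn he hub).mono le_rfl ?_
  rintro M₃ ⟨h5, h6⟩
  refine ⟨hS.trans h5 (by simp) (by simp),
    hdir.of_eq ((h5 dir (by simp)).trans (h3 dir (by simp))), ?_, h6⟩
  rw [h5 num₁ (by simp), h5 quo₁ (by simp)]
  exact h4

/-- Make the move that is determined by the random number. -/
def jumpP : Prog :=
  .seq (.cond (vr num₂ * vr quo₁ * vr modu - vr rnd * totE) (moveP 1 num₁ quo₁)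
    (moveP (-1) num₂ quo₂)) freezeP

/-- The registers that are used in a step of the walk. -/
abbrev walkRegs : List Reg :=
  [piv, dir, num₁, quo₁, num₂, quo₂, cnt, val, acc, modu, rnd, flag, pos, den, del, row, vec, det',
    col, mat, Reg.det]

/-- A step of the walk. -/
def stepP : Prog :=
  .seq pivP (.cond (vr piv + .lit 1) (.seq prepP (.seq drawP jumpP)) .skip)

/-- The potential, as a function of the memory. -/
noncomputable def memPot {E : Type*} [NormedAddCommGroup E] [InnerProductSpace ℝ E] {n : ℕ}
    (v : Fin n → E) (θ : E) (M : ℤ → ℤ) : ℝ :=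
  walkPot v θ (fun i => rd M pos (i : ℕ)) (rd M den 0)

theorem memPot_eq {E : Type*} [NormedAddCommGroup E] [InnerProductSpace ℝ E] {n : ℕ}
    {v : Fin n → E} {θ : E} {M : ℤ → ℤ} {z : Fin n → ℤ} {e : ℤ} (hz : HasVec pos M z)
    (he : rd M den 0 = e) : memPot v θ M = walkPot v θ z e := by
  unfold memPot
  rw [he, show (fun i : Fin n => rd M pos (i : ℕ)) = z from funext hz]

theorem det_jumpP {b n H : ℕ} {M : ℤ → ℤ} {G : Matrix (Fin n) (Fin n) ℤ} {z u : Fin n → ℤ} {e : ℤ}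
    {P₁ q₁ P₂ q₂ r m : ℕ} (h : WalkAt M G z e) (hdir : HasVec dir M u)
    (hu : ∀ i, i ∉ alive z e → u i = 0)
    (h₁ : Least 1 e z u n P₁ q₁) (h₂ : Least (-1) e z u n P₂ q₂)
    (hP₁ : rd M num₁ 0 = P₁) (hq₁ : rd M quo₁ 0 = q₁) (hP₂ : rd M num₂ 0 = P₂)
    (hq₂ : rd M quo₂ 0 = q₂) (hr : rd M rnd 0 = r) (hm : rd M modu 0 = m)
    (hG : IsPosDef G) (hH : ∀ A i j, (adjOn A G i j).natAbs ≤ H) (hHb : H < 2 ^ b)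
    (hn : n * n < 2 ^ b) (hb₁ : (e * q₁).natAbs < 2 ^ b) (hb₂ : (e * q₂).natAbs < 2 ^ b) :
    Det b jumpP (n * (n * n * 4 + n * 4 + 20) + 10) M fun M' =>
      Same walkRegs M M' ∧ ∃ z' e', WalkAt M' G z' e' ∧
        if r * (P₂ * q₁ + P₁ * q₂) < P₂ * q₁ * m then
          z' = (fun i => z i * q₁ + 1 * (P₁ * u i)) ∧ e' = e * q₁
        else z' = (fun i => z i * q₂ + -1 * (P₂ * u i)) ∧ e' = e * q₂ := by
  have hnb : n < 2 ^ b := lt_of_le_of_lt (Nat.le_mul_self n) hn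
  refine (det_seq (T := n * 4 + 6) (U := n * (n * n * 4 + n * 4 + 16) + 3)
    (Det.mono (Q := fun M' => Same [cnt, pos, den] M M' ∧
    (∃ z' e', (0 < e' ∧ (∀ i, |z' i| ≤ e') ∧ alive z' e' ⊆ alive z e ∧ HasVec pos M' z' ∧
      rd M' den 0 = e') ∧
    if r * (P₂ * q₁ + P₁ * q₂) < P₂ * q₁ * m then
      z' = (fun i => z i * q₁ + 1 * (P₁ * u i)) ∧ e' = e * q₁
    else z' = (fun i => z i * q₂ + -1 * (P₂ * u i)) ∧ e' = e * q₂)) ?_ le_rfl ?_)).mono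
    (Nat.le_of_eq (by ring)) fun _ h => h
  · have hev : 0 < (vr num₂ * vr quo₁ * vr modu - vr rnd * totE).eval M ↔
        r * (P₂ * q₁ + P₁ * q₂) < P₂ * q₁ * m := by
      simp only [totE, eval_sub, eval_mul, eval_add, eval_vr, hP₁, hq₁, hP₂, hq₂, hr, hm, sub_pos]
      exact_mod_cast Iff.rfl
    obtain ⟨-, hle₁, hA₁⟩ := h₁.move (Or.inl rfl) h.le hu
    obtain ⟨-, hle₂, hA₂⟩ := h₂.move (Or.inr rfl) h.le hu
    refine det_cond (T := n * 4 + 5) (by simp [totE]) (fun h3 => ?_) fun h3 => ?_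
    · rw [hev] at h3
      refine (det_moveP (Or.inl rfl) (by simp) (by simp) h.size h.den h.pos hdir hP₁ hq₁ hle₁ hnb
        hb₁).mono le_rfl ?_
      rintro M' ⟨h4, h5, h6⟩
      refine ⟨h4, _, _, ⟨mul_pos h.e_pos h₁.quo_pos, hle₁, hA₁.subset, h5, h6⟩, ?_⟩
      rw [if_pos h3]; exact ⟨rfl, rfl⟩
    · rw [← not_lt, hev] at h3
      refine (det_moveP (Or.inr rfl) (by simp) (by simp) h.size h.den h.pos hdir hP₂ hq₂ hle₂ hnb
        hb₂).mono le_rfl ?_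
      rintro M' ⟨h4, h5, h6⟩
      refine ⟨h4, _, _, ⟨mul_pos h.e_pos h₂.quo_pos, hle₂, hA₂.subset, h5, h6⟩, ?_⟩
      rw [if_neg h3]; exact ⟨rfl, rfl⟩
  · rintro M₁ ⟨h1, z', e', ⟨he', hle, hsub, hpos, hden⟩, h2⟩
    have hsize : rd M₁ size 0 = n := by rw [h1 size (by simp), h.size]
    refine (det_freezeP hsize hden hpos hle (h.adj.of_same h1 (by simp)) hsub hG hH hHb
      hn).mono le_rfl ?_
    rintro M₂ ⟨h3, h4⟩
    refine ⟨h1.trans h3 (by simp) (by simp), z', e', ⟨?_, ?_, ?_, he', hle, h4⟩, h2⟩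
    · rw [h3 size (by simp), hsize]
    · rw [h3 den (by simp), hden]
    · exact hpos.of_eq (h3 pos (by simp))

variable {E : Type} [NormedAddCommGroup E] [InnerProductSpace ℝ E]

/-- A bound for the running time of a step. -/
def stepTime (b n : ℕ) : ℕ := n * (n * n * 4 + n * 4 + 61) + b * 6 + 50

/-- The denominator is multiplied by an entry of the adjugate, at most `H`, and at least one
coordinate freezes. The sum of products that governs the choice is at most `4 * Em * H`; `hb` makes
room for twice its `n`-fold. -/
theorem rnd_stepP {b n H Em : ℕ} {M : ℤ → ℤ} {G : Matrix (Fin n) (Fin n) ℤ} {z : Fin n → ℤ} {e : ℤ}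
    {v : Fin n → E} {κ : ℝ} (h : WalkAt M G z e) (hn1 : 1 ≤ n) (hG : IsPosDef G)
    (hgram : ∀ i j, ⟪v i, v j⟫_ℝ = κ * G i j) (hv : LinearIndependent ℝ v)
    (hv1 : ∀ i, ‖v i‖ ≤ 1)
    (hH : ∀ A i j, (adjOn A G i j).natAbs ≤ H) (hH1 : 1 ≤ H) (hE : e ≤ Em)
    (hb : 8 * (n + 1) * (Em * H) < 2 ^ b) (hn : n * n < 2 ^ b) :
    Rnd b stepP (stepTime b n) M (fun M' => Same walkRegs M M' ∧ ∃ z' e', WalkAt M' G z' e' ∧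
      e' ≤ (Em * H : ℕ) ∧ (alive z' e').card ≤ (alive z e).card - 1)
      (fun θ M' => memPot v θ M') fun θ => (1 + 1 / n) * memPot v θ M := by
  have hnb : n < 2 ^ b := lt_of_le_of_lt (Nat.le_mul_self n) hn
  have he0 := h.e_pos
  have hEm1 : 1 ≤ Em := by omega
  have hEH : Em ≤ Em * H := Nat.le_mul_of_pos_right _ hH1
  have hHE : H ≤ Em * H := Nat.le_mul_of_pos_left _ hEm1
  have h16 : 16 * (Em * H) ≤ 8 * (n + 1) * (Em * H) := Nat.mul_le_mul_right _ (by omega)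
  have hpot0 : ∀ θ, 0 ≤ walkPot v θ z e := fun θ => walkPot_nonneg h.e_pos h.le
  have hn0 : (0 : ℝ) < n := by exact_mod_cast hn1
  refine (Rnd.seq (T := n * 5 + 5) (U := n * 36 + 19 + (b * 6 + 5 +
    (n * (n * n * 4 + n * 4 + 20) + 10) + 1) + 1 + 1)
    (Q := fun M' => Same [piv, cnt] M M' ∧ ((alive z e = ∅ ∧ rd M' piv 0 = -1) ∨
        ∃ p ∈ alive z e, (∀ i ∈ alive z e, i ≤ p) ∧ rd M' piv 0 = (p : ℕ)))
    (Φ := fun θ _ => (1 + 1 / n) * memPot v θ M)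
    (.of_det ((det_pivP h.size h.den h.pos h.le hnb hn1).mono le_rfl
      fun M' h => ⟨h, fun _ => le_rfl⟩)) ?_).of_le (by unfold stepTime; nlinarith) fun _ => le_rfl
  rintro M₁ ⟨h1, h2⟩
  have hW : WalkAt M₁ G z e := ⟨by rw [h1 size (by simp), h.size], by rw [h1 den (by simp), h.den],
    h.pos.of_eq (h1 pos (by simp)), h.e_pos, h.le, h.adj.of_same h1 (by simp)⟩
  rw [show (fun θ => (1 + 1 / (n : ℝ)) * memPot v θ M) =
    fun θ => (1 + 1 / (n : ℝ)) * walkPot v θ z e from funext fun θ => by rw [memPot_eq h.pos h.den]]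
  refine Rnd.cond (by simp) (fun h3 => ?_) fun h3 => ?_
  swap
  · refine (Rnd.of_det (T := 1) (det_skip ⟨⟨h1.mono (by simp), z, e, hW, by omega, ?_⟩, fun θ => ?_⟩)).of_le
      (by omega) fun _ => le_rfl
    · rw [memPot_eq hW.pos hW.den]
      have := hpot0 θ
      have h4 : 0 ≤ 1 / (n : ℝ) := by positivity
      nlinarith
    · rcases h2 with ⟨h4, -⟩ | ⟨p, -, -, h4⟩
      · rw [h4]; simp
      · simp only [eval_add, eval_vr, eval_lit, h4] at h3
        omega
  · obtain ⟨p, hp, hmax, hpiv⟩ : ∃ p ∈ alive z e, (∀ i ∈ alive z e, i ≤ p) ∧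
        rd M₁ piv 0 = (p : ℕ) := by
      rcases h2 with ⟨-, h4⟩ | h4
      · simp [h4] at h3
      · exact h4
    refine Rnd.seq (T := n * 36 + 19)
      (Φ := fun θ _ => (1 + 1 / n) * walkPot v θ z e) (.of_det ((det_prepP hW hp hpiv hG hH
      (by omega) hnb (by omega)).mono le_rfl fun M' h => ⟨h, fun _ => le_rfl⟩)) ?_
    rintro M₂ ⟨h4, hdir, h5, h6⟩
    set u : Fin n → ℤ := fun i => adjOn (alive z e) G i p with hu
    have hu0 : ∀ i, i ∉ alive z e → u i = 0 := fun i hi => by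
      simp [hu, adjOn, hi]
    have hW₂ : WalkAt M₂ G z e := ⟨by rw [h4 size (by simp), hW.size],
      by rw [h4 den (by simp), hW.den], h.pos.of_eq ((h4 pos (by simp)).trans (h1 pos (by simp))),
      h.e_pos, h.le, hW.adj.of_same h4 (by simp)⟩
    obtain ⟨hP₁0, hle₁, hA₁⟩ := h5.move (Or.inl rfl) h.le hu0
    obtain ⟨hP₂0, hle₂, hA₂⟩ := h6.move (Or.inr rfl) h.le hu0
    have hbnd : ∀ σ num quo : ℤ, (σ = 1 ∨ σ = -1) → Least σ e z u n num quo →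
        num ≤ 2 * e ∧ quo ≤ H := by
      rintro σ num quo hσ ⟨⟨i, -, rfl, rfl⟩, -⟩
      refine ⟨(gap_nonneg hσ h.le i).2, ?_⟩
      have := hH (alive z e) i p
      have h7 : |u i| = ((u i).natAbs : ℤ) := (Int.natCast_natAbs _).symm
      rw [h7]
      exact_mod_cast this
    obtain ⟨hP₁b, hq₁b⟩ := hbnd _ _ _ (Or.inl rfl) h5
    obtain ⟨hP₂b, hq₂b⟩ := hbnd _ _ _ (Or.inr rfl) h6
    have hq₁0 := h5.quo_pos
    have hq₂0 := h6.quo_pos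
    obtain ⟨P₁, hP₁⟩ := Int.eq_ofNat_of_zero_le hP₁0.le
    obtain ⟨P₂, hP₂⟩ := Int.eq_ofNat_of_zero_le hP₂0.le
    obtain ⟨q₁, hq₁⟩ := Int.eq_ofNat_of_zero_le hq₁0.le
    obtain ⟨q₂, hq₂⟩ := Int.eq_ofNat_of_zero_le hq₂0.le
    rw [hP₁] at h5 hP₁0 hle₁ hA₁ hP₁b
    rw [hP₂] at h6 hP₂0 hle₂ hA₂ hP₂b
    rw [hq₁] at h5 hq₁0 hle₁ hA₁ hq₁b
    rw [hq₂] at h6 hq₂0 hle₂ hA₂ hq₂b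
    set z₁ : Fin n → ℤ := fun i => z i * q₁ + 1 * (P₁ * u i) with hz₁
    set z₂ : Fin n → ℤ := fun i => z i * q₂ + -1 * (P₂ * u i) with hz₂
    have hP₁E : P₁ ≤ 2 * Em := by omega
    have hP₂E : P₂ ≤ 2 * Em := by omega
    have hq₁H : q₁ ≤ H := by exact_mod_cast hq₁b
    have hq₂H : q₂ ≤ H := by exact_mod_cast hq₂b
    have hP₁1 : 0 < P₁ := by exact_mod_cast hP₁0
    have hP₂1 : 0 < P₂ := by exact_mod_cast hP₂0
    have hq₁1 : 0 < q₁ := by exact_mod_cast hq₁0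
    have hq₂1 : 0 < q₂ := by exact_mod_cast hq₂0
    have ht : P₂ * q₁ + P₁ * q₂ ≤ 4 * (Em * H) := by
      have := Nat.mul_le_mul hP₁E hq₂H
      have := Nat.mul_le_mul hP₂E hq₁H
      nlinarith
    have heq : ∀ q : ℕ, q ≤ H → e * q ≤ (Em * H : ℕ) := fun q hq => by
      push_cast
      exact mul_le_mul hE (by exact_mod_cast hq) (by positivity) (by positivity)
    obtain ⟨K, hK⟩ : ∃ K, K = Nat.clog 2 (n * (P₂ * q₁ + P₁ * q₂)) := ⟨_, rfl⟩
    have hKle : n * (P₂ * q₁ + P₁ * q₂) ≤ 2 ^ K := by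
      rw [hK]; exact Nat.le_pow_clog (by norm_num) _
    refine Rnd.seq (T := b * 6 + 5) (Φ := fun θ M' => (fun θ r =>
      if r * (P₂ * q₁ + P₁ * q₂) < P₂ * q₁ * 2 ^ K
      then walkPot v θ z₁ (e * q₁) else walkPot v θ z₂ (e * q₂)) θ (rd M' rnd 0).toNat)
      ((rnd_drawP (fun θ r => if r * (P₂ * q₁ + P₁ * q₂) < P₂ * q₁ * 2 ^ K
      then walkPot v θ z₁ (e * q₁) else walkPot v θ z₂ (e * q₂)) hW₂.size (t := P₂ * q₁ + P₁ * q₂) ?_ hK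
      ?_).of_le le_rfl fun θ => ?_) ?_
    · simp only [totE, eval_add, eval_mul, eval_vr, hP₁, hP₂, hq₁, hq₂]
      push_cast; rfl
    · have h7 : n * (P₂ * q₁ + P₁ * q₂) ≤ n * (4 * (Em * H)) := Nat.mul_le_mul_left _ ht
      have h8 : 1 ≤ Em * H := hEm1.trans hEH
      nlinarith
    · exact walk_step hG hgram hv hv1 h.e_pos hp hmax hP₁1 hq₁1 hP₂1 hq₂1
        (fun i => by simp only [hz₁, hu]; ring) (fun i => by simp only [hz₂, hu]; ring) hle₁ hle₂
        hA₁.subset hA₂.subset (by omega) hKle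
    · rintro M₃ ⟨h7, hmodu, r, hr, hrnd⟩
      have hW₃ : WalkAt M₃ G z e := ⟨by rw [h7 size (by simp), hW₂.size],
        by rw [h7 den (by simp), hW₂.den], hW₂.pos.of_eq (h7 pos (by simp)),
        h.e_pos, h.le, hW₂.adj.of_same h7 (by simp)⟩
      refine .of_det ((det_jumpP hW₃ (hdir.of_eq (h7 dir (by simp))) hu0 h5 h6
        (by rw [h7 num₁ (by simp), hP₁]) (by rw [h7 quo₁ (by simp), hq₁])
        (by rw [h7 num₂ (by simp), hP₂]) (by rw [h7 quo₂ (by simp), hq₂]) hrnd hmodu hG hH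
        (by omega) hn (by have := heq q₁ hq₁H; have := mul_pos he0 hq₁0; omega)
        (by have := heq q₂ hq₂H; have := mul_pos he0 hq₂0; omega)).mono le_rfl ?_)
      rintro M₄ ⟨h8, z', e', h9, h10⟩
      have hS : Same walkRegs M M₄ :=
        ((h1.trans h4 (S'' := walkRegs) (by simp) (by simp)).trans h7 (S'' := walkRegs) (by simp)
          (by simp)).trans h8 (by simp) (by simp)
      have hpot : ∀ θ, memPot v θ M₄ = walkPot v θ z' e' := fun θ => memPot_eq h9.pos h9.den
      have hA₁' := Finset.card_lt_card hA₁
      have hA₂' := Finset.card_lt_card hA₂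
      simp only [hrnd, Int.toNat_natCast, hpot]
      split_ifs at h10 with h11
      · obtain ⟨rfl, rfl⟩ := h10
        refine ⟨⟨hS, _, _, h9, heq _ hq₁H, Nat.le_sub_one_of_lt hA₁'⟩, fun θ => ?_⟩
        rw [if_pos h11]
      · obtain ⟨rfl, rfl⟩ := h10
        refine ⟨⟨hS, _, _, h9, heq _ hq₂H, Nat.le_sub_one_of_lt hA₂'⟩, fun θ => ?_⟩
        rw [if_neg h11]

end RAM

/-! ## The main program -/

namespace RAM

open Reg IntMatrix Matrix GSWalk
open scoped InnerProductSpace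

theorem Rnd.const_mul {b : ℕ} {p : Prog} {T : ℕ} {M : ℤ → ℤ} {Q : (ℤ → ℤ) → Prop} {Θ : Type}
    {Φ : Θ → (ℤ → ℤ) → ℝ} {v : Θ → ℝ} (h : Rnd b p T M Q Φ v) {c : ℝ} (hc : 0 ≤ c) :
    Rnd b p T M Q (fun θ M' => Φ θ M' * c) fun θ => v θ * c := by
  intro hM
  obtain ⟨τ, h1, h2, h3⟩ := h hM
  refine ⟨τ, h1, fun θ => ?_, h3⟩
  rw [Rand.ev_mul_const]
  exact mul_le_mul_of_nonneg_right (h2 θ) hc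

theorem WalkAt.of_same {n : ℕ} {M M' : ℤ → ℤ} {G : Matrix (Fin n) (Fin n) ℤ} {z : Fin n → ℤ}
    {e : ℤ} {S : List Reg} (h : WalkAt M G z e) (h' : Same S M M')
    (hS : Reg.size ∉ S ∧ Reg.den ∉ S ∧ Reg.pos ∉ S ∧ Reg.mat ∉ S ∧ Reg.det ∉ S) :
    WalkAt M' G z e :=
  ⟨by rw [h' _ hS.1, h.size], by rw [h' _ hS.2.1, h.den], h.pos.of_eq (h' _ hS.2.2.1), h.e_pos,
    h.le, h.adj.of_same h' hS.2.2.2⟩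

/-- The walk. -/
def walkP : Prog := forP lvl (vr size) stepP

variable {E : Type} [NormedAddCommGroup E] [InnerProductSpace ℝ E]

/-- Multiplying the potential by the factors `1 + 1 / n` of the steps still to come yields a
supermartingale. After `j` steps at most `n - j` coordinates are alive, so `n` steps suffice;
surplus steps do nothing. -/
theorem rnd_walkP {b n H : ℕ} {M : ℤ → ℤ} {G : Matrix (Fin n) (Fin n) ℤ}
    {v : Fin n → E} {κ : ℝ} (h : WalkAt M G 0 1) (hn1 : 1 ≤ n) (hG : IsPosDef G)
    (hgram : ∀ i j, ⟪v i, v j⟫_ℝ = κ * G i j) (hv : LinearIndependent ℝ v)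
    (hv1 : ∀ i, ‖v i‖ ≤ 1)
    (hH : ∀ A i j, (adjOn A G i j).natAbs ≤ H) (hH1 : 1 ≤ H)
    (hb : 8 * (n + 1) * H ^ n < 2 ^ b) (hn : n * n < 2 ^ b) :
    Rnd b walkP (n * (stepTime b n + 3) + 3) M
      (fun M' => ∃ z e, WalkAt M' G z e ∧ alive z e = ∅) (fun θ M' => memPot v θ M')
      fun θ => (1 + 1 / n) ^ n * memPot v θ M := by
  have hnb : n < 2 ^ b := lt_of_le_of_lt (Nat.le_mul_self n) hn
  have hn0 : (0 : ℝ) < n := by exact_mod_cast hn1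
  have hpot : ∀ {M M' : ℤ → ℤ}, Same [lvl] M M' → ∀ θ, memPot v θ M' = memPot v θ M :=
    fun h θ => by unfold memPot; rw [h pos (by simp), h den (by simp)]
  have hlvl : ∀ (M : ℤ → ℤ) x, Same [lvl] M (upd M lvl 0 x) := fun M x =>
    (Same.refl _ _).upd (by simp) _ _
  refine (rnd_for (T := stepTime b n) n (fun j M' => rd M' lvl 0 = j ∧ ∃ z e, WalkAt M' G z e ∧
    e ≤ (H ^ j : ℕ) ∧ (alive z e).card ≤ n - j)
    (fun j (θ : E) M' => memPot v θ M' * (1 + 1 / n) ^ (n - j)) (by simp) hnb ?_ ?_ ?_).mono le_rfl id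
    ?_ fun θ => ?_
  · rintro j - M' ⟨h1, z, e, h2, -⟩
    exact ⟨by rw [eval_vr, h2.size], h1⟩
  · refine ⟨by simp, 0, 1, h.of_same (hlvl _ _) (by simp), by simp, ?_⟩
    simpa using Finset.card_le_univ (alive (0 : Fin n → ℤ) 1)
  · rintro j hj M' ⟨h1, z, e, h2, h3, h4⟩
    refine ((rnd_stepP h2 hn1 hG hgram hv hv1 hH hH1 h3 ?_ hn).const_mul
      (c := (1 + 1 / (n : ℝ)) ^ (n - (j + 1))) (by positivity)).mono le_rfl id ?_ fun θ => ?_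
    · refine lt_of_le_of_lt (Nat.mul_le_mul_left _ ?_) hb
      rw [← pow_succ]
      exact Nat.pow_le_pow_right hH1 hj
    · rintro M'' ⟨h5, z', e', h6, h7, h8⟩
      refine ⟨⟨by rw [h5 lvl (by simp), h1], by simp, z', e', h6.of_same (hlvl _ _) (by simp),
        by rwa [pow_succ], by omega⟩, fun θ => ?_⟩
      rw [hpot (hlvl _ _)]; rfl
    · rw [show n - j = n - (j + 1) + 1 by omega, pow_succ]
      simp only [id]
      exact le_of_eq (by ring)
  · rintro M' ⟨-, z, e, h1, -, h2⟩
    refine ⟨⟨z, e, h1, Finset.card_eq_zero.1 (by omega)⟩, fun θ => ?_⟩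
    simp
  · rw [hpot (hlvl _ _), id, mul_comm]
    simp

/-- Write the output. -/
def outP : Prog := forP cnt (vr size) (.store (vr cnt) (ar pos (vr cnt) / vr den))

theorem det_outP {b n : ℕ} {M : ℤ → ℤ} {G : Matrix (Fin n) (Fin n) ℤ} {z : Fin n → ℤ} {e : ℤ}
    (h : WalkAt M G z e) (hA : alive z e = ∅) (hn : n < 2 ^ b) :
    Det b outP (n * 4 + 3) M fun M' => (∀ i : Fin n, M' (i : ℕ) = 1 ∨ M' (i : ℕ) = -1) ∧
      ∀ i : Fin n, z i = M' (i : ℕ) * e := by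
  have he := h.e_pos
  have hz : ∀ i, z i = e ∨ z i = -e := fun i => by
    have h1 : i ∉ alive z e := by rw [hA]; simp
    rw [mem_alive, not_lt] at h1
    rcases abs_choice (z i) with h2 | h2 <;> have := h.le i <;> omega
  have hq : ∀ i, z i / e = 1 ∧ z i = 1 * e ∨ z i / e = -1 ∧ z i = -1 * e := fun i => by
    rcases hz i with h1 | h1 <;> rw [h1]
    · left; exact ⟨Int.ediv_self he.ne', by ring⟩
    · right; exact ⟨by rw [Int.neg_ediv_self _ he.ne'], by ring⟩
  -- Only entries of nonnegative index are claimed to survive: an entry of negative index may share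
  -- its address with an output cell.
  refine det_for (T := 1) n (fun j M' => rd M' cnt 0 = j ∧
    (∀ k, k ≠ cnt → ∀ i : ℤ, 0 ≤ i → rd M' k i = rd M k i) ∧
    ∀ i : Fin n, (i : ℕ) < j → M' (i : ℕ) = z i / e) (by simp) hn ?_ ?_ ?_ ?_
  · rintro j - M' ⟨h1, h2, -⟩
    exact ⟨by rw [eval_vr, h2 size (by simp) 0 le_rfl, h.size], h1⟩
  · refine ⟨by simp, fun k hk i _ => by rw [rd_upd_of_ne hk], by simp⟩
  · rintro j hj M' ⟨h1, h2, h3⟩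
    have hv : (ar pos (vr cnt) / vr den).eval M' = z ⟨j, hj⟩ / e := by
      rw [eval_div, eval_ar, eval_vr, eval_vr, h1, h2 pos (by simp) _ (by positivity),
        h2 den (by simp) _ le_rfl, h.den, h.pos ⟨j, hj⟩]
    refine det_store (by simp) (by simp) ?_ ?_
    · rw [hv]
      have : ((z ⟨j, hj⟩) / e).natAbs = 1 := by
        rcases hq ⟨j, hj⟩ with h4 | h4 <;> rw [h4.1] <;> rfl
      omega
    · rw [hv, eval_vr, h1]
      refine ⟨by rw [rd_update_of_nonneg le_rfl (by positivity), h1], by simp, fun k hk i hi => ?_,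
        fun i hi => ?_⟩
      · rw [rd_upd_of_ne hk, rd_update_of_nonneg hi (by positivity), h2 k hk i hi]
      · rw [upd_apply_of_nonneg le_rfl (by positivity), Function.update_apply]
        split_ifs with hij
        · rw [show i = ⟨j, hj⟩ from Fin.ext (by exact_mod_cast hij)]
        · exact h3 i (by
            have : (i : ℕ) ≠ j := fun h => hij (by exact_mod_cast h)
            omega)
  · rintro M' ⟨-, -, h3⟩
    refine ⟨fun i => ?_, fun i => ?_⟩
    · rw [h3 i i.2]
      exact (hq i).imp And.left And.left
    · rw [h3 i i.2]
      rcases hq i with h4 | h4 <;> rw [h4.1, ← h4.2]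

/-- Prepare the walk. -/
def setupP : Prog :=
  .seq readP (.seq scaleMinP (.seq diagP (.seq gramP (sv den (.lit 1)))))

/-- The whole algorithm. -/
def mainP : Prog := .seq setupP (.seq walkP outP)

/-- A bound for the minors of the Gram matrix. -/
def minorBound (n : ℕ) : ℕ := 2 ^ (5 * n ^ 2 + 3 * n)

/-- A bound for the number of binary digits of all integers that are computed. -/
def digitBound (n : ℕ) : ℕ := 5 * n ^ 3 + 8 * n ^ 2 + 9 * n + 20

/-- With `n! ≤ n ^ n`, `n ≤ 2 ^ n` and entries of at most `8 n ^ 4 ≤ 2 ^ (4 n + 3)`, the exponents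
add up to `n ^ 2 + (4 n + 3) n`. -/
theorem hadBound_le {n c : ℕ} (hc : c ≤ 4 * n + n * (n * n * n)) :
    hadBound n c ≤ minorBound n := by
  have h2 : n ≤ 2 ^ n := Nat.lt_two_pow_self.le
  have h3 : c ≤ 2 ^ (4 * n + 3) := by
    have h4 : 4 * n + n * (n * n * n) ≤ 8 * n ^ 4 := by
      have : n ≤ n ^ 4 := Nat.le_self_pow (by norm_num) n
      calc 4 * n + n * (n * n * n) ≤ 4 * n ^ 4 + n ^ 4 := by
            gcongr
            exact le_of_eq (by ring)
        _ ≤ _ := by omega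
    calc c ≤ 8 * n ^ 4 := hc.trans h4
      _ ≤ 8 * (2 ^ n) ^ 4 := by gcongr
      _ = _ := by rw [pow_add, ← pow_mul]; ring
  calc hadBound n c ≤ n ^ n * c ^ n := Nat.mul_le_mul_right _ (Nat.factorial_le_pow n)
    _ ≤ (2 ^ n) ^ n * (2 ^ (4 * n + 3)) ^ n := by gcongr
    _ = minorBound n := by
      rw [minorBound, ← pow_mul, ← pow_mul, ← pow_add]
      congr 1; ring

theorem lt_digitBound {n x c : ℕ} (h : x ≤ 2 ^ c) (hc : c ≤ 5 * n ^ 3 + 8 * n ^ 2 + 9 * n + 19) :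
    x < 2 ^ digitBound n :=
  lt_of_le_of_lt h (Nat.pow_lt_pow_right (by norm_num) (by unfold digitBound; omega))

/-- The registers that are used in the preparation of the walk. -/
abbrev setupRegs : List Reg :=
  [dim, size, cnt, side, scaleMin, lvl, acc, Reg.det, row, mat, scale, weight, fst, snd, dif, flag,
    dig₁, dig₂, val, rep, vec, det', col, den]

/-- A bound for the running time of `setupP`. -/
def setupTime (n : ℕ) : ℕ :=
  n * 6 + 7 + (n * (n * 5 + 11) + 5 + (n * 10 + 9 +
    (n * (n * (n * (rowTime n + 3) + 6) + 11) + 9 + 1 + 1) + 1) + 1) + 1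

theorem det_setupP {d n : ℕ} {N : ℕ → ℕ} {M : ℤ → ℤ} (h0 : M 0 = d)
    (hN : ∀ j < d, M ((j : ℤ) + 1) = N j) (hM : ∀ z : ℤ, z < 0 → M z = 0)
    (hn : ∏ j ∈ Finset.range d, N j = n) (hN1 : ∀ j < d, 1 ≤ N j) (hd : d ≤ n) (hn1 : 1 ≤ n)
    (hrow : ∀ s a a', 1 ≤ s → a' < n → RowOk d N s a a' → ∀ t < s, a + t * (a' - a) < n) :
    Det (digitBound n) setupP (setupTime n) M fun M' =>
      WalkAt M' (gramMat d n N (scaleSeq d N n) n) 0 1 := by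
  have hnn : n ≤ 2 ^ n := Nat.lt_two_pow_self.le
  have hnb : n < 2 ^ digitBound n := lt_digitBound hnn (by omega)
  have h4n : 4 * n ≤ 2 ^ (n + 2) := by rw [pow_add]; omega
  have hs := scaleSeq_le hn hN1 hn1 n
  have hs1 := one_le_scaleSeq d N n
  set s := scaleSeq d N n with hsdef
  have hz : ∀ {M' : ℤ → ℤ} {S : List Reg}, Same S M M' → ∀ k, k ∉ S → ∀ i : ℤ, 0 ≤ i →
      rd M' k i = 0 := fun h k hk i hi => by
    rw [h k hk, rd, hM _ (adr_neg k hi)]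
  unfold setupTime
  refine det_seq (T := n * 6 + 7) (U := n * (n * 5 + 11) + 5 + (n * 10 + 9 +
    (n * (n * (n * (rowTime n + 3) + 6) + 11) + 9 + 1 + 1) + 1) + 1)
    ((det_readP h0 hN hn hN1 hd hnb).mono le_rfl ?_)
  rintro M₁ ⟨h1, hB₁⟩
  refine det_seq (T := n * (n * 5 + 11) + 5) (U := n * 10 + 9 +
    (n * (n * (n * (rowTime n + 3) + 6) + 11) + 9 + 1 + 1) + 1)
    ((det_scaleMinP hB₁ hn hN1 hd hn1 (lt_digitBound h4n (by omega))).mono le_rfl ?_)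
  rintro M₂ ⟨h2, hs₂⟩
  have hB₂ : HasBox M₂ d n N := hB₁.of_same h2 (by simp)
  have hS₂ : Same [dim, size, cnt, side, scaleMin, lvl, acc] M M₂ := h1.trans h2 (by simp) (by simp)
  have hn2 : n ^ 2 = n * n := sq n
  refine det_seq (T := n * 10 + 9) (U := n * (n * (n * (rowTime n + 3) + 6) + 11) + 9 + 1 + 1)
    ((det_diagP hB₂.size hs₂ (hz hS₂ mat (by simp)) hn1 hs1 ?_ hnb).mono le_rfl ?_)
  · refine lt_digitBound (c := (n + 2) * n) ?_ (by nlinarith)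
    rw [pow_mul]
    exact Nat.pow_le_pow_left (hs.trans h4n) n
  rintro M₃ ⟨h3, hA₃⟩
  have hB₃ : HasBox M₃ d n N := hB₂.of_same h3 (by simp)
  have hS₃ : Same [dim, size, cnt, side, scaleMin, lvl, acc, Reg.det, row, mat] M M₃ :=
    hS₂.trans h3 (by simp) (by simp)
  have hscale : rd M₃ scaleMin 0 = s := by rw [h3 scaleMin (by simp), hs₂]
  refine det_seq (T := n * (n * (n * (rowTime n + 3) + 6) + 11) + 9) (U := 1)
    ((det_gramP hB₃ hscale hs1 hd hA₃ hrow ?_ ?_).mono le_rfl ?_)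
  · refine lt_digitBound (c := 2 * n + (5 * n ^ 2 + 3 * n + 1)) ?_ (by omega)
    have h5 : n + 1 ≤ 2 ^ n := Nat.lt_two_pow_self
    have h6 := hadBound_le (Nat.add_le_add_right hs (n * (n * n * n)))
    have h7 : 1 ≤ minorBound n := Nat.one_le_two_pow
    calc (n + 1) * (n + 1) * (hadBound n (s + n * (n * n * n)) + 1) ≤
          2 ^ n * 2 ^ n * (minorBound n * 2) := by gcongr; omega
      _ = _ := by rw [minorBound]; ring
  · refine lt_digitBound (c := 2 * n + (n + 2)) ?_ (by omega)
    rw [pow_add, pow_mul]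
    exact Nat.mul_le_mul le_rfl (hs.trans h4n)
  rintro M₄ ⟨h4, hA₄⟩
  refine det_sv (by simp) ?_ ?_
  · rw [eval_lit]
    exact lt_of_le_of_lt hn1 hnb
  rw [eval_lit]
  have hS₄ : Same setupRegs M (upd M₄ den 0 1) :=
    (hS₃.trans h4 (S'' := setupRegs) (by simp) (by simp)).upd (by simp) _ _
  have hpos : rd (upd M₄ den 0 1) pos = rd M pos := hS₄ pos (by simp)
  have halive : alive (0 : Fin n → ℤ) 1 = Finset.univ := by
    ext i; simp [mem_alive]
  refine ⟨?_, by rw [rd_upd_self, Function.update_self], fun i => ?_, one_pos, fun i => ?_,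
    ⟨?_, ?_⟩⟩
  · rw [rd_upd_of_ne (by simp), h4 size (by simp), hB₃.size]
  · rw [hpos]
    exact hM _ (adr_neg pos (Int.natCast_nonneg i))
  · rw [Pi.zero_apply, abs_zero]; exact zero_le_one
  · rw [halive, adjOn_univ]
    exact hA₄.mat.of_eq (rd_upd_of_ne (by simp))
  · rw [halive, restr_univ, rd_upd_of_ne (by simp), hA₄.det]

/-- A bound for the running time of the algorithm. -/
def mainTime (n : ℕ) : ℕ :=
  setupTime n + (n * (stepTime (digitBound n) n + 3) + 3 + (n * 4 + 3) + 1) + 1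

/-- The program never sees the vectors or the scaling `κ`: the direction and the lengths of the
steps depend only on the integral Gram matrix, so one run serves every realization of it by vectors
of length at most one. -/
theorem rnd_mainP {d n : ℕ} {N : ℕ → ℕ} {M : ℤ → ℤ} [FiniteDimensional ℝ E] (h0 : M 0 = d)
    (hN : ∀ j < d, M ((j : ℤ) + 1) = N j) (hM : ∀ z : ℤ, z < 0 → M z = 0)
    (hn : ∏ j ∈ Finset.range d, N j = n) (hN1 : ∀ j < d, 1 ≤ N j) (hd : d ≤ n) (hn1 : 1 ≤ n)
    (hrow : ∀ s a a', 1 ≤ s → a' < n → RowOk d N s a a' → ∀ t < s, a + t * (a' - a) < n)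
    {v : Fin n → E} {κ : ℝ}
    (hgram : ∀ i j, ⟪v i, v j⟫_ℝ = κ * gramMat d n N (scaleSeq d N n) n i j)
    (hv : LinearIndependent ℝ v) (hv1 : ∀ i, ‖v i‖ ≤ 1) :
    Rnd (digitBound n) mainP (mainTime n) M
      (fun M' => ∀ i : Fin n, M' (i : ℕ) = 1 ∨ M' (i : ℕ) = -1)
      (fun θ M' => Real.exp ⟪θ, ∑ i : Fin n, (M' (i : ℕ) : ℝ) • v i⟫_ℝ)
      fun θ => (1 + 1 / n) ^ n * Real.exp (‖θ‖ ^ 2 / 2) := by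
  have hnn : n + 1 ≤ 2 ^ n := Nat.lt_two_pow_self
  have hn2 : n ^ 2 = n * n := sq n
  have hs := scaleSeq_le hn hN1 hn1 n
  have hs1 := one_le_scaleSeq d N n
  have hadm := (gramMat_adm (d := d) (n := n) N hs1 n)
  unfold mainTime
  refine Rnd.seq (T := setupTime n) (Φ := fun θ _ => (1 + 1 / n) ^ n * Real.exp (‖θ‖ ^ 2 / 2))
    (.of_det ((det_setupP h0 hN hM hn hN1 hd hn1 hrow).mono le_rfl
      fun M' h => ⟨h, fun _ => le_rfl⟩)) ?_
  intro M₁ h1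
  refine Rnd.seq (T := n * (stepTime (digitBound n) n + 3) + 3) (U := n * 4 + 3)
    ((rnd_walkP (H := minorBound n) h1 hn1 hadm.posDef hgram hv hv1 (fun A i j => ?_)
    Nat.one_le_two_pow ?_ ?_).of_le le_rfl fun θ => ?_) ?_
  · refine (natAbs_adjOn_le (c := 4 * n + n * (n * n * n)) (by omega)
      (fun i j => (hadm.le i j).trans (by omega)) A i j).trans ?_
    rw [Fintype.card_fin]
    exact hadBound_le le_rfl
  -- The denominator may acquire a minor in each of the `n` steps. This is what forces a cubic
  -- number of digits.
  · refine lt_digitBound (c := 3 + n + (5 * n ^ 2 + 3 * n) * n) ?_ (by nlinarith)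
    rw [minorBound, ← pow_mul, pow_add, pow_add]
    exact Nat.mul_le_mul_right _ (Nat.mul_le_mul (by norm_num) hnn)
  · refine lt_digitBound (c := n + n) ?_ (by omega)
    rw [pow_add]
    exact Nat.mul_le_mul (by omega) (by omega)
  · refine mul_le_mul_of_nonneg_left ?_ (by positivity)
    have halive : (0 : Fin n → ℤ) = fun _ => 0 := rfl
    have hne : (alive (0 : Fin n → ℤ) 1).Nonempty := ⟨⟨0, hn1⟩, by simp [mem_alive]⟩
    rw [memPot_eq h1.pos h1.den, walkPot, dif_pos hne,
      show frac (0 : Fin n → ℤ) 1 = 0 by funext i; simp [frac]]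
    exact pot_zero_le hv
  · rintro M₂ ⟨z, e, h2, hA⟩
    refine .of_det ((det_outP h2 hA (lt_digitBound (c := n) (by omega) (by omega))).mono le_rfl ?_)
    rintro M₃ ⟨h3, h4⟩
    refine ⟨h3, fun θ => ?_⟩
    have he : (0 : ℝ) < e := by exact_mod_cast h2.e_pos
    rw [memPot_eq h2.pos h2.den, walkPot, dif_neg (by rw [hA]; simp)]
    refine le_of_eq ?_
    congr 3
    funext i
    rw [frac, h4 i]
    push_cast
    rw [mul_div_cancel_right₀ _ he.ne']

theorem exists_polynomial_mainTime : ∃ q : Polynomial ℕ, ∀ n,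
    q.eval n = mainTime n * unit (digitBound n) := by
  open Polynomial in
  let row : ℕ[X] := X * (X * (X * 4 + 10) + X * X * 4 + X * 4 + 20 + 3) + X * 14 + 40
  let dig : ℕ[X] := 5 * X ^ 3 + 8 * X ^ 2 + 9 * X + 20
  let set : ℕ[X] := X * 6 + 7 + (X * (X * 5 + 11) + 5 + (X * 10 + 9 +
    (X * (X * (X * (row + 3) + 6) + 11) + 9 + 1 + 1) + 1) + 1) + 1
  let step : ℕ[X] := X * (X * X * 4 + X * 4 + 61) + dig * 6 + 50
  refine ⟨(set + (X * (step + 3) + 3 + (X * 4 + 3) + 1) + 1) * (500000 * (dig + 1)), fun n => ?_⟩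
  simp [row, dig, set, step, mainTime, setupTime, stepTime, rowTime, digitBound, unit]

end RAM

/-! ## Mixed radix digits -/

namespace RAM

/-- The number with the mixed radix digits `f j`, `j < d`. -/
def ofDig (d : ℕ) (N : ℕ → ℕ) (f : ℕ → ℤ) : ℤ :=
  ∑ j ∈ Finset.range d, f j * ∏ i ∈ Finset.range j, (N i : ℤ)

theorem ofDig_dig (d : ℕ) (N : ℕ → ℕ) (r : ℕ) :
    ofDig d N (fun j => dig N j r) = (r % ∏ i ∈ Finset.range d, N i : ℕ) := by
  induction d with
  | zero => simp [ofDig, Nat.mod_one]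
  | succ d ih =>
    rw [ofDig, Finset.sum_range_succ, ← ofDig, ih, Finset.prod_range_succ, Nat.mod_mul, dig]
    push_cast
    ring

theorem ofDig_nonneg {d : ℕ} {N : ℕ → ℕ} {f : ℕ → ℤ} (hf : ∀ j < d, 0 ≤ f j) :
    0 ≤ ofDig d N f :=
  Finset.sum_nonneg fun j hj => mul_nonneg (hf j (Finset.mem_range.1 hj)) (by positivity)

theorem ofDig_lt {d : ℕ} {N : ℕ → ℕ} {f : ℕ → ℤ} (hf : ∀ j < d, f j < N j) :
    ofDig d N f < ∏ i ∈ Finset.range d, (N i : ℤ) := by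
  induction d with
  | zero => simp [ofDig]
  | succ d ih =>
    rw [ofDig, Finset.sum_range_succ, ← ofDig, Finset.prod_range_succ]
    have h1 := ih fun j hj => hf j (by omega)
    have h2 : f d + 1 ≤ N d := hf d (by omega)
    have h3 : (0 : ℤ) ≤ ∏ i ∈ Finset.range d, (N i : ℤ) := by positivity
    nlinarith

/-- The lower digits sum to less than the place value of digit `j`, and the higher ones to a
multiple of the next place value, so a division followed by a remainder isolates the digit. -/
theorem dig_eq_of_ofDig {d : ℕ} {N : ℕ → ℕ} {f : ℕ → ℤ} (h0 : ∀ j < d, 0 ≤ f j)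
    (hf : ∀ j < d, f j < N j) {r : ℕ} (hr : (r : ℤ) = ofDig d N f) {j : ℕ} (hj : j < d) :
    (dig N j r : ℤ) = f j := by
  have hpos : ∀ k ≤ d, (0 : ℤ) < ∏ i ∈ Finset.range k, (N i : ℤ) := fun k hk =>
    Finset.prod_pos fun i hi => by
      have hi' := (Finset.mem_range.1 hi).trans_le hk
      exact (h0 i hi').trans_lt (hf i hi')
  obtain ⟨c, hc⟩ : ∃ c : ℤ, ofDig d N f = ofDig (j + 1) N f +
      (∏ i ∈ Finset.range (j + 1), (N i : ℤ)) * c := by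
    have : ∀ m, ∃ c : ℤ, ofDig (j + 1 + m) N f = ofDig (j + 1) N f +
        (∏ i ∈ Finset.range (j + 1), (N i : ℤ)) * c := by
      intro m
      induction m with
      | zero => exact ⟨0, by simp⟩
      | succ m ih =>
        obtain ⟨c, hc⟩ := ih
        refine ⟨c + f (j + 1 + m) * ∏ i ∈ Finset.range m, (N (j + 1 + i) : ℤ), ?_⟩
        rw [← add_assoc, ofDig, Finset.sum_range_succ, ← ofDig, hc, Finset.prod_range_add _ (j + 1) m]
        ring
    obtain ⟨c, hc⟩ := this (d - (j + 1))
    rw [show j + 1 + (d - (j + 1)) = d by omega] at hc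
    exact ⟨c, hc⟩
  have hP := hpos j hj.le
  have hN : (0 : ℤ) < N j := (h0 j hj).trans_lt (hf j hj)
  have hA0 : 0 ≤ ofDig j N f := ofDig_nonneg fun i hi => h0 i (by omega)
  have hA1 : ofDig j N f < ∏ i ∈ Finset.range j, (N i : ℤ) := ofDig_lt fun i hi => hf i (by omega)
  rw [dig]
  push_cast
  rw [hr, hc, ofDig, Finset.sum_range_succ, ← ofDig, Finset.prod_range_succ]
  rw [show ofDig j N f + f j * ∏ i ∈ Finset.range j, (N i : ℤ) +
      (∏ i ∈ Finset.range j, (N i : ℤ)) * (N j : ℤ) * c =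
    ofDig j N f + (∏ i ∈ Finset.range j, (N i : ℤ)) * (f j + N j * c) by ring,
    Int.add_mul_ediv_left _ _ hP.ne', Int.ediv_eq_zero_of_lt hA0 hA1, zero_add,
    Int.add_mul_emod_self_left, Int.emod_eq_of_lt (h0 j hj) (hf j hj)]

theorem ofDig_add_mul (d : ℕ) (N : ℕ → ℕ) (f g : ℕ → ℤ) (t : ℤ) :
    ofDig d N (fun j => f j + t * g j) = ofDig d N f + t * ofDig d N g := by
  simp only [ofDig, Finset.mul_sum, ← Finset.sum_add_distrib]
  exact Finset.sum_congr rfl fun j _ => by ring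

theorem ofDig_sub (d : ℕ) (N : ℕ → ℕ) (f g : ℕ → ℤ) :
    ofDig d N (fun j => f j - g j) = ofDig d N f - ofDig d N g := by
  simp only [ofDig, ← Finset.sum_sub_distrib]
  exact Finset.sum_congr rfl fun j _ => by ring

variable {d n : ℕ} {N : ℕ → ℕ}

theorem ofDig_dig_of_lt (hn : ∏ j ∈ Finset.range d, N j = n) {r : ℕ} (hr : r < n) :
    ofDig d N (fun j => dig N j r) = r := by
  rw [ofDig_dig, hn, Nat.mod_eq_of_lt hr]

theorem ofDig_sub_dig (hn : ∏ j ∈ Finset.range d, N j = n) {a a' : ℕ} (ha : a < n) (ha' : a' < n) :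
    ofDig d N (fun j => (dig N j a' : ℤ) - dig N j a) = a' - a := by
  rw [ofDig_sub, ofDig_dig_of_lt hn ha, ofDig_dig_of_lt hn ha']

/-- Rank is linear in the digits, so the last point has rank `a + (s - 1) * (a' - a)`. This is below
`n` because its digits are admissible, and the earlier ranks are smaller. -/
theorem add_mul_lt_of_rowOk (hn : ∏ j ∈ Finset.range d, N j = n) {s a a' : ℕ}
    (ha' : a' < n) (h : RowOk d N s a a') {t : ℕ} (ht : t < s) : a + t * (a' - a) < n := by
  obtain ⟨h1, -, h3⟩ := h
  have ha : a < n := h1.trans ha'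
  have h4 : ofDig d N (lastDig N s a a') = a + ((s : ℤ) - 1) * (a' - a) := by
    rw [← ofDig_sub_dig hn ha ha']
    nth_rw 1 [← ofDig_dig_of_lt hn ha]
    rw [← ofDig_add_mul]
    rfl
  have h5 := ofDig_lt (d := d) (N := N) fun j hj => (h3 j hj).2
  rw [h4] at h5
  have h6 : ((∏ j ∈ Finset.range d, N j : ℕ) : ℤ) = n := by rw [hn]
  push_cast at h6
  rw [h6] at h5
  zify [h1.le]
  have h7 : (0 : ℤ) < a' - a := by omega
  have h8 : (t : ℤ) ≤ s - 1 := by omega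
  nlinarith

end RAM

/-! ## The Gram matrix of the rows -/

namespace RAM

open IntMatrix Matrix

variable {d n : ℕ} {N : ℕ → ℕ}

/-- The rows with `s` points that contain `x`. -/
def rowsAt (d n : ℕ) (N : ℕ → ℕ) (s x : ℕ) : Finset (ℕ × ℕ) :=
  (Finset.range n ×ˢ Finset.range n).filter fun q =>
    RowOk d N s q.1 q.2 ∧ x ∈ progIdx s q.1 (q.2 - q.1)

/-- The digits of the first and the last point both lie in `[0, N j)` and differ by `s - 1` times
the step. -/
theorem natAbs_sub_dig_le {s a a' j : ℕ} (hs : 2 ≤ s) (hN : 0 < N j)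
    (h : 0 ≤ lastDig N s a a' j ∧ lastDig N s a a' j < N j) :
    ((dig N j a' : ℤ) - dig N j a).natAbs ≤ (N j - 1) / (s - 1) := by
  have h1 : dig N j a < N j := Nat.mod_lt _ hN
  obtain ⟨h2, h3⟩ := h
  unfold lastDig at h2 h3
  rw [Nat.le_div_iff_mul_le (by omega)]
  obtain ⟨s', rfl⟩ : ∃ s', s = s' + 1 := ⟨s - 1, by omega⟩
  set D := (dig N j a' : ℤ) - dig N j a with hD
  push_cast at h2 h3
  rw [add_sub_cancel_right] at h2 h3
  rw [Nat.add_sub_cancel]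
  zify [hN]
  rw [mul_comm, ← abs_of_nonneg (show (0 : ℤ) ≤ s' by positivity), ← abs_mul, abs_le]
  constructor <;> omega

/-- A row through `x` is determined by its vector of digit differences. These give the rank
difference `β = a' - a`, and since `a / β` is a multiple of `s`, the position of `x` in the row is
the remainder of `x / β` modulo `s`. -/
theorem card_rowsAt_le (hn : ∏ j ∈ Finset.range d, N j = n) (hN : ∀ j < d, 0 < N j) {s : ℕ}
    (hs : 2 ≤ s) (x : ℕ) :
    (rowsAt d n N s x).card ≤ ∏ j ∈ Finset.range d, (2 * ((N j - 1) / (s - 1)) + 1) := by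
  set T : Finset (Fin d → ℤ) := Fintype.piFinset fun j =>
    Finset.Icc (-(((N j - 1) / (s - 1) : ℕ) : ℤ)) (((N j - 1) / (s - 1) : ℕ) : ℤ) with hT
  have hcard : T.card = ∏ j ∈ Finset.range d, (2 * ((N j - 1) / (s - 1)) + 1) := by
    rw [hT, Fintype.card_piFinset, Finset.prod_range]
    refine Finset.prod_congr rfl fun j _ => ?_
    rw [Int.card_Icc]
    omega
  rw [← hcard]
  refine Finset.card_le_card_of_injOn
    (fun q (j : Fin d) => (dig N j q.2 : ℤ) - dig N j q.1) ?_ ?_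
  · rintro ⟨a, a'⟩ hq
    simp only [rowsAt, Finset.coe_filter, Finset.mem_product, Finset.mem_range, Set.mem_ofPred_eq] at hq
    rw [Finset.mem_coe, hT, Fintype.mem_piFinset]
    intro j
    have := natAbs_sub_dig_le hs (hN j j.2) (hq.2.1.2.2 j j.2)
    rw [Finset.mem_Icc]
    simp only
    omega
  · rintro ⟨a, a'⟩ hq ⟨c, c'⟩ hr heq
    simp only [rowsAt, Finset.coe_filter, Finset.mem_product, Finset.mem_range, Set.mem_ofPred_eq]
      at hq hr
    obtain ⟨⟨ha, ha'⟩, ⟨h1, h2, -⟩, h3⟩ := hq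
    obtain ⟨⟨hc, hc'⟩, ⟨h4, h5, -⟩, h6⟩ := hr
    have hdiff : (a' : ℤ) - a = c' - c := by
      rw [← ofDig_sub_dig hn ha ha', ← ofDig_sub_dig hn hc hc']
      refine Finset.sum_congr rfl fun j hj => ?_
      have := congrFun heq ⟨j, Finset.mem_range.1 hj⟩
      simp only at this ⊢
      rw [this]
    have hdiff' : a' - a = c' - c := by omega
    simp only [progIdx, Finset.mem_image, Finset.mem_range, ← hdiff'] at h3 h6 h5
    obtain ⟨t, ht, hxt⟩ := h3
    obtain ⟨u, hu, hxu⟩ := h6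
    have he : 0 < a' - a := by omega
    have e1 : x / (a' - a) = a / (a' - a) + t := by
      rw [← hxt, Nat.add_mul_div_right _ _ he]
    have e2 : x / (a' - a) = c / (a' - a) + u := by
      rw [← hxu, Nat.add_mul_div_right _ _ he]
    have htu : t = u := by
      obtain ⟨k, hk⟩ := h2
      obtain ⟨l, hl⟩ := h5
      rw [hk] at e1
      rw [hl] at e2
      have h7 := congrArg (· % s) (e1.symm.trans e2)
      simpa [Nat.mul_add_mod, Nat.mod_eq_of_lt ht, Nat.mod_eq_of_lt hu] using h7
    subst htu
    have : a = c := by omega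
    subst this
    exact Prod.ext rfl (by simp only; omega)

/-- If every side is shorter than the row, then all digit differences vanish, which contradicts `a <
a'`. -/
theorem rowsAt_eq_empty (hn : ∏ j ∈ Finset.range d, N j = n) (hN : ∀ j < d, 0 < N j) {s : ℕ}
    (hs : 2 ≤ s) (h : ∀ j < d, N j < s) (x : ℕ) : rowsAt d n N s x = ∅ := by
  refine Finset.eq_empty_of_forall_notMem ?_
  rintro ⟨a, a'⟩ hq
  simp only [rowsAt, Finset.mem_filter, Finset.mem_product, Finset.mem_range] at hq
  obtain ⟨⟨ha, ha'⟩, ⟨h1, -, h2⟩, -⟩ := hq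
  have h3 := ofDig_sub_dig hn ha ha'
  have h4 : ofDig d N (fun j => (dig N j a' : ℤ) - dig N j a) = 0 := by
    refine Finset.sum_eq_zero fun j hj => ?_
    have hj' := Finset.mem_range.1 hj
    have h5 := natAbs_sub_dig_le hs (hN j hj') (h2 j hj')
    rw [Nat.div_eq_of_lt (by have := h j hj'; have := hN j hj'; omega)] at h5
    simp only
    rw [Int.natAbs_eq_zero.1 (Nat.le_zero.1 h5), zero_mul]
  omega

/-- The numerical bound for the number of the rows of a given size that contain a given point. -/
theorem card_rowsAt_le' (hn : ∏ j ∈ Finset.range d, N j = n) (hN : ∀ j < d, 0 < N j) {s₀ : ℕ}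
    (hs : 4 ≤ s₀) (hload : load d N s₀ ≤ s₀) (k x : ℕ) :
    (rowsAt d n N (4 ^ k * s₀) x).card * 4 ^ k ≤ 8 ^ d * s₀ := by
  set s := 4 ^ k * s₀ with hsdef
  have hs4 : 4 ≤ s := hs.trans (Nat.le_mul_of_pos_left _ (by positivity))
  by_cases hex : ∀ j < d, N j < s
  · rw [rowsAt_eq_empty hn hN (by omega) hex]; simp
  push Not at hex
  obtain ⟨i, hi, his⟩ := hex
  -- A side with `s ≤ N j` admits about `N j / s` differences, smaller than `N j / s₀` by the factor
  -- `4 ^ k`. Rounding is absorbed in `4 * (N j / s₀ + 1) ≤ 8 * (N j / s₀)`.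
  have hfac : ∀ j < d, (2 * ((N j - 1) / (s - 1)) + 1) * (if s ≤ N j then 4 ^ k else 1) ≤
      8 * max 1 (N j / s₀) := by
    intro j hj
    split_ifs with hsj
    · have h1 : N j < (N j / s₀ + 1) * s₀ := by
        rw [mul_comm]; exact Nat.lt_mul_div_succ _ (by omega)
      have h2 : 1 ≤ N j / s₀ := by
        rw [Nat.one_le_div_iff (by omega)]
        exact (Nat.le_mul_of_pos_left _ (by positivity)).trans hsj
      have h3 : (N j - 1) / (s - 1) * (s - 1) ≤ N j - 1 := Nat.div_mul_le_self _ _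
      set q := (N j - 1) / (s - 1) with hq
      have h4 : N j - 1 < (q + 1) * (s - 1) := by
        rw [mul_comm]; exact Nat.lt_mul_div_succ _ (by omega)
      have h5 : (2 * q + 1) * s ≤ 4 * N j := by
        obtain ⟨s', hs'⟩ : ∃ s', s = s' + 1 := ⟨s - 1, by omega⟩
        obtain ⟨m, hm⟩ : ∃ m, N j = m + 1 := ⟨N j - 1, by have := hN j hj; omega⟩
        rw [hs', hm, Nat.add_sub_cancel, Nat.add_sub_cancel] at h3
        rw [hs'] at hsj ⊢
        rw [hm] at hsj ⊢
        have h7 : 3 * q ≤ q * s' := by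
          rw [mul_comm]; exact Nat.mul_le_mul_left _ (by omega)
        nlinarith
      have h6 : (2 * q + 1) * s < 4 * ((N j / s₀ + 1) * s₀) := by omega
      have h7 : (2 * q + 1) * 4 ^ k * s₀ < 4 * (N j / s₀ + 1) * s₀ := by
        rw [hsdef] at h6
        calc _ = (2 * q + 1) * (4 ^ k * s₀) := by ring
          _ < _ := h6
          _ = _ := by ring
      have h8 := Nat.lt_of_mul_lt_mul_right h7
      have h9 := le_max_right 1 (N j / s₀)
      omega
    · rw [Nat.div_eq_of_lt (by have := hN j hj; omega)]
      have := le_max_left 1 (N j / s₀)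
      omega
  -- One long side is enough to gain the whole factor `4 ^ k`.
  have h4 : 4 ^ k ≤ ∏ j ∈ Finset.range d, if s ≤ N j then 4 ^ k else 1 := by
    have : (if s ≤ N i then 4 ^ k else 1) ≤ ∏ j ∈ Finset.range d, if s ≤ N j then 4 ^ k else 1 :=
      Finset.single_le_prod' (f := fun j => if s ≤ N j then 4 ^ k else 1)
        (fun j _ => by split_ifs; exacts [Nat.one_le_pow _ _ (by norm_num), le_rfl])
        (Finset.mem_range.2 hi)
    rwa [if_pos his] at this
  calc _ ≤ (∏ j ∈ Finset.range d, (2 * ((N j - 1) / (s - 1)) + 1)) *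
        ∏ j ∈ Finset.range d, (if s ≤ N j then 4 ^ k else 1) :=
        Nat.mul_le_mul (card_rowsAt_le hn hN (by omega) x) h4
    _ = ∏ j ∈ Finset.range d, (2 * ((N j - 1) / (s - 1)) + 1) * (if s ≤ N j then 4 ^ k else 1) :=
        Finset.prod_mul_distrib.symm
    _ ≤ ∏ j ∈ Finset.range d, 8 * max 1 (N j / s₀) :=
        Finset.prod_le_prod' fun j hj => hfac j (Finset.mem_range.1 hj)
    _ = 8 ^ d * load d N s₀ := by rw [Finset.prod_mul_distrib]; simp [load]
    _ ≤ _ := Nat.mul_le_mul_left _ hload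

/-! ### The smallest scale -/

theorem scaleSeq_eq_pow (d : ℕ) (N : ℕ → ℕ) (k : ℕ) : ∃ i, scaleSeq d N k = 4 ^ i := by
  induction k with
  | zero => exact ⟨0, rfl⟩
  | succ k ih =>
    obtain ⟨i, hi⟩ := ih
    rw [scaleSeq]
    split_ifs
    exacts [⟨i + 1, by rw [hi, pow_succ]; ring⟩, ⟨i, hi⟩]

theorem scaleSeq_spec (d : ℕ) (N : ℕ → ℕ) (k : ℕ) :
    scaleSeq d N k = 1 ∨ ∃ s, 1 ≤ s ∧ scaleSeq d N k = 4 * s ∧ s < load d N s := by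
  induction k with
  | zero => exact Or.inl rfl
  | succ k ih =>
    rw [scaleSeq]
    split_ifs with h
    exacts [Or.inr ⟨_, one_le_scaleSeq d N k, rfl, h⟩, ih]

/-- A candidate that has grown in every round equals `4 ^ n`, which exceeds `n` and therefore every
load. -/
theorem load_scaleSeq_le (hn : ∏ j ∈ Finset.range d, N j = n) (hN1 : ∀ j < d, 1 ≤ N j) :
    load d N (scaleSeq d N n) ≤ scaleSeq d N n := by
  have h : ∀ k, scaleSeq d N k = 4 ^ k ∨ load d N (scaleSeq d N k) ≤ scaleSeq d N k := by
    intro k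
    induction k with
    | zero => exact Or.inl rfl
    | succ k ih =>
      rw [scaleSeq]
      split_ifs with h
      · left
        rw [ih.resolve_right (not_le.2 h), pow_succ]; ring
      · exact Or.inr (not_lt.1 h)
  rcases h n with h | h
  · rw [h]
    exact (load_le hn hN1 le_rfl _).trans ((Nat.lt_pow_self (by norm_num : 1 < 4)).le)
  · exact h

/-- At scale one the load is the number of points of the box, so at least one multiplication takes
place. Hence rows have at least four points, and `s - 1` is a harmless divisor. -/
theorem four_le_scaleSeq (hn : ∏ j ∈ Finset.range d, N j = n) (hN : ∀ j < d, 2 ≤ N j)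
    (hd : 0 < d) : 4 ≤ scaleSeq d N n := by
  rcases scaleSeq_spec d N n with h | ⟨s, h1, h2, -⟩
  · exfalso
    have h1 := load_scaleSeq_le hn fun j hj => (by norm_num : 1 ≤ 2).trans (hN j hj)
    rw [h] at h1
    have h2 : N 0 ≤ load d N 1 := by
      have := Finset.single_le_prod' (f := fun j => max 1 (N j / 1)) (s := Finset.range d)
        (fun j _ => le_max_left _ _) (Finset.mem_range.2 hd)
      simp only [Nat.div_one] at this
      rw [load]
      simp only [Nat.div_one]
      exact (le_max_right _ _).trans this
    have := hN 0 hd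
    omega
  · omega

/-! ### The vectors -/

/-- The incidence of the row that starts with `a` and `a'` at the level `k`. -/
def inRow (d n : ℕ) (N : ℕ → ℕ) (s₀ k a a' x : ℕ) : Prop :=
  4 ^ k * s₀ ≤ n ∧ RowOk d N (4 ^ k * s₀) a a' ∧ x ∈ progIdx (4 ^ k * s₀) a (a' - a)

instance (d n : ℕ) (N : ℕ → ℕ) (s₀ k a a' x : ℕ) : Decidable (inRow d n N s₀ k a a' x) := by
  unfold inRow; infer_instance

theorem gramMat_apply (s₀ : ℕ) (x y : Fin n) : gramMat d n N s₀ n x y =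
    (s₀ : ℤ) * (if x = y then 1 else 0) + ∑ k : Fin n, ∑ a : Fin n, ∑ a' : Fin n,
      2 ^ (k : ℕ) * ((if inRow d n N s₀ k a a' x then 1 else 0) *
        if inRow d n N s₀ k a a' y then 1 else 0) := by
  rw [gramMat, Matrix.add_apply, Matrix.smul_apply, Matrix.one_apply, smul_eq_mul]
  congr 1
  rw [Matrix.sum_apply, Finset.sum_range]
  refine Finset.sum_congr rfl fun k _ => ?_
  unfold levelMat inRow
  split_ifs with h
  · rw [Matrix.sum_apply, Finset.sum_range]
    refine Finset.sum_congr rfl fun a _ => ?_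
    rw [Matrix.sum_apply, Finset.sum_range]
    refine Finset.sum_congr rfl fun a' _ => ?_
    unfold rowMat
    by_cases h' : RowOk d N (4 ^ (k : ℕ) * s₀) a a'
    · rw [if_pos h', Matrix.smul_apply, vecMulVec_apply, progVec, progVec]
      simp only [h, h', true_and, smul_eq_mul]
      push_cast
      rfl
    · rw [if_neg h']
      simp [h']
  · simp [h]

/-- At level `k` the weight `2 ^ k` meets at most `8 ^ d * s₀ / 4 ^ k` rows, so the levels form a
geometric series of sum at most `2 * 8 ^ d * s₀`; the scalar part adds `s₀`. -/
theorem gramMat_diag_le (hn : ∏ j ∈ Finset.range d, N j = n) (hN : ∀ j < d, 0 < N j) {s₀ : ℕ}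
    (hs : 4 ≤ s₀) (hload : load d N s₀ ≤ s₀) (x : Fin n) :
    gramMat d n N s₀ n x x ≤ 3 * 8 ^ d * s₀ := by
  have hlev : ∀ k : Fin n, (∑ a : Fin n, ∑ a' : Fin n,
      2 ^ (k : ℕ) * ((if inRow d n N s₀ k a a' x then 1 else 0) *
        if inRow d n N s₀ k a a' x then (1 : ℤ) else 0)) * 2 ^ (k : ℕ) ≤ 8 ^ d * s₀ := by
    intro k
    have h1 : (∑ a : Fin n, ∑ a' : Fin n,
        2 ^ (k : ℕ) * ((if inRow d n N s₀ k a a' x then 1 else 0) *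
        if inRow d n N s₀ k a a' x then (1 : ℤ) else 0)) ≤
        2 ^ (k : ℕ) * (rowsAt d n N (4 ^ (k : ℕ) * s₀) x).card := by
      rw [rowsAt, Finset.card_filter, Finset.sum_product, Finset.sum_range]
      push_cast
      rw [Finset.mul_sum]
      refine Finset.sum_le_sum fun a _ => ?_
      rw [Finset.sum_range, Finset.mul_sum]
      refine Finset.sum_le_sum fun a' _ => mul_le_mul_of_nonneg_left ?_ (by positivity)
      by_cases h : inRow d n N s₀ k a a' x
      · rw [if_pos h, if_pos h.2]; norm_num
      · rw [if_neg h]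
        split_ifs <;> norm_num
    have h2 : (((rowsAt d n N (4 ^ (k : ℕ) * s₀) x).card * 4 ^ (k : ℕ) : ℕ) : ℤ) ≤
        ((8 ^ d * s₀ : ℕ) : ℤ) := by exact_mod_cast card_rowsAt_le' hn hN hs hload k x
    push_cast at h2
    refine (mul_le_mul_of_nonneg_right h1 (by positivity)).trans (le_trans (le_of_eq ?_) h2)
    rw [show (4 : ℤ) ^ (k : ℕ) = 2 ^ (k : ℕ) * 2 ^ (k : ℕ) by rw [← mul_pow]; norm_num]
    ring
  -- The geometric series without division: terms of at most `B / 2 ^ k` have partial sums of at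
  -- most `2 B (1 - 2 ^ (-m))`.
  have hgeo : ∀ m : ℕ, ∀ f : ℕ → ℤ, (∀ k < m, f k * 2 ^ k ≤ 8 ^ d * s₀) →
      (∑ k ∈ Finset.range m, f k) * 2 ^ m ≤ 2 * (8 ^ d * s₀) * (2 ^ m - 1) := by
    intro m f hf
    induction m with
    | zero => simp
    | succ m ih =>
      have h1 := ih fun k hk => hf k (by omega)
      have h2 := hf m (by omega)
      rw [Finset.sum_range_succ, pow_succ]
      nlinarith
  rw [gramMat_apply]
  set f : ℕ → ℤ := fun k => ∑ a : Fin n, ∑ a' : Fin n,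
      2 ^ k * ((if inRow d n N s₀ k a a' x then 1 else 0) *
        if inRow d n N s₀ k a a' x then (1 : ℤ) else 0) with hf
  have h1 := hgeo n f fun k hk => hlev ⟨k, hk⟩
  have h2 : (∑ k ∈ Finset.range n, f k) ≤ 2 * (8 ^ d * s₀) := by
    have hp : (0 : ℤ) < 2 ^ n := by positivity
    refine le_of_mul_le_mul_right ?_ hp
    have : (0 : ℤ) ≤ 2 * (8 ^ d * s₀) := by positivity
    nlinarith
  rw [Finset.sum_range] at h2
  have h3 : (s₀ : ℤ) ≤ 8 ^ d * s₀ := le_mul_of_one_le_left (by positivity)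
    (one_le_pow₀ (by norm_num))
  rw [if_pos rfl]
  calc _ ≤ (s₀ : ℤ) * 1 + 2 * (8 ^ d * s₀) := by
        gcongr
    _ ≤ _ := by linarith

end RAM

/-! ## The vectors of the walk, and the tail bounds -/

namespace RAM

open IntMatrix Matrix
open scoped InnerProductSpace

variable {d n : ℕ} {N : ℕ → ℕ}

/-- The space of the vectors of the walk: a coordinate for each point and one for each row. -/
abbrev RowSpace (n : ℕ) : Type := EuclideanSpace ℝ (Fin n ⊕ (Fin n × Fin n × Fin n))

theorem rowSpace_inner (u v : RowSpace n) : ⟪u, v⟫_ℝ = ∑ y, u (.inl y) * v (.inl y) +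
    ∑ k, ∑ a, ∑ a', u (.inr (k, a, a')) * v (.inr (k, a, a')) := by
  rw [PiLp.inner_apply, Fintype.sum_sum_type, Fintype.sum_prod_type]
  simp only [Fintype.sum_prod_type, RCLike.inner_apply, conj_trivial, mul_comm]

/-- The vectors of the walk, up to the factor `1 / ρ` the columns of the weighted incidence
matrix. -/
noncomputable def gramVec (d n : ℕ) (N : ℕ → ℕ) (s₀ : ℕ) (ρ : ℝ) (x : Fin n) : RowSpace n :=
  WithLp.toLp 2 (Sum.elim (fun y => if x = y then √s₀ / ρ else 0) fun q =>
    if inRow d n N s₀ q.1 q.2.1 q.2.2 x then √(2 ^ (q.1 : ℕ)) / ρ else 0)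

@[simp] theorem gramVec_inl (s₀ : ℕ) (ρ : ℝ) (x y : Fin n) :
    gramVec d n N s₀ ρ x (.inl y) = if x = y then √s₀ / ρ else 0 := rfl

@[simp] theorem gramVec_inr (s₀ : ℕ) (ρ : ℝ) (x : Fin n) (q : Fin n × Fin n × Fin n) :
    gramVec d n N s₀ ρ x (.inr q) =
      if inRow d n N s₀ q.1 q.2.1 q.2.2 x then √(2 ^ (q.1 : ℕ)) / ρ else 0 := rfl

theorem inner_gramVec (s₀ : ℕ) {ρ : ℝ} (hρ : 0 < ρ) (x y : Fin n) :
    ⟪gramVec d n N s₀ ρ x, gramVec d n N s₀ ρ y⟫_ℝ = (ρ ^ 2)⁻¹ * gramMat d n N s₀ n x y := by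
  rw [rowSpace_inner, gramMat_apply]
  push_cast
  rw [mul_add, Finset.mul_sum]
  congr 1
  · simp only [gramVec_inl]
    rw [Finset.sum_eq_single x (fun b _ hb => by rw [if_neg (Ne.symm hb), zero_mul]) (by simp)]
    by_cases h : x = y
    · have h1 : √(s₀ : ℝ) * √s₀ = s₀ := Real.mul_self_sqrt (by positivity)
      rw [if_pos rfl, if_pos h.symm, if_pos h]
      field_simp
      nlinarith
    · rw [if_pos rfl, if_neg (Ne.symm h), if_neg h]; simp
  · refine Finset.sum_congr rfl fun k _ => ?_
    rw [Finset.mul_sum]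
    refine Finset.sum_congr rfl fun a _ => ?_
    rw [Finset.mul_sum]
    refine Finset.sum_congr rfl fun a' _ => ?_
    simp only [gramVec_inr]
    by_cases hx : inRow d n N s₀ k a a' x <;> by_cases hy : inRow d n N s₀ k a a' y
    · have h1 : √((2 : ℝ) ^ (k : ℕ)) * √(2 ^ (k : ℕ)) = 2 ^ (k : ℕ) :=
        Real.mul_self_sqrt (by positivity)
      rw [if_pos hx, if_pos hy, if_pos hx, if_pos hy]
      field_simp
      nlinarith
    all_goals simp [hx, hy]

/-- The coordinates that belong to points form a positive multiple of the identity matrix. -/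
theorem linearIndependent_gramVec {s₀ : ℕ} (hs : 0 < s₀) {ρ : ℝ} (hρ : 0 < ρ) :
    LinearIndependent ℝ (gramVec d n N s₀ ρ) := by
  rw [Fintype.linearIndependent_iff]
  intro g hg y
  have h1 := congrArg (fun u : RowSpace n => u (.inl y)) hg
  have hs' : (0 : ℝ) < √s₀ := Real.sqrt_pos.2 (by exact_mod_cast hs)
  simp only [WithLp.ofLp_sum, Finset.sum_apply, PiLp.smul_apply, gramVec_inl, smul_eq_mul,
    PiLp.zero_apply] at h1
  rw [Finset.sum_eq_single y (fun b _ hb => by rw [if_neg hb, mul_zero]) (by simp), if_pos rfl] at h1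
  exact (mul_eq_zero.1 h1).resolve_right (by positivity)

/-- The scaling factor of the vectors. -/
noncomputable def rowRadius (d s₀ : ℕ) : ℝ := √(3 * 8 ^ d * s₀)

theorem rowRadius_pos (d : ℕ) {s₀ : ℕ} (hs : 0 < s₀) : 0 < rowRadius d s₀ := by
  have : (0 : ℝ) < s₀ := by exact_mod_cast hs
  exact Real.sqrt_pos.2 (by positivity)

theorem norm_gramVec_le (hn : ∏ j ∈ Finset.range d, N j = n) (hN : ∀ j < d, 0 < N j) {s₀ : ℕ}
    (hs : 4 ≤ s₀) (hload : load d N s₀ ≤ s₀) (x : Fin n) :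
    ‖gramVec d n N s₀ (rowRadius d s₀) x‖ ≤ 1 := by
  have hρ := rowRadius_pos d (show 0 < s₀ by omega)
  have h : ‖gramVec d n N s₀ (rowRadius d s₀) x‖ ^ 2 ≤ 1 := by
    rw [← real_inner_self_eq_norm_sq, inner_gramVec s₀ hρ, inv_mul_le_iff₀ (by positivity), mul_one,
      rowRadius, Real.sq_sqrt (by positivity)]
    exact_mod_cast gramMat_diag_le hn hN hs hload x
  exact (sq_le_one_iff₀ (norm_nonneg _)).1 h

/-- The test vectors: a coordinate vector for each row, and a normalized indicator for each
progression whose length is a power of four. -/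
noncomputable def testVec (n : ℕ) :
    (Fin n × Fin n × Fin n) ⊕ (Fin n × Fin n × Fin n) → RowSpace n
  | .inl q => WithLp.toLp 2 (Sum.elim 0 fun q' => if q' = q then 1 else 0)
  | .inr (j, a, e) => WithLp.toLp 2 (Sum.elim
      (fun y => if (y : ℕ) ∈ progIdx (4 ^ (j : ℕ)) a e then (2 ^ (j : ℕ) : ℝ)⁻¹ else 0) 0)

@[simp] theorem testVec_inl_inl (q : Fin n × Fin n × Fin n) (y : Fin n) :
    testVec n (.inl q) (.inl y) = 0 := rfl
@[simp] theorem testVec_inl_inr (q q' : Fin n × Fin n × Fin n) :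
    testVec n (.inl q) (.inr q') = if q' = q then 1 else 0 := rfl
@[simp] theorem testVec_inr_inl (j a e y : Fin n) : testVec n (.inr (j, a, e)) (.inl y) =
    if (y : ℕ) ∈ progIdx (4 ^ (j : ℕ)) a e then (2 ^ (j : ℕ) : ℝ)⁻¹ else 0 := rfl
@[simp] theorem testVec_inr_inr (j a e : Fin n) (q : Fin n × Fin n × Fin n) :
    testVec n (.inr (j, a, e)) (.inr q) = 0 := rfl

theorem inner_testVec_inl (k a a' : Fin n) (u : RowSpace n) :
    ⟪testVec n (.inl (k, a, a')), u⟫_ℝ = u (.inr (k, a, a')) := by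
  rw [rowSpace_inner]
  simp only [testVec_inl_inl, zero_mul, Finset.sum_const_zero, zero_add, testVec_inl_inr]
  rw [Finset.sum_eq_single k _ (by simp), Finset.sum_eq_single a _ (by simp),
    Finset.sum_eq_single a' _ (by simp), if_pos rfl, one_mul]
  · intro b _ hb
    rw [if_neg (by simp [hb]), zero_mul]
  · intro b _ hb
    exact Finset.sum_eq_zero fun _ _ => by rw [if_neg (by simp [hb]), zero_mul]
  · intro b _ hb
    exact Finset.sum_eq_zero fun _ _ => Finset.sum_eq_zero fun _ _ => by
      rw [if_neg (by simp [hb]), zero_mul]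

theorem inner_testVec_inr (j a e : Fin n) (u : RowSpace n) :
    ⟪testVec n (.inr (j, a, e)), u⟫_ℝ =
      ∑ y : Fin n, (if (y : ℕ) ∈ progIdx (4 ^ (j : ℕ)) a e then (2 ^ (j : ℕ) : ℝ)⁻¹ else 0) *
        u (.inl y) := by
  rw [rowSpace_inner]
  simp

theorem norm_testVec_le (i : (Fin n × Fin n × Fin n) ⊕ (Fin n × Fin n × Fin n)) :
    ‖testVec n i‖ ^ 2 ≤ 1 := by
  rw [← real_inner_self_eq_norm_sq]
  rcases i with ⟨k, a, a'⟩ | ⟨j, a, e⟩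
  · rw [inner_testVec_inl]; simp
  · rw [inner_testVec_inr]
    have h1 : ∀ y : Fin n, (if (y : ℕ) ∈ progIdx (4 ^ (j : ℕ)) a e then (2 ^ (j : ℕ) : ℝ)⁻¹ else 0) *
        testVec n (.inr (j, a, e)) (.inl y) =
        (if (y : ℕ) ∈ progIdx (4 ^ (j : ℕ)) a e then 1 else 0) * (4 ^ (j : ℕ) : ℝ)⁻¹ := fun y => by
      rw [testVec_inr_inl]
      split_ifs
      · rw [one_mul, ← mul_inv, ← mul_pow]; norm_num
      · simp
    rw [Finset.sum_congr rfl fun y _ => h1 y, ← Finset.sum_mul, mul_inv_le_iff₀ (by positivity),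
      one_mul, Finset.sum_boole]
    have h2 : (Finset.univ.filter fun y : Fin n => (y : ℕ) ∈ progIdx (4 ^ (j : ℕ)) a e).card ≤
        4 ^ (j : ℕ) := by
      calc _ ≤ (progIdx (4 ^ (j : ℕ)) (a : ℕ) e).card :=
            Finset.card_le_card_of_injOn Fin.val (fun y hy => by simpa using hy)
              Fin.val_injective.injOn
        _ ≤ 4 ^ (j : ℕ) := Finset.card_image_le.trans (by simp)
    exact_mod_cast h2

/-- The colouring `c` has small sums on all rows and on all progressions whose length is a power
of four. -/
structure Balanced (d n : ℕ) (N : ℕ → ℕ) (s₀ : ℕ) (l : ℝ) (c : ℤ → ℤ) : Prop where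
  row : ∀ k a a' : ℕ, k < n → a' < n → 4 ^ k * s₀ ≤ n → RowOk d N (4 ^ k * s₀) a a' →
    |∑ t ∈ Finset.range (4 ^ k * s₀), (c (a + t * (a' - a) : ℕ) : ℝ)| * √(2 ^ k) ≤
      l * rowRadius d s₀
  prog : ∀ j a e : ℕ, j < n → e < n → 0 < e → (∀ t < 4 ^ j, a + t * e < n) →
    |∑ t ∈ Finset.range (4 ^ j), (c (a + t * e : ℕ) : ℝ)| * √s₀ ≤ l * rowRadius d s₀ * 2 ^ j

theorem sum_mul_indicator {s a e : ℕ} (he : 0 < e) (hs : ∀ t < s, a + t * e < n) (c : ℤ → ℤ) :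
    ∑ x : Fin n, (c (x : ℕ) : ℝ) * (if (x : ℕ) ∈ progIdx s a e then 1 else 0) =
      ∑ t ∈ Finset.range s, (c (a + t * e : ℕ) : ℝ) := by
  have h := sum_mul_progVec he hs fun x => c x
  have h' := congrArg (Int.cast : ℤ → ℝ) h
  simp only [progVec] at h'
  push_cast at h' ⊢
  exact h'

/-- The test of a row reads off its sum times `√(2 ^ k) / ρ`, and the test of a short progression
its sum times `√s₀ / (ρ * 2 ^ j)`. -/
theorem balanced_of_tests (hn : ∏ j ∈ Finset.range d, N j = n) {s₀ : ℕ} (hs : 4 ≤ s₀)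
    {l : ℝ} {c : ℤ → ℤ}
    (h : ∀ i, |⟪testVec n i, ∑ x : Fin n, (c (x : ℕ) : ℝ) •
      gramVec d n N s₀ (rowRadius d s₀) x⟫_ℝ| ≤ l) : Balanced d n N s₀ l c := by
  have hρ := rowRadius_pos d (show 0 < s₀ by omega)
  refine ⟨fun k a a' hk ha' hsn hok => ?_, fun j a e hj hen he hprog => ?_⟩
  · have ha : a < n := hok.1.trans ha'
    have h1 := h (.inl (⟨k, hk⟩, ⟨a, ha⟩, ⟨a', ha'⟩))
    rw [inner_testVec_inl] at h1
    have h2 : (∑ x : Fin n, (c (x : ℕ) : ℝ) • gramVec d n N s₀ (rowRadius d s₀) x)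
        (.inr (⟨k, hk⟩, ⟨a, ha⟩, ⟨a', ha'⟩)) =
        (∑ t ∈ Finset.range (4 ^ k * s₀), (c (a + t * (a' - a) : ℕ) : ℝ)) *
          (√(2 ^ k) / rowRadius d s₀) := by
      rw [← sum_mul_indicator (by have := hok.1; omega)
        (fun t ht => add_mul_lt_of_rowOk hn ha' hok ht), Finset.sum_mul]
      simp only [WithLp.ofLp_sum, Finset.sum_apply, PiLp.smul_apply, gramVec_inr, smul_eq_mul]
      refine Finset.sum_congr rfl fun x _ => ?_
      simp only [inRow, hsn, hok, true_and, mul_assoc, ite_mul, one_mul, zero_mul]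
    rw [h2, abs_mul, abs_of_nonneg (show 0 ≤ √(2 ^ k) / rowRadius d s₀ by positivity),
      ← mul_div_assoc, div_le_iff₀ hρ] at h1
    exact h1
  · have ha : a < n := by simpa using hprog 0 (by positivity)
    have h1 := h (.inr (⟨j, hj⟩, ⟨a, ha⟩, ⟨e, hen⟩))
    rw [inner_testVec_inr] at h1
    have h2 : ∑ y : Fin n, (if (y : ℕ) ∈ progIdx (4 ^ j) a e then (2 ^ j : ℝ)⁻¹ else 0) *
        (∑ x : Fin n, (c (x : ℕ) : ℝ) • gramVec d n N s₀ (rowRadius d s₀) x) (.inl y) =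
        (∑ t ∈ Finset.range (4 ^ j), (c (a + t * e : ℕ) : ℝ)) *
          (√s₀ / rowRadius d s₀ / 2 ^ j) := by
      rw [← sum_mul_indicator he hprog, Finset.sum_mul]
      refine Finset.sum_congr rfl fun y _ => ?_
      simp only [WithLp.ofLp_sum, Finset.sum_apply, PiLp.smul_apply, gramVec_inl, smul_eq_mul]
      rw [Finset.sum_eq_single y (fun b _ hb => by rw [if_neg hb, mul_zero]) (by simp), if_pos rfl]
      split_ifs
      · field_simp
      · simp
    rw [h2, abs_mul, abs_of_nonneg (show 0 ≤ √s₀ / rowRadius d s₀ / 2 ^ j by positivity),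
      ← mul_div_assoc, ← mul_div_assoc, div_le_iff₀ (by positivity), div_le_iff₀ hρ] at h1
    linarith

theorem one_add_one_div_pow_le (n : ℕ) : (1 + 1 / (n : ℝ)) ^ n ≤ 3 := by
  rcases Nat.eq_zero_or_pos n with rfl | hn
  · norm_num
  · have hn' : (0 : ℝ) < n := by exact_mod_cast hn
    calc (1 + 1 / (n : ℝ)) ^ n ≤ (Real.exp (1 / n)) ^ n := by
          gcongr
          rw [add_comm]
          exact Real.add_one_le_exp _
      _ = Real.exp 1 := by rw [← Real.exp_nat_mul]; congr 1; field_simp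
      _ ≤ 3 := Real.exp_one_lt_d9.le.trans (by norm_num)

open Classical in
/-- The output of the algorithm is a colouring that is balanced with high probability. -/
theorem exists_rand_mainP {M : ℤ → ℤ} (h0 : M 0 = d) (hd0 : 0 < d)
    (hM1 : ∀ j < d, M ((j : ℤ) + 1) = N j) (hM : ∀ z : ℤ, z < 0 → M z = 0)
    (hbdd : Bdd (digitBound n) M)
    (hn : ∏ j ∈ Finset.range d, N j = n) (hN : ∀ j < d, 2 ≤ N j) (hd : d ≤ n) :
    ∃ τ : Rand (ℤ → ℤ), τ.All (fun M' => ∀ i : Fin n, M' (i : ℕ) = 1 ∨ M' (i : ℕ) = -1) ∧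
      (∀ l : ℝ, 0 ≤ l → τ.ev (fun M' => if Balanced d n N (scaleSeq d N n) l M' then 0 else 1) ≤
        12 * n ^ 3 * Real.exp (-(l ^ 2 / 2))) ∧
      ∀ ω k, ∃ t ≤ mainTime n * unit (digitBound n),
        Run ω mainP ⟨M, k⟩ t ⟨(τ.run ω k).1, (τ.run ω k).2⟩ := by
  have hN1 : ∀ j < d, 1 ≤ N j := fun j hj => (by norm_num : 1 ≤ 2).trans (hN j hj)
  have hs4 := four_le_scaleSeq hn hN hd0
  have hload := load_scaleSeq_le hn hN1
  set s₀ := scaleSeq d N n with hs₀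
  have hρ := rowRadius_pos d (show 0 < s₀ by omega)
  obtain ⟨τ, h1, h2, h3⟩ := rnd_mainP (E := RowSpace n) h0 hM1 hM hn hN1 hd (hd0.trans_le hd)
    (fun s a a' _ ha' h t ht => add_mul_lt_of_rowOk hn ha' h ht)
    (fun i j => inner_gramVec s₀ hρ i j) (linearIndependent_gramVec (by omega) hρ)
    (norm_gramVec_le hn hN1 hs4 hload) hbdd
  refine ⟨τ, h1.mono fun _ h => h.2, fun l hl => ?_, h3⟩
  set S : (ℤ → ℤ) → RowSpace n := fun M' =>
    ∑ x : Fin n, (M' (x : ℕ) : ℝ) • gramVec d n N s₀ (rowRadius d s₀) x with hS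
  -- Chernoff's bound with `θ = ± l` times the test vector: the moment is at most `3 * exp (l ^ 2 /
  -- 2)`, and exceeding `l` is penalized by `exp (l ^ 2)`.
  have hexp : ∀ (i) (σ : ℝ), σ ^ 2 = 1 →
      τ.ev (fun M' => Real.exp (σ * l * ⟪testVec n i, S M'⟫_ℝ - l ^ 2)) ≤
        3 * Real.exp (-(l ^ 2 / 2)) := by
    intro i σ hσ
    have h4 := h2 ((σ * l) • testVec n i)
    have h5 : (fun M' => Real.exp (σ * l * ⟪testVec n i, S M'⟫_ℝ - l ^ 2)) =
        fun M' => Real.exp ⟪(σ * l) • testVec n i, S M'⟫_ℝ * Real.exp (-l ^ 2) := by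
      funext M'
      rw [← Real.exp_add, real_inner_smul_left]; ring_nf
    rw [h5, Rand.ev_mul_const]
    have h6 : ‖(σ * l) • testVec n i‖ ^ 2 ≤ l ^ 2 := by
      rw [norm_smul, mul_pow, Real.norm_eq_abs, sq_abs, mul_pow, hσ, one_mul]
      exact mul_le_of_le_one_right (sq_nonneg _) (norm_testVec_le i)
    calc _ ≤ (1 + 1 / (n : ℝ)) ^ n * Real.exp (‖(σ * l) • testVec n i‖ ^ 2 / 2) *
          Real.exp (-l ^ 2) := mul_le_mul_of_nonneg_right h4 (Real.exp_pos _).le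
      _ ≤ 3 * Real.exp (l ^ 2 / 2) * Real.exp (-l ^ 2) := by
          gcongr
          exact one_add_one_div_pow_le n
      _ = _ := by rw [mul_assoc, ← Real.exp_add]; ring_nf
  calc τ.ev (fun M' => if Balanced d n N s₀ l M' then 0 else 1) ≤
        τ.ev (fun M' => ∑ i, (Real.exp (1 * l * ⟪testVec n i, S M'⟫_ℝ - l ^ 2) +
          Real.exp (-1 * l * ⟪testVec n i, S M'⟫_ℝ - l ^ 2))) := by
        refine Rand.ev_mono (fun M' _ => ?_) h1
        split_ifs with hb
        · exact Finset.sum_nonneg fun i _ => by positivity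
        · obtain ⟨i, hi⟩ : ∃ i, l < |⟪testVec n i, S M'⟫_ℝ| := by
            by_contra hcon
            push Not at hcon
            exact hb (balanced_of_tests hn hs4 hcon)
          refine le_trans ?_ (Finset.single_le_sum (fun i _ => by positivity) (Finset.mem_univ i))
          set x := ⟪testVec n i, S M'⟫_ℝ
          rcases lt_abs.1 hi with hx | hx
          · have h7 : 1 ≤ Real.exp (1 * l * x - l ^ 2) := Real.one_le_exp (by nlinarith)
            have := Real.exp_pos (-1 * l * x - l ^ 2)
            linarith
          · have h7 : 1 ≤ Real.exp (-1 * l * x - l ^ 2) := Real.one_le_exp (by nlinarith)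
            have := Real.exp_pos (1 * l * x - l ^ 2)
            linarith
    -- There are `2 * n ^ 3` tests with two signs and a factor 3 each, hence the constant 12.
    _ ≤ ∑ i : (Fin n × Fin n × Fin n) ⊕ (Fin n × Fin n × Fin n),
          (3 * Real.exp (-(l ^ 2 / 2)) + 3 * Real.exp (-(l ^ 2 / 2))) := by
        rw [Rand.ev_sum]
        refine Finset.sum_le_sum fun i _ => ?_
        have h7 : τ.ev (fun M' => Real.exp (1 * l * ⟪testVec n i, S M'⟫_ℝ - l ^ 2) +
          Real.exp (-1 * l * ⟪testVec n i, S M'⟫_ℝ - l ^ 2)) =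
          τ.ev (fun M' => Real.exp (1 * l * ⟪testVec n i, S M'⟫_ℝ - l ^ 2)) +
          τ.ev (fun M' => Real.exp (-1 * l * ⟪testVec n i, S M'⟫_ℝ - l ^ 2)) := by
          have := Rand.ev_sum (Finset.univ : Finset Bool) (fun b M' =>
            Real.exp ((if b then 1 else -1) * l * ⟪testVec n i, S M'⟫_ℝ - l ^ 2)) τ
          simpa using this
        rw [h7]
        exact add_le_add (hexp i 1 (by norm_num)) (hexp i (-1) (by norm_num))
    _ = _ := by
        simp
        ring

end RAM

/-! ## The decomposition of progressions into aligned blocks -/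

namespace RAM

section Blocks

variable {h : ℕ → ℝ} {e : ℕ → ℝ} {u v : ℕ}

theorem abs_sum_run_le (H : ∀ j q, u ≤ 4 ^ j * q → 4 ^ j * (q + 1) ≤ v →
    |∑ p ∈ Finset.Ico (4 ^ j * q) (4 ^ j * (q + 1)), h p| ≤ e j) {j q m : ℕ}
    (hu : u ≤ 4 ^ j * q) (hv : 4 ^ j * (q + m) ≤ v) :
    |∑ p ∈ Finset.Ico (4 ^ j * q) (4 ^ j * (q + m)), h p| ≤ m * e j := by
  induction m with
  | zero => simp
  | succ m ih =>
    have h1 : 4 ^ j * q ≤ 4 ^ j * (q + m) := Nat.mul_le_mul_left _ (by omega)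
    have h2 : 4 ^ j * (q + m) ≤ 4 ^ j * (q + (m + 1)) := Nat.mul_le_mul_left _ (by omega)
    rw [← Finset.sum_Ico_consecutive h h1 h2]
    have h3 := ih (h2.trans hv)
    have h4 := H j (q + m) (hu.trans h1) hv
    have h5 := abs_add_le (∑ p ∈ Finset.Ico (4 ^ j * q) (4 ^ j * (q + m)), h p)
      (∑ p ∈ Finset.Ico (4 ^ j * (q + m)) (4 ^ j * (q + m + 1)), h p)
    push_cast
    rw [← add_assoc q m 1]
    linarith

theorem abs_sum_run_le_three (he : ∀ j, 0 ≤ e j) (H : ∀ j q, u ≤ 4 ^ j * q → 4 ^ j * (q + 1) ≤ v →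
    |∑ p ∈ Finset.Ico (4 ^ j * q) (4 ^ j * (q + 1)), h p| ≤ e j) {j q r : ℕ} (hqr : q ≤ r)
    (hr : r ≤ q + 3) (hu : u ≤ 4 ^ j * q) (hv : 4 ^ j * r ≤ v) :
    |∑ p ∈ Finset.Ico (4 ^ j * q) (4 ^ j * r), h p| ≤ 3 * e j := by
  obtain ⟨m, rfl⟩ := Nat.exists_eq_add_of_le hqr
  refine (abs_sum_run_le H hu hv).trans (mul_le_mul_of_nonneg_right ?_ (he j))
  have : m ≤ 3 := by omega
  exact_mod_cast this

/-- The expansion of the right end in base four uses at most three blocks of each length. -/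
theorem abs_sum_prefix_le (he : ∀ j, 0 ≤ e j) (H : ∀ j q, u ≤ 4 ^ j * q → 4 ^ j * (q + 1) ≤ v →
    |∑ p ∈ Finset.Ico (4 ^ j * q) (4 ^ j * (q + 1)), h p| ≤ e j) (J : ℕ) : ∀ {q w : ℕ},
    u ≤ 4 ^ J * q → 4 ^ J * q ≤ w → w < 4 ^ J * (q + 1) → w ≤ v →
    |∑ p ∈ Finset.Ico (4 ^ J * q) w, h p| ≤ 3 * ∑ j ∈ Finset.range J, e j := by
  induction J with
  | zero =>
    intro q w _ h2 h3 _
    obtain rfl : w = q := by simp only [pow_zero, one_mul] at h2 h3; omega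
    simp
  | succ J ih =>
    intro q w h1 h2 h3 h4
    rw [pow_succ, mul_assoc] at h1 h2 h3 ⊢
    have hJ : 0 < 4 ^ J := by positivity
    have e1 : 4 ^ J * (w / 4 ^ J) ≤ w := Nat.mul_div_le _ _
    have e2 : w < 4 ^ J * (w / 4 ^ J + 1) := Nat.lt_mul_div_succ _ hJ
    have e3 : 4 * q ≤ w / 4 ^ J := (Nat.le_div_iff_mul_le hJ).2 (by rwa [mul_comm])
    have e4 : w / 4 ^ J < 4 * (q + 1) := Nat.div_lt_of_lt_mul h3
    have e5 : 4 ^ J * (4 * q) ≤ 4 ^ J * (w / 4 ^ J) := Nat.mul_le_mul_left _ e3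
    rw [← Finset.sum_Ico_consecutive h e5 e1]
    have h5 := abs_sum_run_le_three he H e3 (by omega) h1 (e1.trans h4)
    have h6 := ih (h1.trans e5) e1 e2 h4
    have h7 := abs_add_le (∑ p ∈ Finset.Ico (4 ^ J * (4 * q)) (4 ^ J * (w / 4 ^ J)), h p)
      (∑ p ∈ Finset.Ico (4 ^ J * (w / 4 ^ J)) w, h p)
    rw [Finset.sum_range_succ]
    linarith

/-- The piece inside the subblock of `w` may be that whole subblock, and up to three more subblocks
follow it. A length can thus be charged in both pieces, which gives 6 where a prefix has 3. -/
theorem abs_sum_suffix_le (he : ∀ j, 0 ≤ e j) (H : ∀ j q, u ≤ 4 ^ j * q → 4 ^ j * (q + 1) ≤ v →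
    |∑ p ∈ Finset.Ico (4 ^ j * q) (4 ^ j * (q + 1)), h p| ≤ e j) (J : ℕ) : ∀ {q w : ℕ},
    u ≤ w → 4 ^ J * q ≤ w → w ≤ 4 ^ J * (q + 1) → 4 ^ J * (q + 1) ≤ v →
    |∑ p ∈ Finset.Ico w (4 ^ J * (q + 1)), h p| ≤ 6 * ∑ j ∈ Finset.range J, e j + 3 * e J := by
  induction J with
  | zero =>
    intro q w h1 h2 h3 h4
    rcases Nat.eq_or_lt_of_le h3 with h5 | h5
    · rw [h5]
      simpa using he 0
    · obtain rfl : w = 4 ^ 0 * q := by simp only [pow_zero, one_mul] at h2 h5 ⊢; omega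
      have h6 := H 0 q h1 h4
      have := he 0
      simp only [Finset.range_zero, Finset.sum_empty, mul_zero, zero_add]
      linarith
  | succ J ih =>
    intro q w h1 h2 h3 h4
    have hs : 0 ≤ ∑ j ∈ Finset.range J, e j := Finset.sum_nonneg fun j _ => he j
    have heJ := he J
    have heJ' := he (J + 1)
    rw [pow_succ, mul_assoc] at h2 h3 h4 ⊢
    have hJ : 0 < 4 ^ J := by positivity
    rw [Finset.sum_range_succ]
    rcases Nat.eq_or_lt_of_le h3 with h5 | h5
    · rw [h5, Finset.Ico_self, Finset.sum_empty, abs_zero]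
      linarith
    · have e1 : 4 ^ J * (w / 4 ^ J) ≤ w := Nat.mul_div_le _ _
      have e2 : w < 4 ^ J * (w / 4 ^ J + 1) := Nat.lt_mul_div_succ _ hJ
      have e3 : 4 * q ≤ w / 4 ^ J := (Nat.le_div_iff_mul_le hJ).2 (by rwa [mul_comm])
      have e4 : w / 4 ^ J < 4 * (q + 1) := Nat.div_lt_of_lt_mul h5
      have e5 : 4 ^ J * (w / 4 ^ J + 1) ≤ 4 ^ J * (4 * (q + 1)) := Nat.mul_le_mul_left _ e4
      rw [← Finset.sum_Ico_consecutive h e2.le e5]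
      have h6 := abs_sum_run_le_three he H (j := J) (q := w / 4 ^ J + 1) (r := 4 * (q + 1)) e4
        (by omega) (h1.trans e2.le) h4
      have h7 := ih h1 e1 e2.le (e5.trans h4)
      have h8 := abs_add_le (∑ p ∈ Finset.Ico w (4 ^ J * (w / 4 ^ J + 1)), h p)
        (∑ p ∈ Finset.Ico (4 ^ J * (w / 4 ^ J + 1)) (4 ^ J * (4 * (q + 1))), h p)
      linarith

/-- At the coarsest scale where the ends lie in different blocks, the interval is a suffix, a run of
at most three blocks, and a prefix. Shorter lengths are charged 6 + 3 times, this one 3 + 3 times.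
-/
theorem abs_sum_interval_le (he : ∀ j, 0 ≤ e j) (H : ∀ j q, u ≤ 4 ^ j * q → 4 ^ j * (q + 1) ≤ v →
    |∑ p ∈ Finset.Ico (4 ^ j * q) (4 ^ j * (q + 1)), h p| ≤ e j) (huv : u ≤ v) (J : ℕ) : ∀ {q : ℕ},
    4 ^ J * q ≤ u → v ≤ 4 ^ J * (q + 1) →
    |∑ p ∈ Finset.Ico u v, h p| ≤ 9 * ∑ j ∈ Finset.range (J + 1), e j := by
  induction J with
  | zero =>
    intro q h1 h2
    simp only [pow_zero, one_mul] at h1 h2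
    have h0 := he 0
    rw [Finset.sum_range_one]
    rcases Nat.eq_or_lt_of_le huv with h3 | h3
    · rw [h3, Finset.Ico_self, Finset.sum_empty, abs_zero]
      linarith
    · obtain rfl : u = q := by omega
      obtain rfl : v = u + 1 := by omega
      have := H 0 u (by simp) (by simp)
      simp only [pow_zero, one_mul] at this
      linarith
  | succ J ih =>
    intro q h1 h2
    have hJ : 0 < 4 ^ J := by positivity
    have e1 : 4 ^ J * (u / 4 ^ J) ≤ u := Nat.mul_div_le _ _
    have e2 : u < 4 ^ J * (u / 4 ^ J + 1) := Nat.lt_mul_div_succ _ hJ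
    have heJ := he (J + 1)
    rw [Finset.sum_range_succ]
    rcases le_or_gt v (4 ^ J * (u / 4 ^ J + 1)) with h3 | h3
    · have := ih e1 h3
      linarith
    · have e3 : 4 ^ J * (v / 4 ^ J) ≤ v := Nat.mul_div_le _ _
      have e4 : v < 4 ^ J * (v / 4 ^ J + 1) := Nat.lt_mul_div_succ _ hJ
      rw [pow_succ, mul_assoc] at h1 h2
      have e5 : 4 * q ≤ u / 4 ^ J := (Nat.le_div_iff_mul_le hJ).2 (by rwa [mul_comm])
      have e6 : v / 4 ^ J ≤ 4 * (q + 1) := Nat.div_le_of_le_mul h2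
      have e7 : u / 4 ^ J + 1 ≤ v / 4 ^ J := (Nat.le_div_iff_mul_le hJ).2 (by
        rw [mul_comm]; exact h3.le)
      have e8 : 4 ^ J * (u / 4 ^ J + 1) ≤ 4 ^ J * (v / 4 ^ J) := Nat.mul_le_mul_left _ e7
      rw [← Finset.sum_Ico_consecutive h e2.le (e8.trans e3), ← Finset.sum_Ico_consecutive h e8 e3]
      have h4 := abs_sum_suffix_le he H J le_rfl e1 e2.le h3.le
      have h5 := abs_sum_run_le_three he H (j := J) e7 (by omega) e2.le e3
      have h6 := abs_sum_prefix_le he H J (e2.le.trans e8) e3 e4 le_rfl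
      have h7 := abs_add_le (∑ p ∈ Finset.Ico u (4 ^ J * (u / 4 ^ J + 1)), h p)
        (∑ p ∈ Finset.Ico (4 ^ J * (u / 4 ^ J + 1)) (4 ^ J * (v / 4 ^ J)), h p +
          ∑ p ∈ Finset.Ico (4 ^ J * (v / 4 ^ J)) v, h p)
      have h8 := abs_add_le (∑ p ∈ Finset.Ico (4 ^ J * (u / 4 ^ J + 1)) (4 ^ J * (v / 4 ^ J)), h p)
        (∑ p ∈ Finset.Ico (4 ^ J * (v / 4 ^ J)) v, h p)
      have h9 : 0 ≤ ∑ j ∈ Finset.range J, e j := Finset.sum_nonneg fun j _ => he j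
      rw [Finset.sum_range_succ]
      have heJ0 := he J
      linarith

end Blocks

/-! ### The errors of the blocks and their sum -/

theorem sqrt_two_pow (k : ℕ) : √((2 : ℝ) ^ k) = √2 ^ k := by
  rw [Real.sqrt_eq_iff_mul_self_eq (by positivity) (by positivity), ← mul_pow,
    Real.mul_self_sqrt (by norm_num)]

/-- The errors of the blocks of the different sizes, in units of the error for single points. -/
noncomputable def blockErr (i j : ℕ) : ℝ := if j < i then 2 ^ j else 2 ^ i * (√2)⁻¹ ^ (j - i)

theorem blockErr_nonneg (i j : ℕ) : 0 ≤ blockErr i j := by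
  unfold blockErr; split_ifs <;> positivity

/-- Below `i` the terms double and sum to at most `2 ^ i`. From `i` on they decay with ratio `1 / √2
≤ 3 / 4` and sum to at most `4 * 2 ^ i`. -/
theorem sum_blockErr_le (i J : ℕ) : ∑ j ∈ Finset.range J, blockErr i j ≤ 5 * 2 ^ i := by
  have h1 : (√2)⁻¹ ≤ (3 / 4 : ℝ) := by
    have h4 : (4 / 3 : ℝ) ≤ √2 := Real.le_sqrt_of_sq_le (by norm_num)
    calc (√2)⁻¹ ≤ (4 / 3 : ℝ)⁻¹ := inv_anti₀ (by norm_num) h4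
      _ = _ := by norm_num
  have h2 : ∀ K, ∑ k ∈ Finset.range K, (3 / 4 : ℝ) ^ k ≤ 4 := fun K => by
    rw [geom_sum_eq (by norm_num)]
    have : (0 : ℝ) ≤ (3 / 4) ^ K := by positivity
    rw [div_le_iff_of_neg (by norm_num)]
    linarith
  have h3 : ∑ j ∈ Finset.range i, blockErr i j ≤ 2 ^ i := by
    have h : ∀ j ∈ Finset.range i, blockErr i j = 2 ^ j := fun j hj => by
      rw [blockErr, if_pos (Finset.mem_range.1 hj)]
    rw [Finset.sum_congr rfl h, geom_sum_eq (by norm_num)]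
    norm_num
  have h4 : ∑ j ∈ Finset.range J, blockErr i (i + j) ≤ 2 ^ i * 4 := by
    refine le_trans (le_of_eq (Finset.sum_congr rfl fun j _ => ?_))
      ((Finset.mul_sum _ _ _).symm.le.trans (mul_le_mul_of_nonneg_left
        ((Finset.sum_le_sum fun k _ => pow_le_pow_left₀ (by positivity) h1 k).trans (h2 J))
        (by positivity)))
    rw [blockErr, if_neg (by omega), Nat.add_sub_cancel_left]
  calc ∑ j ∈ Finset.range J, blockErr i j ≤ ∑ j ∈ Finset.range (i + J), blockErr i j :=
        Finset.sum_le_sum_of_subset_of_nonneg (Finset.range_subset_range.2 (by omega))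
          fun j _ _ => blockErr_nonneg i j
    _ = _ := Finset.sum_range_add _ _ _
    _ ≤ _ := by linarith

variable {d n : ℕ} {N : ℕ → ℕ}

/-- The sums of a balanced colouring on progressions in the box. -/
theorem Balanced.abs_sum_le (hn : ∏ j ∈ Finset.range d, N j = n) {i : ℕ} (hi : 1 ≤ i)
    {l : ℝ} (hl : 1 ≤ l) {c : ℤ → ℤ} (hc : Balanced d n N (4 ^ i) l c)
    (hc1 : ∀ x : Fin n, c (x : ℕ) = 1 ∨ c (x : ℕ) = -1) {f g : ℕ → ℤ} {m : ℕ}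
    (hbox : ∀ t < m, ∀ j < d, 0 ≤ f j + t * g j ∧ f j + t * g j < N j) (hg : 0 < ofDig d N g) :
    |∑ t ∈ Finset.range m, (c (ofDig d N f + t * ofDig d N g) : ℝ)| ≤
      45 * l * √(3 * 8 ^ d) * 2 ^ i := by
  set R : ℝ := √(3 * 8 ^ d) with hR
  have hR1 : 1 ≤ R := by
    rw [hR, Real.one_le_sqrt]
    have : (1 : ℝ) ≤ 8 ^ d := one_le_pow₀ (by norm_num)
    linarith
  have hsqrt : √((4 ^ i : ℕ) : ℝ) = 2 ^ i := by
    rw [Real.sqrt_eq_iff_mul_self_eq (by positivity) (by positivity), ← mul_pow]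
    push_cast; norm_num
  have hrad : rowRadius d (4 ^ i) = R * 2 ^ i := by
    rw [rowRadius, Real.sqrt_mul (by positivity), hsqrt]
  have hpos : ∀ k ≤ m, ∀ t < k, ∃ r : ℕ, (r : ℤ) = ofDig d N f + t * ofDig d N g ∧ r < n ∧
      ∀ j < d, (dig N j r : ℤ) = f j + t * g j := by
    intro k hk t ht
    have h1 := hbox t (by omega)
    have h2 := ofDig_nonneg (N := N) fun j hj => (h1 j hj).1
    have h3 := ofDig_lt (N := N) fun j hj => (h1 j hj).2
    have h4 : ofDig d N (fun j => f j + t * g j) = ofDig d N f + t * ofDig d N g :=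
      ofDig_add_mul _ _ _ _ _
    obtain ⟨r, hr⟩ := Int.eq_ofNat_of_zero_le h2
    have h5 : ((∏ j ∈ Finset.range d, N j : ℕ) : ℤ) = n := by rw [hn]
    push_cast at h5
    refine ⟨r, by rw [← h4, hr], by omega, fun j hj => ?_⟩
    exact dig_eq_of_ofDig (fun j hj => (h1 j hj).1) (fun j hj => (h1 j hj).2) hr.symm hj
  have htriv : (1 : ℝ) ≤ 45 * l * R * 2 ^ i := by
    have : (1 : ℝ) ≤ 2 ^ i := one_le_pow₀ (by norm_num)
    calc (1 : ℝ) = 1 * 1 * 1 * 1 := by norm_num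
      _ ≤ 45 * l * R * 2 ^ i := by gcongr; norm_num
  rcases Nat.lt_or_ge m 2 with hm | hm
  · refine le_trans ?_ htriv
    interval_cases m
    · simp
    · obtain ⟨r, hr, hrn, -⟩ := hpos 1 le_rfl 0 (by norm_num)
      rw [Finset.sum_range_one, ← hr]
      rcases hc1 ⟨r, hrn⟩ with h | h <;> simp only at h <;> rw [h] <;> simp
  obtain ⟨r₀, hr₀, -⟩ := hpos m le_rfl 0 (by omega)
  obtain ⟨β, hβ⟩ := Int.eq_ofNat_of_zero_le hg.le
  rw [Nat.cast_zero, zero_mul, add_zero] at hr₀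
  have hβ0 : 0 < β := by omega
  have hmem : ∀ t < m, r₀ + t * β < n ∧ ∀ j < d, (dig N j (r₀ + t * β) : ℤ) = f j + t * g j := by
    intro t ht
    obtain ⟨r, h1, h2, h3⟩ := hpos m le_rfl t ht
    have : r = r₀ + t * β := by
      zify
      rw [h1, ← hr₀, hβ]
    exact this ▸ ⟨h2, h3⟩
  -- The points of the residue class of `r₀` modulo `β` are numbered by their quotients. In this
  -- numbering the progression is an interval, and its 4-adic blocks are exactly the aligned
  -- progressions.
  set p₀ := r₀ / β with hp₀
  set ρ := r₀ % β with hρ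
  have hr₀' : r₀ = ρ + p₀ * β := by
    rw [hρ, hp₀, mul_comm]; exact (Nat.mod_add_div _ _).symm
  set h : ℕ → ℝ := fun p => (c (ρ + p * β : ℕ) : ℝ) with hh
  have hsum : ∑ t ∈ Finset.range m, (c (ofDig d N f + t * ofDig d N g) : ℝ) =
      ∑ p ∈ Finset.Ico p₀ (p₀ + m), h p := by
    rw [Finset.sum_Ico_eq_sum_range, Nat.add_sub_cancel_left]
    refine Finset.sum_congr rfl fun t _ => ?_
    rw [hh]
    simp only
    congr 2
    rw [← hr₀, hβ, hr₀']
    push_cast; ring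
  have hl0 : 0 ≤ l := by linarith
  have hblock : ∀ j q, p₀ ≤ 4 ^ j * q → 4 ^ j * (q + 1) ≤ p₀ + m →
      |∑ p ∈ Finset.Ico (4 ^ j * q) (4 ^ j * (q + 1)), h p| ≤ l * R * blockErr i j := by
    intro j q h1 h2
    have h4j : 0 < 4 ^ j := by positivity
    obtain ⟨t₀, ht₀⟩ := Nat.exists_eq_add_of_le h1
    rw [mul_add, mul_one, ht₀] at h2
    set a := r₀ + t₀ * β with ha
    have hat : ∀ t, a + t * β = r₀ + (t₀ + t) * β := fun t => by rw [ha]; ring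
    have haρ : a = ρ + 4 ^ j * q * β := by rw [ha, hr₀', ht₀]; ring
    have hlt : ∀ t < 4 ^ j, a + t * β < n := fun t ht => by
      rw [hat]; exact (hmem _ (by omega)).1
    have hs : ∑ p ∈ Finset.Ico (4 ^ j * q) (4 ^ j * (q + 1)), h p =
        ∑ t ∈ Finset.range (4 ^ j), (c (a + t * β : ℕ) : ℝ) := by
      rw [Finset.sum_Ico_eq_sum_range, mul_add, mul_one, Nat.add_sub_cancel_left]
      refine Finset.sum_congr rfl fun t _ => ?_
      rw [hh, haρ]
      simp only
      congr 3
      ring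
    rw [hs]
    have h4n : 4 ^ j ≤ n := by
      have := hlt (4 ^ j - 1) (by omega)
      have h5 : 4 ^ j - 1 ≤ (4 ^ j - 1) * β := Nat.le_mul_of_pos_right _ hβ0
      omega
    have hjn : j < n := (Nat.lt_pow_self (by norm_num : 1 < 4)).trans_le h4n
    have hβn : β < n := by
      have := (hmem 1 (by omega)).1
      rw [one_mul] at this
      omega
    unfold blockErr
    split_ifs with hji
    · have h5 := hc.prog j a β hjn hβn hβ0 hlt
      rw [hsqrt, hrad] at h5
      refine le_of_mul_le_mul_right ?_ (show (0 : ℝ) < 2 ^ i by positivity)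
      linarith
    · obtain ⟨k, rfl⟩ := Nat.exists_eq_add_of_le (not_lt.1 hji)
      have hs4 : 4 ^ k * 4 ^ i = 4 ^ (i + k) := by rw [pow_add, mul_comm]
      have h4s : 4 ≤ 4 ^ (i + k) := by
        calc 4 = 4 ^ 1 := by norm_num
          _ ≤ _ := Nat.pow_le_pow_right (by norm_num) (by omega)
      have hsub : a + β - a = β := by omega
      have hdig : ∀ t < 4 ^ (i + k), ∀ j < d, (dig N j (a + t * β) : ℤ) =
          f j + (t₀ + t : ℕ) * g j := fun t ht j hj => by
        rw [hat]; exact (hmem _ (by omega)).2 j hj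
      -- The quotient `a / β` is the start of the 4-adic block, a multiple of its length; this is
      -- the alignment of the row.
      have hok : RowOk d N (4 ^ (i + k)) a (a + β) := by
        refine ⟨by omega, ?_, fun j hj => ?_⟩
        · rw [hsub, haρ, Nat.add_mul_div_right _ _ hβ0, Nat.div_eq_of_lt (Nat.mod_lt _ hβ0), zero_add]
          exact Dvd.intro _ rfl
        · have d0 := hdig 0 (by omega) j hj
          have d1 := hdig 1 (by omega) j hj
          rw [zero_mul, add_zero, add_zero] at d0
          rw [one_mul] at d1
          have d2 := hbox (t₀ + (4 ^ (i + k) - 1)) (by omega) j hj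
          have d3 : lastDig N (4 ^ (i + k)) a (a + β) j =
              f j + ((t₀ + (4 ^ (i + k) - 1) : ℕ) : ℤ) * g j := by
            rw [lastDig, d0, d1]
            push_cast [Nat.cast_sub (show 1 ≤ 4 ^ (i + k) by omega)]
            ring
          rw [d3]
          exact d2
      have hk : 4 ^ k ≤ 4 ^ (i + k) := Nat.pow_le_pow_right (by norm_num) (by omega)
      have h5 := hc.row k a (a + β) ((Nat.lt_pow_self (by norm_num : 1 < 4)).trans_le (hk.trans h4n))
        (by simpa using hlt 1 (by omega)) (by rw [hs4]; exact h4n) (by rw [hs4]; exact hok)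
      rw [hs4, hsub, sqrt_two_pow, hrad] at h5
      rw [Nat.add_sub_cancel_left, inv_pow, ← mul_assoc, ← div_eq_mul_inv,
        le_div_iff₀ (by positivity)]
      linarith
  rw [hsum]
  -- Any large enough `J` will do, as the sum of the errors is bounded independently of it; the
  -- constant is `45 = 9 * 5`.
  obtain ⟨J, hJ⟩ : ∃ J, p₀ + m ≤ 4 ^ J := ⟨p₀ + m, (Nat.lt_pow_self (by norm_num)).le⟩
  have h5 := abs_sum_interval_le (fun j => mul_nonneg (by positivity) (blockErr_nonneg i j)) hblock
    (by omega) J (q := 0) (by simp) (by simpa using hJ)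
  rw [← Finset.mul_sum] at h5
  have h6 := sum_blockErr_le i (J + 1)
  have h7 : l * R * ∑ j ∈ Finset.range (J + 1), blockErr i j ≤ l * R * (5 * 2 ^ i) :=
    mul_le_mul_of_nonneg_left h6 (by positivity)
  linarith

end RAM

/-! ## The discrepancy of progressions in a box -/

namespace RAM

section Box

variable {d : ℕ}

/-- The side lengths of a box as a sequence that is continued by `1`. -/
def sides (N : Fin d → ℕ) (j : ℕ) : ℕ := if h : j < d then N ⟨j, h⟩ else 1

/-- The coordinates of a vector as a sequence that is continued by `0`. -/
def coords (x : Fin d → ℤ) (j : ℕ) : ℤ := if h : j < d then x ⟨j, h⟩ else 0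

@[simp] theorem sides_fin (N : Fin d → ℕ) (i : Fin d) : sides N i = N i := by simp [sides]

@[simp] theorem coords_fin (x : Fin d → ℤ) (i : Fin d) : coords x i = x i := by simp [coords]

theorem prod_sides (N : Fin d → ℕ) : ∏ j ∈ Finset.range d, sides N j = (box N).card := by
  rw [Finset.prod_range, box, Pi.card_Icc]
  simp

theorem outCell_eq (N : Fin d → ℕ) (x : Fin d → ℤ) :
    outCell N x = ofDig d (sides N) (coords fun i => x i - 1) := by
  rw [outCell, ofDig, Finset.sum_range]
  refine Finset.sum_congr rfl fun i _ => ?_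
  rw [coords_fin, ← Nat.Iio_eq_range, ← Fin.map_valEmbedding_Iio, Finset.prod_map]
  simp

theorem outCell_add_mul (N : Fin d → ℕ) (a b : Fin d → ℤ) (t : ℤ) :
    outCell N (a + t • b) = outCell N a + t * ofDig d (sides N) (coords b) := by
  rw [outCell_eq, outCell_eq, ← ofDig_add_mul]
  refine congrArg _ (funext fun j => ?_)
  unfold coords
  split_ifs
  · simp only [Pi.add_apply, Pi.smul_apply, smul_eq_mul]; ring
  · ring

theorem mem_box_iff {N : Fin d → ℕ} {x : Fin d → ℤ} : x ∈ box N ↔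
    ∀ j < d, 0 ≤ coords (fun i => x i - 1) j ∧ coords (fun i => x i - 1) j < sides N j := by
  rw [box, Finset.mem_Icc, Pi.le_def, Pi.le_def, ← forall_and]
  constructor
  · intro h j hj
    have := h ⟨j, hj⟩
    simp only [coords, sides, hj, dite_true]
    omega
  · intro h i
    have := h i i.2
    rw [coords_fin, sides_fin] at this
    omega

theorem exists_outCell_eq {N : Fin d → ℕ} {x : Fin d → ℤ} (hx : x ∈ box N) :
    ∃ r : Fin (box N).card, ((r : ℕ) : ℤ) = outCell N x := by
  rw [mem_box_iff] at hx
  have h1 := ofDig_nonneg (N := sides N) fun j hj => (hx j hj).1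
  have h2 := ofDig_lt (N := sides N) fun j hj => (hx j hj).2
  obtain ⟨r, hr⟩ := Int.eq_ofNat_of_zero_le h1
  have h3 : ((∏ j ∈ Finset.range d, sides N j : ℕ) : ℤ) = (box N).card := by rw [prod_sides]
  push_cast at h3
  exact ⟨⟨r, by omega⟩, by rw [outCell_eq, hr]⟩

theorem outCell_injOn (N : Fin d → ℕ) : Set.InjOn (outCell N) (box N) := by
  intro x hx y hy h
  obtain ⟨r, hr⟩ := exists_outCell_eq hx
  have hr' := hr.trans h
  rw [outCell_eq] at hr hr'
  rw [Finset.mem_coe, mem_box_iff] at hx hy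
  funext i
  have h1 := dig_eq_of_ofDig (fun j hj => (hx j hj).1) (fun j hj => (hx j hj).2) hr i.2
  have h2 := dig_eq_of_ofDig (fun j hj => (hy j hj).1) (fun j hj => (hy j hj).2) hr' i.2
  rw [coords_fin] at h1 h2
  omega

/-- The bound on the sums of a balanced colouring. -/
noncomputable def progBound (d i : ℕ) (l : ℝ) : ℝ := 45 * l * √(3 * 8 ^ d) * 2 ^ i

theorem one_le_progBound (d i : ℕ) {l : ℝ} (hl : 1 ≤ l) : 1 ≤ progBound d i l := by
  have h1 : (1 : ℝ) ≤ 2 ^ i := one_le_pow₀ (by norm_num)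
  have h2 : (1 : ℝ) ≤ √(3 * 8 ^ d) := by
    rw [Real.one_le_sqrt]
    have : (1 : ℝ) ≤ 8 ^ d := one_le_pow₀ (by norm_num)
    linarith
  calc (1 : ℝ) = 1 * 1 * 1 * 1 := by norm_num
    _ ≤ 45 * l * √(3 * 8 ^ d) * 2 ^ i := by gcongr; norm_num

variable {N : Fin d → ℕ} {i : ℕ} {l : ℝ} {c : ℤ → ℤ}

theorem Balanced.abs_sum_outCell_le_of_pos (hi : 1 ≤ i) (hl : 1 ≤ l)
    (hc : Balanced d (box N).card (sides N) (4 ^ i) l c)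
    (hc1 : ∀ x : Fin (box N).card, c (x : ℕ) = 1 ∨ c (x : ℕ) = -1) {a b : Fin d → ℤ} {m : ℕ}
    (hab : ∀ t < m, a + (t : ℤ) • b ∈ box N) (hb : 0 < ofDig d (sides N) (coords b)) :
    |∑ t ∈ Finset.range m, (c (outCell N (a + (t : ℤ) • b)) : ℝ)| ≤ progBound d i l := by
  simp only [outCell_add_mul, outCell_eq N a]
  refine hc.abs_sum_le (prod_sides N) hi hl hc1 (fun t ht j hj => ?_) hb
  have := mem_box_iff.1 (hab t ht) j hj
  simp only [coords, hj, dite_true, Pi.add_apply, Pi.smul_apply, smul_eq_mul] at this ⊢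
  constructor <;> linarith

/-- A negative difference of ranks is made positive by reversing the progression. A zero difference
would give two points of the box the same rank, hence `b = 0`. -/
theorem Balanced.abs_sum_outCell_le (hi : 1 ≤ i) (hl : 1 ≤ l)
    (hc : Balanced d (box N).card (sides N) (4 ^ i) l c)
    (hc1 : ∀ x : Fin (box N).card, c (x : ℕ) = 1 ∨ c (x : ℕ) = -1) {a b : Fin d → ℤ} {m : ℕ}
    (hab : ∀ t < m, a + (t : ℤ) • b ∈ box N) (hb : b ≠ 0) :
    |∑ t ∈ Finset.range m, (c (outCell N (a + (t : ℤ) • b)) : ℝ)| ≤ progBound d i l := by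
  rcases Nat.lt_or_ge m 2 with hm | hm
  · refine le_trans ?_ (one_le_progBound d i hl)
    interval_cases m
    · simp
    · obtain ⟨r, hr⟩ := exists_outCell_eq (hab 0 (by norm_num))
      rw [Finset.sum_range_one, ← hr]
      rcases hc1 r with h | h <;> rw [h] <;> simp
  rcases lt_trichotomy 0 (ofDig d (sides N) (coords b)) with h | h | h
  · exact hc.abs_sum_outCell_le_of_pos hi hl hc1 hab h
  · refine absurd ?_ hb
    have h2 := outCell_injOn N (hab 1 (by omega)) (hab 0 (by omega))
      (by rw [outCell_add_mul, outCell_add_mul, ← h, mul_zero, mul_zero])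
    simpa using h2
  · have hneg : ofDig d (sides N) (coords (-b)) = -ofDig d (sides N) (coords b) := by
      have := outCell_add_mul N 0 b (-1)
      have h2 := outCell_add_mul N 0 (-b) 1
      rw [one_smul] at h2
      rw [neg_smul, one_smul] at this
      linarith
    have hrev : ∀ t < m, a + ((m - 1 : ℕ) : ℤ) • b + (t : ℤ) • (-b) =
        a + ((m - 1 - t : ℕ) : ℤ) • b := fun t ht => by
      rw [show ((m - 1 - t : ℕ) : ℤ) = ((m - 1 : ℕ) : ℤ) - t by omega, sub_smul, smul_neg]
      abel
    have := hc.abs_sum_outCell_le_of_pos hi hl hc1 (a := a + ((m - 1 : ℕ) : ℤ) • b) (b := -b)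
      (m := m) (fun t ht => by rw [hrev t ht]; exact hab _ (by omega)) (by rw [hneg]; omega)
    rw [Finset.sum_congr rfl fun t ht => by rw [hrev t (Finset.mem_range.1 ht)]] at this
    rwa [Finset.sum_range_reflect (fun t => (c (outCell N (a + (t : ℤ) • b)) : ℝ)) m] at this

/-- The box is convex, so a progression meets it in an interval of indices. -/
theorem filter_range_mem_box (N : Fin d → ℕ) (a b : Fin d → ℤ) (L : ℕ) :
    ∃ u m, {t ∈ Finset.range L | a + ((t : ℕ) : ℤ) • b ∈ box N} =
      (Finset.range m).map (addLeftEmbedding u) := by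
  set T := {t ∈ Finset.range L | a + ((t : ℕ) : ℤ) • b ∈ box N} with hT
  rcases T.eq_empty_or_nonempty with h | h
  · exact ⟨0, 0, by simp [h]⟩
  refine ⟨T.min' h, T.max' h + 1 - T.min' h, ?_⟩
  have hu := T.min'_mem h
  have hv := T.max'_mem h
  ext t
  simp only [Finset.mem_map, Finset.mem_range, addLeftEmbedding_apply]
  constructor
  · intro ht
    have h1 := T.min'_le t ht
    have h2 := T.le_max' t ht
    exact ⟨t - T.min' h, by omega, by omega⟩
  · rintro ⟨s, hs, rfl⟩
    generalize T.min' h = u at *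
    generalize T.max' h = v at *
    simp only [hT, Finset.mem_filter, Finset.mem_range, box, Finset.mem_Icc, Pi.le_def,
      Pi.add_apply, Pi.smul_apply, smul_eq_mul] at hu hv ⊢
    refine ⟨by omega, fun j => ?_, fun j => ?_⟩
    · have h1 := hu.2.1 j
      have h2 := hv.2.1 j
      rcases le_total 0 (b j) with hb | hb <;> push_cast
      · nlinarith
      · have : (u : ℤ) + s ≤ v := by omega
        nlinarith
    · have h1 := hu.2.2 j
      have h2 := hv.2.2 j
      rcases le_total 0 (b j) with hb | hb <;> push_cast
      · have : (u : ℤ) + s ≤ v := by omega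
        nlinarith
      · nlinarith

theorem Balanced.discWith_le (hi : 1 ≤ i) (hl : 1 ≤ l)
    (hc : Balanced d (box N).card (sides N) (4 ^ i) l c)
    (hc1 : ∀ x : Fin (box N).card, c (x : ℕ) = 1 ∨ c (x : ℕ) = -1) {χ : box N → ℤˣ}
    (hχ : ∀ x : box N, c (outCell N x) = χ x) :
    (discWith (boxAPs N) χ : ℝ) ≤ progBound d i l := by
  have h0 := one_le_progBound d i hl
  rw [← Nat.le_floor_iff (by linarith), discWith]
  refine Finset.sup_le fun A hA => ?_
  rw [Nat.le_floor_iff (by linarith), Nat.cast_natAbs, Int.cast_abs]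
  simp only [boxAPs, Finset.mem_filter, Finset.mem_univ, true_and] at hA
  obtain ⟨a, b, L, -, rfl⟩ := hA
  set A := Finset.univ.filter fun x : box N => (x : Fin d → ℤ) ∈ arithProg a b L with hA
  have hsum : ((∑ x ∈ A, (χ x : ℤ) : ℤ) : ℝ) =
      ∑ y ∈ A.map (Function.Embedding.subtype _), (c (outCell N y) : ℝ) := by
    rw [Finset.sum_map, Int.cast_sum]
    exact Finset.sum_congr rfl fun x _ => by
      rw [← hχ]; rfl
  have hmap : A.map (Function.Embedding.subtype _) =
      {t ∈ Finset.range L | a + ((t : ℕ) : ℤ) • b ∈ box N}.image fun t : ℕ => a + (t : ℤ) • b := by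
    ext y
    simp only [hA, arithProg, Finset.mem_map, Finset.mem_filter, Finset.mem_univ, true_and,
      Finset.mem_image, Function.Embedding.coe_subtype]
    constructor
    · rintro ⟨x, ⟨t, ht, hx⟩, rfl⟩
      exact ⟨t, ⟨ht, hx ▸ x.2⟩, hx⟩
    · rintro ⟨t, ⟨ht, hx⟩, rfl⟩
      exact ⟨⟨_, hx⟩, ⟨t, ht, rfl⟩, rfl⟩
  rw [hsum, hmap]
  obtain ⟨u, m, hum⟩ := filter_range_mem_box N a b L
  have hmem : ∀ t < m, a + (u : ℤ) • b + (t : ℤ) • b ∈ box N := fun t ht => by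
    have : u + t ∈ {t ∈ Finset.range L | a + ((t : ℕ) : ℤ) • b ∈ box N} := by
      rw [hum]
      exact Finset.mem_map.2 ⟨t, Finset.mem_range.2 ht, rfl⟩
    have h2 := (Finset.mem_filter.1 this).2
    rwa [Nat.cast_add, add_smul, ← add_assoc] at h2
  rw [hum, Finset.map_eq_image, Finset.image_image]
  -- With `b = 0` the parametrization is not injective and the set is a single point or empty.
  by_cases hb : b = 0
  · subst hb
    rcases Nat.eq_zero_or_pos m with rfl | hm
    · simpa using zero_le_one.trans h0
    · have : ((Finset.range m).image ((fun t : ℕ => a + (t : ℤ) • (0 : Fin d → ℤ)) ∘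
          addLeftEmbedding u)) = {a} := by
        have h1 : ((fun t : ℕ => a + (t : ℤ) • (0 : Fin d → ℤ)) ∘ addLeftEmbedding u) =
            fun _ => a := by
          funext t; simp
        rw [h1, Finset.image_const ⟨0, Finset.mem_range.2 hm⟩]
      rw [this, Finset.sum_singleton]
      have h2 := hmem 0 hm
      rw [smul_zero, smul_zero, add_zero, add_zero] at h2
      obtain ⟨r, hr⟩ := exists_outCell_eq h2
      refine le_trans ?_ h0
      rw [← hr]
      rcases hc1 r with h | h <;> rw [h] <;> simp
  · rw [Finset.sum_image]
    · refine le_trans (le_of_eq ?_) (hc.abs_sum_outCell_le hi hl hc1 hmem hb)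
      refine congrArg _ (Finset.sum_congr rfl fun t _ => ?_)
      simp only [Function.comp, addLeftEmbedding_apply, Nat.cast_add, add_smul, add_assoc]
    · intro t _ t' _ h
      simp only [Function.comp, addLeftEmbedding_apply, add_right_inj] at h
      have h1 := smul_left_injective ℤ hb h
      simpa using h1

/-- The rejected scale `s = s₀ / 4` is below the product of `⌊N_j / s⌋` over `I = {j : s ≤ N_j}`.
Multiplication by `s ^ |I|` gives `s ^ (|I| + 1) ≤ ∏_I N_j`, and the root of order `2 |I| + 2` gives
`√s ≤ f(N)`. -/
theorem two_pow_le_boxF (hi : 4 ^ i = scaleSeq d (sides N) (box N).card) (hi1 : 1 ≤ i) :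
    (2 : ℝ) ^ i ≤ 2 * boxF N := by
  have h4 : 4 ≤ 4 ^ i := by
    calc 4 = 4 ^ 1 := by norm_num
      _ ≤ _ := Nat.pow_le_pow_right (by norm_num) hi1
  rcases scaleSeq_spec d (sides N) (box N).card with h | ⟨s, hs1, hs, hload⟩
  · omega
  have h2i : (2 : ℝ) ^ i = 2 * √s := by
    have h5 : (4 : ℝ) ^ i = 4 * s := by exact_mod_cast hi.trans hs
    have h6 : (2 : ℝ) ^ i = √(4 ^ i) := by
      rw [show (4 : ℝ) = 2 * 2 by norm_num, mul_pow, Real.sqrt_mul_self (by positivity)]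
    rw [h6, h5, Real.sqrt_mul (by norm_num), show (4 : ℝ) = 2 * 2 by norm_num,
      Real.sqrt_mul_self (by norm_num)]
  rw [h2i]
  refine mul_le_mul_of_nonneg_left ?_ (by norm_num)
  set I : Finset (Fin d) := Finset.univ.filter fun j => s ≤ N j with hI
  have h1 : s ^ (I.card + 1) ≤ ∏ j ∈ I, N j := by
    have h2 : load d (sides N) s = ∏ j ∈ I, N j / s := by
      rw [load, Finset.prod_range, hI, Finset.prod_filter]
      refine Finset.prod_congr rfl fun j _ => ?_
      rw [sides_fin]
      split_ifs with h
      · exact max_eq_right ((Nat.one_le_div_iff (by omega)).2 h)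
      · rw [Nat.div_eq_of_lt (not_le.1 h)]; rfl
    calc s ^ (I.card + 1) = s ^ I.card * s := pow_succ _ _
      _ ≤ s ^ I.card * ∏ j ∈ I, N j / s := Nat.mul_le_mul_left _ (h2 ▸ hload.le)
      _ = ∏ j ∈ I, s * (N j / s) := by rw [Finset.prod_mul_distrib, Finset.prod_const]
      _ ≤ _ := Finset.prod_le_prod' fun j _ => Nat.mul_div_le _ _
  have h3 : √(s : ℝ) = ((s : ℝ) ^ (I.card + 1)) ^ (1 / (2 * (I.card : ℝ) + 2)) := by
    rw [← Real.rpow_natCast, ← Real.rpow_mul (by positivity), Real.sqrt_eq_rpow]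
    congr 1
    push_cast
    field_simp
  rw [h3]
  refine le_trans (Real.rpow_le_rpow (by positivity) ?_ (by positivity))
    (Finset.le_sup' (fun I : Finset (Fin d) =>
      (∏ i ∈ I, (N i : ℝ)) ^ (1 / (2 * (I.card : ℝ) + 2))) (Finset.mem_univ I))
  exact_mod_cast h1

end Box

end RAM

/-! ## The algorithm -/

namespace RAM

section Main

variable {d : ℕ}

theorem two_pow_le_card_box {N : Fin d → ℕ} (hN : ∀ i, 1 < N i) : 2 ^ d ≤ (box N).card := by
  rw [← prod_sides]
  calc 2 ^ d = ∏ _j ∈ Finset.range d, 2 := by simp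
    _ ≤ _ := Finset.prod_le_prod' fun j hj => by
      rw [sides, dif_pos (Finset.mem_range.1 hj)]
      exact hN _

theorem input_mem_succ (N : Fin d → ℕ) {j : ℕ} (hj : j < d) :
    (input N).mem ((j : ℤ) + 1) = sides N j := by
  simp only [input]
  rw [if_neg (by omega), Finset.sum_eq_single ⟨j, hj⟩]
  · simp [sides, hj]
  · intro i _ hi
    rw [if_neg]
    intro h
    exact hi (Fin.ext (by simp only; omega))
  · simp

theorem input_mem_eq_zero (N : Fin d → ℕ) {z : ℤ} (hz : z < 0 ∨ d < z) : (input N).mem z = 0 := by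
  simp only [input]
  rw [if_neg (by omega)]
  exact Finset.sum_eq_zero fun i _ => if_neg (by have := i.2; omega)

theorem natAbs_input_mem_le {N : Fin d → ℕ} (hN : ∀ i, 1 < N i) (z : ℤ) :
    ((input N).mem z).natAbs ≤ (box N).card := by
  rcases lt_or_ge z 0 with hz | hz
  · rw [input_mem_eq_zero N (Or.inl hz)]; exact Nat.zero_le _
  obtain ⟨k, rfl⟩ := Int.eq_ofNat_of_zero_le hz
  rcases k with _ | j
  · simpa [input] using Nat.lt_two_pow_self.le.trans (two_pow_le_card_box hN)
  · rcases Nat.lt_or_ge j d with hj | hj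
    · rw [Nat.cast_succ, input_mem_succ N hj, ← prod_sides, Int.natAbs_natCast]
      refine Finset.single_le_prod' (fun i hi => ?_) (Finset.mem_range.2 hj)
      rw [sides, dif_pos (Finset.mem_range.1 hi)]
      exact (hN _).le
    · rw [input_mem_eq_zero N (Or.inr (by omega))]; exact Nat.zero_le _

theorem bdd_input {N : Fin d → ℕ} (hN : ∀ i, 1 < N i) :
    Bdd (digitBound (box N).card) (input N).mem := by
  refine ⟨by unfold digitBound; omega, fun z => ?_⟩
  exact lt_digitBound (c := (box N).card)
    ((natAbs_input_mem_le hN z).trans Nat.lt_two_pow_self.le) (by omega)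

/-- The colouring that is read off the memory. -/
def coloring (N : Fin d → ℕ) (M : ℤ → ℤ) (x : box N) : ℤˣ := if M (outCell N x) = 1 then 1 else -1

theorem coe_coloring {N : Fin d → ℕ} {M : ℤ → ℤ}
    (hM : ∀ r : Fin (box N).card, M (r : ℕ) = 1 ∨ M (r : ℕ) = -1) (x : box N) :
    M (outCell N x) = (coloring N M x : ℤ) := by
  obtain ⟨r, hr⟩ := exists_outCell_eq x.2
  rw [coloring, ← hr]
  rcases hM r with h | h <;> rw [h] <;> simp

open Classical in
/-- The behaviour of the program on the input `N`. -/
theorem exists_rand_coloring (hd : 0 < d) {N : Fin d → ℕ} (hN : ∀ i, 1 < N i) :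
    ∃ τ : Rand (ℤ → ℤ), (∀ ω, ∃ t ≤ mainTime (box N).card * unit (digitBound (box N).card),
        Outputs mainP N ω t (coloring N (τ.run ω 0).1)) ∧
      ∀ l : ℝ, 1 ≤ l → 1 - 12 * ((box N).card : ℝ) ^ 3 * Real.exp (-(l ^ 2 / 2)) ≤
        coins.real {ω | (discWith (boxAPs N) (coloring N (τ.run ω 0).1) : ℝ) ≤
          90 * l * √(3 * 8 ^ d) * boxF N} := by
  have hN' : ∀ j < d, 2 ≤ sides N j := fun j hj => by
    rw [sides, dif_pos hj]; exact hN _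
  obtain ⟨τ, h1, h2, h3⟩ := exists_rand_mainP (M := (input N).mem) (N := sides N)
    (n := (box N).card) (by simp [input]) hd (fun j hj => input_mem_succ N hj)
    (fun z hz => input_mem_eq_zero N (Or.inl hz)) (bdd_input hN) (prod_sides N) hN'
    (Nat.lt_two_pow_self.le.trans (two_pow_le_card_box hN))
  refine ⟨τ, fun ω => ?_, fun l hl => ?_⟩
  · obtain ⟨t, ht, hrun⟩ := h3 ω 0
    exact ⟨t, ht, _, hrun, fun x => coe_coloring (h1.run ω 0) x⟩
  · obtain ⟨i, hi⟩ := scaleSeq_eq_pow d (sides N) (box N).card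
    have hi1 : 1 ≤ i := by
      by_contra h
      have := four_le_scaleSeq (prod_sides N) hN' hd
      rw [hi, show i = 0 by omega] at this
      omega
    have hbad := h2 l (by linarith)
    rw [hi] at hbad
    have hgood : (1 : ℝ) - τ.ev (fun M' => if Balanced d (box N).card (sides N) (4 ^ i) l M'
        then 0 else 1) ≤ coins.real {ω | Balanced d (box N).card (sides N) (4 ^ i) l
          (τ.run ω 0).1} := by
      have hm := Rand.coins_real_eq
        (fun M' => ¬ Balanced d (box N).card (sides N) (4 ^ i) l M') τ 0
      have h4 := MeasureTheory.probReal_compl_eq_one_sub (μ := coins) hm.1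
      rw [hm.2] at h4
      refine le_trans (le_of_eq ?_) (h4.symm.le.trans ?_)
      · refine congrArg (fun Φ => 1 - τ.ev Φ) (funext fun M' => ?_)
        by_cases h : Balanced d (box N).card (sides N) (4 ^ i) l M' <;> simp [h]
      · exact MeasureTheory.measureReal_mono fun ω hω => not_not.1 hω
    refine le_trans (by linarith) (hgood.trans (MeasureTheory.measureReal_mono fun ω hω => ?_))
    have h5 := Balanced.discWith_le hi1 hl hω (h1.run ω 0)
      (fun x => coe_coloring (h1.run ω 0) x)
    refine h5.trans ?_
    have h6 := two_pow_le_boxF hi.symm hi1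
    calc progBound d i l = 45 * l * √(3 * 8 ^ d) * 2 ^ i := rfl
      _ ≤ 45 * l * √(3 * 8 ^ d) * (2 * boxF N) := by gcongr
      _ = _ := by ring

/-! ### The deviation that makes the failure probability polynomially small -/

/-- The constant in the discrepancy bound that fails with probability at most `n ^ (-c)`. -/
noncomputable def discConst (d : ℕ) (c : ℝ) : ℝ := 90 * √(2 * (c + 7)) * √(3 * 8 ^ d)

theorem discConst_pos (d : ℕ) {c : ℝ} (hc : 0 < c) : 0 < discConst d c := by
  unfold discConst; positivity

/-- With `l ^ 2 / 2 = (c + 7) * log n` the exponential is `n ^ (-c - 7)`; the spare `n ^ (-7)`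
absorbs `12 * n ^ 3`, because `n ^ 4 ≥ 16`. -/
theorem twelve_mul_pow_mul_exp_le {c : ℝ} (hc : 0 < c) {n : ℕ} (hn : 2 ≤ n) :
    1 ≤ √(2 * (c + 7)) * √(Real.log n) ∧
      12 * (n : ℝ) ^ 3 * Real.exp (-((√(2 * (c + 7)) * √(Real.log n)) ^ 2 / 2)) ≤
        (n : ℝ) ^ (-c) := by
  have hn2 : (2 : ℝ) ≤ n := by exact_mod_cast hn
  have hlog : 0.69 ≤ Real.log n :=
    (by linarith [Real.log_two_gt_d9] : 0.69 ≤ Real.log 2).trans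
      (Real.log_le_log (by norm_num) hn2)
  constructor
  · rw [← Real.sqrt_mul (by positivity), Real.one_le_sqrt]
    nlinarith
  · rw [mul_pow, Real.sq_sqrt (by positivity), Real.sq_sqrt (by linarith),
      show -(2 * (c + 7) * Real.log n / 2) = Real.log n * (-c - 7) by ring,
      ← Real.rpow_def_of_pos (by linarith), sub_eq_add_neg, Real.rpow_add (by linarith),
      Real.rpow_neg (by linarith) 7]
    have h7 : (n : ℝ) ^ (7 : ℝ) = (n : ℝ) ^ 3 * (n : ℝ) ^ 4 := by
      rw [← pow_add, ← Real.rpow_natCast]; norm_num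
    have h4 : (12 : ℝ) ≤ (n : ℝ) ^ 4 := by
      calc (12 : ℝ) ≤ 2 ^ 4 := by norm_num
        _ ≤ _ := by gcongr
    have hpos : (0 : ℝ) < (n : ℝ) ^ (-c) := Real.rpow_pos_of_pos (by linarith) _
    have hn0 : (n : ℝ) ≠ 0 := by positivity
    rw [h7]
    calc 12 * (n : ℝ) ^ 3 * ((n : ℝ) ^ (-c) * ((n : ℝ) ^ 3 * (n : ℝ) ^ 4)⁻¹) =
        (n : ℝ) ^ (-c) * (12 / (n : ℝ) ^ 4) := by field_simp
      _ ≤ (n : ℝ) ^ (-c) * 1 := by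
        gcongr
        rw [div_le_one (by positivity)]
        exact h4
      _ = _ := mul_one _

theorem exists_rand_coloring_log (hd : 0 < d) {N : Fin d → ℕ} (hN : ∀ i, 1 < N i) :
    ∃ τ : Rand (ℤ → ℤ), (∀ ω, ∃ t ≤ mainTime (box N).card * unit (digitBound (box N).card),
        Outputs mainP N ω t (coloring N (τ.run ω 0).1)) ∧
      ∀ c : ℝ, 0 < c → 1 - ((box N).card : ℝ) ^ (-c) ≤
        coins.real {ω | (discWith (boxAPs N) (coloring N (τ.run ω 0).1) : ℝ) ≤
          discConst d c * √(Real.log (box N).card) * boxF N} := by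
  obtain ⟨τ, h1, h2⟩ := exists_rand_coloring hd hN
  refine ⟨τ, h1, fun c hc => ?_⟩
  have hn : 2 ≤ (box N).card := by
    calc 2 = 2 ^ 1 := by norm_num
      _ ≤ 2 ^ d := Nat.pow_le_pow_right (by norm_num) hd
      _ ≤ _ := two_pow_le_card_box hN
  obtain ⟨h3, h4⟩ := twelve_mul_pow_mul_exp_le hc hn
  have h5 := h2 _ h3
  rw [show 90 * (√(2 * (c + 7)) * √(Real.log (box N).card)) * √(3 * 8 ^ d) =
    discConst d c * √(Real.log (box N).card) by rw [discConst]; ring] at h5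
  linarith

end Main

end RAM

theorem theorem1p2 :
    -- the bound on the discrepancy
    (∀ d : ℕ, 0 < d → ∃ C : ℝ, 0 < C ∧ ∀ N : Fin d → ℕ, (∀ i, 1 < N i) →
      (disc (boxAPs N) : ℝ) ≤ C * Real.sqrt (Real.log (box N).card) * boxF N) ∧
    -- the randomized polynomial-time algorithm
    (∃ (p : RAM.Prog) (q : Polynomial ℕ),
      (∀ d : ℕ, 0 < d → ∀ N : Fin d → ℕ, (∀ i, 1 < N i) → ∀ ω : ℕ → Bool,
        ∃ (t : ℕ) (χ : box N → ℤˣ), RAM.Outputs p N ω t χ ∧ t ≤ q.eval (box N).card) ∧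
      (∀ d : ℕ, 0 < d → ∀ c : ℝ, 0 < c → ∃ C : ℝ, 0 < C ∧
        ∀ N : Fin d → ℕ, (∀ i, 1 < N i) →
          1 - ((box N).card : ℝ) ^ (-c) ≤
            RAM.coins.real {ω | ∃ (t : ℕ) (χ : box N → ℤˣ), RAM.Outputs p N ω t χ ∧
              (discWith (boxAPs N) χ : ℝ) ≤
                C * Real.sqrt (Real.log (box N).card) * boxF N})) := by
  obtain ⟨q, hq⟩ := RAM.exists_polynomial_mainTime
  refine ⟨fun d hd => ⟨_, RAM.discConst_pos d one_pos, fun N hN => ?_⟩, RAM.mainP, q,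
    fun d hd N hN ω => ?_, fun d hd c hc => ⟨_, RAM.discConst_pos d hc, fun N hN => ?_⟩⟩
  · obtain ⟨τ, -, h⟩ := RAM.exists_rand_coloring_log hd hN
    have hn : 1 < (box N).card := (Nat.one_lt_two_pow hd.ne').trans_le (RAM.two_pow_le_card_box hN)
    have h1 : ((box N).card : ℝ) ^ (-1 : ℝ) < 1 :=
      Real.rpow_lt_one_of_one_lt_of_neg (by exact_mod_cast hn) (by norm_num)
    -- With `c = 1` the success probability is at least `1 - 1 / n > 0`, so some sequence of coins
    -- yields a good colouring.
    obtain ⟨ω, hω⟩ : {ω | (discWith (boxAPs N) (RAM.coloring N (τ.run ω 0).1) : ℝ) ≤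
        RAM.discConst d 1 * √(Real.log (box N).card) * boxF N}.Nonempty := by
      by_contra hemp
      have h2 := h 1 one_pos
      rw [Set.not_nonempty_iff_eq_empty.1 hemp, MeasureTheory.measureReal_empty] at h2
      linarith
    exact (Nat.cast_le.2 (Finset.inf'_le _ (Finset.mem_univ _))).trans hω
  · obtain ⟨τ, h, -⟩ := RAM.exists_rand_coloring_log hd hN
    obtain ⟨t, ht, h1⟩ := h ω
    exact ⟨t, _, h1, ht.trans_eq (hq _).symm⟩
  · obtain ⟨τ, h, h2⟩ := RAM.exists_rand_coloring_log hd hN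
    refine (h2 c hc).trans (MeasureTheory.measureReal_mono fun ω hω => ?_)
    obtain ⟨t, -, h1⟩ := h ω
    exact ⟨t, _, h1, hω⟩
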